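/- **Setting.** Let $d\ge 1$ and let $P(x,D)$ be an elliptic pseudo-differential operator on $\mathbb R^d$ of real order $\mathfrak m>d$. Let $G(t,x;y)$ be its real-valued Green's function, i.e. the kernel of the semigroup $e^{-tP(x,D)}$. Assume that $G(t,x;y)=G(t,y;x)$ is continuous for $t>0$ and that, for every $T>0$, $$\text{(regG)}\qquad \sup_{0<t<T,\,y}\int_{\mathbb R^d}|G(t,x;y)|\,dx+\sup_{0<t<T,\,y}t^{d/\mathfrak m}\int_{\mathbb R^d}|G(t,x;y)|^2\,dx+\sup_{0<t<T,\,x,y}t^{d/\mathfrak m}|G(t,x;y)|<\infty,$$ $$\text{(modulusG)}\qquad \sup_{0<s<T,\ \zeta}s^{\gamma}\int_{\mathbb R^d}|G(s,x;\zeta)-G(s,x+y;\zeta)|\,dx\to0\ \text{ as } y\to0,\qquad \gamma=2\Big(1-\frac d{\mathfrak m}\Big).$$ Let $u_0\in L^1(\mathbb R^d)\cap L^2(\mathbb R^d)$ be real-valued, and put $e^{-tP}u_0(x)=\int G(t,x;y)u_0(y)\,dy$ for $t>0$ and $e^{-0P}u_0=u_0$. Let $q$ be a (jointly measurable) mean zero,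 stationary, real Gaussian field on $\mathbb R^d$ with integrable correlation function $R(x)=\mathbb E\{q(0)q(x)\}$, and let $\sigma\ge0$, $\sigma^2=\int_{\mathbb R^d} R(x)\,dx$. Let $\rho=\mathcal F^{-1}(\hat R^{1/2})$, where $\hat R=\mathcal F R$ and $\mathcal F$ is normalized so that it maps convolutions to products (thus $\rho*\rho=R$), and assume that $\rho\in L^1(\mathbb R^d)$. Let $W$ be a white noise on $\mathbb R^d$, defined on a probability space $\Omega$ (not necessarily the one on which $q$ is defined). *Random potentials.* For a random potential $V$, the Duhamel solution at time $t\ge 0$ is the sum in $L^2(\mathbb R^d\times\Omega)$ of the series $\sum_{n\ge0}v_n(t)$, where $v_0(t)=e^{-tP}u_0$ and $v_{n+1}(t,x)=\int_0^t\int_{\mathbb R^d} G(t-s,x;y)\,v_n(s,y)\,V(y)\,dy\,ds$ (with the probability space of $V$ in place of $\Omega$). Let $u_\varepsilon$ be the Duhamel solution for $V(x)=\varepsilon^{-d/2}q(x/\varepsilon)$, and let $\tilde u_\varepsilon$ be the Duhamel solution for the mollified white noise $$\tilde q_\varepsilon(x)=\varepsilon^{-d}\int_{\mathbb R^d}\rho\Big(\frac{x-y}\varepsilon\Big)\,dW(y),$$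 which for each $\varepsilon>0$ has the same law as $\varepsilon^{-d/2}q(x/\varepsilon)$ (a jointly measurable version of this field is used). *Stochastic equation.* For $f:(\mathbb R^d)^n\to\mathbb R$ let $$\|f\|_n^2=\sum_{\mathfrak p}\int |f(x_1,\dots,x_n)|\,|f(x_{n+1},\dots,x_{2n})|\prod_{\{k,l\}\in\mathfrak p}\delta(x_k-x_l)\,dx_k\,dx_l ,$$ the sum being over all pairings $\mathfrak p$ of $\{1,\dots,2n\}$. The iterated Stratonovich integral $\mathcal I_n$ is given by $\mathcal I_n(\prod_k f_k(x_k))=\prod_k\int f_k\,dW$ on products of continuous compactly supported functions, is extended linearly, and then by density from $\|\cdot\|_n$ to $L^2(\Omega)$. The Duhamel solution $u$ of the Stratonovich equation $\partial_tu+P(x,D)u-\sigma u\circ\dot W=0$, $u(0,\cdot)=u_0$, is at time $t\ge0$ the sum $u(t,x)=\sum_{n\ge0}\mathcal I_n(f_n(t,x,\cdot))$ in $L^2(\mathbb R^d\times\Omega)$, where $f_0(t,x)=e^{-tP}u_0(x)$ and $$f_{n+1}(t,x,y_1,\dots,y_{n+1})=\sigma\int_0^tG(t-s,x;y_1)\,f_n(s,y_1,y_2,\dots,y_{n+1})\,ds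 .$$ **Theorem 4.2.** The solutions $u_\varepsilon$, $\tilde u_\varepsilon$ ($\varepsilon>0$) and $u$ exist for all $t\ge0$, and: 1. $u_\varepsilon$ converges in distribution to $u$ as $\varepsilon\to0$: for all times $t_1,\dots,t_k\ge0$, the $L^2(\mathbb R^d)^k$-valued random variables $(u_\varepsilon(t_1,\cdot),\dots,u_\varepsilon(t_k,\cdot))$ converge in distribution to $(u(t_1,\cdot),\dots,u(t_k,\cdot))$. 2. More precisely, for the potential built from the same white noise, for every $T>0$, $$\sup_{0\le t\le T}\|\tilde u_\varepsilon(t)-u(t)\|_{L^2(\mathbb R^d\times\Omega)}\to0\qquad\text{as }\varepsilon\to0.$$ -/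

import Mathlib

open MeasureTheory ProbabilityTheory Filter Topology Set
open scoped ENNReal NNReal FourierTransform CompactlySupported

noncomputable section

namespace StratSPDE

/-- The Euclidean space `ℝ^d`. -/
abbrev Space (d : ℕ) := EuclideanSpace ℝ (Fin d)

/-- The real Hilbert space `L²(ℝ^d)`. -/
abbrev L2 (d : ℕ) := Lp ℝ 2 (volume : Measure (Space d))

instance L2.instMeasurableSpace (d : ℕ) : MeasurableSpace (L2 d) := borel _

instance L2.instBorelSpace (d : ℕ) : BorelSpace (L2 d) := ⟨rfl⟩

instance L2.instSecondCountableTopology (d : ℕ) : SecondCountableTopology (L2 d) :=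
  haveI : Fact ((2 : ℝ≥0∞) ≠ ∞) := ⟨ENNReal.ofNat_ne_top⟩
  Lp.SecondCountableTopology

variable {d : ℕ}

/-! ### The unperturbed operator and its Green's function -/

/-- `p(x, ξ)` is the symbol of an elliptic pseudo-differential operator of (real) order `m`: for
large `ξ` it is a smooth symbol of type `(1,0)`, locally uniformly in `x`, and it is bounded below
by a multiple of `|ξ|^m`. At low frequencies only measurability and local boundedness are required,
so that `|ξ|^m` qualifies for every real `m > 0`. -/
structure IsEllipticSymbol (m : ℝ) (p : Space d → Space d → ℂ) : Prop where
  measurable : Measurable (Function.uncurry p)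
  symbol : ∃ r : ℝ, 0 < r ∧
    ContDiffOn ℝ ((⊤ : ℕ∞) : WithTop ℕ∞) (Function.uncurry p) {z : Space d × Space d | r < ‖z.2‖} ∧
    (∀ K : Set (Space d), IsCompact K → ∀ j k : ℕ, ∃ C : ℝ, ∀ x ∈ K, ∀ ξ, r < ‖ξ‖ →
      ‖iteratedFDeriv ℝ k (fun η => iteratedFDeriv ℝ j (fun y => p y η) x) ξ‖
        ≤ C * ‖ξ‖ ^ (m - k)) ∧
    (∀ K : Set (Space d), IsCompact K → ∃ C : ℝ, ∀ x ∈ K, ∀ ξ, ‖ξ‖ ≤ r → ‖p x ξ‖ ≤ C)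
  elliptic : ∀ K : Set (Space d), IsCompact K → ∃ c r : ℝ, 0 < c ∧ ∀ x ∈ K, ∀ ξ, r < ‖ξ‖ →
    c * ‖ξ‖ ^ m ≤ ‖p x ξ‖

/-- The operator `P(x, D)` with `D = -i∇`, that is
`(P(x,D) φ)(x) = ∫ exp(2πi x·ξ) p(x, 2πξ) (𝓕 φ)(ξ) dξ`, where
`(𝓕 φ)(ξ) = ∫ exp(-2πi y·ξ) φ(y) dy`. -/
def pseudoDiff (p : Space d → Space d → ℂ) (φ : Space d → ℂ) (x : Space d) : ℂ :=
  ∫ ξ, Complex.exp (2 * Real.pi * Complex.I * (inner ℝ x ξ : ℝ)) *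
    p x ((2 * Real.pi) • ξ) * 𝓕 φ ξ

/-- `G(t, x; y)` is the kernel of the semigroup `e^{-tP(x,D)}`: the operators with these kernels
form a semigroup, whose generator on `L²(ℝ^d)` is `-P(x,D)` on test functions. -/
structure IsGreenFunction (p : Space d → Space d → ℂ) (G : ℝ → Space d → Space d → ℝ) :
    Prop where
  semigroup : ∀ s t : ℝ, 0 < s → 0 < t → ∀ x y, ∫ z, G s x z * G t z y = G (s + t) x y
  generator : ∀ φ : Space d → ℝ, ContDiff ℝ ((⊤ : ℕ∞) : WithTop ℕ∞) φ → HasCompactSupport φ →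
    Tendsto (fun t : ℝ => eLpNorm (fun x =>
      (((t⁻¹ * ((∫ y, G t x y * φ y) - φ x) : ℝ) : ℂ) + pseudoDiff p (fun y => (φ y : ℂ)) x))
      2 volume) (𝓝[>] 0) (𝓝 0)

/-- The `L¹`, `L²` and `L^∞` bounds on the Green's function, on every bounded time interval. -/
def GreenBounds (m : ℝ) (G : ℝ → Space d → Space d → ℝ) : Prop :=
  ∀ T : ℝ, 0 < T → ∃ C : ℝ≥0, ∀ t ∈ Ioo 0 T,
    (∀ y, ∫⁻ x, ‖G t x y‖ₑ ≤ C) ∧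
    (∀ y, ENNReal.ofReal (t ^ ((d : ℝ) / m)) * ∫⁻ x, ‖G t x y‖ₑ ^ 2 ≤ C) ∧
    (∀ x y, t ^ ((d : ℝ) / m) * |G t x y| ≤ C)

/-- The modulus of continuity of the Green's function in `L¹`, with `γ = 2 (1 - d / m)`. -/
def GreenModulus (m : ℝ) (G : ℝ → Space d → Space d → ℝ) : Prop :=
  ∀ T : ℝ, 0 < T → Tendsto (fun y : Space d => ⨆ s ∈ Ioo 0 T, ⨆ ζ : Space d,
      ENNReal.ofReal (s ^ (2 * (1 - (d : ℝ) / m))) * ∫⁻ x, ‖G s x ζ - G s (x + y) ζ‖ₑ)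
    (𝓝 0) (𝓝 0)

/-- The unperturbed solution `e^{-tP(x,D)} u₀`. -/
def freeEvolution (G : ℝ → Space d → Space d → ℝ) (u₀ : Space d → ℝ) (t : ℝ) (x : Space d) : ℝ :=
  if t = 0 then u₀ x else ∫ y, G t x y * u₀ y

/-! ### The equation with a random potential -/

/-- The terms of the Duhamel expansion for a fixed potential `V`:
`u_{n+1}(t,x) = ∫_0^t ∫ G(t-s,x;y) u_n(s,y) V(y) dy ds`. -/
def duhamelTerm (G : ℝ → Space d → Space d → ℝ) (u₀ : Space d → ℝ) (V : Space d → ℝ) :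
    ℕ → ℝ → Space d → ℝ
  | 0, t, x => freeEvolution G u₀ t x
  | n + 1, t, x => ∫ s in (0 : ℝ)..t, ∫ y, G (t - s) x y * duhamelTerm G u₀ V n s y * V y

section Random

variable {Ω : Type*} [MeasurableSpace Ω]

/-- `u` is, at time `t`, the Duhamel solution with random potential `V`: the sum of the Duhamel
series, converging in `L²(ℝ^d × Ω)`. -/
structure IsDuhamelSolution (P : Measure Ω) (G : ℝ → Space d → Space d → ℝ) (u₀ : Space d → ℝ)
    (V : Space d → Ω → ℝ) (t : ℝ) (u : Space d × Ω → ℝ) : Prop where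
  memLp_term : ∀ n, MemLp (fun z : Space d × Ω => duhamelTerm G u₀ (fun y => V y z.2) n t z.1) 2
    (volume.prod P)
  memLp : MemLp u 2 (volume.prod P)
  tendsto : Tendsto (fun N : ℕ => eLpNorm (fun z : Space d × Ω =>
      u z - ∑ n ∈ Finset.range N, duhamelTerm G u₀ (fun y => V y z.2) n t z.1) 2
    (volume.prod P)) atTop (𝓝 0)

/-- A jointly measurable, mean zero, stationary Gaussian random field. -/
structure IsStationaryGaussianField (P : Measure Ω) (q : Space d → Ω → ℝ) : Prop where
  measurable : Measurable (Function.uncurry q)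
  gaussian : IsGaussianProcess q P
  mean_zero : ∀ x, ∫ ω, q x ω ∂P = 0
  stationary : ∀ (h : Space d) (I : Finset (Space d)),
    IdentDistrib (fun ω (x : I) => q (x + h) ω) (fun ω (x : I) => q x ω) P P

/-- The correlation function `R(x) = 𝔼[q(0) q(x)]`. -/
def correlation (P : Measure Ω) (q : Space d → Ω → ℝ) (x : Space d) : ℝ :=
  ∫ ω, q 0 ω * q x ω ∂P

/-- The rescaled potential `q_ε(x) = ε^{-d/2} q(x / ε)`. -/
def rescale (q : Space d → Ω → ℝ) (ε : ℝ) (x : Space d) (ω : Ω) : ℝ :=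
  ε ^ (-(d : ℝ) / 2) * q (ε⁻¹ • x) ω

/-! ### White noise and Stratonovich integrals -/

/-- `W` is white noise on `ℝ^d`, as an isonormal Gaussian process: `W f = ∫ f dW` is a linear
isometry from `L²(ℝ^d)` to `L²(Ω)` and each `W f` is a centred Gaussian variable. -/
def IsWhiteNoise {P : Measure Ω} (W : L2 d →ₗᵢ[ℝ] Lp ℝ 2 P) : Prop :=
  ∀ f : L2 d, P.map (W f) = gaussianReal 0 (‖f‖₊ ^ 2)

open scoped Classical in
/-- The Wiener integral `∫ f dW` of a square integrable function. -/
def wienerIntegral {P : Measure Ω} (W : L2 d →ₗᵢ[ℝ] Lp ℝ 2 P) (f : Space d → ℝ) : Ω → ℝ :=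
  if h : MemLp f 2 volume then W (h.toLp f) else 0

end Random

/-- The pairings of `n` indices: the involutions without fixed points. -/
abbrev Pairing (n : ℕ) := {l : Equiv.Perm (Fin n) // ∀ k, l k ≠ k ∧ l (l k) = k}

/-- The set `A₀` of the smaller indices of the pairs. -/
abbrev Pairing.Lower {n : ℕ} (l : Pairing n) := {k : Fin n // k < l.1 k}

/-- The smaller index of the pair that contains `k`. -/
def Pairing.rep {n : ℕ} (l : Pairing n) (k : Fin n) : l.Lower :=
  if h : k < l.1 k then ⟨k, h⟩
  else ⟨l.1 k, by
    rw [(l.2 k).2]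
    exact lt_of_le_of_ne (not_lt.mp h) (l.2 k).1⟩

/-- The norm `‖f‖_n`, whose square is the sum over all pairings of `2n` variables of the integral
of `|f(x_1,…,x_n)| |f(x_{n+1},…,x_{2n})|` over the set where paired variables coincide, that is
against `∏_{k ∈ A₀} δ(x_k - x_{l(k)}) dx_k dx_{l(k)}`. -/
def traceNorm (n : ℕ) (f : (Fin n → Space d) → ℝ) : ℝ≥0∞ :=
  (∑ l : Pairing (n + n), ∫⁻ z : l.Lower → Space d,
    ‖f (fun i => z (l.rep (Fin.castAdd n i)))‖ₑ * ‖f (fun i => z (l.rep (Fin.natAdd n i)))‖ₑ)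
    ^ (1 / 2 : ℝ)

/-- A finite linear combination of products `f_1(x_1) ⋯ f_n(x_n)` of continuous functions with
compact support. -/
structure ProductSum (d n : ℕ) where
  size : ℕ
  coeff : Fin size → ℝ
  factor : Fin size → Fin n → C_c(Space d, ℝ)

/-- The function of `n` variables represented by a sum of products. -/
def ProductSum.toFun {n : ℕ} (S : ProductSum d n) (y : Fin n → Space d) : ℝ :=
  ∑ j, S.coeff j * ∏ k, S.factor j k (y k)

section Random

variable {Ω : Type*} [MeasurableSpace Ω]

/-- The iterated Stratonovich integral of a sum of products: the integral of a product is the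
product of the Wiener integrals. -/
def ProductSum.integral {P : Measure Ω} (W : L2 d →ₗᵢ[ℝ] Lp ℝ 2 P) {n : ℕ} (S : ProductSum d n)
    (ω : Ω) : ℝ :=
  ∑ j, S.coeff j * ∏ k, wienerIntegral W (S.factor j k) ω

/-- `Z` is the iterated Stratonovich integral of `f`, defined by density: `f` is the limit for the
norm `‖·‖_n` of sums of products whose integrals converge to `Z` in `L²(Ω)`. -/
def IsStratonovichIntegral {P : Measure Ω} (W : L2 d →ₗᵢ[ℝ] Lp ℝ 2 P) (n : ℕ)
    (f : (Fin n → Space d) → ℝ) (Z : Ω → ℝ) : Prop :=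
  MemLp Z 2 P ∧ ∃ S : ℕ → ProductSum d n,
    Tendsto (fun k => traceNorm n (fun y => f y - (S k).toFun y)) atTop (𝓝 0) ∧
    Tendsto (fun k => eLpNorm (fun ω => Z ω - (S k).integral W ω) 2 P) atTop (𝓝 0)

end Random

/-- The integrands `f_n(t,x,·)` of the Duhamel expansion of the stochastic equation:
`f_{n+1}(t,x,y_1,…,y_{n+1}) = σ ∫_0^t G(t-s,x;y_1) f_n(s,y_1,y_2,…,y_{n+1}) ds`. -/
def stratKernel (σ : ℝ) (G : ℝ → Space d → Space d → ℝ) (u₀ : Space d → ℝ) :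
    (n : ℕ) → ℝ → Space d → (Fin n → Space d) → ℝ
  | 0, t, x, _ => freeEvolution G u₀ t x
  | n + 1, t, x, y =>
    σ * ∫ s in (0 : ℝ)..t, G (t - s) x (y 0) * stratKernel σ G u₀ n s (y 0) (Fin.tail y)

section Random

variable {Ω : Type*} [MeasurableSpace Ω]

/-- `u` is, at time `t`, the Duhamel solution of the stochastic equation
`∂_t u + P(x,D) u - σ u ∘ Ẇ = 0`: the sum, converging in `L²(ℝ^d × Ω)`, of the iterated
Stratonovich integrals of the functions `f_n(t,x,·)`. -/
def IsStratonovichSolution {P : Measure Ω} (W : L2 d →ₗᵢ[ℝ] Lp ℝ 2 P) (σ : ℝ)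
    (G : ℝ → Space d → Space d → ℝ) (u₀ : Space d → ℝ) (t : ℝ) (u : Space d × Ω → ℝ) : Prop :=
  MemLp u 2 (volume.prod P) ∧ ∃ v : ℕ → Space d × Ω → ℝ,
    (∀ n, MemLp (v n) 2 (volume.prod P)) ∧
    (∀ n, ∀ᵐ x : Space d, IsStratonovichIntegral W n (stratKernel σ G u₀ n t x)
      (fun ω => v n (x, ω))) ∧
    Tendsto (fun N : ℕ => eLpNorm (fun z => u z - ∑ n ∈ Finset.range N, v n z) 2
      (volume.prod P)) atTop (𝓝 0)

/-! ### The mollified noise and convergence -/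

/-- `ρ` is the inverse Fourier transform, in `L²(ℝ^d)`, of the square root of the power spectrum
`R̂`. The Fourier transform is normalized so that it maps convolutions to products. -/
def IsSpectralRoot (R ρ : Space d → ℝ) : Prop :=
  ∃ h : MemLp (fun ξ : Space d => ((√(𝓕 (fun x => (R x : ℂ)) ξ).re : ℝ) : ℂ)) 2 volume,
    (fun x => (ρ x : ℂ)) =ᵐ[volume] (𝓕⁻ (h.toLp _) : Lp ℂ 2 (volume : Measure (Space d)))

/-- For every `ε > 0`, `Q ε` is a jointly measurable version of the mollified white noise
`x ↦ ∫ ε^{-d} ρ((x - y) / ε) dW(y)`. -/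
def IsMollifiedNoise {P : Measure Ω} (W : L2 d →ₗᵢ[ℝ] Lp ℝ 2 P) (ρ : Space d → ℝ)
    (Q : ℝ → Space d → Ω → ℝ) : Prop :=
  ∀ ε : ℝ, 0 < ε → Measurable (Function.uncurry (Q ε)) ∧
    ∀ x, Q ε x =ᵐ[P] wienerIntegral W (fun y => (ε ^ d)⁻¹ * ρ (ε⁻¹ • (x - y)))

open scoped Classical in
/-- The random element `ω ↦ u(·, ω)` of `L²(ℝ^d)`. -/
def toRandomL2 (u : Space d × Ω → ℝ) (ω : Ω) : L2 d :=
  if h : MemLp (fun x => u (x, ω)) 2 volume then h.toLp _ else 0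

end Random

end StratSPDE

end

open StratSPDE

noncomputable section

namespace StratSPDE

open Function (uncurry update updateFinset)
open ENNReal (ofReal mul_ne_top pow_ne_top ofReal_mul ofReal_pow ofReal_le_ofReal ofReal_ne_top
  pow_le_pow_left_iff coe_ne_top ofReal_coe_nnreal rpow_natCast rpow_mul)
open Finset (measurable_fun_prod sum_congr sum_le_sum prod_congr prod_mul_distrib card_univ mul_sum
  sum_nonneg single_le_sum mem_erase)
open Fin (castAdd natAdd tail)
open Real (exp cos sin)
open Equiv (swap Perm)
set_option linter.unusedSectionVars false
variable {d n : ℕ} {Ω Ω' : Type*} [MeasurableSpace Ω] {P : Measure Ω} [IsProbabilityMeasure P]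
  [MeasurableSpace Ω'] {P' : Measure Ω'} [IsProbabilityMeasure P'] {C : ℝ≥0} {a T t : ℝ}
  {g G : ℝ → Space d → Space d → ℝ} {u₀ ρ : Space d → ℝ} {W : L2 d →ₗᵢ[ℝ] Lp ℝ 2 P}
  {Q : ℝ → Space d → Ω → ℝ} {ε : ℝ}
local notation "low(" l ", " i ")" => Pairing.rep l (castAdd _ i)
local notation "upp(" l ", " i ")" => Pairing.rep l (natAdd _ i)

/-! Reduction to kernels. The n-th Duhamel term for a potential V is `∫ F_n(t,x,y) ∏ V(y_i) dy`,
where F_n (`chainInt`) is the product of the Green's functions along the chain x, y_1, …, y_n, w,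
weighted with u₀(w) and integrated over the intermediate times and over w (`duhamelTerm_eq`); the
Stratonovich kernel is σ^n F_n (`stratKernel_eq`). If V is the mollified noise, the term is, at each
x, a superposition of products of n Wiener integrals. By the Isserlis–Wick formula
(`integral_prod_whiteNoise`) its second moment is a sum over all pairings of 2n variables, and the
L² distance of two such random variables is at most the norm ‖·‖_n of the difference of their
kernels (`IsChaos.eLpNorm_sub_le`). The kernel at scale ε is the average of F_n(y + εη) with weights
∏ ρ(η_i) (`mollify`); at ε = 0 it is (∫ρ)^n F_n = σ^n F_n, because the Fourier transform of ρ at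
zero is the square root of that of R (`IsSpectralRoot.integral_eq`). What remains are deterministic
statements about F_n with shifted vertices.

Bounds. For a fixed pairing, the two chains form one path from an initial point through x to the
other initial point, with 2n + 2 edges and n + 3 distinct vertices. Along this path an edge to a new
vertex is integrated and costs the L¹ norm of the Green's function; an edge to an old vertex costs
the supremum, at most C τ^(-a) with a = d/m < 1. Whatever the pairing, n + 2 edges are new and n are
old. The two factors u₀ are reduced to a square at one end. Weighting the time increments with
exp(-λτ) makes the time integral a product: a new edge costs C/λ, an old one C Γ(1-a) λ^(a-1). With
λ = n + 1 the factors λ^(-n) absorb the at most (2n)^n pairings, and λ^((a-1)n) remains, which makes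
the series converge uniformly in ε and in t ≤ T (`exists_summable_energyBound`).

Convergence of a term. The same path, explored edge by edge, shows continuity under shifts of the
vertices: at new edges by continuity of translations in L¹, at old edges by continuity of the
Green's function (`tendsto_lmarginal_pathProd_sub`). Dominated convergence in the times and in η
follows (`DuhamelData.tendsto_mollify`). Hence the terms are a Cauchy family as ε → 0, and since
sums of products are dense for ‖·‖_n, the limits are the iterated Stratonovich integrals
(`DuhamelData.exists_limit`). Uniformity in time comes from the semigroup property: a term at time t
+ r is the Green's operator applied to the term at time t, which is bounded in L² by Schur's test,
plus a remainder whose first time increment is less than r, and this remainder is small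
(`DuhamelData.eLpNorm_noiseTerm_sub_le`). Convergence on a finite grid of times therefore propagates
(`tendsto_iSup_of_propagation`), and the series is summed by dominated convergence.

Convergence in distribution. The correlation function is positive definite, so its Fourier transform
is nonnegative and ρ * ρ = R almost everywhere. Thus the rescaled field and the mollified noise are
jointly measurable Gaussian fields with the same covariance almost everywhere. Multiplied by a
Gaussian weight they are random elements of L²(ℝ^d) with the same characteristic functional, hence
the same law (`IsCenteredGaussianField.map_fieldElement_eq`). The Duhamel terms with n ≥ 1 depend
only on the class of the field modulo null sets, so both solutions are the same functional of this
random element (`GreenSetting.map_toRandomL2_eq`). The strong convergence for the mollified noise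
then gives the convergence in law. -/

/-! ### Gaussian integration by parts and moments of Wiener integrals. -/

lemma integrable_polynomial_gaussianReal (v : ℝ≥0) (p : Polynomial ℝ) :
    Integrable (fun x => p.eval x) (gaussianReal 0 v) := by
  simp_rw [Polynomial.eval_eq_sum]
  refine integrable_finsetSum _ fun k _ => Integrable.const_mul ?_ _
  have h := memLp_id_gaussianReal' (μ := 0) (v := v) k (by simp)
  rcases Nat.eq_zero_or_pos k with rfl | hk
  · simp
  have h2 := h.integrable_norm_rpow (by exact_mod_cast hk.ne') (by simp)
  simp only [id, ENNReal.toReal_natCast, Real.rpow_natCast] at h2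
  refine (integrable_norm_iff (by fun_prop)).1 ?_
  simpa using h2

/-- Integration by parts against the density, since `-v` times the density is an antiderivative of
`x` times the density. For `v = 0` the law is the Dirac mass at zero and both sides vanish. -/
lemma integral_mul_polynomial_gaussianReal (v : ℝ≥0) (p : Polynomial ℝ) :
    ∫ x, x * p.eval x ∂(gaussianReal 0 v) = v * ∫ x, p.derivative.eval x ∂(gaussianReal 0 v) := by
  by_cases hv : v = 0
  · subst hv; simp
  have hint : ∀ p : Polynomial ℝ, Integrable (fun x => p.eval x * gaussianPDFReal 0 v x) := by
    intro p
    have h := integrable_polynomial_gaussianReal v p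
    rw [gaussianReal_of_var_ne_zero _ hv,
      integrable_withDensity_iff (by fun_prop) (by simp [gaussianPDF])] at h
    refine h.congr (ae_of_all _ fun x => ?_)
    simp [toReal_gaussianPDF]
  have hd : ∀ x, HasDerivAt (fun x => -(v : ℝ) * gaussianPDFReal 0 v x)
      (x * gaussianPDFReal 0 v x) x := by
    intro x
    have hv' : (v : ℝ) ≠ 0 := by exact_mod_cast hv
    have h1 : HasDerivAt (fun x : ℝ => exp (-(x - 0) ^ 2 / (2 * v)))
        (exp (-(x - 0) ^ 2 / (2 * v)) * (-(2 * (x - 0)) / (2 * v))) x := by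
      have : HasDerivAt (fun x : ℝ => -(x - 0) ^ 2 / (2 * v)) (-(2 * (x - 0)) / (2 * v)) x := by
        have := (((hasDerivAt_id x).sub_const 0).pow 2).neg.div_const (2 * v : ℝ)
        refine this.congr_deriv ?_
        simp
      exact this.exp
    have h2 := (h1.const_mul ((√(2 * Real.pi * v))⁻¹)).const_mul (-(v : ℝ))
    refine h2.congr_deriv ?_
    simp only [gaussianPDFReal]
    field_simp
    ring
  have key := integral_mul_deriv_eq_deriv_mul_of_integrable (u := fun x => p.eval x)
    (v := fun x => -(v : ℝ) * gaussianPDFReal 0 v x) (u' := fun x => p.derivative.eval x)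
    (v' := fun x => x * gaussianPDFReal 0 v x) (fun x _ => p.hasDerivAt x) (fun x _ => hd x) ?_ ?_ ?_
  · rw [integral_gaussianReal_eq_integral_smul hv, integral_gaussianReal_eq_integral_smul hv,
      ← integral_const_mul]
    simp only [smul_eq_mul]
    calc _ = ∫ x, p.eval x * (x * gaussianPDFReal 0 v x) := by
          congr 1; ext x; ring
      _ = _ := by rw [key, ← integral_neg]; congr 1; ext x; ring
  · refine (hint (Polynomial.X * p)).congr (ae_of_all _ fun x => ?_)
    simp; ring
  · refine ((hint p.derivative).const_mul (-(v : ℝ))).congr (ae_of_all _ fun x => ?_)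
    simp only [Pi.mul_apply]; ring
  · refine ((hint p).const_mul (-(v : ℝ))).congr (ae_of_all _ fun x => ?_)
    simp only [Pi.mul_apply]; ring

lemma integral_whiteNoise (hW : IsWhiteNoise W) (f : L2 d) : ∫ ω, W f ω ∂P = 0 := by
  have h := integral_map (μ := P) (φ := W f) (f := fun x : ℝ => x)
    (Lp.aestronglyMeasurable _).aemeasurable (by fun_prop)
  rw [← h, hW f]; exact integral_id_gaussianReal

lemma hasGaussianLaw_whiteNoise (hW : IsWhiteNoise W) (f : L2 d) :
    HasGaussianLaw (W f) P := ⟨by rw [hW f]; infer_instance⟩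

lemma integral_whiteNoise_mul (f g : L2 d) : ∫ ω, W f ω * W g ω ∂P = inner ℝ f g := by
  rw [← W.inner_map_map f g, L2.inner_def]
  congr 1; ext ω; simp [mul_comm]

lemma whiteNoise_sum_ae {ι : Type*} (s : Finset ι) (a : ι → ℝ) (f : ι → L2 d) :
    (W (∑ i ∈ s, a i • f i) : Ω → ℝ) =ᵐ[P] fun ω => ∑ i ∈ s, a i * W (f i) ω := by
  classical
  induction s using Finset.induction with
  | empty => simp only [Finset.sum_empty, map_zero]; exact Lp.coeFn_zero _ _ _
  | insert i s hi ih =>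
    rw [Finset.sum_insert hi, map_add, map_smul]
    filter_upwards [ih, Lp.coeFn_add (a i • W (f i)) (W (∑ i ∈ s, a i • f i)),
      Lp.coeFn_smul (a i) (W (f i))] with ω h1 h2 h3
    rw [h2, Pi.add_apply, h1, h3, Finset.sum_insert hi]; rfl

/-- A linear functional of finitely many Wiener integrals is the Wiener integral of one linear
combination, so the one-dimensional laws determine everything. -/
lemma isGaussianProcess_whiteNoise (hW : IsWhiteNoise W) :
    IsGaussianProcess (fun (f : L2 d) ω => W f ω) P where
  hasGaussianLaw I := by
    classical
    have hm : AEMeasurable (fun ω => I.restrict (fun f : L2 d => (W f : Ω → ℝ) ω)) P :=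
      aemeasurable_pi_lambda _ fun i => (Lp.aestronglyMeasurable _).aemeasurable
    refine ⟨⟨fun L => ?_⟩⟩
    have h1 : (P.map (fun ω => I.restrict (fun f : L2 d => (W f : Ω → ℝ) ω))).map L
        = P.map (W (∑ i : I, L (Pi.single i 1) • (i : L2 d))) := by
      rw [AEMeasurable.map_map_of_aemeasurable (by fun_prop) hm]
      refine Measure.map_congr ?_
      filter_upwards [whiteNoise_sum_ae (W := W) Finset.univ (fun i : I => L (Pi.single i 1))
        (fun i : I => (i : L2 d))] with ω h
      rw [h]
      simp only [Function.comp_apply]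
      conv_lhs => rw [← Finset.univ_sum_single (I.restrict (fun f : L2 d => (W f : Ω → ℝ) ω))]
      rw [map_sum]
      refine sum_congr rfl fun i _ => ?_
      have : (Pi.single i (I.restrict (fun f : L2 d => (W f : Ω → ℝ) ω) i) : I → ℝ)
          = (W (i : L2 d) ω) • Pi.single i 1 := by
        ext j; by_cases h : j = i
        · subst h; simp
        · simp [h]
      rw [this, map_smul, smul_eq_mul, mul_comm]
    have : IsGaussian ((P.map (fun ω => I.restrict (fun f : L2 d => (W f : Ω → ℝ) ω))).map L) := by
      rw [h1, hW]; infer_instance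
    rw [this.eq_gaussianReal, integral_map (by fun_prop) (by fun_prop),
      variance_map (by fun_prop) (by fun_prop)]
    rfl

lemma memLp_whiteNoise (hW : IsWhiteNoise W) (f : L2 d) (p : ℝ≥0∞) (hp : p ≠ ∞) :
    MemLp (W f) p P := (hasGaussianLaw_whiteNoise hW f).memLp hp

/-- If all factors are below one, so is the product; otherwise the largest factor is at least one
and its power dominates. This replaces Hölder's inequality in the integrability of products of
Gaussian variables. -/
lemma prod_abs_le_one_add_sum {ι : Type*} (s : Finset ι) (x : ι → ℝ) (N : ℕ) (hN : s.card ≤ N) :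
    ∏ i ∈ s, |x i| ≤ 1 + ∑ i ∈ s, |x i| ^ N := by
  classical
  by_cases h : ∃ i ∈ s, 1 ≤ |x i|
  · obtain ⟨i, hi, hmax⟩ := s.exists_max_image (fun i => |x i|) ⟨h.choose, h.choose_spec.1⟩
    have h1 : 1 ≤ |x i| := h.choose_spec.2.trans (hmax _ h.choose_spec.1)
    calc ∏ i ∈ s, |x i| ≤ ∏ _j ∈ s, |x i| :=
          Finset.prod_le_prod (fun _ _ => abs_nonneg _) fun j hj => hmax j hj
      _ = |x i| ^ s.card := by simp
      _ ≤ |x i| ^ N := pow_le_pow_right₀ h1 hN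
      _ ≤ ∑ i ∈ s, |x i| ^ N :=
          single_le_sum (f := fun i => |x i| ^ N) (fun _ _ => by positivity) hi
      _ ≤ _ := by linarith
  · push Not at h
    have h1 : ∏ i ∈ s, |x i| ≤ 1 := Finset.prod_le_one (fun _ _ => abs_nonneg _) fun i hi => (h i hi).le
    have h2 : 0 ≤ ∑ i ∈ s, |x i| ^ N := sum_nonneg fun _ _ => by positivity
    linarith

/-- The absolute moment of order `N` of a centred Gaussian variable of variance one. -/
def gaussianMoment (N : ℕ) : ℝ := ∫ x, |x| ^ N ∂(gaussianReal 0 1)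

lemma gaussianMoment_nonneg (N : ℕ) : 0 ≤ gaussianMoment N := integral_nonneg fun _ => by positivity

lemma integral_abs_whiteNoise_pow (hW : IsWhiteNoise W) (f : L2 d) (N : ℕ) :
    ∫ ω, |W f ω| ^ N ∂P = ‖f‖ ^ N * gaussianMoment N := by
  have h := integral_map (μ := P) (φ := W f) (f := fun x : ℝ => |x| ^ N)
    (Lp.aestronglyMeasurable _).aemeasurable (by fun_prop)
  rw [← h, hW f]
  have h2 := gaussianReal_map_const_mul (μ := 0) (v := 1) ‖f‖
  have h3 : gaussianReal 0 (‖f‖₊ ^ 2) = (gaussianReal 0 1).map (fun x => ‖f‖ * x) := by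
    rw [h2]; congr 1
    · simp
    · ext; simp
  rw [h3, integral_map (by fun_prop) (by fun_prop), gaussianMoment, ← integral_const_mul]
  congr 1; ext x; rw [abs_mul, abs_norm, mul_pow]

lemma integrable_abs_whiteNoise_pow (hW : IsWhiteNoise W) (f : L2 d) (N : ℕ) :
    Integrable (fun ω => |W f ω| ^ N) P := by
  rcases Nat.eq_zero_or_pos N with rfl | hk
  · simp
  have h2 := (memLp_whiteNoise hW f N (by simp)).integrable_norm_rpow (by exact_mod_cast hk.ne')
    (by simp)
  simpa using h2

lemma integrable_prod_whiteNoise (hW : IsWhiteNoise W) {ι : Type*} (s : Finset ι) (f : ι → L2 d) :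
    Integrable (fun ω => ∏ i ∈ s, W (f i) ω) P := by
  refine Integrable.mono' (g := fun ω => 1 + ∑ i ∈ s, |W (f i) ω| ^ s.card) ?_ ?_ ?_
  · exact (integrable_const _).add
      (integrable_finsetSum _ fun i _ => integrable_abs_whiteNoise_pow hW _ _)
  · exact Finset.aestronglyMeasurable_fun_prod _ fun i _ => Lp.aestronglyMeasurable _
  · refine ae_of_all _ fun ω => ?_
    rw [Real.norm_eq_abs, Finset.abs_prod]
    exact prod_abs_le_one_add_sum s _ _ le_rfl

lemma integral_abs_prod_whiteNoise_le (hW : IsWhiteNoise W) {ι : Type*} (s : Finset ι)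
    (f : ι → L2 d) {M : ℝ} (hM : ∀ i ∈ s, ‖f i‖ ≤ M) :
    ∫ ω, |∏ i ∈ s, W (f i) ω| ∂P ≤ 1 + s.card * (M ^ s.card * gaussianMoment s.card) := by
  calc _ ≤ ∫ ω, (1 + ∑ i ∈ s, |W (f i) ω| ^ s.card) ∂P := by
        refine integral_mono (integrable_prod_whiteNoise hW s f).abs ?_ fun ω => ?_
        · exact (integrable_const _).add
            (integrable_finsetSum _ fun i _ => integrable_abs_whiteNoise_pow hW _ _)
        · simp only [Finset.abs_prod]
          exact prod_abs_le_one_add_sum s _ _ le_rfl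
    _ = 1 + ∑ i ∈ s, ‖f i‖ ^ s.card * gaussianMoment s.card := by
        rw [integral_add (integrable_const _)
          (integrable_finsetSum _ fun i _ => integrable_abs_whiteNoise_pow hW _ _),
          integral_finsetSum _ fun i _ => integrable_abs_whiteNoise_pow hW _ _]
        simp [integral_abs_whiteNoise_pow hW]
    _ ≤ 1 + ∑ i ∈ s, M ^ s.card * gaussianMoment s.card := by
        have := gaussianMoment_nonneg s.card
        gcongr with i hi
        exact hM i hi
    _ = _ := by simp

/-- Gaussian integration by parts for products of Wiener integrals. -/
lemma integral_whiteNoise_mul_prod (hW : IsWhiteNoise W) {ι : Type*} [DecidableEq ι] (f₀ : L2 d)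
    (J : Finset ι) (f : ι → L2 d) : ∫ ω, W f₀ ω * ∏ j ∈ J, W (f j) ω ∂P
      = ∑ j ∈ J, inner ℝ f₀ (f j) * ∫ ω, ∏ i ∈ J.erase j, W (f i) ω ∂P := by
  by_cases h0 : f₀ = 0
  · subst h0
    have : ∫ ω, (W (0 : L2 d) : Ω → ℝ) ω * ∏ j ∈ J, W (f j) ω ∂P = ∫ ω, (0 : ℝ) ∂P := by
      refine integral_congr_ae ?_
      rw [map_zero]
      filter_upwards [Lp.coeFn_zero ℝ 2 P] with ω h
      rw [h]; simp
    rw [this]; simp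
  have hn : ‖f₀‖ ≠ 0 := norm_ne_zero_iff.2 h0
  -- Split `f j` into its projection on `f₀` and the orthogonal part `y j`. The noises of `f₀` and
  -- of the `y j` are uncorrelated and jointly Gaussian, hence independent.
  set a : ι → ℝ := fun j => inner ℝ f₀ (f j) / ‖f₀‖ ^ 2 with ha
  set y : ι → L2 d := fun j => f j - a j • f₀ with hy
  have horth : ∀ j, inner ℝ f₀ (y j) = 0 := by
    intro j
    simp only [hy, ha, inner_sub_right, inner_smul_right, real_inner_self_eq_norm_sq]
    field_simp; simp
  have hdec : ∀ᵐ ω ∂P, ∀ j ∈ J, W (f j) ω = a j * W f₀ ω + W (y j) ω := by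
    rw [Finset.eventually_all]
    intro j _
    have : f j = a j • f₀ + y j := by simp [hy]
    have h1 : W (f j) = a j • W f₀ + W (y j) := by
      conv_lhs => rw [this]
      rw [map_add, map_smul]
    filter_upwards [Lp.coeFn_add (a j • W f₀) (W (y j)), Lp.coeFn_smul (a j) (W f₀)] with ω h2 h3
    rw [h1, h2, Pi.add_apply, h3]; rfl
  -- independence
  have hmeas : ∀ g : L2 d, AEMeasurable (W g) P := fun _ => by fun_prop
  have hind : IndepFun (W f₀) (fun ω (j : J) => W (y j) ω) P := by
    have hG : IsGaussianProcess (Sum.elim (fun (_ : Unit) ω => W f₀ ω)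
        (fun (j : J) ω => W (y j) ω)) P := by
      have := (isGaussianProcess_whiteNoise hW).comp_right
        (Sum.elim (fun _ : Unit => f₀) (fun j : J => y j))
      have heq : (Sum.elim (fun (_ : Unit) ω => W f₀ ω) (fun (j : J) ω => W (y j) ω))
          = (fun (f : L2 d) ω => W f ω) ∘ (Sum.elim (fun _ : Unit => f₀) (fun j : J => y j)) := by
        ext x ω; cases x <;> rfl
      rw [heq]; exact this
    have h := hG.indepFun_of_covariance_eq_zero (fun _ => hmeas _) (fun _ => hmeas _) ?_
    · exact h.comp (φ := fun u : Unit → ℝ => u ()) (ψ := fun u => u) (by fun_prop) measurable_id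
    · intro s t
      rw [covariance_eq_sub (memLp_whiteNoise hW _ 2 (by simp)) (memLp_whiteNoise hW _ 2 (by simp))]
      have := integral_whiteNoise_mul (W := W) f₀ (y t)
      simp only [Pi.mul_apply, this, horth, integral_whiteNoise hW, mul_zero, sub_zero]
  set v : ℝ≥0 := ‖f₀‖₊ ^ 2 with hv
  set ν : Measure (J → ℝ) := P.map (fun ω (j : J) => W (y j) ω) with hν
  have hym : AEMeasurable (fun ω (j : J) => W (y j) ω) P := by fun_prop
  have hlaw : P.map (fun ω => (W f₀ ω, fun (j : J) => W (y j) ω)) = (gaussianReal 0 v).prod ν := by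
    rw [(indepFun_iff_map_prod_eq_prod_map_map (hmeas _) hym).1 hind, hW f₀]
  have : IsProbabilityMeasure ν := Measure.isProbabilityMeasure_map hym
  -- change of variables
  have hcv : ∀ g : ℝ × (J → ℝ) → ℝ, Measurable g → Integrable (fun ω => g (W f₀ ω, fun (j : J) => W (y j) ω)) P →
      ∫ ω, g (W f₀ ω, fun (j : J) => W (y j) ω) ∂P = ∫ u, ∫ x, g (x, u) ∂(gaussianReal 0 v) ∂ν := by
    intro g hg hgi
    have hp : AEMeasurable (fun ω => (W f₀ ω, fun (j : J) => W (y j) ω)) P := by fun_prop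
    rw [← integral_map (f := g) hp hg.aestronglyMeasurable, hlaw, integral_prod_symm]
    rw [← hlaw]
    exact (integrable_map_measure hg.aestronglyMeasurable hp).2 hgi
  have hcvf : ∀ g : ℝ × (J → ℝ) → ℝ, Measurable g → Integrable (fun ω => g (W f₀ ω, fun (j : J) => W (y j) ω)) P →
      Integrable (fun u => ∫ x, g (x, u) ∂(gaussianReal 0 v)) ν := by
    intro g hg hgi
    have hp : AEMeasurable (fun ω => (W f₀ ω, fun (j : J) => W (y j) ω)) P := by fun_prop
    have h1 := (integrable_map_measure hg.aestronglyMeasurable hp).2 hgi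
    rw [hlaw] at h1
    exact h1.integral_prod_right
  -- With the independent part frozen at `u`, the product is a polynomial in the single Gaussian
  -- variable `W f₀`, and the one-dimensional integration by parts applies.
  let q : (J → ℝ) → J → Polynomial ℝ := fun u j =>
    Polynomial.C (a j) * Polynomial.X + Polynomial.C (u j)
  have hq : ∀ u j x, (q u j).eval x = a j * x + u j := by intro u j x; simp [q]
  have hqd : ∀ u j, (q u j).derivative = Polynomial.C (a j) := by intro u j; simp [q]
  have hae1 : ∀ᵐ ω ∂P, W f₀ ω * ∏ j ∈ J, W (f j) ω
      = W f₀ ω * ∏ j : J, (a j * W f₀ ω + W (y j) ω) := by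
    filter_upwards [hdec] with ω h
    rw [← Finset.prod_coe_sort J]
    congr 1
    exact prod_congr rfl fun j _ => h j j.2
  have hae2 : ∀ k : J, ∀ᵐ ω ∂P, ∏ i ∈ J.erase k, W (f i) ω
      = ∏ i ∈ Finset.univ.erase k, (a i * W f₀ ω + W (y i) ω) := by
    intro k
    filter_upwards [hdec] with ω h
    refine Finset.prod_bij' (fun i hi => ⟨i, Finset.mem_of_mem_erase hi⟩) (fun i _ => (i : ι))
      ?_ ?_ ?_ ?_ ?_
    · intro i hi; simp only [mem_erase, Finset.mem_univ, and_true]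
      intro h; exact (Finset.ne_of_mem_erase hi) (congrArg Subtype.val h)
    · intro i hi; simp only [mem_erase] at hi ⊢
      exact ⟨fun h => hi.1 (Subtype.ext h), i.2⟩
    · intros; rfl
    · intros; rfl
    · intro i hi; exact h i (Finset.mem_of_mem_erase hi)
  have hint1 : Integrable (fun ω => W f₀ ω * ∏ j : J, (a j * W f₀ ω + W (y j) ω)) P := by
    have := integrable_prod_whiteNoise hW (Finset.univ : Finset (Option J))
      (fun o => o.elim f₀ (fun j => f j))
    refine this.congr ?_
    filter_upwards [hae1] with ω h
    rw [← h, Fintype.prod_option]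
    simp only [Option.elim]
    rw [← Finset.prod_coe_sort J]
  have hint2 : ∀ k : J, Integrable (fun ω => ∏ i ∈ Finset.univ.erase k, (a i * W f₀ ω + W (y i) ω)) P :=
    fun k => (integrable_prod_whiteNoise hW _ _).congr (hae2 k)
  rw [integral_congr_ae hae1]
  rw [hcv (fun z => z.1 * ∏ j : J, (a j * z.1 + z.2 j)) (by fun_prop) hint1]
  have hst : ∀ u : J → ℝ, ∫ x, x * ∏ j : J, (a j * x + u j) ∂(gaussianReal 0 v)
      = ∑ k : J, inner ℝ f₀ (f k) * ∫ x, ∏ i ∈ Finset.univ.erase k, (a i * x + u i) ∂(gaussianReal 0 v) := by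
    intro u
    have h := integral_mul_polynomial_gaussianReal v (∏ j : J, q u j)
    rw [Polynomial.derivative_prod_finset] at h
    simp only [Polynomial.eval_prod, hq, hqd, Polynomial.eval_finsetSum,
      Polynomial.eval_mul, Polynomial.eval_C] at h
    rw [h, integral_finsetSum, mul_sum]
    · refine sum_congr rfl fun k _ => ?_
      rw [integral_mul_const]
      have : (v : ℝ) * a k = inner ℝ f₀ (f k) := by
        simp only [hv, ha, NNReal.coe_pow, coe_nnnorm]; field_simp
      rw [← this]; ring
    · intro k _
      have := integrable_polynomial_gaussianReal v (∏ i ∈ Finset.univ.erase k, q u i)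
      simp only [Polynomial.eval_prod, hq] at this
      exact this.mul_const _
  simp_rw [hst]
  rw [integral_finsetSum]
  · rw [← Finset.sum_coe_sort J]
    refine sum_congr rfl fun k _ => ?_
    rw [integral_const_mul, integral_congr_ae (hae2 k)]
    rw [hcv (fun z => ∏ i ∈ Finset.univ.erase k, (a i * z.1 + z.2 i)) (by fun_prop) (hint2 k)]
  · intro k _
    exact (hcvf (fun z => ∏ i ∈ Finset.univ.erase k, (a i * z.1 + z.2 i)) (by fun_prop) (hint2 k)).const_mul _

/-! ### Pairings as involutions, and the Isserlis–Wick formula. -/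

section

variable {ι : Type*} [Fintype ι] [DecidableEq ι]

/-- The involutions that move exactly the elements of `S`. -/
def pairSet (S : Finset ι) : Finset (Perm ι) :=
  Finset.univ.filter fun l => (∀ k, l (l k) = k) ∧ ∀ k, l k ≠ k ↔ k ∈ S

lemma mem_pairSet {S : Finset ι} {l : Perm ι} :
    l ∈ pairSet S ↔ (∀ k, l (l k) = k) ∧ ∀ k, l k ≠ k ↔ k ∈ S := by simp [pairSet]

lemma pairSet_empty : pairSet (∅ : Finset ι) = {1} := by
  ext l
  simp only [mem_pairSet, Finset.notMem_empty, iff_false, not_not, Finset.mem_singleton]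
  constructor
  · rintro ⟨_, h⟩; ext k; simp [h k]
  · rintro rfl; simp

lemma swap_mul_apply_of_ne {S : Finset ι} {i j : ι} {l : Perm ι}
    (hl : l ∈ pairSet ((S.erase i).erase j)) {k : ι} (hi : k ≠ i) (hj : k ≠ j) :
    (swap i j * l) k = l k := by
  rw [mem_pairSet] at hl
  have hli : l i = i := by by_contra h; have := (hl.2 i).1 h; simp at this
  have hlj : l j = j := by by_contra h; have := (hl.2 j).1 h; simp at this
  rw [Perm.mul_apply]
  refine Equiv.swap_apply_of_ne_of_ne ?_ ?_
  · intro h; exact hi (l.injective (h.trans hli.symm))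
  · intro h; exact hj (l.injective (h.trans hlj.symm))

lemma swap_mul_apply_left {S : Finset ι} {i j : ι} {l : Perm ι}
    (hl : l ∈ pairSet ((S.erase i).erase j)) : (swap i j * l) i = j := by
  rw [mem_pairSet] at hl
  have hli : l i = i := by by_contra h; have := (hl.2 i).1 h; simp at this
  simp [hli]

lemma swap_mul_apply_right {S : Finset ι} {i j : ι} {l : Perm ι}
    (hl : l ∈ pairSet ((S.erase i).erase j)) : (swap i j * l) j = i := by
  rw [mem_pairSet] at hl
  have hlj : l j = j := by by_contra h; have := (hl.2 j).1 h; simp at this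
  simp [hlj]

lemma swap_mul_mem_pairSet {S : Finset ι} {i j : ι} (hi : i ∈ S) (hj : j ∈ S.erase i)
    {l : Perm ι} (hl : l ∈ pairSet ((S.erase i).erase j)) :
    swap i j * l ∈ pairSet S := by
  have hij : j ≠ i := Finset.ne_of_mem_erase hj
  have h1 := swap_mul_apply_left hl
  have h2 := swap_mul_apply_right hl
  have h3 : ∀ k, k ≠ i → k ≠ j → (swap i j * l) k = l k := fun k => swap_mul_apply_of_ne hl
  have hl' := mem_pairSet.1 hl
  have hli : l i = i := by by_contra h; have := (hl'.2 i).1 h; simp at this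
  have hlj : l j = j := by by_contra h; have := (hl'.2 j).1 h; simp at this
  rw [mem_pairSet]
  refine ⟨fun k => ?_, fun k => ?_⟩
  · by_cases hki : k = i
    · subst hki; rw [h1, h2]
    by_cases hkj : k = j
    · subst hkj; rw [h2, h1]
    rw [h3 k hki hkj, h3 (l k) (fun h => hki (l.injective (h.trans hli.symm)))
      (fun h => hkj (l.injective (h.trans hlj.symm))), hl'.1]
  · by_cases hki : k = i
    · subst hki; rw [h1]; exact ⟨fun _ => hi, fun _ => hij⟩
    by_cases hkj : k = j
    · subst hkj; rw [h2]; exact ⟨fun _ => Finset.mem_of_mem_erase hj, fun _ => hij.symm⟩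
    rw [h3 k hki hkj, hl'.2]; simp [hki, hkj]

lemma swap_mul_mem_pairSet_erase {S : Finset ι} {i : ι} (hi : i ∈ S) {l : Perm ι}
    (hl : l ∈ pairSet S) : swap i (l i) * l ∈ pairSet ((S.erase i).erase (l i)) := by
  rw [mem_pairSet] at hl
  obtain ⟨h1, h2⟩ := hl
  have h3 : ∀ k, k ≠ i → k ≠ l i → (swap i (l i) * l) k = l k := by
    intro k hk hk'
    rw [Perm.mul_apply]
    refine Equiv.swap_apply_of_ne_of_ne (fun h => hk' ?_) (fun h => hk (l.injective h))
    rw [← h, h1]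
  have h4 : (swap i (l i) * l) i = i := by simp
  have h5 : (swap i (l i) * l) (l i) = l i := by simp [h1]
  rw [mem_pairSet]
  refine ⟨fun k => ?_, fun k => ?_⟩
  · by_cases hki : k = i
    · subst hki; rw [h4, h4]
    by_cases hkj : k = l i
    · subst hkj; rw [h5, h5]
    rw [h3 k hki hkj, h3 (l k) (fun h => hkj (by rw [← h, h1])) (fun h => hki (l.injective h)), h1]
  · by_cases hki : k = i
    · rw [hki, h4]; simp
    by_cases hkj : k = l i
    · rw [hkj, h5]; simp
    rw [h3 k hki hkj, h2]; simp [hki, hkj]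

/-- A pairing of `S` amounts to a partner `j` of `i` and a pairing of the remaining elements;
multiplication by the transposition of `i` and `j` passes between the two descriptions. -/
lemma sum_pairSet {M : Type*} [AddCommMonoid M] {S : Finset ι} {i : ι} (hi : i ∈ S)
    (Φ : Perm ι → M) :
    ∑ l ∈ pairSet S, Φ l = ∑ j ∈ S.erase i, ∑ l ∈ pairSet ((S.erase i).erase j),
      Φ (swap i j * l) := by
  rw [Finset.sum_sigma']
  refine Finset.sum_bij' (fun l _ => ⟨l i, swap i (l i) * l⟩)
    (fun x _ => swap i x.1 * x.2) ?_ ?_ ?_ ?_ ?_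
  · intro l hl
    rw [Finset.mem_sigma]
    refine ⟨?_, swap_mul_mem_pairSet_erase hi hl⟩
    have hl' := mem_pairSet.1 hl
    rw [mem_erase]
    refine ⟨(hl'.2 i).2 hi, (hl'.2 _).1 ?_⟩
    rw [hl'.1]; exact fun h => (hl'.2 i).2 hi h.symm
  · intro x hx
    rw [Finset.mem_sigma] at hx
    exact swap_mul_mem_pairSet hi hx.1 hx.2
  · intro l hl; simp [← mul_assoc]
  · rintro ⟨j, l⟩ hx
    rw [Finset.mem_sigma] at hx
    have := swap_mul_apply_left hx.2
    simp only at this ⊢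
    refine Sigma.ext this ?_
    simp only [heq_eq_eq]
    rw [this, ← mul_assoc, Equiv.swap_mul_self, one_mul]
  · intro l hl; simp [← mul_assoc]

/-- A crude form of the double factorial: fewer than `S.card` partners for one element, after which
two elements fewer remain. -/
lemma card_pairSet_le (S : Finset ι) : (pairSet S).card ≤ S.card ^ (S.card / 2) := by
  induction h : S.card using Nat.strong_induction_on generalizing S with
  | _ n ih =>
  rcases S.eq_empty_or_nonempty with rfl | ⟨i, hi⟩
  · simp [pairSet_empty, ← h]
  · have hc := sum_pairSet hi (fun _ => 1)
    simp only [Finset.sum_const, smul_eq_mul, mul_one] at hc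
    rw [hc]
    have hn : 0 < n := h ▸ Finset.card_pos.2 ⟨i, hi⟩
    have hc1 : (S.erase i).card = n - 1 := by rw [Finset.card_erase_of_mem hi, h]
    by_cases h1 : n = 1
    · have : S.erase i = ∅ := Finset.card_eq_zero.1 (by omega)
      rw [this]; simp
    calc ∑ j ∈ S.erase i, (pairSet ((S.erase i).erase j)).card
        ≤ ∑ j ∈ S.erase i, n ^ ((n - 2) / 2) := by
          refine sum_le_sum fun j hj => ?_
          have hc2 : ((S.erase i).erase j).card = n - 2 := by
            rw [Finset.card_erase_of_mem hj, hc1]; omega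
          exact (ih (n - 2) (by omega) _ hc2).trans (Nat.pow_le_pow_left (by omega) _)
      _ = (n - 1) * n ^ ((n - 2) / 2) := by simp [hc1]
      _ ≤ n * n ^ ((n - 2) / 2) := Nat.mul_le_mul_right _ (by omega)
      _ = n ^ (n / 2) := by rw [← pow_succ']; congr 1; omega

/-- As `i` is minimal it is the lower index of its pair, so that removing the pair removes exactly
the factor `B i j` and leaves the orientation of the other pairs unchanged. -/
lemma prod_pairSet_swap_mul [LinearOrder ι] {M : Type*} [CommMonoid M] {S : Finset ι} {i j : ι}
    (hi : i ∈ S) (hmin : ∀ k ∈ S, i ≤ k) (hj : j ∈ S.erase i) {l : Perm ι}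
    (hl : l ∈ pairSet ((S.erase i).erase j)) (B : ι → ι → M) :
    ∏ k ∈ S.filter (fun k => k < (swap i j * l) k), B k ((swap i j * l) k)
      = B i j * ∏ k ∈ ((S.erase i).erase j).filter (fun k => k < l k), B k (l k) := by
  have hij : i < j := lt_of_le_of_ne (hmin j (Finset.mem_of_mem_erase hj))
    (Finset.ne_of_mem_erase hj).symm
  have h1 := swap_mul_apply_left hl
  have h2 := swap_mul_apply_right hl
  have hset : S.filter (fun k => k < (swap i j * l) k)
      = insert i (((S.erase i).erase j).filter (fun k => k < l k)) := by
    ext k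
    simp only [Finset.mem_filter, Finset.mem_insert, mem_erase]
    by_cases hki : k = i
    · rw [hki, h1]; simp [hi, hij]
    by_cases hkj : k = j
    · rw [hkj, h2]; simp [hij.le, hij.ne']
    rw [swap_mul_apply_of_ne hl hki hkj]; simp [hki, hkj]
  rw [hset, Finset.prod_insert (by simp), h1]
  congr 1
  refine prod_congr rfl fun k hk => ?_
  simp only [Finset.mem_filter, mem_erase] at hk
  rw [swap_mul_apply_of_ne hl hk.1.2.1 hk.1.1]

end

lemma Pairing.mem_pairSet_iff (l : Perm (Fin n)) :
    (∀ k, l k ≠ k ∧ l (l k) = k) ↔ l ∈ pairSet (Finset.univ : Finset (Fin n)) := by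
  rw [mem_pairSet]
  simp [forall_and, and_comm]

lemma Pairing.sum_eq {M : Type*} [AddCommMonoid M] (Φ : Perm (Fin n) → M) :
    ∑ l : Pairing n, Φ l.1 = ∑ l ∈ pairSet (Finset.univ : Finset (Fin n)), Φ l :=
  (Finset.sum_subtype _ (fun l => (Pairing.mem_pairSet_iff l).symm) Φ).symm

lemma Pairing.card_le (n : ℕ) : Fintype.card (Pairing (n + n)) ≤ (2 * n) ^ n := by
  have h := Pairing.sum_eq (n := n + n) (fun _ => 1)
  simp only [Finset.sum_const, smul_eq_mul, mul_one, card_univ] at h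
  rw [h]
  refine (card_pairSet_le _).trans ?_
  rw [card_univ, Fintype.card_fin]
  rw [show (n + n) / 2 = n by omega, two_mul]

/-- Induction on the number of factors: integration by parts in the factor with the smallest index
produces the recursion `sum_pairSet` of the pairings. -/
lemma integral_prod_whiteNoise_finset (hW : IsWhiteNoise W) {ι : Type*} [Fintype ι] [LinearOrder ι]
    (f : ι → L2 d) (S : Finset ι) :
    ∫ ω, ∏ i ∈ S, W (f i) ω ∂P = ∑ l ∈ pairSet S, ∏ k ∈ S.filter (fun k => k < l k),
      inner ℝ (f k) (f (l k)) := by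
  induction h : S.card using Nat.strong_induction_on generalizing S with
  | _ n ih =>
  rcases S.eq_empty_or_nonempty with rfl | hne
  · simp [pairSet_empty]
  · set i := S.min' hne with hidef
    have hi : i ∈ S := S.min'_mem hne
    have hmin : ∀ k ∈ S, i ≤ k := fun k hk => S.min'_le k hk
    rw [sum_pairSet hi]
    simp_rw [← Finset.mul_prod_erase S _ hi]
    rw [integral_whiteNoise_mul_prod hW]
    refine sum_congr rfl fun j hj => ?_
    have hc1 : (S.erase i).card = n - 1 := by rw [Finset.card_erase_of_mem hi, h]
    have hc2 : ((S.erase i).erase j).card = n - 2 := by rw [Finset.card_erase_of_mem hj, hc1]; omega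
    have hn : 0 < n := h ▸ Finset.card_pos.2 ⟨i, hi⟩
    rw [ih (n - 2) (by omega) _ hc2, mul_sum]
    refine sum_congr rfl fun l hl => ?_
    rw [prod_pairSet_swap_mul hi hmin hj hl (fun a b => inner ℝ (f a) (f b))]

/-- The Isserlis–Wick formula. -/
lemma integral_prod_whiteNoise (hW : IsWhiteNoise W) (f : Fin n → L2 d) :
    ∫ ω, ∏ i, W (f i) ω ∂P = ∑ l : Pairing n, ∏ k : l.Lower, inner ℝ (f k.1) (f (l.1 k.1)) := by
  rw [integral_prod_whiteNoise_finset hW f Finset.univ,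
    ← Pairing.sum_eq (fun l => ∏ k ∈ Finset.univ.filter (fun k => k < l k),
      inner ℝ (f k) (f (l k)))]
  refine sum_congr rfl fun l _ => ?_
  rw [Finset.prod_subtype _ (p := fun k => k < l.1 k) (by simp)]

/-! ### Continuity of translations, and integrals of products of kernels along a path. -/

section

variable {G : Type*} [NormedAddCommGroup G] [MeasurableSpace G] [BorelSpace G]
  [SecondCountableTopology G] {μ : Measure G} [μ.IsAddRightInvariant] [IsLocallyFiniteMeasure μ]
  [μ.InnerRegularCompactLTTop]

/-- Translations are continuous in `L^p`. -/
lemma tendsto_eLpNorm_translate_sub {F : Type*} [NormedAddCommGroup F] {p : ℝ≥0∞} (hp1 : 1 ≤ p)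
    (hp : p ≠ ∞) {f : G → F} (hf : MemLp f p μ) :
    Tendsto (fun h => eLpNorm (fun x => f (x + h) - f x) p μ) (𝓝 0) (𝓝 0) := by
  have : Fact (1 ≤ p) := ⟨hp1⟩
  have hmp : ∀ h : G, MeasurePreserving (fun x : G => x + h) μ μ :=
    fun h => measurePreserving_add_right μ h
  let g : C(G, C(G, G)) := (ContinuousMap.mk (fun z : G × G => z.2 + z.1) (by fun_prop)).curry
  have h1 := Filter.Tendsto.compMeasurePreservingLp (l := 𝓝 (0 : G)) (f := fun _ => hf.toLp f)
    (f₀ := hf.toLp f) (g := fun h => g h) (g₀ := g 0) tendsto_const_nhds (g.continuous.tendsto 0)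
    (fun h => hmp h) (hmp 0) hp
  have h2 := (tendsto_iff_edist_tendsto_0.1 h1)
  refine h2.congr fun h => ?_
  rw [Lp.edist_def]
  refine eLpNorm_congr_ae ?_
  have e1 := Lp.coeFn_compMeasurePreserving (hf.toLp f) (hmp h)
  have e2 := Lp.coeFn_compMeasurePreserving (hf.toLp f) (hmp 0)
  have e3 := (hmp h).quasiMeasurePreserving.ae_eq_comp hf.coeFn_toLp
  have e4 := (hmp 0).quasiMeasurePreserving.ae_eq_comp hf.coeFn_toLp
  filter_upwards [e1, e2, e3, e4] with x h1 h2 h3 h4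
  simp only [Pi.sub_apply]
  erw [h1, h2]
  rw [h3, h4]; simp

lemma tendsto_lintegral_translate_sub {f : G → ℝ} (hf : Integrable f μ) :
    Tendsto (fun h => ∫⁻ x, ‖f (x + h) - f x‖ₑ ∂μ) (𝓝 0) (𝓝 0) := by
  have := tendsto_eLpNorm_translate_sub le_rfl (by simp) (memLp_one_iff_integrable.2 hf)
  simpa only [eLpNorm_one_eq_lintegral_enorm] using this

end

section

variable {E : Type*} [NormedAddCommGroup E] [MeasurableSpace E] [BorelSpace E]
  [SecondCountableTopology E] {μ : Measure E} [μ.IsAddRightInvariant] [SigmaFinite μ]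
variable {ι : Type*} [DecidableEq ι]

/-- The labels visited by a path up to step `N`. -/
def visited (v : ℕ → ι) (N : ℕ) : Finset ι := (Finset.range (N + 1)).image v

lemma mem_visited {v : ℕ → ι} {j N : ℕ} (h : j ≤ N) : v j ∈ visited v N :=
  Finset.mem_image_of_mem _ (Finset.mem_range.2 (by omega))

lemma visited_succ (v : ℕ → ι) (N : ℕ) : visited v (N + 1) = insert (v (N + 1)) (visited v N) := by
  rw [visited, Finset.range_add_one, Finset.image_insert]; rfl

/-- The product of the edge kernels `K j` along the path with vertices `z (v j) + c j`, weighted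
with `A` at the starting point. -/
def pathProd {R : Type*} [CommMonoid R] (A : E → R) (K : ℕ → E → E → R) (v : ℕ → ι) (c : ℕ → E)
    (N : ℕ) (z : ι → E) : R :=
  A (z (v 0) + c 0) * ∏ j ∈ Finset.range N, K j (z (v j) + c j) (z (v (j + 1)) + c (j + 1))

lemma pathProd_succ {R : Type*} [CommMonoid R] (A : E → R) (K : ℕ → E → E → R) (v : ℕ → ι)
    (c : ℕ → E) (N : ℕ) (z : ι → E) : pathProd A K v c (N + 1) z
      = pathProd A K v c N z * K N (z (v N) + c N) (z (v (N + 1)) + c (N + 1)) := by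
  rw [pathProd, pathProd, Finset.prod_range_succ, mul_assoc]

lemma pathProd_update {R : Type*} [CommMonoid R] (A : E → R) (K : ℕ → E → E → R) (v : ℕ → ι)
    (c : ℕ → E) (N : ℕ) (z : ι → E) {i : ι} (hi : i ∉ visited v N) (y : E) :
    pathProd A K v c N (update z i y) = pathProd A K v c N z := by
  have : ∀ j ≤ N, update z i y (v j) = z (v j) := by
    intro j hj
    rw [Function.update_of_ne]
    rintro rfl; exact hi (mem_visited hj)
  unfold pathProd
  rw [this 0 (Nat.zero_le _)]
  congr 1
  refine prod_congr rfl fun j hj => ?_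
  rw [Finset.mem_range] at hj
  rw [this j hj.le, this (j + 1) hj]

@[fun_prop]
lemma measurable_pathProd {R : Type*} [CommMonoid R] [MeasurableSpace R] [MeasurableMul₂ R]
    {A : E → R} {K : ℕ → E → E → R} (hA : Measurable A) (hK : ∀ j, Measurable (uncurry (K j)))
    (v : ℕ → ι) (c : ℕ → E) (N : ℕ) : Measurable (pathProd A K v c N) := by
  unfold pathProd
  refine Measurable.mul (by fun_prop) (measurable_fun_prod _ fun j _ => ?_)
  exact (hK j).comp (f := fun z : ι → E => (z (v j) + c j, z (v (j + 1)) + c (j + 1))) (by fun_prop)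

lemma lmarginal_mul_const (s : Finset ι) {f : (ι → E) → ℝ≥0∞} (hf : Measurable f) (b : ℝ≥0∞)
    (x : ι → E) :
    (∫⋯∫⁻_s, (fun z => f z * b) ∂(fun _ => μ)) x = (∫⋯∫⁻_s, f ∂(fun _ => μ)) x * b := by
  unfold lmarginal
  exact lintegral_mul_const _ (by fun_prop)

/-- The integral of a product of kernels along a path: an edge that leads to a new variable costs
its `L¹` norm, an edge that leads to an old variable costs its supremum. -/
lemma lmarginal_pathProd_le {A : E → ℝ≥0∞} {K : ℕ → E → E → ℝ≥0∞} (hA : Measurable A)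
    (hK : ∀ j, Measurable (uncurry (K j))) (v : ℕ → ι) (c : ℕ → E) (w : ℕ → ℝ≥0∞) (N : ℕ)
    (hold : ∀ j < N, v (j + 1) ∈ visited v j → ∀ x y, K j x y ≤ w j)
    (hnew : ∀ j < N, v (j + 1) ∉ visited v j → ∀ x, ∫⁻ y, K j x y ∂μ ≤ w j) (x : ι → E) :
    (∫⋯∫⁻_visited v N, pathProd A K v c N ∂(fun _ => μ)) x
      ≤ (∫⁻ y, A y ∂μ) * ∏ j ∈ Finset.range N, w j := by
  induction N with
  | zero =>
    have : visited v 0 = {v 0} := by simp [visited]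
    rw [this, lmarginal_singleton]
    simp only [pathProd, Finset.range_zero, Finset.prod_empty, mul_one, Function.update_self]
    rw [lintegral_add_right_eq_self]
  | succ N ih =>
    have ih' := ih (fun j hj => hold j (by omega)) (fun j hj => hnew j (by omega))
    rw [Finset.prod_range_succ, ← mul_assoc, visited_succ]
    by_cases h : v (N + 1) ∈ visited v N
    · rw [Finset.insert_eq_of_mem h]
      refine le_trans ?_ (mul_le_mul_left ih' _)
      rw [← lmarginal_mul_const _ (by fun_prop)]
      refine lmarginal_mono (fun z => ?_) x
      simp only [pathProd_succ]
      gcongr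
      exact hold N (by omega) h _ _
    -- The new variable occurs in the last edge only, so it can be integrated first.
    · rw [lmarginal_insert' _ (by fun_prop) h]
      refine le_trans ?_ (mul_le_mul_left ih' _)
      rw [← lmarginal_mul_const _ (by fun_prop)]
      refine lmarginal_mono (fun z => ?_) x
      have hne : v N ≠ v (N + 1) := by intro h'; exact h (h' ▸ mem_visited le_rfl)
      simp only [pathProd_succ, pathProd_update _ _ _ _ _ _ h, Function.update_self,
        Function.update_of_ne hne]
      rw [lintegral_const_mul]
      · gcongr
        rw [lintegral_add_right_eq_self (μ := μ) (fun y => K N (z (v N) + c N) y)]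
        exact hnew N (by omega) h _
      · exact (hK N).comp (f := fun y => (z (v N) + c N, y + c (N + 1))) (by fun_prop)

/-- The function `a x * K x y` is integrable in both variables, so its translates converge in `L¹`.
The weight is then shifted as well; undoing this costs a translate difference of `a`, against which
the integral of the kernel is at most `B`. -/
lemma tendsto_lintegral_kernel_translate_sub [IsLocallyFiniteMeasure μ] [μ.InnerRegularCompactLTTop]
    [(μ.prod μ).InnerRegularCompactLTTop] {α : Type*} {l : Filter α} {a : E → ℝ≥0∞}
    (ha : Measurable a) (ha' : ∫⁻ x, a x ∂μ ≠ ∞) {K : E → E → ℝ} (hK : Measurable (uncurry K))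
    {B : ℝ≥0∞} (hB : B ≠ ∞) (hKB : ∀ x, ∫⁻ y, ‖K x y‖ₑ ∂μ ≤ B) {c c' : α → E}
    (hc : Tendsto c l (𝓝 0)) (hc' : Tendsto c' l (𝓝 0)) :
    Tendsto (fun t => ∫⁻ x, a x * ∫⁻ y, ‖K (x + c t) (y + c' t) - K x y‖ₑ ∂μ ∂μ) l (𝓝 0) := by
  set b : E → ℝ := fun x => (a x).toReal with hb
  have hbm : Measurable b := by fun_prop
  have hbi : Integrable b μ := integrable_toReal_of_lintegral_ne_top ha.aemeasurable ha'
  have hab : ∀ᵐ x ∂μ, a x = ‖b x‖ₑ := by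
    filter_upwards [ae_lt_top ha ha'] with x hx
    rw [hb, Real.enorm_of_nonneg ENNReal.toReal_nonneg, ENNReal.ofReal_toReal hx.ne]
  let F : E × E → ℝ := fun z => b z.1 * K z.1 z.2
  have hFm : Measurable F := by fun_prop
  have hFi : Integrable F (μ.prod μ) := by
    refine ⟨hFm.aestronglyMeasurable, ?_⟩
    rw [hasFiniteIntegral_iff_enorm, lintegral_prod _ hFm.enorm.aemeasurable]
    calc ∫⁻ x, ∫⁻ y, ‖F (x, y)‖ₑ ∂μ ∂μ ≤ ∫⁻ x, ‖b x‖ₑ * B ∂μ := by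
          refine lintegral_mono fun x => ?_
          simp only [F, enorm_mul]
          rw [lintegral_const_mul _ (f := fun y => ‖K x y‖ₑ) (hK.comp measurable_prodMk_left).enorm]
          gcongr; exact hKB x
      _ = (∫⁻ x, ‖b x‖ₑ ∂μ) * B := lintegral_mul_const _ hbm.enorm
      _ < ∞ := ENNReal.mul_lt_top hbi.2 (lt_top_iff_ne_top.2 hB)
  have h1 := (tendsto_lintegral_translate_sub hbi).comp hc
  have h2 := (tendsto_lintegral_translate_sub hFi).comp (hc.prodMk_nhds hc')
  have h3 : Tendsto (fun t => (∫⁻ x, ‖b (x + c t) - b x‖ₑ ∂μ) * B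
      + ∫⁻ z, ‖F (z + (c t, c' t)) - F z‖ₑ ∂(μ.prod μ)) l (𝓝 0) := by
    have := (ENNReal.Tendsto.mul_const h1 (Or.inr hB)).add h2
    simpa using this
  refine tendsto_of_tendsto_of_tendsto_of_le_of_le tendsto_const_nhds h3 (fun _ => zero_le) ?_
  intro t
  have hKt : Measurable fun z : E × E => K (z.1 + c t) (z.2 + c' t) := by fun_prop
  have hFt : Measurable fun z : E × E => F (z + (c t, c' t)) := by fun_prop
  calc ∫⁻ x, a x * ∫⁻ y, ‖K (x + c t) (y + c' t) - K x y‖ₑ ∂μ ∂μ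
      = ∫⁻ x, ∫⁻ y, ‖b x‖ₑ * ‖K (x + c t) (y + c' t) - K x y‖ₑ ∂μ ∂μ := by
        refine lintegral_congr_ae ?_
        filter_upwards [hab] with x hx
        rw [hx, lintegral_const_mul]
        exact ((hKt.sub hK).comp measurable_prodMk_left).enorm
    _ ≤ ∫⁻ x, ∫⁻ y, (‖b (x + c t) - b x‖ₑ * ‖K (x + c t) (y + c' t)‖ₑ
          + ‖F ((x, y) + (c t, c' t)) - F (x, y)‖ₑ) ∂μ ∂μ := by
        refine lintegral_mono fun x => lintegral_mono fun y => ?_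
        simp only [F, Prod.mk_add_mk, ← enorm_mul]
        -- With primes for shifted arguments, `b x * (K' - K) = (F' - F) - (b (x + c) - b x) * K'`.
        refine le_trans (le_of_eq ?_) ((enorm_sub_le).trans (le_of_eq (add_comm _ _)))
        congr 1; ring
    _ = ∫⁻ x, ((‖b (x + c t) - b x‖ₑ * ∫⁻ y, ‖K (x + c t) (y + c' t)‖ₑ ∂μ)
          + ∫⁻ y, ‖F ((x, y) + (c t, c' t)) - F (x, y)‖ₑ ∂μ) ∂μ := by
        refine lintegral_congr fun x => ?_
        rw [lintegral_add_left, lintegral_const_mul]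
        · exact (hKt.comp measurable_prodMk_left).enorm
        · exact (hKt.comp measurable_prodMk_left).enorm.const_mul _
    _ ≤ ∫⁻ x, (‖b (x + c t) - b x‖ₑ * B + ∫⁻ y, ‖F ((x, y) + (c t, c' t)) - F (x, y)‖ₑ ∂μ) ∂μ := by
        refine lintegral_mono fun x => ?_
        gcongr
        rw [lintegral_add_right_eq_self (μ := μ) (fun y => ‖K (x + c t) y‖ₑ)]
        exact hKB _
    _ = _ := by
        rw [lintegral_add_left, lintegral_mul_const]
        · dsimp only
          rw [lintegral_prod (μ := μ) (ν := μ) (fun z => ‖F (z + (c t, c' t)) - F z‖ₑ)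
            (hFt.sub hFm).enorm.aemeasurable]
        · exact ((hbm.comp (by fun_prop)).sub hbm).enorm
        · exact ((hbm.comp (by fun_prop)).sub hbm).enorm.mul_const _

/-- The integral of a product of kernels along a path depends continuously on small shifts of the
vertices. -/
lemma tendsto_lmarginal_pathProd_sub [IsLocallyFiniteMeasure μ] [μ.InnerRegularCompactLTTop]
    [(μ.prod μ).InnerRegularCompactLTTop] {α : Type*} {l : Filter α} [l.IsCountablyGenerated]
    {A : E → ℝ} {K : ℕ → E → E → ℝ} (hA : Measurable A) (hAi : Integrable A μ)
    (hK : ∀ j, Measurable (uncurry (K j))) (v : ℕ → ι) {c : α → ℕ → E}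
    (hc : ∀ j, Tendsto (fun t => c t j) l (𝓝 0)) (w : ℕ → ℝ≥0∞) (hw : ∀ j, w j ≠ ∞) (N : ℕ)
    (hcont : ∀ j < N, v (j + 1) ∈ visited v j → Continuous (uncurry (K j)))
    (hold : ∀ j < N, v (j + 1) ∈ visited v j → ∀ x y, ‖K j x y‖ₑ ≤ w j)
    (hnew : ∀ j < N, v (j + 1) ∉ visited v j → ∀ x, ∫⁻ y, ‖K j x y‖ₑ ∂μ ≤ w j) (x : ι → E) :
    Tendsto (fun t => (∫⋯∫⁻_visited v N,
      (fun z => ‖pathProd A K v (c t) N z - pathProd A K v 0 N z‖ₑ) ∂(fun _ => μ)) x) l (𝓝 0) := by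
  induction N with
  | zero =>
    have hv0 : visited v 0 = {v 0} := by simp [visited]
    simp only [hv0, lmarginal_singleton]
    simp only [pathProd, Finset.range_zero, Finset.prod_empty, mul_one, Function.update_self,
      Pi.zero_apply, add_zero]
    exact (tendsto_lintegral_translate_sub hAi).comp (hc 0)
  | succ N ih =>
    have ih' := ih (fun j hj => hcont j (by omega)) (fun j hj => hold j (by omega))
      (fun j hj => hnew j (by omega))
    set P := fun (c : ℕ → E) (z : ι → E) => pathProd A K v c N z with hP
    set k := fun (c : ℕ → E) (z : ι → E) => K N (z (v N) + c N) (z (v (N + 1)) + c (N + 1)) with hk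
    have hPm : ∀ c, Measurable (P c) := fun _ => by fun_prop
    have hkm : ∀ c, Measurable (k c) := fun _ => by fun_prop
    have hP0 : (∫⋯∫⁻_visited v N, (fun z => ‖P 0 z‖ₑ) ∂(fun _ => μ)) x ≠ ∞ := by
      have := lmarginal_pathProd_le (μ := μ) (A := fun y => ‖A y‖ₑ) (K := fun j x y => ‖K j x y‖ₑ)
        hA.enorm (fun j => (hK j).enorm) v 0 w N (fun j hj => hold j (by omega))
        (fun j hj => hnew j (by omega)) x
      refine ne_top_of_le_ne_top (mul_ne_top hAi.2.ne
        (ENNReal.prod_ne_top fun j _ => hw j)) (le_trans (le_of_eq ?_) this)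
      congr 1
      ext z
      simp only [hP, pathProd, enorm_mul]
      congr 1
      simp only [enorm_eq_nnnorm, nnnorm_prod, ENNReal.ofNNReal_finsetProd]
    -- Telescoping: the first `N` edges are compared with the last edge shifted, and then the last
    -- edge is compared with the first `N` edges unshifted.
    have hsplit : ∀ t z, ‖pathProd A K v (c t) (N + 1) z - pathProd A K v 0 (N + 1) z‖ₑ
        ≤ ‖P (c t) z - P 0 z‖ₑ * ‖k (c t) z‖ₑ + ‖P 0 z‖ₑ * ‖k (c t) z - k 0 z‖ₑ := by
      intro t z
      rw [pathProd_succ, pathProd_succ, ← enorm_mul, ← enorm_mul]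
      refine le_trans (le_of_eq ?_) (enorm_add_le _ _)
      congr 1; simp only [hP, hk]; ring
    have hmm : ∀ t, Measurable fun z => ‖P (c t) z - P 0 z‖ₑ * ‖k (c t) z‖ₑ := fun _ => by fun_prop
    have hmm' : ∀ t, Measurable fun z => ‖P 0 z‖ₑ * ‖k (c t) z - k 0 z‖ₑ := fun _ => by fun_prop
    have hmarg : ∀ (s : Finset ι) t, (∫⋯∫⁻_s, (fun z => ‖pathProd A K v (c t) (N + 1) z
          - pathProd A K v 0 (N + 1) z‖ₑ) ∂(fun _ => μ)) x
        ≤ (∫⋯∫⁻_s, (fun z => ‖P (c t) z - P 0 z‖ₑ * ‖k (c t) z‖ₑ) ∂(fun _ => μ)) x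
          + (∫⋯∫⁻_s, (fun z => ‖P 0 z‖ₑ * ‖k (c t) z - k 0 z‖ₑ) ∂(fun _ => μ)) x := by
      intro s t
      refine (lmarginal_mono (hsplit t) x).trans (le_of_eq ?_)
      unfold lmarginal
      exact lintegral_add_left ((hmm t).comp measurable_updateFinset) _
    have hfirst : Tendsto (fun t => (∫⋯∫⁻_visited v N,
        (fun z => ‖P (c t) z - P 0 z‖ₑ) ∂(fun _ => μ)) x * w N) l (𝓝 0) := by
      have := ENNReal.Tendsto.mul_const ih' (Or.inr (hw N))
      simpa using this
    rw [visited_succ]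
    by_cases h : v (N + 1) ∈ visited v N
    · rw [Finset.insert_eq_of_mem h]
      -- An edge to an old label is bounded and continuous, which gives dominated convergence
      -- against the integrable unshifted path.
      have hsecond : Tendsto (fun t => (∫⋯∫⁻_visited v N,
          (fun z => ‖P 0 z‖ₑ * ‖k (c t) z - k 0 z‖ₑ) ∂(fun _ => μ)) x) l (𝓝 0) := by
        unfold lmarginal
        have hlim := tendsto_lintegral_filter_of_dominated_convergence
          (μ := Measure.pi fun _ : visited v N => μ) (l := l)
          (F := fun t y => ‖P 0 (updateFinset x (visited v N) y)‖ₑ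
            * ‖k (c t) (updateFinset x (visited v N) y)
              - k 0 (updateFinset x (visited v N) y)‖ₑ) (f := fun _ => 0)
          (fun y => ‖P 0 (updateFinset x (visited v N) y)‖ₑ * (w N + w N))
          (Eventually.of_forall fun t => (hmm' t).comp measurable_updateFinset) ?_ ?_ ?_
        · simpa using hlim
        · refine Eventually.of_forall fun t => ae_of_all _ fun y => ?_
          gcongr
          refine (enorm_sub_le).trans (add_le_add ?_ ?_)
          · exact hold N (by omega) h _ _
          · exact hold N (by omega) h _ _
        · rw [lintegral_mul_const _ (f := fun y => ‖P 0 (updateFinset x (visited v N) y)‖ₑ)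
            ((hPm _).enorm.comp measurable_updateFinset)]
          exact mul_ne_top hP0 (by simp [hw N])
        · refine ae_of_all _ fun y => ?_
          set z := updateFinset x (visited v N) y
          have h1 : Tendsto (fun t => k (c t) z) l (𝓝 (k 0 z)) := by
            have hc1 : Tendsto (fun t => (z (v N) + c t N, z (v (N + 1)) + c t (N + 1))) l
                (𝓝 (z (v N) + 0, z (v (N + 1)) + 0)) :=
              (tendsto_const_nhds.add (hc _)).prodMk_nhds (tendsto_const_nhds.add (hc _))
            exact ((hcont N (by omega) h).tendsto _).comp hc1
          have h2 : Tendsto (fun t => ‖k (c t) z - k 0 z‖ₑ) l (𝓝 0) := by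
            have := (h1.sub_const (k 0 z)).enorm
            simpa using this
          have := ENNReal.Tendsto.const_mul h2 (Or.inr (enorm_ne_top (x := P 0 z)))
          simpa using this
      have hsum := hfirst.add hsecond
      rw [add_zero] at hsum
      refine tendsto_of_tendsto_of_tendsto_of_le_of_le tendsto_const_nhds hsum
        (fun _ => zero_le) fun t => ?_
      refine (hmarg _ t).trans ?_
      refine add_le_add ?_ le_rfl
      rw [← lmarginal_mul_const _ (f := fun z => ‖P (c t) z - P 0 z‖ₑ) ((hPm _).sub (hPm _)).enorm]
      refine lmarginal_mono (fun z => ?_) x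
      dsimp only
      gcongr
      exact hold N (by omega) h _ _
    · have hne : v N ≠ v (N + 1) := by intro h'; exact h (h' ▸ mem_visited le_rfl)
      have hPu : ∀ c z y, P c (update z (v (N + 1)) y) = P c z :=
        fun c z y => pathProd_update _ _ _ _ _ _ h y
      have hku : ∀ c z y, k c (update z (v (N + 1)) y) = K N (z (v N) + c N) (y + c (N + 1)) := by
        intro c z y; simp only [hk, Function.update_self, Function.update_of_ne hne]
      have hKm1 : ∀ (a b : E), Measurable fun y => K N a (y + b) := fun a b =>
        (hK N).comp (f := fun y => (a, y + b)) (by fun_prop)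
      have hi : v N ∈ visited v N := mem_visited le_rfl
      set S := visited v N
      set θ : α → E → ℝ≥0∞ := fun t u =>
        ∫⁻ y, ‖K N (u + c t N) (y + c t (N + 1)) - K N u y‖ₑ ∂μ with hθ
      have hθm : ∀ t, Measurable (θ t) := fun _ => by fun_prop
      -- The new edge is attached at the label `v N`. Integrating out all other visited labels
      -- leaves an integrable weight at this vertex, so the claim is about a single kernel.
      set a : E → ℝ≥0∞ := fun u => (∫⋯∫⁻_S.erase (v N), (fun z => ‖P 0 z‖ₑ) ∂(fun _ => μ))
        (update x (v N) u) with ha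
      have ham : Measurable a := by
        have : Measurable (∫⋯∫⁻_S.erase (v N), (fun z => ‖P 0 z‖ₑ) ∂(fun _ => μ)) :=
          Measurable.lmarginal _ (hPm 0).enorm
        exact this.comp (measurable_update x)
      have hai : ∫⁻ u, a u ∂μ ≠ ∞ := by
        have := lmarginal_erase (μ := fun _ => μ) _ (hPm 0).enorm hi x
        rw [this] at hP0; exact hP0
      have hsecond := tendsto_lintegral_kernel_translate_sub ham hai (hK N) (hw N)
        (hnew N (by omega) h) (hc N) (hc (N + 1))
      have hsum := hfirst.add hsecond
      rw [add_zero] at hsum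
      refine tendsto_of_tendsto_of_tendsto_of_le_of_le tendsto_const_nhds hsum
        (fun _ => zero_le) fun t => ?_
      refine (hmarg _ t).trans ?_
      refine add_le_add ?_ (le_of_eq ?_)
      · rw [lmarginal_insert' _ (hmm t) h,
          ← lmarginal_mul_const _ (f := fun z => ‖P (c t) z - P 0 z‖ₑ) ((hPm _).sub (hPm _)).enorm]
        refine lmarginal_mono (fun z => ?_) x
        simp only [hPu, hku]
        rw [lintegral_const_mul _ (hKm1 _ _).enorm]
        gcongr
        rw [lintegral_add_right_eq_self (μ := μ) (fun y => ‖K N (z (v N) + c t N) y‖ₑ)]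
        exact hnew N (by omega) h _
      · rw [lmarginal_insert' _ (hmm' t) h]
        have : (fun z => ∫⁻ y, ‖P 0 (update z (v (N + 1)) y)‖ₑ * ‖k (c t) (update z (v (N + 1)) y)
              - k 0 (update z (v (N + 1)) y)‖ₑ ∂μ) = fun z => ‖P 0 z‖ₑ * θ t (z (v N)) := by
          ext z
          simp only [hPu, hku, Pi.zero_apply, add_zero]
          rw [lintegral_const_mul]
          exact ((hKm1 _ _).sub (by simpa using hKm1 (z (v N)) 0)).enorm
        rw [this, lmarginal_erase (fun z => ‖P 0 z‖ₑ * θ t (z (v N))) ((hPm 0).enorm.mul ((hθm t).comp (by fun_prop))) hi]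
        refine lintegral_congr fun u => ?_
        unfold lmarginal at ha ⊢
        simp only [ha]
        rw [← lintegral_mul_const _ (f := fun y => ‖P 0 (updateFinset
          (update x (v N) u) (S.erase (v N)) y)‖ₑ)
          ((hPm 0).enorm.comp measurable_updateFinset)]
        refine lintegral_congr fun y => ?_
        congr 1
        rw [Function.updateFinset_def]
        simp [hθ]

end

/-! ### Chains of points and times, and the gluing of two chains. -/

/-- The sequence `a, y 0, …, y (n - 1), b, b, …`. -/
def chainPos {β : Type*} {n : ℕ} (a : β) (y : Fin n → β) (b : β) : ℕ → β
  | 0 => a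
  | k + 1 => if h : k < n then y ⟨k, h⟩ else b

@[simp] lemma chainPos_zero {β : Type*} (a : β) (y : Fin n → β) (b : β) :
    chainPos a y b 0 = a := rfl

lemma chainPos_succ {β : Type*} (a : β) (y : Fin n → β) (b : β) (k : ℕ) :
    chainPos a y b (k + 1) = if h : k < n then y ⟨k, h⟩ else b := rfl

lemma chainPos_last {β : Type*} (a : β) (y : Fin n → β) (b : β) :
    chainPos a y b (n + 1) = b := by simp [chainPos_succ]

lemma chainPos_tail {β : Type*} (a : β) (y : Fin (n + 1) → β) (b : β) (k : ℕ) :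
    chainPos a y b (k + 1) = chainPos (y 0) (tail y) b k := by
  cases k with
  | zero => simp [chainPos_succ]
  | succ k =>
    rw [chainPos_succ, chainPos_succ]
    by_cases h : k < n
    · rw [dif_pos (by omega), dif_pos h]; rfl
    · rw [dif_neg (by omega), dif_neg h]

lemma comp_chainPos {β γ : Type*} (f : β → γ) (a : β) (y : Fin n → β) (b : β) (k : ℕ) :
    f (chainPos a y b k) = chainPos (f a) (fun i => f (y i)) (f b) k := by
  cases k with
  | zero => rfl
  | succ k =>
    simp only [chainPos_succ]
    split_ifs <;> rfl

lemma chainPos_add {β : Type*} [Add β] (a a' : β) (y y' : Fin n → β) (b b' : β) (k : ℕ) :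
    chainPos a y b k + chainPos a' y' b' k
      = chainPos (a + a') (fun i => y i + y' i) (b + b') k := by
  cases k with
  | zero => rfl
  | succ k =>
    simp only [chainPos_succ]
    split_ifs <;> rfl

/-- The time increments `t - s 0, s 0 - s 1, …, s (n - 1)`. -/
def increment (t : ℝ) (s : Fin n → ℝ) (k : ℕ) : ℝ := chainPos t s 0 k - chainPos t s 0 (k + 1)

lemma increment_tail (t : ℝ) (s : Fin (n + 1) → ℝ) (k : ℕ) :
    increment t s (k + 1) = increment (s 0) (tail s) k := by
  rw [increment, increment, chainPos_tail, chainPos_tail]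

lemma increment_zero (t : ℝ) (s : Fin (n + 1) → ℝ) : increment t s 0 = t - s 0 := rfl

lemma increment_nil (t : ℝ) (s : Fin 0 → ℝ) : increment t s 0 = t := by
  simp [increment, chainPos_succ]

/-- The product of the kernels `g` along a chain of points and times. -/
def chainKernel {X R : Type*} [CommMonoid R] (g : ℝ → X → X → R) (n : ℕ) (t : ℝ) (x : X)
    (s : Fin n → ℝ) (y : Fin n → X) (w : X) : R :=
  ∏ k ∈ Finset.range (n + 1), g (increment t s k) (chainPos x y w k) (chainPos x y w (k + 1))

lemma chainKernel_zero {X R : Type*} [CommMonoid R] (g : ℝ → X → X → R) (t : ℝ) (x : X)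
    (s : Fin 0 → ℝ) (y : Fin 0 → X) (w : X) : chainKernel g 0 t x s y w = g t x w := by
  simp [chainKernel, increment_nil, chainPos_succ]

lemma chainKernel_succ {X R : Type*} [CommMonoid R] (g : ℝ → X → X → R) (n : ℕ) (t : ℝ) (x : X)
    (s : Fin (n + 1) → ℝ) (y : Fin (n + 1) → X) (w : X) : chainKernel g (n + 1) t x s y w
      = g (t - s 0) x (y 0) * chainKernel g n (s 0) (y 0) (tail s) (tail y) w := by
  rw [chainKernel, Finset.prod_range_succ', mul_comm]
  simp only [chainPos_tail, increment_tail, increment_zero, chainPos_zero]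
  rfl

lemma measurable_chainPos {β γ : Type*} [MeasurableSpace β] [MeasurableSpace γ] {a : γ → β}
    {y : γ → Fin n → β} {b : γ → β} (ha : Measurable a) (hy : Measurable y) (hb : Measurable b)
    (k : ℕ) : Measurable fun z => chainPos (a z) (y z) (b z) k := by
  cases k with
  | zero => exact ha
  | succ k =>
    simp only [chainPos_succ]
    split_ifs with h
    · exact (measurable_pi_apply _).comp hy
    · exact hb

lemma lintegral_pi_fin_succ {X : Type*} [MeasureSpace X] [SigmaFinite (volume : Measure X)]
    {f : (Fin (n + 1) → X) → ℝ≥0∞} (hf : Measurable f) :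
    ∫⁻ s, f s = ∫⁻ a, ∫⁻ s : Fin n → X, f (Fin.cons a s) := by
  have h := (volume_preserving_piFinSuccAbove (fun _ : Fin (n + 1) => X) 0).symm
  rw [← h.lintegral_comp hf, Measure.volume_eq_prod, lintegral_prod]
  · refine lintegral_congr fun a => lintegral_congr fun s => ?_
    congr 1
    simp [MeasurableEquiv.piFinSuccAbove, Fin.insertNthEquiv]
  · exact (hf.comp (MeasurableEquiv.measurable _)).aemeasurable

/-- Products of functions of the increments, integrated over the times. -/
def timeProd (c : ℕ → ℝ → ℝ≥0∞) (n : ℕ) (t : ℝ) (s : Fin n → ℝ) : ℝ≥0∞ :=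
  ∏ k ∈ Finset.range (n + 1), c k (increment t s k)

lemma measurable_timeProd {c : ℕ → ℝ → ℝ≥0∞} (hc : ∀ k, Measurable (c k)) (n : ℕ) (t : ℝ) :
    Measurable (timeProd c n t) := by
  refine measurable_fun_prod _ fun k _ => (hc k).comp ?_
  exact (measurable_chainPos measurable_const measurable_id measurable_const k).sub
    (measurable_chainPos measurable_const measurable_id measurable_const (k + 1))

lemma timeProd_succ (c : ℕ → ℝ → ℝ≥0∞) (n : ℕ) (t : ℝ) (s : Fin (n + 1) → ℝ) :
    timeProd c (n + 1) t s = c 0 (t - s 0) * timeProd (fun k => c (k + 1)) n (s 0) (tail s) := by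
  rw [timeProd, Finset.prod_range_succ', mul_comm]
  simp only [increment_tail, increment_zero]
  rfl

/-- The increments add up to `t`, so the factors `exp (-lam * τ)` attached to them multiply to `exp
(-lam * t)`, and the iterated convolution splits into separate integrals. There are `n` times for `n
+ 1` increments, so the last factor is bounded pointwise. -/
lemma lintegral_timeProd_le (lam : ℝ) (c : ℕ → ℝ → ℝ≥0∞) (hc : ∀ k, Measurable (c k)) (b : ℕ → ℝ≥0∞)
    (n : ℕ) (hb : ∀ k < n, ∫⁻ τ, c k τ * ofReal (exp (-lam * τ)) ≤ b k)
    (hn : ∀ τ, c n τ * ofReal (exp (-lam * τ)) ≤ b n) (t : ℝ) :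
    ∫⁻ s, timeProd c n t s ≤ ofReal (exp (lam * t)) * ∏ k ∈ Finset.range (n + 1), b k := by
  have hexp : ∀ u : ℝ, ofReal (exp (lam * u)) * ofReal (exp (-lam * u)) = 1 := by
    intro u
    rw [← ofReal_mul (Real.exp_nonneg _), ← Real.exp_add]; simp
  induction n generalizing c b t with
  | zero =>
    simp only [timeProd, zero_add, Finset.range_one, Finset.prod_singleton, increment_nil]
    rw [lintegral_const]
    have : (volume : Measure (Fin 0 → ℝ)) univ = 1 := by simp [volume_pi]
    rw [this, mul_one]
    calc c 0 t = ofReal (exp (lam * t))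
          * (c 0 t * ofReal (exp (-lam * t))) := by
          rw [mul_comm (c 0 t), ← mul_assoc, hexp, one_mul]
      _ ≤ _ := by gcongr; exact hn t
  | succ n ih =>
    rw [lintegral_pi_fin_succ (measurable_timeProd hc _ _)]
    simp only [timeProd_succ, Fin.cons_zero, Fin.tail_cons]
    have hm : ∀ a, Measurable (timeProd (fun k => c (k + 1)) n a) :=
      fun a => measurable_timeProd (fun k => hc (k + 1)) _ _
    calc ∫⁻ a, ∫⁻ s : Fin n → ℝ, c 0 (t - a) * timeProd (fun k => c (k + 1)) n a s
        = ∫⁻ a, c 0 (t - a) * ∫⁻ s : Fin n → ℝ, timeProd (fun k => c (k + 1)) n a s := by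
          refine lintegral_congr fun a => ?_
          rw [lintegral_const_mul _ (hm a)]
      _ ≤ ∫⁻ a, c 0 (t - a) * (ofReal (exp (lam * a)) * ∏ k ∈ Finset.range (n + 1), b (k + 1)) := by
          refine lintegral_mono fun a => ?_
          gcongr
          exact ih (fun k => c (k + 1)) (fun k => hc (k + 1)) (fun k => b (k + 1))
            (fun k hk => hb (k + 1) (by omega)) hn a
      _ = ∫⁻ a, (c 0 (t - a) * ofReal (exp (-lam * (t - a))))
            * (ofReal (exp (lam * t)) * ∏ k ∈ Finset.range (n + 1), b (k + 1)) := by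
          refine lintegral_congr fun a => ?_
          have : ofReal (exp (lam * a)) = ofReal (exp (-lam * (t - a)))
              * ofReal (exp (lam * t)) := by
            rw [← ofReal_mul (Real.exp_nonneg _), ← Real.exp_add]; congr 2; ring
          rw [this]; ring
      _ = (∫⁻ τ, c 0 τ * ofReal (exp (-lam * τ)))
            * (ofReal (exp (lam * t)) * ∏ k ∈ Finset.range (n + 1), b (k + 1)) := by
          rw [lintegral_mul_const]
          · rw [lintegral_sub_left_eq_self (μ := volume)
              (fun τ => c 0 τ * ofReal (exp (-lam * τ))) t]
          · exact ((hc 0).comp (by fun_prop)).mul (by fun_prop)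
      _ ≤ b 0 * (ofReal (exp (lam * t)) * ∏ k ∈ Finset.range (n + 1), b (k + 1)) := by
          gcongr; exact hb 0 (by omega)
      _ = _ := by rw [Finset.prod_range_succ' _ (n + 1)]; ring

/-- The path that runs through `a (n + 1), …, a 0` and then through `b 1, b 2, …`. -/
def glue {β : Type*} (n : ℕ) (a b : ℕ → β) (j : ℕ) : β :=
  if j ≤ n + 1 then a (n + 1 - j) else b (j - (n + 1))

/-- The edges of the path `glue n a b`. -/
def glueEdge {β : Type*} (n : ℕ) (a b : ℕ → β) (j : ℕ) : β :=
  if j < n + 1 then a (n - j) else b (j - (n + 1))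

lemma comp_glue {β γ : Type*} (f : β → γ) (n : ℕ) (a b : ℕ → β) (j : ℕ) :
    f (glue n a b j) = glue n (fun k => f (a k)) (fun k => f (b k)) j := by
  unfold glue; split_ifs <;> rfl

lemma glue_add {β : Type*} [Add β] (n : ℕ) (a b a' b' : ℕ → β) (j : ℕ) :
    glue n a b j + glue n a' b' j = glue n (fun k => a k + a' k) (fun k => b k + b' k) j := by
  unfold glue; split_ifs <;> rfl

lemma glue_of_ge {β : Type*} {a b : ℕ → β} (hab : a 0 = b 0) {j : ℕ} (hj : n + 1 ≤ j) :
    glue n a b j = b (j - (n + 1)) := by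
  unfold glue
  split_ifs with h
  · have : j = n + 1 := by omega
    subst this; simp [hab]
  · rfl

lemma prod_glueEdge {R : Type*} [CommMonoid R] (n : ℕ) (A B : ℕ → R) :
    ∏ j ∈ Finset.range (n + 1 + (n + 1)), glueEdge n A B j
      = (∏ k ∈ Finset.range (n + 1), A k) * ∏ k ∈ Finset.range (n + 1), B k := by
  rw [Finset.prod_range_add]
  congr 1
  · rw [← Finset.prod_range_reflect]
    refine prod_congr rfl fun j hj => ?_
    rw [Finset.mem_range] at hj
    rw [glueEdge, if_pos (by omega)]; congr 1; omega
  · refine prod_congr rfl fun j _ => ?_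
    rw [glueEdge, if_neg (by omega)]; congr 1; omega

/-- The first chain is traversed backwards, from its end to the common vertex, whence the symmetry
of its kernels; the second is traversed forwards. -/
lemma prod_glueEdge_glue {X R : Type*} [CommMonoid R] (n : ℕ) (K K' : ℕ → X → X → R)
    (hK : ∀ k x y, K k x y = K k y x) (a b : ℕ → X) (hab : a 0 = b 0) :
    ∏ j ∈ Finset.range (n + 1 + (n + 1)), glueEdge n K K' j (glue n a b j) (glue n a b (j + 1))
      = (∏ k ∈ Finset.range (n + 1), K k (a k) (a (k + 1)))
      * ∏ k ∈ Finset.range (n + 1), K' k (b k) (b (k + 1)) := by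
  rw [← prod_glueEdge]
  refine prod_congr rfl fun j _ => ?_
  unfold glueEdge
  split_ifs with h
  · rw [glue, if_pos (by omega), glue, if_pos (by omega), hK]
    congr 2 <;> omega
  · rw [glue_of_ge hab (by omega), glue_of_ge hab (by omega)]
    congr 2; omega

/-- Every label except the first is reached by exactly one new edge, so the numbers of new and of
old edges depend on the number of labels and not on the order of visits. -/
lemma prod_ite_visited {ι R : Type*} [DecidableEq ι] [CommMonoid R] (v : ℕ → ι) (a b : R) (N : ℕ) :
    ∃ p q : ℕ, p + 1 = (visited v N).card ∧ p + q = N ∧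
      ∏ j ∈ Finset.range N, (if v (j + 1) ∈ visited v j then b else a) = a ^ p * b ^ q := by
  induction N with
  | zero => exact ⟨0, 0, by simp [visited], rfl, by simp⟩
  | succ N ih =>
    obtain ⟨p, q, h1, h2, h3⟩ := ih
    rw [Finset.prod_range_succ, h3, visited_succ]
    by_cases h : v (N + 1) ∈ visited v N
    · refine ⟨p, q + 1, by rw [Finset.insert_eq_of_mem h, h1], by omega, ?_⟩
      rw [if_pos h, pow_succ, mul_assoc]
    · refine ⟨p + 1, q, by rw [Finset.card_insert_of_notMem h, h1], by omega, ?_⟩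
      rw [if_neg h, pow_succ]; exact mul_right_comm _ _ _

section

variable (l : Pairing (n + n))

/-- The variables of integration: one for every pair, the central point and the two end points. -/
abbrev Pairing.Label := l.Lower ⊕ Fin 3

/-- The labels of the first chain. -/
def Pairing.chain₁ : ℕ → l.Label := chainPos (Sum.inr 0) (fun i => Sum.inl low(l, i)) (Sum.inr 1)

/-- The labels of the second chain. -/
def Pairing.chain₂ : ℕ → l.Label := chainPos (Sum.inr 0) (fun i => Sum.inl upp(l, i)) (Sum.inr 2)

lemma Pairing.rep_lower (k : l.Lower) : l.rep k = k := by unfold Pairing.rep; rw [dif_pos k.2]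

lemma Pairing.card_lower : Fintype.card l.Lower = n := by
  have h1 : Fintype.card l.Lower = Fintype.card {k : Fin (n + n) // ¬ k < l.1 k} := by
    refine Fintype.card_congr ⟨fun k => ⟨l.1 k, ?_⟩, fun k => ⟨l.1 k, ?_⟩, ?_, ?_⟩
    · rw [(l.2 k).2]; exact not_lt.2 k.2.le
    · rw [(l.2 k).2]; exact lt_of_le_of_ne (not_lt.1 k.2) (l.2 k).1
    · intro k; ext; simp [(l.2 k).2]
    · intro k; ext; simp [(l.2 k).2]
  have h2 := Fintype.card_subtype_compl (fun k : Fin (n + n) => k < l.1 k)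
  have h3 := Fintype.card_subtype_le (fun k : Fin (n + n) => k < l.1 k)
  rw [Fintype.card_fin] at h2 h3
  change Fintype.card l.Lower ≤ _ at h3
  change _ = _ - Fintype.card l.Lower at h2
  omega

lemma Pairing.mem_chain (q : l.Label) :
    (∃ k ≤ n + 1, l.chain₁ k = q) ∨ ∃ k ≤ n + 1, l.chain₂ k = q := by
  rcases q with k | i
  · have hk := l.rep_lower k
    obtain ⟨k, hk'⟩ := k
    induction k using Fin.addCases with
    | left i =>
      refine Or.inl ⟨i + 1, by omega, ?_⟩
      rw [Pairing.chain₁, chainPos_succ, dif_pos i.2]; exact congrArg _ hk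
    | right i =>
      refine Or.inr ⟨i + 1, by omega, ?_⟩
      rw [Pairing.chain₂, chainPos_succ, dif_pos i.2]; exact congrArg _ hk
  · fin_cases i
    · exact Or.inl ⟨0, by omega, rfl⟩
    · exact Or.inl ⟨n + 1, le_rfl, chainPos_last _ _ _⟩
    · exact Or.inr ⟨n + 1, le_rfl, chainPos_last _ _ _⟩

lemma visited_glue_eq_univ {ι : Type*} [Fintype ι] [DecidableEq ι] {a b : ℕ → ι} (hab : a 0 = b 0)
    (h : ∀ q, (∃ k ≤ n + 1, a k = q) ∨ ∃ k ≤ n + 1, b k = q) :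
    visited (glue n a b) (n + 1 + (n + 1)) = Finset.univ := by
  rw [Finset.eq_univ_iff_forall]
  intro q
  rcases h q with ⟨k, hk, rfl⟩ | ⟨k, hk, rfl⟩
  · have : glue n a b (n + 1 - k) = a k := by rw [glue, if_pos (by omega)]; congr 1; omega
    rw [← this]; exact mem_visited (by omega)
  · have : glue n a b (n + 1 + k) = b k := by rw [glue_of_ge hab (by omega)]; congr 1; omega
    rw [← this]; exact mem_visited (by omega)

/-- The two labels at the ends of the glued path are visited for the first time. -/
lemma glue_ends_notMem {a b : ℕ → l.Label}
    (hab : (a = l.chain₁ ∧ b = l.chain₂) ∨ (a = l.chain₂ ∧ b = l.chain₁)) :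
    glue n a b 1 ∉ visited (glue n a b) 0 ∧
      glue n a b (n + 1 + n + 1) ∉ visited (glue n a b) (n + 1 + n) := by
  have ha0 : a 0 = Sum.inr 0 := by rcases hab with ⟨rfl, rfl⟩ | ⟨rfl, rfl⟩ <;> rfl
  have hb0 : b 0 = Sum.inr 0 := by rcases hab with ⟨rfl, rfl⟩ | ⟨rfl, rfl⟩ <;> rfl
  -- Among the three special labels, a chain contains only the centre, at its first place, and its
  -- own end label, at its last place.
  have key : ∀ (i i' : Fin 3) (y : Fin n → l.Lower), i' ≠ 0 → ∀ k ≤ n + 1,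
      (chainPos (Sum.inr 0) (fun i => Sum.inl (y i)) (Sum.inr i') k : l.Label) = Sum.inr i →
      i = 0 ∨ (i = i' ∧ k = n + 1) := by
    intro i i' y hi' k hk h
    cases k with
    | zero => left; simpa using h.symm
    | succ k =>
      rw [chainPos_succ] at h
      split_ifs at h with h'
      right; exact ⟨by simpa using h.symm, by omega⟩
  obtain ⟨ia, ib, ya, yb, hia, hib, hiab, ha, hb⟩ : ∃ (ia ib : Fin 3) (ya yb : Fin n → l.Lower),
      ia ≠ 0 ∧ ib ≠ 0 ∧ ia ≠ ib ∧ a = chainPos (Sum.inr 0) (fun i => Sum.inl (ya i)) (Sum.inr ia) ∧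
      b = chainPos (Sum.inr 0) (fun i => Sum.inl (yb i)) (Sum.inr ib) := by
    rcases hab with ⟨rfl, rfl⟩ | ⟨rfl, rfl⟩
    · exact ⟨1, 2, _, _, by decide, by decide, by decide, rfl, rfl⟩
    · exact ⟨2, 1, _, _, by decide, by decide, by decide, rfl, rfl⟩
  have hae : a (n + 1) = Sum.inr ia := by rw [ha]; exact chainPos_last _ _ _
  have hbe : b (n + 1) = Sum.inr ib := by rw [hb]; exact chainPos_last _ _ _
  constructor
  · have h1 : visited (glue n a b) 0 = {Sum.inr ia} := by simp [visited, glue, hae]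
    rw [h1, Finset.mem_singleton]
    have h2 : glue n a b 1 = a n := by simp [glue]
    rw [h2, ha]
    intro h
    rcases key ia ia ya hia n (by omega) h with h | h
    · exact hia h
    · omega
  · have h1 : glue n a b (n + 1 + n + 1) = Sum.inr ib := by
      rw [glue_of_ge (ha0.trans hb0.symm) (by omega), ← hbe]; congr 1; omega
    rw [h1, visited, Finset.mem_image]
    rintro ⟨j, hj, h⟩
    rw [Finset.mem_range] at hj
    by_cases hjn : j ≤ n + 1
    · rw [glue, if_pos hjn, ha] at h
      rcases key ib ia ya hia _ (by omega) h with h | h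
      · exact hib h
      · exact hiab h.1.symm
    · rw [glue, if_neg hjn, hb] at h
      rcases key ib ib yb hib _ (by omega) h with h | h
      · exact hib h
      · omega

end

/-! ### Bounds for the contribution of one pairing. -/

/-- The cost of an edge that leads to a new variable. -/
def newWeight (C : ℝ≥0) (T τ : ℝ) : ℝ≥0∞ := (Ioo 0 T).indicator (fun _ => (C : ℝ≥0∞)) τ

/-- The cost of an edge that leads to an old variable. -/
def oldWeight (C : ℝ≥0) (a T τ : ℝ) : ℝ≥0∞ :=
  (Ioo 0 T).indicator (fun τ => (C : ℝ≥0∞) * ofReal (τ ^ (-a))) τ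

lemma measurable_newWeight (C : ℝ≥0) (T : ℝ) : Measurable (newWeight C T) :=
  measurable_const.indicator measurableSet_Ioo

lemma measurable_oldWeight (C : ℝ≥0) (a T : ℝ) : Measurable (oldWeight C a T) :=
  Measurable.indicator (by fun_prop) measurableSet_Ioo

lemma oldWeight_ne_top (C : ℝ≥0) (a T τ : ℝ) : oldWeight C a T τ ≠ ∞ := by
  unfold oldWeight
  by_cases h : τ ∈ Ioo 0 T
  · rw [indicator_of_mem h]; exact mul_ne_top coe_ne_top ofReal_ne_top
  · rw [indicator_of_notMem h]; simp

lemma newWeight_le (C : ℝ≥0) (T τ : ℝ) : newWeight C T τ ≤ C := by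
  unfold newWeight; exact indicator_le_self' (by simp) _

/-- The Green's function, cut off to the times in `(0, T)`, with its bounds. -/
structure GreenKernel (g : ℝ → Space d → Space d → ℝ) (C : ℝ≥0) (a T : ℝ) : Prop where
  measurable : Measurable fun z : ℝ × Space d × Space d => g z.1 z.2.1 z.2.2
  symm : ∀ τ x y, g τ x y = g τ y x
  continuous : ∀ τ, Continuous (uncurry (g τ))
  l1_le : ∀ τ x, ∫⁻ y, ‖g τ x y‖ₑ ≤ newWeight C T τ
  sup_le : ∀ τ x y, ‖g τ x y‖ₑ ≤ oldWeight C a T τ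

/-- The cost of an edge. -/
def edgeWeight (C : ℝ≥0) (a T : ℝ) (old : Prop) [Decidable old] (τ : ℝ) : ℝ≥0∞ :=
  if old then oldWeight C a T τ else newWeight C T τ

lemma measurable_edgeWeight (C : ℝ≥0) (a T : ℝ) (old : Prop) [Decidable old] :
    Measurable (edgeWeight C a T old) := by
  unfold edgeWeight
  split_ifs
  · exact measurable_oldWeight C a T
  · exact measurable_newWeight C T

section

variable {l : Pairing (n + n)}

/-- The costs of the edges of the first half of a glued path. -/
def firstWeight (C : ℝ≥0) (a T : ℝ) (p q : ℕ → l.Label) (k : ℕ) (τ : ℝ) : ℝ≥0∞ :=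
  edgeWeight C a T (glue n p q (n - k + 1) ∈ visited (glue n p q) (n - k)) τ

/-- The costs of the edges of the second half of a glued path. -/
def secondWeight (C : ℝ≥0) (a T : ℝ) (p q : ℕ → l.Label) (k : ℕ) (τ : ℝ) : ℝ≥0∞ :=
  edgeWeight C a T (glue n p q (n + 1 + k + 1) ∈ visited (glue n p q) (n + 1 + k)) τ

lemma measurable_firstWeight (p q : ℕ → l.Label) (k : ℕ) :
    Measurable (firstWeight C a T p q k) := measurable_edgeWeight _ _ _ _

lemma measurable_secondWeight (p q : ℕ → l.Label) (k : ℕ) :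
    Measurable (secondWeight C a T p q k) := measurable_edgeWeight _ _ _ _

/-- The last increment of each chain is not integrated in time and needs a pointwise bound. Its edge
ends at an initial point, which belongs to one chain only, so it carries the bounded weight and not
the singular one. -/
lemma firstWeight_last {p q : ℕ → l.Label}
    (hpq : (p = l.chain₁ ∧ q = l.chain₂) ∨ (p = l.chain₂ ∧ q = l.chain₁)) :
    firstWeight C a T p q n = newWeight C T := by
  ext τ
  have := (glue_ends_notMem l hpq).1
  unfold firstWeight edgeWeight
  rw [if_neg (by simpa using this)]

lemma secondWeight_last {p q : ℕ → l.Label}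
    (hpq : (p = l.chain₁ ∧ q = l.chain₂) ∨ (p = l.chain₂ ∧ q = l.chain₁)) :
    secondWeight C a T p q n = newWeight C T := by
  ext τ
  have := (glue_ends_notMem l hpq).2
  unfold secondWeight edgeWeight
  rw [if_neg this]

lemma labels_of_order {p q : ℕ → l.Label}
    (hpq : (p = l.chain₁ ∧ q = l.chain₂) ∨ (p = l.chain₂ ∧ q = l.chain₁)) :
    p 0 = q 0 ∧ visited (glue n p q) (n + 1 + (n + 1)) = Finset.univ := by
  have h0 : p 0 = q 0 := by rcases hpq with ⟨rfl, rfl⟩ | ⟨rfl, rfl⟩ <;> rfl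
  refine ⟨h0, visited_glue_eq_univ h0 fun r => ?_⟩
  rcases hpq with ⟨rfl, rfl⟩ | ⟨rfl, rfl⟩
  · exact l.mem_chain r
  · exact (l.mem_chain r).symm

lemma edgeWeight_glueEdge (p q : ℕ → l.Label) (e₁ e₂ : ℕ → ℝ) (j : ℕ) :
    edgeWeight C a T (glue n p q (j + 1) ∈ visited (glue n p q) j) (glueEdge n e₁ e₂ j)
      = glueEdge n (fun k => firstWeight C a T p q k (e₁ k))
      (fun k => secondWeight C a T p q k (e₂ k)) j := by
  unfold glueEdge firstWeight secondWeight
  split_ifs with h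
  · dsimp only
    have : n - (n - j) = j := by omega
    rw [this]
  · dsimp only
    have : n + 1 + (j - (n + 1)) = j := by omega
    rw [this]

/-- The integral over all vertices of the glued path, started with the weight `A` at an end. -/
lemma lintegral_glue_le (hg : GreenKernel g C a T) {A : Space d → ℝ≥0∞} (hA : Measurable A)
    {p q : ℕ → l.Label} (hpq : (p = l.chain₁ ∧ q = l.chain₂) ∨ (p = l.chain₂ ∧ q = l.chain₁))
    (e₁ e₂ : ℕ → ℝ) (c₁ c₂ : ℕ → Space d) (hc : c₁ 0 = c₂ 0) :
    ∫⁻ u : l.Label → Space d, A (u (p (n + 1)) + c₁ (n + 1))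
        * ((∏ k ∈ Finset.range (n + 1), ‖g (e₁ k) (u (p k) + c₁ k) (u (p (k + 1)) + c₁ (k + 1))‖ₑ)
        * ∏ k ∈ Finset.range (n + 1), ‖g (e₂ k) (u (q k) + c₂ k) (u (q (k + 1)) + c₂ (k + 1))‖ₑ)
      ≤ (∫⁻ x, A x) * ((∏ k ∈ Finset.range (n + 1), firstWeight C a T p q k (e₁ k))
      * ∏ k ∈ Finset.range (n + 1), secondWeight C a T p q k (e₂ k)) := by
  obtain ⟨h0, huniv⟩ := labels_of_order hpq
  have key := lmarginal_pathProd_le (μ := (volume : Measure (Space d))) (A := A)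
    (K := glueEdge n (fun k x y => ‖g (e₁ k) x y‖ₑ) (fun k x y => ‖g (e₂ k) x y‖ₑ)) hA ?_
    (glue n p q) (glue n c₁ c₂)
    (fun j => edgeWeight C a T (glue n p q (j + 1) ∈ visited (glue n p q) j) (glueEdge n e₁ e₂ j))
    (n + 1 + (n + 1)) ?_ ?_ 0
  · rw [huniv, lmarginal_univ] at key
    simp only [edgeWeight_glueEdge] at key
    rw [prod_glueEdge] at key
    refine le_trans (le_of_eq ?_) key
    refine lintegral_congr fun u => ?_
    rw [pathProd]
    have hpos : ∀ j, u (glue n p q j) + glue n c₁ c₂ j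
        = glue n (fun k => u (p k) + c₁ k) (fun k => u (q k) + c₂ k) j := by
      intro j; rw [comp_glue u, glue_add]
    simp only [hpos]
    rw [prod_glueEdge_glue n _ _ (fun k x y => by rw [hg.symm]) _ _ (by rw [h0, hc])]
    congr 2
  · intro j
    have : ∀ τ, Measurable (uncurry fun x y => ‖g τ x y‖ₑ) := fun τ =>
      (hg.measurable.comp (measurable_const.prodMk measurable_id)).enorm
    unfold glueEdge
    split_ifs <;> exact this _
  · intro j _ h x y
    rw [edgeWeight, if_pos h]
    unfold glueEdge
    split_ifs <;> exact hg.sup_le _ _ _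
  · intro j _ h x
    rw [edgeWeight, if_neg h]
    unfold glueEdge
    split_ifs <;> exact hg.l1_le _ _

/-- The absolute value of the contribution of a pairing at fixed times, in terms of the joint
vector `u` of all variables, with shifts `c₁` and `c₂` of the vertices. -/
def pairDensity (g : ℝ → Space d → Space d → ℝ) (u₀ : Space d → ℝ) (t : ℝ) (s s' : Fin n → ℝ)
    (c₁ c₂ : Fin n → Space d) (u : l.Label → Space d) : ℝ≥0∞ :=
  ‖u₀ (u (Sum.inr 1)) * chainKernel g n t (u (Sum.inr 0)) s
      (fun i => u (Sum.inl low(l, i)) + c₁ i) (u (Sum.inr 1))‖ₑ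
    * ‖u₀ (u (Sum.inr 2)) * chainKernel g n t (u (Sum.inr 0)) s'
      (fun i => u (Sum.inl upp(l, i)) + c₂ i) (u (Sum.inr 2))‖ₑ

lemma chain₁_add (u : l.Label → Space d) (c : Fin n → Space d) (k : ℕ) :
    chainPos (u (Sum.inr 0)) (fun i => u (Sum.inl low(l, i)) + c i)
      (u (Sum.inr 1)) k = u (l.chain₁ k) + chainPos 0 c 0 k := by
  rw [Pairing.chain₁, comp_chainPos u, chainPos_add]; simp

lemma chain₂_add (u : l.Label → Space d) (c : Fin n → Space d) (k : ℕ) :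
    chainPos (u (Sum.inr 0)) (fun i => u (Sum.inl upp(l, i)) + c i)
      (u (Sum.inr 2)) k = u (l.chain₂ k) + chainPos 0 c 0 k := by
  rw [Pairing.chain₂, comp_chainPos u, chainPos_add]; simp

lemma chainKernel_chain₁ {R : Type*} [CommMonoid R] (g : ℝ → Space d → Space d → R)
    (u : l.Label → Space d) (c : Fin n → Space d) (t : ℝ) (s : Fin n → ℝ) :
    chainKernel g n t (u (Sum.inr 0)) s (fun i => u (Sum.inl low(l, i)) + c i) (u (Sum.inr 1))
    = ∏ k ∈ Finset.range (n + 1), g (increment t s k) (u (l.chain₁ k) + chainPos 0 c 0 k)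
      (u (l.chain₁ (k + 1)) + chainPos 0 c 0 (k + 1)) := by
  unfold chainKernel; simp only [chain₁_add]

lemma chainKernel_chain₂ {R : Type*} [CommMonoid R] (g : ℝ → Space d → Space d → R)
    (u : l.Label → Space d) (c : Fin n → Space d) (t : ℝ) (s : Fin n → ℝ) :
    chainKernel g n t (u (Sum.inr 0)) s (fun i => u (Sum.inl upp(l, i)) + c i) (u (Sum.inr 2))
    = ∏ k ∈ Finset.range (n + 1), g (increment t s k) (u (l.chain₂ k) + chainPos 0 c 0 k)
      (u (l.chain₂ (k + 1)) + chainPos 0 c 0 (k + 1)) := by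
  unfold chainKernel; simp only [chain₂_add]

lemma enorm_prod_real {ι : Type*} (s : Finset ι) (f : ι → ℝ) :
    ‖∏ i ∈ s, f i‖ₑ = ∏ i ∈ s, ‖f i‖ₑ := by
  simp only [enorm_eq_nnnorm, nnnorm_prod, ENNReal.ofNNReal_finsetProd]

lemma mul_le_sq_add_sq_ennreal (x y : ℝ≥0∞) : x * y ≤ x ^ 2 + y ^ 2 := by
  rcases le_total x y with h | h
  · calc x * y ≤ y * y := by gcongr
      _ = y ^ 2 := (sq y).symm
      _ ≤ _ := le_add_self
  · calc x * y ≤ x * x := by gcongr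
      _ = x ^ 2 := (sq x).symm
      _ ≤ _ := le_self_add

/-- The bound for the contribution of a pairing at fixed times. -/
def pairBound (C : ℝ≥0) (a T : ℝ) (l : Pairing (n + n)) (t : ℝ) (s s' : Fin n → ℝ) : ℝ≥0∞ :=
  timeProd (firstWeight C a T l.chain₁ l.chain₂) n t s
      * timeProd (secondWeight C a T l.chain₁ l.chain₂) n t s'
    + timeProd (secondWeight C a T l.chain₂ l.chain₁) n t s
      * timeProd (firstWeight C a T l.chain₂ l.chain₁) n t s'

/-- The product of the two factors `|u₀|` is at most the sum of their squares, and each square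
serves as the starting weight of the glued path, which is therefore run once in each direction.
Shifting vertices changes nothing, since `L¹` norms and suprema are invariant under translations. -/
lemma lintegral_pairDensity_le (hg : GreenKernel g C a T) (hu : Measurable u₀) (t : ℝ)
    (s s' : Fin n → ℝ) (c₁ c₂ : Fin n → Space d) :
    ∫⁻ u : l.Label → Space d, pairDensity g u₀ t s s' c₁ c₂ u
      ≤ (∫⁻ x, ‖u₀ x‖ₑ ^ 2) * pairBound C a T l t s s' := by
  have h1 := lintegral_glue_le (l := l) hg (A := fun x => ‖u₀ x‖ₑ ^ 2) (hu.enorm.pow_const 2)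
    (Or.inl ⟨rfl, rfl⟩) (increment t s) (increment t s') (chainPos 0 c₁ 0) (chainPos 0 c₂ 0) rfl
  have h2 := lintegral_glue_le (l := l) hg (A := fun x => ‖u₀ x‖ₑ ^ 2) (hu.enorm.pow_const 2)
    (Or.inr ⟨rfl, rfl⟩) (increment t s') (increment t s) (chainPos 0 c₂ 0) (chainPos 0 c₁ 0) rfl
  unfold pairBound timeProd
  rw [mul_add]
  refine le_trans ?_ (add_le_add h1 (h2.trans (le_of_eq (by rw [mul_comm (∏ k ∈ _, firstWeight C a T l.chain₂ l.chain₁ k _)]))))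
  rw [← lintegral_add_left]
  · refine lintegral_mono fun u => ?_
    simp only [pairDensity, enorm_mul, chainKernel_chain₁, chainKernel_chain₂, enorm_prod_real]
    set X := ∏ k ∈ Finset.range (n + 1), ‖g (increment t s k) (u (l.chain₁ k) + chainPos 0 c₁ 0 k)
        (u (l.chain₁ (k + 1)) + chainPos 0 c₁ 0 (k + 1))‖ₑ
    set Y := ∏ k ∈ Finset.range (n + 1), ‖g (increment t s' k) (u (l.chain₂ k) + chainPos 0 c₂ 0 k)
        (u (l.chain₂ (k + 1)) + chainPos 0 c₂ 0 (k + 1))‖ₑ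
    have e1 : l.chain₁ (n + 1) = Sum.inr 1 := chainPos_last _ _ _
    have e2 : l.chain₂ (n + 1) = Sum.inr 2 := chainPos_last _ _ _
    rw [e1, e2, chainPos_last, chainPos_last, add_zero, add_zero]
    calc ‖u₀ (u (Sum.inr 1))‖ₑ * X * (‖u₀ (u (Sum.inr 2))‖ₑ * Y)
        = (‖u₀ (u (Sum.inr 1))‖ₑ * ‖u₀ (u (Sum.inr 2))‖ₑ) * (X * Y) := by ring
      _ ≤ (‖u₀ (u (Sum.inr 1))‖ₑ ^ 2 + ‖u₀ (u (Sum.inr 2))‖ₑ ^ 2) * (X * Y) := by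
          gcongr; exact mul_le_sq_add_sq_ennreal _ _
      _ = _ := by ring
  · have hgm : ∀ τ, ∀ (x y : (l.Label → Space d) → Space d), Measurable x → Measurable y →
        Measurable fun u => ‖g τ (x u) (y u)‖ₑ := fun τ x y hx hy =>
      (hg.measurable.comp (measurable_const.prodMk (hx.prodMk hy))).enorm
    refine Measurable.mul ?_ (Measurable.mul ?_ ?_)
    · exact (hu.comp (by fun_prop)).enorm.pow_const 2
    · exact measurable_fun_prod _ fun k _ => hgm _ _ _ (by fun_prop) (by fun_prop)
    · exact measurable_fun_prod _ fun k _ => hgm _ _ _ (by fun_prop) (by fun_prop)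

end

section

variable {l : Pairing (n + n)}

/-- The glued path has `2n + 2` edges and `n + 3` labels (the pairs, the centre and the two ends),
hence `n + 2` new and `n` old edges for every pairing. The factor `L` is paid once per chain, for
the last increment, to express its pointwise bound through the integral bound `bn`. -/
lemma lintegral_timeProd_weights_le (lam : ℝ) {bn bo L : ℝ≥0∞}
    (hn : ∫⁻ τ, newWeight C T τ * ofReal (exp (-lam * τ)) ≤ bn)
    (ho : ∫⁻ τ, oldWeight C a T τ * ofReal (exp (-lam * τ)) ≤ bo)
    (hL : ∀ τ, newWeight C T τ * ofReal (exp (-lam * τ)) ≤ L * bn) {p q : ℕ → l.Label}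
    (hpq : (p = l.chain₁ ∧ q = l.chain₂) ∨ (p = l.chain₂ ∧ q = l.chain₁)) (t : ℝ) :
    (∫⁻ s, timeProd (firstWeight C a T p q) n t s) * (∫⁻ s, timeProd (secondWeight C a T p q) n t s)
      ≤ ofReal (exp (lam * t)) ^ 2 * L ^ 2 * (bn ^ (n + 2) * bo ^ n) := by
  set w : ℕ → ℝ≥0∞ := fun j =>
    if glue n p q (j + 1) ∈ visited (glue n p q) j then bo else bn with hw
  have hww : ∀ j, ∫⁻ τ, edgeWeight C a T (glue n p q (j + 1) ∈ visited (glue n p q) j) τ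
      * ofReal (exp (-lam * τ)) ≤ w j := by
    intro j
    simp only [hw, edgeWeight]
    split_ifs
    · exact ho
    · exact hn
  set Lk : ℕ → ℝ≥0∞ := fun k => if k = n then L else 1 with hLk
  have hLn : ∀ k, k ≠ n → Lk k = 1 := fun k hk => by simp [hLk, hk]
  have hends := glue_ends_notMem l hpq
  have h1 := lintegral_timeProd_le lam (firstWeight C a T p q) (measurable_firstWeight p q)
    (fun k => Lk k * w (n - k)) n
    (fun k hk => by rw [hLn k hk.ne, one_mul]; exact hww _)
    (fun τ => by
      rw [firstWeight_last hpq]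
      have : w (n - n) = bn := by simp only [hw, Nat.sub_self]; rw [if_neg hends.1]
      rw [this]; simp only [hLk, if_true]; exact hL τ) t
  have h2 := lintegral_timeProd_le lam (secondWeight C a T p q) (measurable_secondWeight p q)
    (fun k => Lk k * w (n + 1 + k)) n
    (fun k hk => by rw [hLn k hk.ne, one_mul]; exact hww _)
    (fun τ => by
      rw [secondWeight_last hpq]
      have : w (n + 1 + n) = bn := by simp only [hw]; rw [if_neg hends.2]
      rw [this]; simp only [hLk, if_true]; exact hL τ) t
  have hLprod : ∏ k ∈ Finset.range (n + 1), Lk k = L := by simp [hLk, Finset.prod_ite_eq']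
  have hw1 : (∏ k ∈ Finset.range (n + 1), w (n - k)) * (∏ k ∈ Finset.range (n + 1), w (n + 1 + k))
      = ∏ j ∈ Finset.range (n + 1 + (n + 1)), w j := by
    rw [← prod_glueEdge n (fun k => w (n - k)) (fun k => w (n + 1 + k))]
    refine prod_congr rfl fun j _ => ?_
    unfold glueEdge
    split_ifs with h
    · have : n - (n - j) = j := by omega
      simp only [this]
    · have : n + 1 + (j - (n + 1)) = j := by omega
      simp only [this]
  obtain ⟨P, Q, hP, hPQ, hprod⟩ := prod_ite_visited (glue n p q) bn bo (n + 1 + (n + 1))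
  have hcard : (visited (glue n p q) (n + 1 + (n + 1))).card = n + 3 := by
    rw [(labels_of_order hpq).2, card_univ, Fintype.card_sum, l.card_lower, Fintype.card_fin]
  have hP' : P = n + 2 := by omega
  have hQ' : Q = n := by omega
  subst hP' hQ'
  calc _ ≤ _ := mul_le_mul' h1 h2
    _ = ofReal (exp (lam * t)) ^ 2 * L ^ 2
        * ((∏ k ∈ Finset.range (Q + 1), w (Q - k)) * (∏ k ∈ Finset.range (Q + 1), w (Q + 1 + k))) := by
      rw [prod_mul_distrib, prod_mul_distrib, hLprod]; ring
    _ = _ := by rw [hw1, ← hprod]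

lemma lintegral_pairBound_le (lam : ℝ) {bn bo L : ℝ≥0∞}
    (hn : ∫⁻ τ, newWeight C T τ * ofReal (exp (-lam * τ)) ≤ bn)
    (ho : ∫⁻ τ, oldWeight C a T τ * ofReal (exp (-lam * τ)) ≤ bo)
    (hL : ∀ τ, newWeight C T τ * ofReal (exp (-lam * τ)) ≤ L * bn) (t : ℝ) :
    ∫⁻ s, ∫⁻ s', pairBound C a T l t s s'
      ≤ 2 * (ofReal (exp (lam * t)) ^ 2 * L ^ 2 * (bn ^ (n + 2) * bo ^ n)) := by
  have h1 := lintegral_timeProd_weights_le lam hn ho hL (l := l) (Or.inl ⟨rfl, rfl⟩) t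
  have h2 := lintegral_timeProd_weights_le lam hn ho hL (l := l) (Or.inr ⟨rfl, rfl⟩) t
  have hm1 : ∀ p q : ℕ → l.Label, Measurable (timeProd (firstWeight C a T p q) n t) :=
    fun p q => measurable_timeProd (measurable_firstWeight p q) n t
  have hm2 : ∀ p q : ℕ → l.Label, Measurable (timeProd (secondWeight C a T p q) n t) :=
    fun p q => measurable_timeProd (measurable_secondWeight p q) n t
  unfold pairBound
  calc _ = ∫⁻ s, (timeProd (firstWeight C a T l.chain₁ l.chain₂) n t s
          * (∫⁻ s', timeProd (secondWeight C a T l.chain₁ l.chain₂) n t s')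
        + timeProd (secondWeight C a T l.chain₂ l.chain₁) n t s
          * (∫⁻ s', timeProd (firstWeight C a T l.chain₂ l.chain₁) n t s')) := by
        refine lintegral_congr fun s => ?_
        rw [lintegral_add_left ((hm2 _ _).const_mul _), lintegral_const_mul _ (hm2 _ _),
          lintegral_const_mul _ (hm1 _ _)]
    _ ≤ _ := by
        rw [lintegral_add_left ((hm1 _ _).mul_const _), lintegral_mul_const _ (hm1 _ _),
          lintegral_mul_const _ (hm2 _ _), two_mul]
        rw [mul_comm] at h2
        exact add_le_add h1 h2

/-- If the first time increment is restricted to be less than `r`, the contribution of a pairing is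
small. -/
lemma lintegral_pairBound_restrict_le {l : Pairing (n + 1 + (n + 1))} {δ M : ℝ≥0∞} {r : ℝ}
    (hn : ∫⁻ τ, newWeight C T τ ≤ M) (ho : ∫⁻ τ, oldWeight C a T τ ≤ M)
    (hn' : ∫⁻ τ in Iio r, newWeight C T τ ≤ δ) (ho' : ∫⁻ τ in Iio r, oldWeight C a T τ ≤ δ)
    (hC : (C : ℝ≥0∞) ≤ M) (t : ℝ) :
    ∫⁻ s in {s : Fin (n + 1) → ℝ | t - s 0 < r}, ∫⁻ s' in {s : Fin (n + 1) → ℝ | t - s 0 < r},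
      pairBound C a T l t s s' ≤ 2 * (δ * M ^ (n + 1)) ^ 2 := by
  set B := {s : Fin (n + 1) → ℝ | t - s 0 < r} with hB
  have hBm : MeasurableSet B := measurableSet_lt (by fun_prop) measurable_const
  have key : ∀ c : ℕ → ℝ → ℝ≥0∞, (∀ k, c k = oldWeight C a T ∨ c k = newWeight C T) →
      c (n + 1) = newWeight C T → ∫⁻ s in B, timeProd c (n + 1) t s ≤ δ * M ^ (n + 1) := by
    intro c hc hlast
    have hcm : ∀ k, Measurable (c k) := fun k => by
      rcases hc k with h | h <;> rw [h]
      · exact measurable_oldWeight C a T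
      · exact measurable_newWeight C T
    -- The restriction to `B` concerns the first increment only and becomes an indicator in its
    -- factor. No exponential weight is needed here, so the parameter is zero.
    set c' : ℕ → ℝ → ℝ≥0∞ := fun k => if k = 0 then (Iio r).indicator (c 0) else c k with hc'
    have hcm' : ∀ k, Measurable (c' k) := by
      intro k; simp only [hc']; split_ifs
      · exact (hcm 0).indicator measurableSet_Iio
      · exact hcm k
    have h1 := lintegral_timeProd_le 0 c' hcm' (fun k => if k = 0 then δ else M) (n + 1) ?_ ?_ t
    · rw [Finset.prod_range_succ'] at h1
      simp only [zero_mul, Real.exp_zero, ENNReal.ofReal_one, one_mul, Nat.add_eq_zero_iff,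
        one_ne_zero, and_false, if_false, if_true, Finset.prod_const, Finset.card_range] at h1
      rw [mul_comm] at h1
      refine le_trans ?_ h1
      rw [← lintegral_indicator hBm]
      refine lintegral_mono fun s => ?_
      by_cases hs : s ∈ B
      · rw [indicator_of_mem hs, timeProd_succ, timeProd_succ]
        simp only [hc', if_true, Nat.add_eq_zero_iff, one_ne_zero, and_false, if_false]
        rw [indicator_of_mem (show t - s 0 ∈ Iio r from hs)]
      · rw [indicator_of_notMem hs]; exact zero_le
    · intro k hk
      simp only [neg_zero, zero_mul, Real.exp_zero, ENNReal.ofReal_one, mul_one, hc']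
      split_ifs with h
      · rw [lintegral_indicator measurableSet_Iio]
        rcases hc 0 with h | h <;> rw [h]
        · exact ho'
        · exact hn'
      · rcases hc k with h | h <;> rw [h]
        · exact ho
        · exact hn
    · intro τ
      simp only [neg_zero, zero_mul, Real.exp_zero, ENNReal.ofReal_one, mul_one, hc',
        Nat.add_eq_zero_iff, one_ne_zero, and_false, if_false]
      rw [hlast]
      exact (newWeight_le _ _ _).trans hC
  have hw : ∀ (old : Prop) [Decidable old], edgeWeight C a T old = oldWeight C a T ∨
      edgeWeight C a T old = newWeight C T := by
    intro old _
    by_cases h : old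
    · left; ext τ; simp [edgeWeight, h]
    · right; ext τ; simp [edgeWeight, h]
  have hm1 : ∀ p q : ℕ → l.Label, Measurable (timeProd (firstWeight C a T p q) (n + 1) t) :=
    fun p q => measurable_timeProd (measurable_firstWeight p q) _ t
  have hm2 : ∀ p q : ℕ → l.Label, Measurable (timeProd (secondWeight C a T p q) (n + 1) t) :=
    fun p q => measurable_timeProd (measurable_secondWeight p q) _ t
  unfold pairBound
  calc _ = ∫⁻ s in B, (timeProd (firstWeight C a T l.chain₁ l.chain₂) (n + 1) t s
          * (∫⁻ s' in B, timeProd (secondWeight C a T l.chain₁ l.chain₂) (n + 1) t s')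
        + timeProd (secondWeight C a T l.chain₂ l.chain₁) (n + 1) t s
          * (∫⁻ s' in B, timeProd (firstWeight C a T l.chain₂ l.chain₁) (n + 1) t s')) := by
        refine lintegral_congr fun s => ?_
        rw [lintegral_add_left ((hm2 _ _).const_mul _), lintegral_const_mul _ (hm2 _ _),
          lintegral_const_mul _ (hm1 _ _)]
    _ ≤ _ := by
        rw [lintegral_add_left ((hm1 _ _).mul_const _), lintegral_mul_const _ (hm1 _ _),
          lintegral_mul_const _ (hm2 _ _), two_mul]
        refine add_le_add ?_ ?_
        · rw [sq]
          exact mul_le_mul' (key _ (fun k => hw _) (firstWeight_last (Or.inl ⟨rfl, rfl⟩)))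
            (key _ (fun k => hw _) (secondWeight_last (Or.inl ⟨rfl, rfl⟩)))
        · rw [sq]
          exact mul_le_mul' (key _ (fun k => hw _) (secondWeight_last (Or.inr ⟨rfl, rfl⟩)))
            (key _ (fun k => hw _) (firstWeight_last (Or.inr ⟨rfl, rfl⟩)))

end

/-! ### Dependence of the contribution of a pairing on shifts of the vertices. -/

section

variable {l : Pairing (n + n)}

/-- The integrand of the `n`-th term of the Duhamel expansion. -/
def chainDensity (g : ℝ → Space d → Space d → ℝ) (u₀ : Space d → ℝ) (n : ℕ) (t : ℝ) (x : Space d)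
    (s : Fin n → ℝ) (w : Space d) (y : Fin n → Space d) : ℝ :=
  u₀ w * chainKernel g n t x s y w

lemma GreenKernel.measurable_comp (hg : GreenKernel g C a T) {β : Type*} [MeasurableSpace β]
    {τ : β → ℝ} {x y : β → Space d} (hτ : Measurable τ := by fun_prop)
    (hx : Measurable x := by fun_prop) (hy : Measurable y := by fun_prop) :
    Measurable fun b => g (τ b) (x b) (y b) :=
  hg.measurable.comp (hτ.prodMk (hx.prodMk hy))

lemma GreenKernel.measurable_chainDensity (hg : GreenKernel g C a T) (hu : Measurable u₀)
    {β : Type*} [MeasurableSpace β] {t : β → ℝ} {x w : β → Space d} {s : β → Fin n → ℝ}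
    {y : β → Fin n → Space d} (ht : Measurable t := by fun_prop) (hx : Measurable x := by fun_prop)
    (hs : Measurable s := by fun_prop)
    (hw : Measurable w := by fun_prop) (hy : Measurable y := by fun_prop) :
    Measurable fun b => chainDensity g u₀ n (t b) (x b) (s b) (w b) (y b) := by
  refine (hu.comp hw).mul (measurable_fun_prod _ fun k _ => hg.measurable_comp ?_ ?_ ?_)
  · exact (measurable_chainPos ht hs measurable_const k).sub
      (measurable_chainPos ht hs measurable_const (k + 1))
  · exact measurable_chainPos hx hy hw k
  · exact measurable_chainPos hx hy hw (k + 1)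

/-- The product of the integrands for the two halves of a pairing. -/
def pairProd (g : ℝ → Space d → Space d → ℝ) (u₀ : Space d → ℝ) (t : ℝ) (s s' : Fin n → ℝ)
    (c₁ c₂ : Fin n → Space d) (u : l.Label → Space d) : ℝ :=
  chainDensity g u₀ n t (u (Sum.inr 0)) s (u (Sum.inr 1)) (fun i => u (Sum.inl low(l, i)) + c₁ i)
    * chainDensity g u₀ n t (u (Sum.inr 0)) s' (u (Sum.inr 2))
      (fun i => u (Sum.inl upp(l, i)) + c₂ i)

lemma enorm_pairProd (g : ℝ → Space d → Space d → ℝ) (u₀ : Space d → ℝ) (t : ℝ) (s s' : Fin n → ℝ)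
    (c₁ c₂ : Fin n → Space d) (u : l.Label → Space d) :
    ‖pairProd g u₀ t s s' c₁ c₂ u‖ₑ = pairDensity g u₀ t s s' c₁ c₂ u := by
  rw [pairProd, enorm_mul]; rfl

/-- The edges of the glued path, with the weight `u₀` of the last vertex attached to the last
edge. -/
def endEdge (g : ℝ → Space d → Space d → ℝ) (u₀ : Space d → ℝ) (n : ℕ) (e₁ e₂ : ℕ → ℝ) (j : ℕ)
    (x y : Space d) : ℝ :=
  glueEdge n (fun k => g (e₁ k)) (fun k => g (e₂ k)) j x y * if j = n + 1 + n then u₀ y else 1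

/-- The path starts at the end of the first chain, where `u₀` is the starting weight. The `u₀` of
the second chain is put on the last edge, so that the estimates for paths with one starting weight
apply. -/
lemma pairProd_eq_pathProd (hg : GreenKernel g C a T) (u₀ : Space d → ℝ) (t : ℝ) (s s' : Fin n → ℝ)
    (c₁ c₂ : Fin n → Space d) (u : l.Label → Space d) :
    pairProd g u₀ t s s' c₁ c₂ u = pathProd u₀ (endEdge g u₀ n (increment t s) (increment t s'))
      (glue n l.chain₁ l.chain₂) (glue n (chainPos 0 c₁ 0) (chainPos 0 c₂ 0))
      (n + 1 + (n + 1)) u := by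
  have hpos : ∀ j, u (glue n l.chain₁ l.chain₂ j) + glue n (chainPos 0 c₁ 0) (chainPos 0 c₂ 0) j
      = glue n (fun k => u (l.chain₁ k) + chainPos 0 c₁ 0 k)
          (fun k => u (l.chain₂ k) + chainPos 0 c₂ 0 k) j := by
    intro j; rw [comp_glue u, glue_add]
  have e1 : l.chain₁ (n + 1) = Sum.inr 1 := chainPos_last _ _ _
  have e2 : l.chain₂ (n + 1) = Sum.inr 2 := chainPos_last _ _ _
  have h00 : l.chain₁ 0 = l.chain₂ 0 := rfl
  rw [pathProd]
  simp only [hpos, endEdge]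
  rw [prod_mul_distrib, prod_glueEdge_glue n (fun k => g (increment t s k))
    (fun k => g (increment t s' k)) (fun k x y => hg.symm _ _ _) _ _ (by rw [h00]; rfl)]
  have hlast : ∏ j ∈ Finset.range (n + 1 + (n + 1)), (if j = n + 1 + n then
      u₀ (glue n (fun k => u (l.chain₁ k) + chainPos 0 c₁ 0 k)
          (fun k => u (l.chain₂ k) + chainPos 0 c₂ 0 k) (j + 1)) else 1) = u₀ (u (Sum.inr 2)) := by
    rw [Finset.prod_ite_eq' (Finset.range (n + 1 + (n + 1))) (n + 1 + n), if_pos (by simp),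
      glue_of_ge (by rw [h00]; rfl) (by omega)]
    have : n + 1 + n + 1 - (n + 1) = n + 1 := by omega
    rw [this, e2, chainPos_last, add_zero]
  rw [hlast]
  have h0 : glue n (fun k => u (l.chain₁ k) + chainPos 0 c₁ 0 k)
          (fun k => u (l.chain₂ k) + chainPos 0 c₂ 0 k) 0 = u (Sum.inr 1) := by
    rw [glue, if_pos (by omega)]
    simp only [Nat.sub_zero]
    rw [e1, chainPos_last, add_zero]
  rw [h0, pairProd, chainDensity, chainDensity, chainKernel_chain₁, chainKernel_chain₂]
  ring

/-- The continuity of path integrals under shifts of the vertices, at fixed times. The centre and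
the two ends are not shifted. -/
lemma tendsto_lintegral_pairProd_sub (hg : GreenKernel g C a T) (hu : Measurable u₀)
    (hui : Integrable u₀ volume) (t : ℝ) (s s' : Fin n → ℝ) {α : Type*} {f : Filter α}
    [f.IsCountablyGenerated] {c₁ c₂ : α → Fin n → Space d} (h₁ : Tendsto c₁ f (𝓝 0))
    (h₂ : Tendsto c₂ f (𝓝 0)) : Tendsto (fun e => ∫⁻ u : l.Label → Space d,
      ‖pairProd g u₀ t s s' (c₁ e) (c₂ e) u - pairProd g u₀ t s s' 0 0 u‖ₑ) f (𝓝 0) := by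
  obtain ⟨h0, huniv⟩ := labels_of_order (l := l) (Or.inl ⟨rfl, rfl⟩)
  set e₁ := increment t s
  set e₂ := increment t s'
  -- At fixed times any finite weight will do; the sum of both costs, times one plus the `L¹` norm
  -- of `u₀`, covers the ordinary edges and the last edge, where `u₀` is integrated against the
  -- supremum of the kernel.
  set w : ℕ → ℝ≥0∞ := fun j => glueEdge n (fun k => newWeight C T (e₁ k) + oldWeight C a T (e₁ k))
    (fun k => newWeight C T (e₂ k) + oldWeight C a T (e₂ k)) j * (1 + ∫⁻ x, ‖u₀ x‖ₑ) with hw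
  have hKm : ∀ j, Measurable (uncurry (endEdge g u₀ n e₁ e₂ j)) := by
    intro j
    have : ∀ τ, Measurable (uncurry (g τ)) := fun τ => (hg.continuous τ).measurable
    refine Measurable.mul (f := fun z : Space d × Space d =>
      glueEdge n (fun k => g (e₁ k)) (fun k => g (e₂ k)) j z.1 z.2) ?_ ?_
    · unfold glueEdge; split_ifs <;> exact this _
    · split_ifs
      · exact hu.comp measurable_snd
      · exact measurable_const
  have hpos : ∀ (c c' : Fin n → Space d) j,
      glue n (chainPos 0 c 0) (chainPos 0 c' 0) j = chainPos 0 c 0 (n + 1 - j) ∨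
      glue n (chainPos 0 c 0) (chainPos 0 c' 0) j = chainPos 0 c' 0 (j - (n + 1)) := by
    intro c c' j; unfold glue; split_ifs
    · exact Or.inl rfl
    · exact Or.inr rfl
  have hchain : ∀ (c : α → Fin n → Space d), Tendsto c f (𝓝 0) → ∀ k,
      Tendsto (fun e => chainPos 0 (c e) 0 k) f (𝓝 0) := by
    intro c hc k
    cases k with
    | zero => exact tendsto_const_nhds
    | succ k =>
      simp only [chainPos_succ]
      split_ifs with h
      · exact (tendsto_pi_nhds.1 hc ⟨k, h⟩)
      · exact tendsto_const_nhds
  have hend := (glue_ends_notMem l (Or.inl ⟨rfl, rfl⟩)).2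
  have key := tendsto_lmarginal_pathProd_sub (μ := (volume : Measure (Space d))) (l := f)
    (A := u₀) (K := endEdge g u₀ n e₁ e₂) hu hui hKm (glue n l.chain₁ l.chain₂)
    (c := fun e => glue n (chainPos 0 (c₁ e) 0) (chainPos 0 (c₂ e) 0)) ?_ w ?_ (n + 1 + (n + 1))
    ?_ ?_ ?_ 0
  · rw [huniv] at key
    simp only [lmarginal_univ] at key
    refine key.congr fun e => lintegral_congr fun u => ?_
    rw [pairProd_eq_pathProd hg, pairProd_eq_pathProd hg]
    congr 3
    ext j : 1
    rcases hpos 0 0 j with h | h <;> rw [h]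
    · cases (n + 1 - j) <;> simp [chainPos_succ]
    · cases (j - (n + 1)) <;> simp [chainPos_succ]
  · intro j
    unfold glue
    split_ifs
    · exact hchain c₁ h₁ _
    · exact hchain c₂ h₂ _
  · intro j
    refine mul_ne_top ?_ (ENNReal.add_ne_top.2 ⟨ENNReal.one_ne_top, hui.2.ne⟩)
    have : ∀ τ, newWeight C T τ + oldWeight C a T τ ≠ ∞ := fun τ => ENNReal.add_ne_top.2
      ⟨ne_top_of_le_ne_top coe_ne_top (newWeight_le _ _ _), oldWeight_ne_top _ _ _ _⟩
    unfold glueEdge; split_ifs <;> exact this _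
  · intro j _ hj
    -- The last edge is new, so no old edge contains `u₀`, which is not continuous in general.
    have hj' : j ≠ n + 1 + n := by rintro rfl; exact hend hj
    have : endEdge g u₀ n e₁ e₂ j = glueEdge n (fun k => g (e₁ k)) (fun k => g (e₂ k)) j := by
      ext x y; simp [endEdge, hj']
    rw [this]
    unfold glueEdge; split_ifs <;> exact hg.continuous _
  · intro j _ hj x y
    have hj' : j ≠ n + 1 + n := by rintro rfl; exact hend hj
    rw [endEdge, if_neg hj', mul_one, hw]
    refine le_trans ?_ (le_mul_of_one_le_right (zero_le) le_self_add)
    unfold glueEdge; split_ifs <;> exact (hg.sup_le _ _ _).trans le_add_self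
  · intro j _ hj x
    simp only [endEdge, hw, enorm_mul]
    split_ifs with h
    · refine (lintegral_mono (g := fun y => glueEdge n
        (fun k => newWeight C T (e₁ k) + oldWeight C a T (e₁ k))
        (fun k => newWeight C T (e₂ k) + oldWeight C a T (e₂ k)) j * ‖u₀ y‖ₑ) fun y => ?_).trans ?_
      · dsimp only
        gcongr
        unfold glueEdge; split_ifs <;> exact (hg.sup_le _ _ _).trans le_add_self
      · rw [lintegral_const_mul _ hu.enorm]
        gcongr
        exact le_add_self
    · simp only [enorm_one, mul_one]
      refine le_trans ?_ (le_mul_of_one_le_right (zero_le) le_self_add)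
      unfold glueEdge; split_ifs <;> exact (hg.l1_le _ _).trans le_self_add

/-- The difference between the shifted and the unshifted integrand. -/
def chainDiff (g : ℝ → Space d → Space d → ℝ) (u₀ : Space d → ℝ) (n : ℕ) (t : ℝ)
    (c : Fin n → Space d) (x : Space d) (s : Fin n → ℝ) (w : Space d) (y : Fin n → Space d) : ℝ :=
  chainDensity g u₀ n t x s w (fun i => y i + c i) - chainDensity g u₀ n t x s w y

/-- The product of the differences for the two halves of a pairing. -/
def pairDiff (g : ℝ → Space d → Space d → ℝ) (u₀ : Space d → ℝ) (t : ℝ) (s s' : Fin n → ℝ)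
    (c₁ c₂ : Fin n → Space d) (u : l.Label → Space d) : ℝ≥0∞ :=
  ‖chainDiff g u₀ n t c₁ (u (Sum.inr 0)) s (u (Sum.inr 1)) (fun i => u (Sum.inl low(l, i)))‖ₑ
    * ‖chainDiff g u₀ n t c₂ (u (Sum.inr 0)) s' (u (Sum.inr 2)) (fun i => u (Sum.inl upp(l, i)))‖ₑ

lemma GreenKernel.measurable_pairProd (hg : GreenKernel g C a T) (hu : Measurable u₀) (t : ℝ)
    (s s' : Fin n → ℝ) (c₁ c₂ : Fin n → Space d) :
    Measurable (pairProd (l := l) g u₀ t s s' c₁ c₂) := by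
  refine Measurable.mul ?_ ?_ <;>
  exact hg.measurable_chainDensity hu

lemma pairDiff_eq (g : ℝ → Space d → Space d → ℝ) (u₀ : Space d → ℝ) (t : ℝ) (s s' : Fin n → ℝ)
    (c₁ c₂ : Fin n → Space d) (u : l.Label → Space d) :
    pairDiff g u₀ t s s' c₁ c₂ u = ‖pairProd g u₀ t s s' c₁ c₂ u - pairProd g u₀ t s s' c₁ 0 u
      - pairProd g u₀ t s s' 0 c₂ u + pairProd g u₀ t s s' 0 0 u‖ₑ := by
  rw [pairDiff, ← enorm_mul]
  congr 1
  simp only [pairProd, chainDiff, Pi.zero_apply, add_zero]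
  ring

/-- The product of two differences is a signed sum of four shifted products with coefficients adding
up to zero, so it is controlled by three distances from the unshifted product. -/
lemma tendsto_lintegral_pairDiff (hg : GreenKernel g C a T) (hu : Measurable u₀)
    (hui : Integrable u₀ volume) (t : ℝ) (s s' : Fin n → ℝ) {α : Type*} {f : Filter α}
    [f.IsCountablyGenerated] {c₁ c₂ : α → Fin n → Space d} (h₁ : Tendsto c₁ f (𝓝 0))
    (h₂ : Tendsto c₂ f (𝓝 0)) :
    Tendsto (fun e => ∫⁻ u : l.Label → Space d, pairDiff g u₀ t s s' (c₁ e) (c₂ e) u) f (𝓝 0) := by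
  have t1 := tendsto_lintegral_pairProd_sub (l := l) hg hu hui t s s' h₁ h₂
  have t2 := tendsto_lintegral_pairProd_sub (l := l) hg hu hui t s s' h₁
    (tendsto_const_nhds (x := (0 : Fin n → Space d)))
  have t3 := tendsto_lintegral_pairProd_sub (l := l) hg hu hui t s s'
    (tendsto_const_nhds (x := (0 : Fin n → Space d))) h₂
  have t4 := (t1.add t2).add t3
  simp only [add_zero] at t4
  refine tendsto_of_tendsto_of_tendsto_of_le_of_le tendsto_const_nhds t4 (fun _ => zero_le)
    fun e => ?_
  have hm := fun c c' => hg.measurable_pairProd (l := l) hu t s s' c c'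
  dsimp only
  have hm' : ∀ c c', Measurable fun u : l.Label → Space d =>
      ‖pairProd g u₀ t s s' c c' u - pairProd g u₀ t s s' 0 0 u‖ₑ := fun _ _ => by fun_prop
  rw [← lintegral_add_right _ (hm' _ _), ← lintegral_add_right _ (hm' _ _)]
  refine lintegral_mono fun u => ?_
  rw [pairDiff_eq]
  set p₁ := pairProd g u₀ t s s' (c₁ e) (c₂ e) u
  set p₂ := pairProd g u₀ t s s' (c₁ e) 0 u
  set p₃ := pairProd g u₀ t s s' 0 (c₂ e) u
  set p₄ := pairProd g u₀ t s s' 0 0 u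
  have : p₁ - p₂ - p₃ + p₄ = ((p₁ - p₄) - (p₂ - p₄)) - (p₃ - p₄) := by ring
  rw [this]
  exact (enorm_sub_le).trans (add_le_add enorm_sub_le le_rfl)

/-- A bound that does not see the shifts: it serves as the dominating function when the shifts tend
to zero. -/
lemma lintegral_pairDiff_le (hg : GreenKernel g C a T) (hu : Measurable u₀) (t : ℝ)
    (s s' : Fin n → ℝ) (c₁ c₂ : Fin n → Space d) :
    ∫⁻ u : l.Label → Space d, pairDiff g u₀ t s s' c₁ c₂ u
      ≤ 4 * ((∫⁻ x, ‖u₀ x‖ₑ ^ 2) * pairBound C a T l t s s') := by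
  have hm := fun c c' => (hg.measurable_pairProd (l := l) hu t s s' c c').enorm
  have hb := fun c c' => lintegral_pairDensity_le (l := l) hg hu t s s' c c'
  simp only [← enorm_pairProd] at hb
  calc _ ≤ ∫⁻ u : l.Label → Space d, (‖pairProd g u₀ t s s' c₁ c₂ u‖ₑ
        + ‖pairProd g u₀ t s s' c₁ 0 u‖ₑ + ‖pairProd g u₀ t s s' 0 c₂ u‖ₑ
        + ‖pairProd g u₀ t s s' 0 0 u‖ₑ) := by
        refine lintegral_mono fun u => ?_
        rw [pairDiff_eq]
        refine (enorm_add_le _ _).trans (add_le_add (enorm_sub_le.trans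
          (add_le_add enorm_sub_le le_rfl)) le_rfl)
    _ ≤ _ := by
        rw [lintegral_add_right _ (hm _ _), lintegral_add_right _ (hm _ _),
          lintegral_add_right _ (hm _ _)]
        refine (add_le_add (add_le_add (add_le_add (hb _ _) (hb _ _)) (hb _ _)) (hb _ _)).trans
          (le_of_eq ?_)
        ring

end

/-! ### Energy estimates: the spatial integral of the squared norm `‖·‖_n`. -/

lemma lintegral_sum_elim {ι κ X : Type*} [Fintype ι] [Fintype κ] [MeasureSpace X]
    [SigmaFinite (volume : Measure X)] {f : (ι ⊕ κ → X) → ℝ≥0∞} (hf : Measurable f) :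
    ∫⁻ u, f u = ∫⁻ z : ι → X, ∫⁻ v : κ → X, f (Sum.elim z v) := by
  have h := (volume_measurePreserving_sumPiEquivProdPi (fun _ : ι ⊕ κ => X)).symm
  rw [← h.lintegral_comp hf, Measure.volume_eq_prod, lintegral_prod]
  · refine lintegral_congr fun z => lintegral_congr fun v => ?_
    congr 1
  · exact (hf.comp (MeasurableEquiv.measurable _)).aemeasurable

lemma lintegral_fin_three {X : Type*} [MeasureSpace X] [SigmaFinite (volume : Measure X)]
    {f : (Fin 3 → X) → ℝ≥0∞} (hf : Measurable f) :
    ∫⁻ u, f u = ∫⁻ x, ∫⁻ w, ∫⁻ w', f ![x, w, w'] := by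
  have hc : ∀ {m : ℕ} (a : X), Measurable fun s : Fin m → X => (Fin.cons a s : Fin (m + 1) → X) :=
    fun a => measurable_pi_iff.2 fun i => by
      refine Fin.cases ?_ (fun j => ?_) i
      · simp only [Fin.cons_zero]; exact measurable_const
      · simp only [Fin.cons_succ]; exact measurable_pi_apply j
  rw [lintegral_pi_fin_succ hf]
  refine lintegral_congr fun x => ?_
  rw [lintegral_pi_fin_succ (f := fun s => f (Fin.cons x s)) (hf.comp (hc x))]
  refine lintegral_congr fun w => ?_
  rw [lintegral_pi_fin_succ (f := fun s => f (Fin.cons x (Fin.cons w s)))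
    ((hf.comp (hc x)).comp (hc w))]
  refine lintegral_congr fun w' => ?_
  rw [lintegral_unique]
  have : (volume : Measure (Fin 0 → X)) univ = 1 := by simp [volume_pi]
  rw [this, mul_one]
  congr 1

lemma lintegral_mul_lintegral_swap {Y B : Type*} [MeasurableSpace Y] [MeasurableSpace B]
    (μ : Measure Y) [SFinite μ] (β : Measure B) [SFinite β] {F H : Y → B → ℝ≥0∞}
    (hF : Measurable (uncurry F)) (hH : Measurable (uncurry H)) :
    ∫⁻ y, (∫⁻ b, F y b ∂β) * (∫⁻ b, H y b ∂β) ∂μ = ∫⁻ b, ∫⁻ b', ∫⁻ y, F y b * H y b' ∂μ ∂β ∂β := by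
  have hF1 : ∀ y, Measurable (F y) := fun _ => by fun_prop
  have hH1 : ∀ y, Measurable (H y) := fun _ => by fun_prop
  calc _ = ∫⁻ y, ∫⁻ b, F y b * (∫⁻ b', H y b' ∂β) ∂β ∂μ := by
        refine lintegral_congr fun y => ?_
        rw [lintegral_mul_const _ (hF1 y)]
    _ = ∫⁻ b, ∫⁻ y, F y b * (∫⁻ b', H y b' ∂β) ∂μ ∂β := by
        refine lintegral_lintegral_swap (Measurable.aemeasurable ?_)
        exact hF.mul (hH.lintegral_prod_right.comp measurable_fst)
    _ = ∫⁻ b, ∫⁻ y, ∫⁻ b', F y b * H y b' ∂β ∂μ ∂β := by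
        refine lintegral_congr fun b => lintegral_congr fun y => ?_
        rw [lintegral_const_mul _ (hH1 y)]
    _ = _ := by
        refine lintegral_congr fun b => ?_
        refine lintegral_lintegral_swap (Measurable.aemeasurable ?_)
        exact (hF.comp (measurable_fst.prodMk measurable_const)).mul hH

/-- The contribution of a pairing as an integral over all variables. -/
lemma lintegral_pairing_eq (l : Pairing (n + n)) {B : Type*} [MeasurableSpace B] (β : Measure B)
    [SFinite β] {Φ Ψ : Space d → B → Space d → (Fin n → Space d) → ℝ≥0∞}
    (hΦ : Measurable fun z : Space d × B × Space d × (Fin n → Space d) => Φ z.1 z.2.1 z.2.2.1 z.2.2.2)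
    (hΨ : Measurable fun z : Space d × B × Space d × (Fin n → Space d) =>
      Ψ z.1 z.2.1 z.2.2.1 z.2.2.2) :
    ∫⁻ x, ∫⁻ z : l.Lower → Space d, (∫⁻ b, ∫⁻ w, Φ x b w (fun i => z low(l, i)) ∂volume ∂β)
        * (∫⁻ b, ∫⁻ w, Ψ x b w (fun i => z upp(l, i)) ∂volume ∂β)
      = ∫⁻ b, ∫⁻ b', ∫⁻ u : l.Label → Space d,
        Φ (u (Sum.inr 0)) b (u (Sum.inr 1)) (fun i => u (Sum.inl low(l, i)))
        * Ψ (u (Sum.inr 0)) b' (u (Sum.inr 2)) (fun i => u (Sum.inl upp(l, i)))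
        ∂volume ∂β ∂β := by
  have hF : Measurable fun z : (Space d × (l.Lower → Space d)) × B =>
      ∫⁻ w, Φ z.1.1 z.2 w (fun i => z.1.2 low(l, i)) := by fun_prop
  have hH : Measurable fun z : (Space d × (l.Lower → Space d)) × B =>
      ∫⁻ w, Ψ z.1.1 z.2 w (fun i => z.1.2 upp(l, i)) := by fun_prop
  have e1 := lintegral_mul_lintegral_swap ((volume : Measure (Space d)).prod
    (volume : Measure (l.Lower → Space d))) β
    (F := fun y b => ∫⁻ w, Φ y.1 b w (fun i => y.2 low(l, i)))
    (H := fun y b => ∫⁻ w, Ψ y.1 b w (fun i => y.2 upp(l, i))) hF hH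
  rw [lintegral_prod] at e1
  · refine e1.trans (lintegral_congr fun b => lintegral_congr fun b' => ?_)
    rw [lintegral_sum_elim, lintegral_prod_symm]
    · refine lintegral_congr fun z => ?_
      rw [lintegral_fin_three]
      · refine lintegral_congr fun x => ?_
        simp only [Sum.elim_inl, Sum.elim_inr, Matrix.cons_val_zero, Matrix.cons_val_one,
          Matrix.cons_val]
        have m1 : Measurable fun w => Φ x b w (fun i => z low(l, i)) := by fun_prop
        have m2 : Measurable fun w => Ψ x b' w (fun i => z upp(l, i)) := by fun_prop
        rw [← lintegral_mul_const _ m1]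
        refine lintegral_congr fun w => ?_
        rw [← lintegral_const_mul _ m2]
      · refine Measurable.mul ?_ ?_
        · exact hΦ.comp (f := fun v : Fin 3 → Space d => (v 0, b, v 1,
            fun i => z low(l, i))) (by fun_prop)
        · exact hΨ.comp (f := fun v : Fin 3 → Space d => (v 0, b', v 2,
            fun i => z upp(l, i))) (by fun_prop)
    · refine (Measurable.mul ?_ ?_).aemeasurable
      · exact Measurable.lintegral_prod_right (by fun_prop)
      · exact Measurable.lintegral_prod_right (by fun_prop)
    · refine Measurable.mul ?_ ?_
      · exact hΦ.comp (f := fun u : l.Label → Space d => (u (Sum.inr 0), b, u (Sum.inr 1),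
            fun i => u (Sum.inl low(l, i)))) (by fun_prop)
      · exact hΨ.comp (f := fun u : l.Label → Space d => (u (Sum.inr 0), b', u (Sum.inr 2),
            fun i => u (Sum.inl upp(l, i)))) (by fun_prop)
  · exact (Measurable.mul hF.lintegral_prod_right' hH.lintegral_prod_right').aemeasurable

lemma traceNorm_sq (f : (Fin n → Space d) → ℝ) :
    traceNorm n f ^ 2 = ∑ l : Pairing (n + n), ∫⁻ z : l.Lower → Space d,
      ‖f (fun i => z low(l, i))‖ₑ * ‖f (fun i => z upp(l, i))‖ₑ := by
  rw [traceNorm, ← rpow_natCast, ← rpow_mul]; norm_num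

/-- Tonelli, in the form that gives access to the joint vector of all vertices. The parameter `b`
will collect the times and the mollification variables, and `w` is the initial point. -/
lemma lintegral_traceNorm_sq_le {B : Type*} [MeasurableSpace B] (β : Measure B) [SFinite β]
    {Φ : Space d → B → Space d → (Fin n → Space d) → ℝ≥0∞}
    (hΦ : Measurable fun z : Space d × B × Space d × (Fin n → Space d) => Φ z.1 z.2.1 z.2.2.1 z.2.2.2)
    {f : Space d → (Fin n → Space d) → ℝ} (hf : ∀ x z, ‖f x z‖ₑ ≤ ∫⁻ b, ∫⁻ w, Φ x b w z ∂volume ∂β) :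
    ∫⁻ x, traceNorm n (f x) ^ 2 ≤ ∑ l : Pairing (n + n), ∫⁻ b, ∫⁻ b', ∫⁻ u : l.Label → Space d,
        Φ (u (Sum.inr 0)) b (u (Sum.inr 1)) (fun i => u (Sum.inl low(l, i)))
        * Φ (u (Sum.inr 0)) b' (u (Sum.inr 2)) (fun i => u (Sum.inl upp(l, i)))
        ∂volume ∂β ∂β := by
  simp only [traceNorm_sq]
  have hG : ∀ l : Pairing (n + n), Measurable fun x => ∫⁻ z : l.Lower → Space d,
      (∫⁻ b, ∫⁻ w, Φ x b w (fun i => z low(l, i)) ∂volume ∂β)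
        * (∫⁻ b, ∫⁻ w, Φ x b w (fun i => z upp(l, i)) ∂volume ∂β) := by
    intro l
    refine Measurable.lintegral_prod_right' (f := fun z : Space d × (l.Lower → Space d) =>
      (∫⁻ b, ∫⁻ w, Φ z.1 b w (fun i => z.2 low(l, i)) ∂volume ∂β)
        * (∫⁻ b, ∫⁻ w, Φ z.1 b w (fun i => z.2 upp(l, i)) ∂volume ∂β))
      (Measurable.mul ?_ ?_)
    · exact Measurable.lintegral_prod_right (by fun_prop)
    · exact Measurable.lintegral_prod_right (by fun_prop)
  calc _ ≤ ∫⁻ x, ∑ l : Pairing (n + n), ∫⁻ z : l.Lower → Space d,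
      (∫⁻ b, ∫⁻ w, Φ x b w (fun i => z low(l, i)) ∂volume ∂β)
        * (∫⁻ b, ∫⁻ w, Φ x b w (fun i => z upp(l, i)) ∂volume ∂β) := by
        refine lintegral_mono fun x => sum_le_sum fun l _ => lintegral_mono fun z => ?_
        exact mul_le_mul' (hf _ _) (hf _ _)
    _ = _ := by
        rw [lintegral_finsetSum _ fun l _ => hG l]
        exact sum_congr rfl fun l _ => lintegral_pairing_eq l β hΦ hΦ

/-- The bound for the energy of the `n`-th term, with times restricted to the set `S`. -/
def energyBound (C : ℝ≥0) (a T : ℝ) (U : ℝ≥0∞) (n : ℕ) (t : ℝ) (S : Set (Fin n → ℝ)) : ℝ≥0∞ :=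
  ∑ l : Pairing (n + n), U * ∫⁻ s in S, ∫⁻ s' in S, pairBound C a T l t s s'

lemma measurable_pairBound (l : Pairing (n + n)) (t : ℝ) :
    Measurable (uncurry (pairBound C a T l t)) := by
  have hm1 : ∀ p q : ℕ → l.Label, Measurable (timeProd (firstWeight C a T p q) n t) :=
    fun p q => measurable_timeProd (measurable_firstWeight p q) n t
  have hm2 : ∀ p q : ℕ → l.Label, Measurable (timeProd (secondWeight C a T p q) n t) :=
    fun p q => measurable_timeProd (measurable_secondWeight p q) n t
  exact (((hm1 _ _).comp measurable_fst).mul ((hm2 _ _).comp measurable_snd)).add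
    (((hm2 _ _).comp measurable_fst).mul ((hm1 _ _).comp measurable_snd))

lemma lintegral_lintegral_prod_snd {Y S : Type*} [MeasurableSpace Y] [MeasurableSpace S]
    (m : Measure Y) [SFinite m] (ν : Measure S) [SFinite ν] (U : ℝ≥0∞) {F : S → S → ℝ≥0∞}
    (hF : Measurable (uncurry F)) : ∫⁻ b, ∫⁻ b', U * F b.2 b'.2 ∂(m.prod ν) ∂(m.prod ν)
      = m univ ^ 2 * (U * ∫⁻ s, ∫⁻ s', F s s' ∂ν ∂ν) := by
  have e1 : ∀ s, ∫⁻ b, U * F s b.2 ∂(m.prod ν) = m univ * (U * ∫⁻ s', F s s' ∂ν) := by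
    intro s
    have hmb : Measurable (F s) := by fun_prop
    have hm2 : Measurable fun b : Y × S => U * F s b.2 := by fun_prop
    rw [lintegral_prod _ hm2.aemeasurable]
    simp only [lintegral_const_mul U hmb, lintegral_const]
    rw [mul_comm]
  simp only [e1]
  have hmb : Measurable fun s => ∫⁻ s', F s s' ∂ν := by fun_prop
  have hm2 : Measurable fun b : Y × S => m univ * (U * ∫⁻ s', F b.2 s' ∂ν) := by fun_prop
  rw [lintegral_prod _ hm2.aemeasurable]
  simp only [lintegral_const_mul (m univ) (hmb.const_mul U), lintegral_const_mul U hmb,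
    lintegral_const]
  ring

/-- The bound on a pairing is uniform in the shifts, so averaging over shifts costs only the mass of
`m`, once for each of the two chains. -/
lemma lintegral_traceNorm_sq_le_energyBound
    (hg : GreenKernel g C a T)  (hu : Measurable u₀) (t : ℝ)
    (S : Set (Fin n → ℝ)) (m : Measure (Fin n → Space d)) [IsFiniteMeasure m]
    {c : (Fin n → Space d) → Fin n → Space d} (hc : Measurable c)
    {f : Space d → (Fin n → Space d) → ℝ}
    (hf : ∀ x z, ‖f x z‖ₑ ≤ ∫⁻ η, ∫⁻ s in S, ∫⁻ w, ‖chainDensity g u₀ n t x s w (z + c η)‖ₑ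
      ∂volume ∂volume ∂m) :
    ∫⁻ x, traceNorm n (f x) ^ 2 ≤ m univ ^ 2 * energyBound C a T (∫⁻ x, ‖u₀ x‖ₑ ^ 2) n t S := by
  have hm : Measurable fun z : Space d × ((Fin n → Space d) × (Fin n → ℝ)) × Space d
      × (Fin n → Space d) => ‖chainDensity g u₀ n t z.1 z.2.1.2 z.2.2.1 (z.2.2.2 + c z.2.1.1)‖ₑ :=
    (hg.measurable_chainDensity hu).enorm
  have h := lintegral_traceNorm_sq_le (m.prod (volume.restrict S)) (Φ := fun x b w z =>
    ‖chainDensity g u₀ n t x b.2 w (z + c b.1)‖ₑ) hm (f := f) (fun x z => by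
      rw [lintegral_prod]
      · exact hf x z
      · exact (Measurable.lintegral_prod_right' (hm.comp (f := fun z' : ((Fin n → Space d)
          × (Fin n → ℝ)) × Space d => (x, z'.1, z'.2, z)) (by fun_prop))).aemeasurable)
  refine h.trans ?_
  rw [energyBound, mul_sum]
  refine sum_le_sum fun l _ => ?_
  set U := ∫⁻ x, ‖u₀ x‖ₑ ^ 2
  calc _ ≤ ∫⁻ b, ∫⁻ b', U * pairBound C a T l t b.2 b'.2
          ∂(m.prod (volume.restrict S)) ∂(m.prod (volume.restrict S)) := by
        refine lintegral_mono fun b => lintegral_mono fun b' => ?_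
        have := lintegral_pairDensity_le (l := l) hg hu t b.2 b'.2 (c b.1) (c b'.1)
        unfold pairDensity at this
        exact this
    _ = _ := lintegral_lintegral_prod_snd m _ U (measurable_pairBound l t)

/-- Dominated convergence over two independent copies of shifts and times: for fixed parameters the
integrals over the vertices tend to zero, and they are dominated by a multiple of `pairBound`, whose
integral is finite. -/
lemma tendsto_lintegral_traceNorm_sq
    (hg : GreenKernel g C a T)  (hu : Measurable u₀) (hui : Integrable u₀ volume)
    (t : ℝ) (hfin : energyBound C a T (∫⁻ x, ‖u₀ x‖ₑ ^ 2) n t univ ≠ ∞)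
    (m : Measure (Fin n → Space d)) [IsFiniteMeasure m]
    {α : Type*} {F : Filter α} [F.IsCountablyGenerated]
    {c : α → (Fin n → Space d) → Fin n → Space d} (hc : ∀ e, Measurable (c e))
    (hc0 : ∀ η, Tendsto (fun e => c e η) F (𝓝 0))
    {f : α → Space d → (Fin n → Space d) → ℝ}
    (hf : ∀ e x z, ‖f e x z‖ₑ ≤ ∫⁻ η, ∫⁻ s, ∫⁻ w, ‖chainDiff g u₀ n t (c e η) x s w z‖ₑ
      ∂volume ∂volume ∂m) :
    Tendsto (fun e => ∫⁻ x, traceNorm n (f e x) ^ 2) F (𝓝 0) := by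
  set β := m.prod (volume : Measure (Fin n → ℝ)) with hβ
  set U := ∫⁻ x, ‖u₀ x‖ₑ ^ 2 with hU
  have hmc : ∀ e, Measurable fun z : Space d × ((Fin n → Space d) × (Fin n → ℝ)) × Space d
      × (Fin n → Space d) => chainDiff g u₀ n t (c e z.2.1.1) z.1 z.2.1.2 z.2.2.1 z.2.2.2 := by
    intro e
    have := hc e
    refine Measurable.sub ?_ ?_
    · exact hg.measurable_chainDensity hu
    · exact hg.measurable_chainDensity hu
  have hm := fun e => (hmc e).enorm
  have h := fun e => lintegral_traceNorm_sq_le β (Φ := fun x b w z =>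
    ‖chainDiff g u₀ n t (c e b.1) x b.2 w z‖ₑ) (hm e) (f := f e) (fun x z => by
      rw [lintegral_prod]
      · exact hf e x z
      · exact (Measurable.lintegral_prod_right' ((hm e).comp (f := fun z' : ((Fin n → Space d)
          × (Fin n → ℝ)) × Space d => (x, z'.1, z'.2, z)) (by fun_prop))).aemeasurable)
  refine tendsto_of_tendsto_of_tendsto_of_le_of_le tendsto_const_nhds ?_ (fun _ => zero_le) h
  have h0 : (0 : ℝ≥0∞) = ∑ l : Pairing (n + n), 0 := by simp
  rw [h0]
  refine tendsto_finsetSum _ fun l _ => ?_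
  have hpm : ∀ e, Measurable fun b : ((Fin n → Space d) × (Fin n → ℝ))
      × ((Fin n → Space d) × (Fin n → ℝ)) => ∫⁻ u : l.Label → Space d,
        pairDiff g u₀ t b.1.2 b.2.2 (c e b.1.1) (c e b.2.1) u := by
    intro e
    have := hc e
    refine Measurable.lintegral_prod_right' (f := fun z : (((Fin n → Space d) × (Fin n → ℝ))
      × ((Fin n → Space d) × (Fin n → ℝ))) × (l.Label → Space d) =>
        pairDiff g u₀ t z.1.1.2 z.1.2.2 (c e z.1.1.1) (c e z.1.2.1) z.2) ?_
    unfold pairDiff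
    refine Measurable.mul (M := ℝ≥0∞) ?_ ?_
    · exact (hm e).comp (f := fun z : (((Fin n → Space d) × (Fin n → ℝ))
        × ((Fin n → Space d) × (Fin n → ℝ))) × (l.Label → Space d) =>
        (z.2 (Sum.inr 0), z.1.1, z.2 (Sum.inr 1), fun i => z.2 (Sum.inl low(l, i))))
        (by fun_prop)
    · exact (hm e).comp (f := fun z : (((Fin n → Space d) × (Fin n → ℝ))
        × ((Fin n → Space d) × (Fin n → ℝ))) × (l.Label → Space d) =>
        (z.2 (Sum.inr 0), z.1.2, z.2 (Sum.inr 2), fun i => z.2 (Sum.inl upp(l, i))))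
        (by fun_prop)
  have hconv : Tendsto (fun e => ∫⁻ b, ∫⁻ u : l.Label → Space d,
        pairDiff g u₀ t b.1.2 b.2.2 (c e b.1.1) (c e b.2.1) u ∂volume ∂(β.prod β)) F (𝓝 0) := by
    have hz : (0 : ℝ≥0∞) = ∫⁻ b, 0 ∂(β.prod β) := by simp
    rw [hz]
    refine tendsto_lintegral_filter_of_dominated_convergence
      (fun b => 4 * (U * pairBound C a T l t b.1.2 b.2.2)) (Eventually.of_forall hpm)
      (Eventually.of_forall fun e => ae_of_all _ fun b => lintegral_pairDiff_le hg hu t _ _ _ _)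
      ?_ (ae_of_all _ fun b => tendsto_lintegral_pairDiff hg hu hui t _ _ (hc0 _) (hc0 _))
    have hpb := measurable_pairBound (C := C) (a := a) (T := T) l t
    have hpb' : Measurable fun b : ((Fin n → Space d) × (Fin n → ℝ))
      × ((Fin n → Space d) × (Fin n → ℝ)) => U * pairBound C a T l t b.1.2 b.2.2 := by fun_prop
    rw [lintegral_const_mul _ hpb']
    refine mul_ne_top (by norm_num) ?_
    have hfin' : U * ∫⁻ s, ∫⁻ s', pairBound C a T l t s s' ≠ ∞ := by
      have := ENNReal.sum_ne_top.1 hfin l (Finset.mem_univ _)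
      simpa using this
    rw [lintegral_prod _ hpb'.aemeasurable, lintegral_lintegral_prod_snd m volume U hpb]
    exact mul_ne_top (pow_ne_top (measure_ne_top _ _)) hfin'
  refine hconv.congr fun e => ?_
  rw [lintegral_prod _ (hpm e).aemeasurable]
  rfl

/-! ### Laplace transforms of the weights and summability of the energy bounds. -/

lemma lintegral_newWeight_exp_le {lam : ℝ} (hlam : 0 < lam) :
    ∫⁻ τ, newWeight C T τ * ofReal (exp (-lam * τ)) ≤ ofReal (C / lam) := by
  have h1 : ∫⁻ τ in Ioi (0 : ℝ), ofReal (exp (-lam * τ)) = ofReal (1 / lam) := by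
    rw [← ofReal_integral_eq_lintegral_ofReal (integrableOn_exp_mul_Ioi (by linarith) 0)
      (ae_of_all _ fun _ => (Real.exp_pos _).le), integral_exp_mul_Ioi (by linarith)]
    congr 1; simp
  calc _ ≤ ∫⁻ τ, (Ioi (0 : ℝ)).indicator
        (fun τ => (C : ℝ≥0∞) * ofReal (exp (-lam * τ))) τ := by
        refine lintegral_mono fun τ => ?_
        by_cases hτ : τ ∈ Ioo 0 T
        · rw [newWeight, indicator_of_mem hτ, indicator_of_mem (show τ ∈ Ioi 0 from hτ.1)]
        · rw [newWeight, indicator_of_notMem hτ, zero_mul]; exact zero_le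
    _ = _ := by
        rw [lintegral_indicator measurableSet_Ioi, lintegral_const_mul _ (by fun_prop), h1,
          div_eq_mul_one_div (C : ℝ), ofReal_mul (NNReal.coe_nonneg C),
          ofReal_coe_nnreal]

lemma lintegral_oldWeight_exp_le (ha : a < 1) {lam : ℝ} (hlam : 0 < lam) :
    ∫⁻ τ, oldWeight C a T τ * ofReal (exp (-lam * τ))
      ≤ ofReal (C * (Real.Gamma (1 - a) * lam ^ (a - 1))) := by
  have hg := Real.integral_rpow_mul_exp_neg_mul_Ioi (a := 1 - a) (by linarith) hlam
  have hgi : IntegrableOn (fun t : ℝ => t ^ (1 - a - 1) * exp (-(lam * t))) (Ioi 0) := by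
    have := integrableOn_rpow_mul_exp_neg_mul_rpow (p := 1) (s := 1 - a - 1) (b := lam)
      (by linarith) one_pos hlam
    simpa [neg_mul] using this
  calc _ ≤ ∫⁻ τ, (Ioi (0 : ℝ)).indicator
        (fun τ => (C : ℝ≥0∞) * ofReal (τ ^ (1 - a - 1) * exp (-(lam * τ)))) τ := by
        refine lintegral_mono fun τ => ?_
        by_cases hτ : τ ∈ Ioo 0 T
        · rw [oldWeight, indicator_of_mem hτ, indicator_of_mem (show τ ∈ Ioi 0 from hτ.1), mul_assoc,
            ← ofReal_mul (Real.rpow_nonneg hτ.1.le _)]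
          simp
        · rw [oldWeight, indicator_of_notMem hτ, zero_mul]; exact zero_le
    _ = _ := by
        rw [lintegral_indicator measurableSet_Ioi, lintegral_const_mul _ (by fun_prop),
          ← ofReal_integral_eq_lintegral_ofReal hgi
          ((ae_restrict_iff' measurableSet_Ioi).2 (ae_of_all _ fun τ hτ => mul_nonneg
            (Real.rpow_nonneg (le_of_lt hτ) _) (Real.exp_pos _).le)), hg,
          ofReal_mul (NNReal.coe_nonneg C), ofReal_coe_nnreal]
        congr 2
        rw [one_div, Real.inv_rpow hlam.le, ← Real.rpow_neg hlam.le, neg_sub, mul_comm]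

lemma newWeight_mul_exp_le {lam : ℝ} (hlam : 0 < lam) (τ : ℝ) :
    newWeight C T τ * ofReal (exp (-lam * τ)) ≤ ofReal lam * ofReal (C / lam) := by
  rw [← ofReal_mul hlam.le, mul_div_cancel₀ _ hlam.ne', ofReal_coe_nnreal]
  by_cases hτ : τ ∈ Ioo 0 T
  · rw [newWeight, indicator_of_mem hτ]
    refine mul_le_of_le_one_right (zero_le) ?_
    rw [ENNReal.ofReal_le_one, Real.exp_le_one_iff]
    nlinarith [hτ.1]
  · rw [newWeight, indicator_of_notMem hτ, zero_mul]; exact zero_le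

/-- Eventually `|x n| ≤ 1 / 4`, so the square roots are dominated by a geometric series of ratio one
half. -/
lemma summable_sqrt_mul_pow {A : ℝ} {x : ℕ → ℝ} (hlim : Tendsto x atTop (𝓝 0)) :
    Summable fun n => √(A * x n ^ n) := by
  have h4 : ∀ᶠ n in atTop, |x n| ≤ 1 / 4 := by
    have := hlim.abs
    rw [abs_zero] at this
    exact this.eventually_le_const (by norm_num)
  refine Summable.of_norm_bounded_eventually_nat (g := fun n => √|A| * (1 / 2) ^ n)
    ((summable_geometric_of_lt_one (by norm_num) (by norm_num)).mul_left _) ?_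
  filter_upwards [h4] with n hn
  rw [Real.norm_eq_abs, abs_of_nonneg (Real.sqrt_nonneg _)]
  calc √(A * x n ^ n) ≤ √(|A| * (1 / 4) ^ n) := by
        refine Real.sqrt_le_sqrt ((le_abs_self _).trans ?_)
        rw [abs_mul, abs_pow]; gcongr
    _ = _ := by
        rw [Real.sqrt_mul (abs_nonneg _)]
        congr 1
        rw [show (1 / 4 : ℝ) = (1 / 2) ^ 2 by norm_num, ← pow_mul, mul_comm 2 n, pow_mul,
          Real.sqrt_sq (by positivity)]

/-- Choose the exponential weight `lam = n + 1`. Of the `n + 2` factors `C / lam` from new edges,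
`n` cancel the growth of the number of pairings, at most `(2 * lam) ^ n`, and two cancel the factor
`lam ^ 2` paid for the last increments. The old edges leave `lam ^ ((a - 1) * n)`, which beats every
geometric growth because `a < 1`, in particular `exp (lam * T)` and the powers of `N`. -/
lemma exists_summable_energyBound (ha : a < 1) {U : ℝ≥0∞} (hU : U ≠ ∞) (N : ℝ≥0) :
    ∃ b : ℕ → ℝ≥0, Summable b ∧ ∀ n, ∀ t ≤ T,
      ((N : ℝ≥0∞) ^ n) ^ 2 * energyBound C a T U n t univ ≤ (b n : ℝ≥0∞) ^ 2 := by
  set Γ := Real.Gamma (1 - a) with hΓ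
  have hΓ0 : 0 < Γ := Real.Gamma_pos_of_pos (by linarith)
  set A : ℝ := 2 * U.toReal * exp T ^ 2 * C ^ 2 with hA
  -- The growth per order: `N ^ 2` from the mollifier, `2 * C` from the pairings and the new edges,
  -- `exp T ^ 2` from undoing the exponential weight on both chains, and the rest from the old
  -- edges.
  set x : ℕ → ℝ := fun n => N ^ 2 * (2 * C) * exp T ^ 2 * (C * Γ) * ((n : ℝ) + 1) ^ (a - 1) with hx
  have hx0 : ∀ n, 0 ≤ x n := fun n => by simp only [hx]; positivity
  have hA0 : 0 ≤ A := by positivity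
  have hlim : Tendsto x atTop (𝓝 0) := by
    have h1 : Tendsto (fun n : ℕ => ((n : ℝ) + 1) ^ (a - 1)) atTop (𝓝 0) := by
      have h2 : Tendsto (fun n : ℕ => (n : ℝ) + 1) atTop atTop :=
        tendsto_atTop_add_const_right _ _ tendsto_natCast_atTop_atTop
      have := (tendsto_rpow_neg_atTop (y := 1 - a) (by linarith)).comp h2
      simpa [Function.comp_def] using this
    simpa using h1.const_mul (N ^ 2 * (2 * C) * exp T ^ 2 * (C * Γ))
  refine ⟨fun n => Real.toNNReal (√(A * x n ^ n)), ?_, fun n t ht => ?_⟩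
  · exact (summable_sqrt_mul_pow hlim).toNNReal
  set lam : ℝ := (n : ℝ) + 1 with hlam
  have hlam0 : 0 < lam := by positivity
  have hpb : ∀ l : Pairing (n + n), ∫⁻ s, ∫⁻ s', pairBound C a T l t s s' ≤ _ := fun l =>
    lintegral_pairBound_le (l := l) lam (lintegral_newWeight_exp_le (C := C) (T := T) hlam0)
      (lintegral_oldWeight_exp_le (C := C) (T := T) ha hlam0) (newWeight_mul_exp_le hlam0) t
  have hsum : energyBound C a T U n t univ ≤ (Fintype.card (Pairing (n + n)) : ℝ≥0∞)
      * (U * (2 * (ofReal (exp (lam * t)) ^ 2 * ofReal lam ^ 2 * (ofReal (C / lam) ^ (n + 2)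
          * ofReal (C * (Γ * lam ^ (a - 1))) ^ n)))) := by
    rw [energyBound]
    simp only [Measure.restrict_univ]
    refine (Finset.sum_le_card_nsmul _ _ _ fun l _ => mul_le_mul' le_rfl (hpb l)).trans ?_
    rw [nsmul_eq_mul, card_univ]
  have hcard : (Fintype.card (Pairing (n + n)) : ℝ≥0∞) ≤ ofReal ((2 * lam) ^ n) := by
    have := Pairing.card_le n
    calc (Fintype.card (Pairing (n + n)) : ℝ≥0∞) ≤ (((2 * n) ^ n : ℕ) : ℝ≥0∞) := by exact_mod_cast this
      _ = ofReal (((2 * n) ^ n : ℕ) : ℝ) := (ENNReal.ofReal_natCast _).symm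
      _ ≤ _ := by
        refine ofReal_le_ofReal ?_
        push_cast
        gcongr
        rw [hlam]; linarith
  have hexp : exp (lam * t) ≤ exp T ^ (n + 1) := by
    rw [← Real.exp_nat_mul]
    refine Real.exp_le_exp.2 ?_
    push_cast
    exact mul_le_mul_of_nonneg_left ht hlam0.le
  have hUr : U = ofReal U.toReal := (ENNReal.ofReal_toReal hU).symm
  have hNr : (N : ℝ≥0∞) = ofReal N := (ofReal_coe_nnreal).symm
  have h2r : (2 : ℝ≥0∞) = ofReal 2 := by simp
  calc _ ≤ ((ofReal N) ^ n) ^ 2 * (ofReal ((2 * lam) ^ n)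
      * (ofReal U.toReal * (ofReal 2 * (ofReal (exp T ^ (n + 1)) ^ 2
        * ofReal lam ^ 2 * (ofReal (C / lam) ^ (n + 2)
          * ofReal (C * (Γ * lam ^ (a - 1))) ^ n))))) := by
        rw [← hNr, ← hUr, ← h2r]
        refine mul_le_mul' le_rfl (hsum.trans ?_)
        gcongr
    _ = ofReal (A * x n ^ n) := by
        have p1 : 0 ≤ C * (Γ * lam ^ (a - 1)) := by positivity
        have p2 : 0 ≤ (C : ℝ) / lam := by positivity
        simp only [← ofReal_pow (NNReal.coe_nonneg N), ← ofReal_pow (pow_nonneg (NNReal.coe_nonneg N) n), ← ofReal_pow hlam0.le, ← ofReal_pow p1,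
          ← ofReal_pow p2, ← ofReal_pow (show 0 ≤ exp T ^ (n + 1) by positivity)]
        rw [← ofReal_mul (by positivity),
          ← ofReal_mul (by positivity), ← ofReal_mul (by positivity),
          ← ofReal_mul (by positivity), ← ofReal_mul (by positivity),
          ← ofReal_mul (by positivity), ← ofReal_mul (by positivity)]
        congr 1
        have e1 : (2 * lam) ^ n * lam ^ 2 * ((C : ℝ) / lam) ^ (n + 2) = (2 * C) ^ n * (C : ℝ) ^ 2 := by
          rw [div_pow, mul_pow, mul_pow]; field_simp; ring
        simp only [hx, hA, ← hlam]
        generalize lam ^ (a - 1) = r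
        generalize exp T = e
        calc _ = ((2 * lam) ^ n * lam ^ 2 * ((C : ℝ) / lam) ^ (n + 2)) * (((N : ℝ) ^ n) ^ 2
              * (U.toReal * (2 * ((e ^ (n + 1)) ^ 2 * (C * (Γ * r)) ^ n)))) := by ring
          _ = _ := by rw [e1]; ring
    _ = _ := by
        rw [← ofReal, ← ofReal_pow (Real.sqrt_nonneg _), Real.sq_sqrt]
        exact mul_nonneg hA0 (pow_nonneg (hx0 n) n)

/-! ### Pointwise and `L¹` bounds on the integrands, at a fixed base point. -/

lemma lintegral_oldWeight_ne_top (ha : a < 1) : ∫⁻ τ, oldWeight C a T τ ≠ ∞ := by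
  have h := lintegral_oldWeight_exp_le (C := C) (T := T) ha one_pos
  have hm : Measurable fun τ => oldWeight C a T τ * ofReal (exp (-1 * τ)) :=
    (measurable_oldWeight C a T).mul (by fun_prop)
  have h2 : ∫⁻ τ, oldWeight C a T τ ≤ ofReal (exp T)
      * ∫⁻ τ, oldWeight C a T τ * ofReal (exp (-1 * τ)) := by
    rw [← lintegral_const_mul _ hm]
    refine lintegral_mono fun τ => ?_
    by_cases hτ : τ ∈ Ioo 0 T
    · rw [mul_comm, mul_assoc, ← ofReal_mul (Real.exp_pos _).le, ← Real.exp_add]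
      refine le_mul_of_one_le_right zero_le ?_
      rw [ENNReal.one_le_ofReal, Real.one_le_exp_iff]
      linarith [hτ.2]
    · simp only [oldWeight]; rw [indicator_of_notMem hτ]; exact zero_le
  exact ne_top_of_le_ne_top (mul_ne_top ofReal_ne_top (ne_top_of_le_ne_top ofReal_ne_top h)) h2

lemma newWeight_le_oldWeight (ha0 : 0 ≤ a) (τ : ℝ) :
    newWeight C T τ ≤ ofReal (T ^ a) * oldWeight C a T τ := by
  by_cases hτ : τ ∈ Ioo 0 T
  · rw [newWeight, oldWeight, indicator_of_mem hτ, indicator_of_mem hτ, mul_left_comm,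
      ← ofReal_mul (Real.rpow_nonneg (hτ.1.trans hτ.2).le _)]
    refine le_mul_of_one_le_right zero_le ?_
    rw [ENNReal.one_le_ofReal, Real.rpow_neg hτ.1.le, ← div_eq_mul_inv,
      one_le_div (Real.rpow_pos_of_pos hτ.1 _)]
    exact Real.rpow_le_rpow hτ.1.le hτ.2.le ha0
  · rw [newWeight, indicator_of_notMem hτ]; exact zero_le

/-- The convolution of two singular weights has the same singularity. -/
lemma exists_lintegral_oldWeight_mul_le (ha0 : 0 ≤ a) (ha : a < 1) (C : ℝ≥0) (T : ℝ) :
    ∃ K : ℝ≥0∞, K ≠ ∞ ∧ ∀ t < T,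
      ∫⁻ s, oldWeight C a T (t - s) * oldWeight 1 a T s ≤ K * oldWeight 1 a T t := by
  refine ⟨C * ofReal (2 ^ a) * (2 * ∫⁻ τ, oldWeight 1 a T τ), mul_ne_top
    (mul_ne_top coe_ne_top ofReal_ne_top)
    (mul_ne_top (by norm_num) (lintegral_oldWeight_ne_top ha)), fun t ht => ?_⟩
  have hm := measurable_oldWeight 1 a T
  have hpt : ∀ s, oldWeight C a T (t - s) * oldWeight 1 a T s
      ≤ (C * ofReal (2 ^ a) * oldWeight 1 a T t)
        * (oldWeight 1 a T (t - s) + oldWeight 1 a T s) := by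
    intro s
    by_cases h1 : t - s ∈ Ioo 0 T
    swap
    · rw [oldWeight, indicator_of_notMem h1, zero_mul]; exact zero_le
    by_cases h2 : s ∈ Ioo 0 T
    swap
    · rw [mul_comm, oldWeight, indicator_of_notMem h2, zero_mul]; exact zero_le
    have ht0 : t ∈ Ioo 0 T := ⟨by linarith [h1.1, h2.1], ht⟩
    simp only [oldWeight]
    rw [indicator_of_mem h1, indicator_of_mem h1, indicator_of_mem h2, indicator_of_mem ht0]
    simp only [ENNReal.coe_one, one_mul]
    have p1 := Real.rpow_nonneg h1.1.le (-a)
    have p2 := Real.rpow_nonneg h2.1.le (-a)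
    have p3 := Real.rpow_nonneg ht0.1.le (-a)
    have p4 : (0 : ℝ) ≤ 2 ^ a := by positivity
    rw [mul_assoc, mul_assoc, mul_assoc, ← ENNReal.ofReal_add p1 p2, ← ofReal_mul p3,
      ← ofReal_mul p4, ← ofReal_mul p1]
    refine mul_le_mul' le_rfl (ofReal_le_ofReal ?_)
    -- One of `s` and `t - s` is at least `t / 2`; its singular factor is at most `2 ^ a * t ^
    -- (-a)`, and the other one stays integrable.
    have key : ∀ x, t / 2 ≤ x → x ^ (-a) ≤ 2 ^ a * t ^ (-a) := by
      intro x hx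
      calc x ^ (-a) ≤ (t / 2) ^ (-a) :=
            Real.rpow_le_rpow_of_nonpos (by linarith [ht0.1]) hx (by linarith)
        _ = _ := by
          rw [Real.div_rpow ht0.1.le (by norm_num), Real.rpow_neg (by norm_num : (0 : ℝ) ≤ 2),
            div_inv_eq_mul, mul_comm]
    rcases le_total (t / 2) s with h | h
    · have := mul_le_mul_of_nonneg_left (key s h) p1
      nlinarith [mul_nonneg (mul_nonneg p4 p3) p2]
    · have := mul_le_mul_of_nonneg_right (key (t - s) (by linarith)) p2
      nlinarith [mul_nonneg (mul_nonneg p4 p3) p1]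
  calc _ ≤ ∫⁻ s, (C * ofReal (2 ^ a) * oldWeight 1 a T t)
        * (oldWeight 1 a T (t - s) + oldWeight 1 a T s) := lintegral_mono hpt
    _ = _ := by
        have hm' : Measurable fun s => oldWeight 1 a T (t - s) := by fun_prop
        have hm2 : Measurable fun s => oldWeight 1 a T (t - s) + oldWeight 1 a T s := hm'.add hm
        rw [lintegral_const_mul _ hm2, lintegral_add_right _ hm,
          lintegral_sub_left_eq_self (fun s => oldWeight 1 a T s) t]
        ring

/-- The total variation of the integrand over the times and the initial point. -/
def absChain (g : ℝ → Space d → Space d → ℝ) (u₀ : Space d → ℝ) (n : ℕ) (t : ℝ) (x : Space d)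
    (y : Fin n → Space d) : ℝ≥0∞ :=
  ∫⁻ s, ∫⁻ w, ‖chainDensity g u₀ n t x s w y‖ₑ

/-- The integrand integrated over the times and the initial point. -/
def chainInt (g : ℝ → Space d → Space d → ℝ) (u₀ : Space d → ℝ) (n : ℕ) (t : ℝ) (x : Space d)
    (y : Fin n → Space d) : ℝ :=
  ∫ s, ∫ w, chainDensity g u₀ n t x s w y

lemma enorm_chainInt_le (g : ℝ → Space d → Space d → ℝ) (u₀ : Space d → ℝ) (t : ℝ) (x : Space d)
    (y : Fin n → Space d) : ‖chainInt g u₀ n t x y‖ₑ ≤ absChain g u₀ n t x y :=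
  (enorm_integral_le_lintegral_enorm _).trans
    (lintegral_mono fun _ => enorm_integral_le_lintegral_enorm _)

lemma chainDensity_succ (g : ℝ → Space d → Space d → ℝ) (u₀ : Space d → ℝ) (t : ℝ) (x : Space d)
    (s : Fin (n + 1) → ℝ) (w : Space d) (y : Fin (n + 1) → Space d) :
    chainDensity g u₀ (n + 1) t x s w y
      = g (t - s 0) x (y 0) * chainDensity g u₀ n (s 0) (y 0) (tail s) w (tail y) := by
  rw [chainDensity, chainKernel_succ, chainDensity]; ring

lemma lintegral_fin_zero {X : Type*} [MeasureSpace X] (f : (Fin 0 → X) → ℝ≥0∞) :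
    ∫⁻ s, f s = f default := by
  rw [lintegral_unique]
  have : (volume : Measure (Fin 0 → X)) univ = 1 := by simp [volume_pi]
  rw [this, mul_one]

lemma integral_fin_zero {X : Type*} [MeasureSpace X] (f : (Fin 0 → X) → ℝ) :
    ∫ s, f s = f default := by
  rw [integral_unique]
  have : (volume : Measure (Fin 0 → X)) univ = 1 := by simp [volume_pi]
  rw [measureReal_def, this]; simp

lemma integral_pi_fin_succ {X : Type*} [MeasureSpace X] [SigmaFinite (volume : Measure X)]
    {f : (Fin (n + 1) → X) → ℝ} (hf : Integrable f) :
    ∫ s, f s = ∫ a, ∫ s : Fin n → X, f (Fin.cons a s) := by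
  have h := (volume_preserving_piFinSuccAbove (fun _ : Fin (n + 1) => X) 0).symm
  rw [← h.integral_comp' f, Measure.volume_eq_prod, integral_prod]
  · refine integral_congr_ae (ae_of_all _ fun a => integral_congr_ae (ae_of_all _ fun s => ?_))
    simp [MeasurableEquiv.piFinSuccAbove, Fin.insertNthEquiv]
  · exact (h.integrable_comp_emb (MeasurableEquiv.measurableEmbedding _)).2 hf

lemma absChain_zero (g : ℝ → Space d → Space d → ℝ) (u₀ : Space d → ℝ) (t : ℝ) (x : Space d)
    (y : Fin 0 → Space d) : absChain g u₀ 0 t x y = ∫⁻ w, ‖u₀ w * g t x w‖ₑ := by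
  rw [absChain, lintegral_fin_zero]; simp only [chainDensity, chainKernel_zero]

lemma chainInt_zero (g : ℝ → Space d → Space d → ℝ) (u₀ : Space d → ℝ) (t : ℝ) (x : Space d)
    (y : Fin 0 → Space d) : chainInt g u₀ 0 t x y = ∫ w, u₀ w * g t x w := by
  rw [chainInt, integral_fin_zero]; simp only [chainDensity, chainKernel_zero]

lemma GreenKernel.measurable_absChain (hg : GreenKernel g C a T) (hu : Measurable u₀) {β : Type*}
    [MeasurableSpace β] {t : β → ℝ} {x : β → Space d} {y : β → Fin n → Space d}
    (ht : Measurable t := by fun_prop)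
    (hx : Measurable x := by fun_prop) (hy : Measurable y := by fun_prop) :
    Measurable fun b => absChain g u₀ n (t b) (x b) (y b) := by
  unfold absChain
  refine Measurable.lintegral_prod_right (Measurable.lintegral_prod_right ?_)
  exact (hg.measurable_chainDensity hu).enorm

lemma GreenKernel.measurable_chainInt (hg : GreenKernel g C a T) (hu : Measurable u₀) {β : Type*}
    [MeasurableSpace β] {t : β → ℝ} {x : β → Space d} {y : β → Fin n → Space d}
    (ht : Measurable t := by fun_prop)
    (hx : Measurable x := by fun_prop) (hy : Measurable y := by fun_prop) :
    Measurable fun b => chainInt g u₀ n (t b) (x b) (y b) := by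
  unfold chainInt
  have hm := (hg.measurable_chainDensity hu (β := (β × (Fin n → ℝ)) × Space d)
    (t := fun b => t b.1.1) (x := fun b => x b.1.1) (s := fun b => b.1.2) (w := fun b => b.2)
    (y := fun b => y b.1.1)).stronglyMeasurable
  have h2 : StronglyMeasurable fun b : β × (Fin n → ℝ) =>
      ∫ w, chainDensity g u₀ n (t b.1) (x b.1) b.2 w (y b.1) := hm.integral_prod_right'
  exact h2.integral_prod_right'.measurable

lemma measurable_tail {X : Type*} [MeasurableSpace X] :
    Measurable (tail : (Fin (n + 1) → X) → Fin n → X) :=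
  measurable_pi_iff.2 fun i => measurable_pi_apply i.succ

lemma absChain_succ (hg : GreenKernel g C a T) (hu : Measurable u₀) (t : ℝ) (x : Space d)
    (y : Fin (n + 1) → Space d) : absChain g u₀ (n + 1) t x y
      = ∫⁻ s, ‖g (t - s) x (y 0)‖ₑ * absChain g u₀ n s (y 0) (tail y) := by
  rw [absChain, lintegral_pi_fin_succ]
  · refine lintegral_congr fun s₀ => ?_
    simp only [chainDensity_succ, Fin.cons_zero, Fin.tail_cons, enorm_mul]
    have hm : Measurable fun z : (Fin n → ℝ) × Space d =>
        ‖chainDensity g u₀ n s₀ (y 0) z.1 z.2 (tail y)‖ₑ :=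
      (hg.measurable_chainDensity hu).enorm
    rw [absChain, ← lintegral_const_mul _ hm.lintegral_prod_right']
    refine lintegral_congr fun s => ?_
    have hm2 : Measurable fun w => ‖chainDensity g u₀ n s₀ (y 0) s w (tail y)‖ₑ :=
      hm.comp measurable_prodMk_left
    rw [lintegral_const_mul _ hm2]
  · exact Measurable.lintegral_prod_right (hg.measurable_chainDensity hu
      (β := (Fin (n + 1) → ℝ) × Space d)).enorm

/-- Pointwise bound on the integrands. -/
lemma exists_absChain_le (hg : GreenKernel g C a T) (ha0 : 0 ≤ a) (ha : a < 1) (hu : Measurable u₀)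
    (hui : Integrable u₀ volume) (n : ℕ) :
    ∃ K : ℝ≥0∞, K ≠ ∞ ∧ ∀ t < T, ∀ x y, absChain g u₀ n t x y ≤ K * oldWeight 1 a T t := by
  have hC : ∀ τ, oldWeight C a T τ = C * oldWeight 1 a T τ := by
    intro τ; simp only [oldWeight]
    by_cases h : τ ∈ Ioo 0 T
    · rw [indicator_of_mem h, indicator_of_mem h]; simp
    · rw [indicator_of_notMem h, indicator_of_notMem h]; simp
  obtain ⟨K₁, hK₁, hconv⟩ := exists_lintegral_oldWeight_mul_le ha0 ha C T
  induction n with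
  | zero =>
    refine ⟨C * ∫⁻ w, ‖u₀ w‖ₑ, mul_ne_top coe_ne_top hui.2.ne, fun t _ x y => ?_⟩
    rw [absChain_zero]
    calc _ ≤ ∫⁻ w, ‖u₀ w‖ₑ * oldWeight C a T t := by
          refine lintegral_mono fun w => ?_
          rw [enorm_mul]
          exact mul_le_mul' le_rfl (hg.sup_le _ _ _)
      _ = _ := by rw [lintegral_mul_const _ hu.enorm, hC]; ring
  | succ n ih =>
    obtain ⟨K, hK, ih⟩ := ih
    refine ⟨K * K₁, mul_ne_top hK hK₁, fun t ht x y => ?_⟩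
    rw [absChain_succ hg hu]
    calc _ ≤ ∫⁻ s, K * (oldWeight C a T (t - s) * oldWeight 1 a T s) := by
          refine lintegral_mono fun s => ?_
          rcases lt_or_ge s T with hs | hs
          · refine (mul_le_mul' (hg.sup_le _ _ _) (ih s hs _ _)).trans (le_of_eq (by ring))
          · have : ‖g (t - s) x (y 0)‖ₑ = 0 := by
              refine le_antisymm ((hg.sup_le _ _ _).trans ?_) zero_le
              rw [oldWeight, indicator_of_notMem]
              exact fun h => by linarith [h.1]
            simp only [this, zero_mul]; exact zero_le
      _ ≤ _ := by
          have hmw : Measurable fun s => oldWeight C a T (t - s) * oldWeight 1 a T s :=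
            ((measurable_oldWeight C a T).comp (by fun_prop)).mul (measurable_oldWeight 1 a T)
          rw [lintegral_const_mul _ hmw, mul_assoc]
          gcongr
          exact hconv t ht

/-- `L¹` bound on the integrands. -/
lemma exists_lintegral_absChain_le (hg : GreenKernel g C a T) (ha0 : 0 ≤ a) (ha : a < 1)
    (hu : Measurable u₀) (hui : Integrable u₀ volume) (n : ℕ) :
    ∃ K : ℝ≥0∞, K ≠ ∞ ∧ ∀ t < T, ∀ x, ∫⁻ y, absChain g u₀ n t x y ≤ K * oldWeight 1 a T t := by
  obtain ⟨K₁, hK₁, hconv⟩ := exists_lintegral_oldWeight_mul_le ha0 ha C T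
  induction n with
  | zero =>
    obtain ⟨K, hK, h⟩ := exists_absChain_le hg ha0 ha hu hui 0
    exact ⟨K, hK, fun t ht x => by rw [lintegral_fin_zero]; exact h t ht x _⟩
  | succ n ih =>
    obtain ⟨K, hK, ih⟩ := ih
    refine ⟨ofReal (T ^ a) * (K * K₁), mul_ne_top ofReal_ne_top
      (mul_ne_top hK hK₁), fun t ht x => ?_⟩
    have hcons : Measurable fun z : Space d × (Fin n → Space d) => (Fin.cons z.1 z.2 : Fin (n + 1) → Space d) := by fun_prop
    have hm3 : Measurable fun z : (ℝ × Space d) × (Fin n → Space d) =>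
        ‖g (t - z.1.1) x z.1.2‖ₑ * absChain g u₀ n z.1.1 z.1.2 z.2 :=
      hg.measurable_comp.enorm.mul (hg.measurable_absChain hu)
    have hmA : Measurable fun y : Fin (n + 1) → Space d => absChain g u₀ (n + 1) t x y :=
      hg.measurable_absChain hu
    rw [lintegral_pi_fin_succ hmA]
    simp only [absChain_succ hg hu, Fin.cons_zero, Fin.tail_cons]
    calc _ = ∫⁻ y₀, ∫⁻ s, ∫⁻ y : Fin n → Space d, ‖g (t - s) x y₀‖ₑ * absChain g u₀ n s y₀ y := by
          refine lintegral_congr fun y₀ => lintegral_lintegral_swap ?_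
          exact (hm3.comp (f := fun z : (Fin n → Space d) × ℝ => ((z.2, y₀), z.1))
            (by fun_prop)).aemeasurable
      _ = ∫⁻ s, ∫⁻ y₀, ∫⁻ y : Fin n → Space d, ‖g (t - s) x y₀‖ₑ * absChain g u₀ n s y₀ y := by
          refine lintegral_lintegral_swap ?_
          exact (hm3.lintegral_prod_right'.comp (f := fun z : Space d × ℝ => (z.2, z.1))
            (by fun_prop)).aemeasurable
      _ ≤ ∫⁻ s, (ofReal (T ^ a) * K) * (oldWeight C a T (t - s) * oldWeight 1 a T s) := by
          refine lintegral_mono fun s => ?_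
          have hgm : Measurable fun y₀ => ‖g (t - s) x y₀‖ₑ := hg.measurable_comp.enorm
          rcases lt_or_ge s T with hs | hs
          · calc _ ≤ ∫⁻ y₀, ‖g (t - s) x y₀‖ₑ * (K * oldWeight 1 a T s) := by
                  refine lintegral_mono fun y₀ => ?_
                  have hmB : Measurable fun y : Fin n → Space d => absChain g u₀ n s y₀ y :=
                    hg.measurable_absChain hu
                  rw [lintegral_const_mul _ hmB]
                  exact mul_le_mul' le_rfl (ih s hs _)
              -- The bounded weight is raised to the singular one on purpose: then the same
              -- convolution estimate closes the induction.
              _ ≤ (ofReal (T ^ a) * oldWeight C a T (t - s)) * (K * oldWeight 1 a T s) := by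
                  rw [lintegral_mul_const _ hgm]
                  exact mul_le_mul' ((hg.l1_le _ _).trans (newWeight_le_oldWeight ha0 _)) le_rfl
              _ = _ := by ring
          · have : ∀ y, ‖g (t - s) x y‖ₑ = 0 := fun y => by
              refine le_antisymm ((hg.sup_le _ _ _).trans ?_) zero_le
              rw [oldWeight, indicator_of_notMem]
              exact fun h => by linarith [h.1]
            simp only [this, zero_mul, lintegral_zero]; exact zero_le
      _ ≤ _ := by
          have hmw : Measurable fun s => oldWeight C a T (t - s) * oldWeight 1 a T s :=
            ((measurable_oldWeight C a T).comp (by fun_prop)).mul (measurable_oldWeight 1 a T)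
          rw [lintegral_const_mul _ hmw, mul_assoc, mul_assoc, mul_assoc]
          gcongr
          exact hconv t ht

lemma chainInt_succ (hg : GreenKernel g C a T) (hu : Measurable u₀) {x : Space d}
    {y : Fin (n + 1) → Space d} (hfin : absChain g u₀ (n + 1) t x y ≠ ∞) :
    chainInt g u₀ (n + 1) t x y = ∫ s, g (t - s) x (y 0) * chainInt g u₀ n s (y 0) (tail y) := by
  have hm : StronglyMeasurable fun z : (Fin (n + 1) → ℝ) × Space d =>
      chainDensity g u₀ (n + 1) t x z.1 z.2 y :=
    (hg.measurable_chainDensity hu).stronglyMeasurable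
  have hint : Integrable fun s => ∫ w, chainDensity g u₀ (n + 1) t x s w y := by
    refine ⟨hm.integral_prod_right'.aestronglyMeasurable, ?_⟩
    exact lt_of_le_of_lt (lintegral_mono fun _ => enorm_integral_le_lintegral_enorm _) hfin.lt_top
  rw [chainInt, integral_pi_fin_succ hint]
  refine integral_congr_ae (ae_of_all _ fun s₀ => ?_)
  simp only [chainDensity_succ, Fin.cons_zero, Fin.tail_cons, integral_const_mul]
  rfl

/-- The increments add up to `t`, so for `t ≤ 0` at least one of them is not positive, and the
kernel vanishes there. -/
lemma absChain_eq_zero (hg : GreenKernel g C a T) (hu : Measurable u₀) (ht : t ≤ 0) (x : Space d)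
    (y : Fin n → Space d) : absChain g u₀ n t x y = 0 := by
  have hz : ∀ τ ≤ 0, ∀ x y, ‖g τ x y‖ₑ = 0 := fun τ hτ x y => by
    refine le_antisymm ((hg.sup_le _ _ _).trans ?_) zero_le
    rw [oldWeight, indicator_of_notMem]
    exact fun h => by linarith [h.1]
  induction n generalizing t x with
  | zero => rw [absChain_zero]; simp [enorm_mul, hz t ht]
  | succ n ih =>
    rw [absChain_succ hg hu]
    refine lintegral_eq_zero_of_ae_eq_zero (ae_of_all _ fun s => ?_)
    rcases le_total s 0 with hs | hs
    · simp [ih hs]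
    · simp [hz (t - s) (by linarith)]

lemma chainInt_eq_zero (hg : GreenKernel g C a T) (hu : Measurable u₀) (ht : t ≤ 0) (x : Space d)
    (y : Fin n → Space d) : chainInt g u₀ n t x y = 0 := by
  have := enorm_chainInt_le g u₀ t x y
  rw [absChain_eq_zero hg hu ht] at this
  simpa using this

/-! ### The cut-off Green's function, and the integrands as kernels of the Duhamel terms. -/

/-- The Green's function, set to zero outside the time interval `(0, T)`. -/
def greenCutoff (G : ℝ → Space d → Space d → ℝ) (T τ : ℝ) (x y : Space d) : ℝ :=
  (Ioo 0 T).indicator (fun τ => G τ x y) τ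

lemma greenCutoff_of_mem (G : ℝ → Space d → Space d → ℝ) {τ : ℝ} (h : τ ∈ Ioo 0 T) (x y : Space d) :
    greenCutoff G T τ x y = G τ x y := indicator_of_mem h _

lemma greenCutoff_of_notMem (G : ℝ → Space d → Space d → ℝ) {τ : ℝ} (h : τ ∉ Ioo 0 T)
    (x y : Space d) : greenCutoff G T τ x y = 0 := indicator_of_notMem h _

lemma exists_greenKernel {m : ℝ} (hG_symm : ∀ t : ℝ, 0 < t → ∀ x y, G t x y = G t y x)
    (hG_cont : ContinuousOn (fun z : ℝ × Space d × Space d => G z.1 z.2.1 z.2.2) (Ioi 0 ×ˢ univ))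
    (hG : GreenBounds m G) (hT : 0 < T) : ∃ C : ℝ≥0, GreenKernel (greenCutoff G T) C (d / m) T := by
  obtain ⟨C, hC⟩ := hG T hT
  refine ⟨C, ?_, ?_, ?_, ?_, ?_⟩
  · have hS : MeasurableSet (Ioo 0 T ×ˢ (univ : Set (Space d × Space d))) :=
      measurableSet_Ioo.prod MeasurableSet.univ
    have h1 : Measurable ((Ioo 0 T ×ˢ (univ : Set (Space d × Space d))).indicator
        (fun z : ℝ × Space d × Space d => G z.1 z.2.1 z.2.2)) := by
      classical
      rw [← piecewise_eq_indicator]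
      exact ContinuousOn.measurable_piecewise (g := 0)
        (hG_cont.mono (prod_mono (fun x hx => hx.1) subset_rfl)) continuousOn_const hS
    convert h1 using 1
    ext z
    by_cases hz : z.1 ∈ Ioo 0 T
    · rw [greenCutoff_of_mem G hz, indicator_of_mem (by exact ⟨hz, mem_univ _⟩)]
    · rw [greenCutoff_of_notMem G hz, indicator_of_notMem (fun h => hz h.1)]
  · intro τ x y
    by_cases h : τ ∈ Ioo 0 T
    · rw [greenCutoff_of_mem G h, greenCutoff_of_mem G h, hG_symm τ h.1]
    · rw [greenCutoff_of_notMem G h, greenCutoff_of_notMem G h]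
  · intro τ
    by_cases h : τ ∈ Ioo 0 T
    · have : uncurry (greenCutoff G T τ) = fun z => G τ z.1 z.2 := by
        ext z; exact greenCutoff_of_mem G h _ _
      rw [this]
      exact hG_cont.comp_continuous (f := fun z : Space d × Space d => (τ, z)) (by fun_prop)
        fun z => ⟨h.1, mem_univ _⟩
    · have : uncurry (greenCutoff G T τ) = fun z => 0 := by
        ext z; exact greenCutoff_of_notMem G h _ _
      rw [this]; exact continuous_const
  · intro τ x
    by_cases h : τ ∈ Ioo 0 T
    · simp only [greenCutoff_of_mem G h]
      rw [newWeight, indicator_of_mem h]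
      simp only [hG_symm τ h.1 x]
      exact (hC τ h).1 x
    · simp [greenCutoff_of_notMem G h]
  · intro τ x y
    by_cases h : τ ∈ Ioo 0 T
    · rw [greenCutoff_of_mem G h, oldWeight, indicator_of_mem h, Real.enorm_eq_ofReal_abs,
        ← ofReal_coe_nnreal, ← ofReal_mul (NNReal.coe_nonneg C)]
      refine ofReal_le_ofReal ?_
      have := (hC τ h).2.2 x y
      rw [Real.rpow_neg h.1.le, ← div_eq_mul_inv, le_div_iff₀ (Real.rpow_pos_of_pos h.1 _), mul_comm]
      exact this
    · simp [greenCutoff_of_notMem G h]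

lemma greenCutoff_semigroup {p : Space d → Space d → ℂ} (hG : IsGreenFunction p G)
    (hG_symm : ∀ t : ℝ, 0 < t → ∀ x y, G t x y = G t y x) {r : ℝ} (hr : 0 < r) (ht : 0 < t)
    (hT : r + t < T) (x y : Space d) :
    ∫ z, greenCutoff G T r x z * greenCutoff G T t z y = greenCutoff G T (r + t) x y := by
  rw [greenCutoff_of_mem G ⟨by linarith, hT⟩, ← hG.semigroup r t hr ht]
  refine integral_congr_ae (ae_of_all _ fun z => ?_)
  dsimp only
  rw [greenCutoff_of_mem G ⟨hr, by linarith⟩, greenCutoff_of_mem G ⟨ht, by linarith⟩, hG_symm t ht]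

lemma GreenKernel.integrable (hg : GreenKernel g C a T) (τ : ℝ) (x : Space d) :
    Integrable (g τ x) := by
  refine ⟨((hg.continuous τ).comp (by fun_prop : Continuous fun y => (x, y))).aestronglyMeasurable,
    ?_⟩
  exact lt_of_le_of_lt ((hg.l1_le τ x).trans (newWeight_le C T τ)) ENNReal.coe_lt_top

lemma GreenKernel.eq_zero_of_nonpos (hg : GreenKernel g C a T) {τ : ℝ} (hτ : τ ≤ 0)
    (x y : Space d) : g τ x y = 0 := by
  have := hg.sup_le τ x y
  rw [oldWeight, indicator_of_notMem (fun h => by linarith [h.1])] at this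
  simpa using this

lemma absChain_ne_top (hg : GreenKernel g C a T) (ha0 : 0 ≤ a) (ha : a < 1) (hu : Measurable u₀)
    (hui : Integrable u₀ volume) (ht : t < T) (x : Space d) (y : Fin n → Space d) :
    absChain g u₀ n t x y ≠ ∞ := by
  obtain ⟨K, hK, h⟩ := exists_absChain_le hg ha0 ha hu hui n
  exact ne_top_of_le_ne_top (mul_ne_top hK (oldWeight_ne_top _ _ _ _)) (h t ht x y)

lemma exists_abs_chainInt_le (hg : GreenKernel g C a T) (ha0 : 0 ≤ a) (ha : a < 1)
    (hu : Measurable u₀) (hui : Integrable u₀ volume) (n : ℕ) :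
    ∃ K : ℝ, 0 ≤ K ∧ ∀ t < T, ∀ x y, |chainInt g u₀ n t x y| ≤ K * (oldWeight 1 a T t).toReal := by
  obtain ⟨K, hK, h⟩ := exists_absChain_le hg ha0 ha hu hui n
  refine ⟨K.toReal, ENNReal.toReal_nonneg, fun t ht x y => ?_⟩
  have h1 := (enorm_chainInt_le g u₀ t x y).trans (h t ht x y)
  rw [← ENNReal.toReal_mul, ← Real.norm_eq_abs, ← toReal_enorm]
  exact ENNReal.toReal_mono (mul_ne_top hK (oldWeight_ne_top _ _ _ _)) h1

lemma continuous_chainInt (hg : GreenKernel g C a T) (ha0 : 0 ≤ a) (ha : a < 1) (hu : Measurable u₀)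
    (hui : Integrable u₀ volume) (n : ℕ) (ht : t < T) :
    Continuous fun z : Space d × (Fin n → Space d) => chainInt g u₀ n t z.1 z.2 := by
  induction n generalizing t with
  | zero =>
    simp only [chainInt_zero]
    refine continuous_of_dominated (bound := fun w => |u₀ w| * (oldWeight C a T t).toReal) ?_ ?_
      (hui.abs.mul_const _) ?_
    · intro z
      exact (hu.mul hg.measurable_comp).aestronglyMeasurable
    · intro z
      refine ae_of_all _ fun w => ?_
      rw [norm_mul, Real.norm_eq_abs, ← toReal_enorm]
      exact mul_le_mul_of_nonneg_left (ENNReal.toReal_mono (oldWeight_ne_top _ _ _ _)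
        (hg.sup_le _ _ _)) (abs_nonneg _)
    · refine ae_of_all _ fun w => continuous_const.mul ?_
      exact (hg.continuous t).comp (by fun_prop : Continuous fun z : Space d × (Fin 0 → Space d) =>
        (z.1, w))
  | succ n ih =>
    obtain ⟨K, hK0, hK⟩ := exists_abs_chainInt_le hg ha0 ha hu hui n
    have hrec : (fun z : Space d × (Fin (n + 1) → Space d) => chainInt g u₀ (n + 1) t z.1 z.2)
        = fun z => ∫ s, g (t - s) z.1 (z.2 0) * chainInt g u₀ n s (z.2 0) (tail z.2) := by
      ext z; exact chainInt_succ hg hu (absChain_ne_top hg ha0 ha hu hui ht _ _)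
    rw [hrec]
    have hzero : ∀ s, T ≤ s → ∀ x y, g (t - s) x y = 0 := fun s hs x y =>
      hg.eq_zero_of_nonpos (by linarith) _ _
    have hmw : Measurable fun s => oldWeight C a T (t - s) * oldWeight 1 a T s :=
      ((measurable_oldWeight C a T).comp (by fun_prop)).mul (measurable_oldWeight 1 a T)
    refine continuous_of_dominated (bound := fun s =>
      K * (oldWeight C a T (t - s) * oldWeight 1 a T s).toReal) ?_ ?_ ?_ ?_
    · intro z
      exact (hg.measurable_comp.mul (hg.measurable_chainInt hu)).aestronglyMeasurable
    · intro z
      refine ae_of_all _ fun s => ?_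
      rcases lt_or_ge s T with hs | hs
      · rw [norm_mul, ENNReal.toReal_mul, ← toReal_enorm, Real.norm_eq_abs]
        calc _ ≤ (oldWeight C a T (t - s)).toReal * (K * (oldWeight 1 a T s).toReal) :=
              mul_le_mul (ENNReal.toReal_mono (oldWeight_ne_top _ _ _ _) (hg.sup_le _ _ _))
                (hK s hs _ _) (abs_nonneg _) ENNReal.toReal_nonneg
          _ = _ := by ring
      · rw [hzero s hs, zero_mul, norm_zero]
        exact mul_nonneg hK0 ENNReal.toReal_nonneg
    · refine (integrable_toReal_of_lintegral_ne_top hmw.aemeasurable ?_).const_mul K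
      obtain ⟨K₁, hK₁, h⟩ := exists_lintegral_oldWeight_mul_le ha0 ha C T
      exact ne_top_of_le_ne_top (mul_ne_top hK₁ (oldWeight_ne_top _ _ _ _)) (h t ht)
    · refine ae_of_all _ fun s => ?_
      rcases lt_or_ge s T with hs | hs
      · refine Continuous.mul ?_ ?_
        · exact (hg.continuous _).comp (by fun_prop :
            Continuous fun z : Space d × (Fin (n + 1) → Space d) => (z.1, z.2 0))
        · refine (ih hs).comp (g := fun z : Space d × (Fin n → Space d) => chainInt g u₀ n s z.1 z.2)
            (f := fun z : Space d × (Fin (n + 1) → Space d) => (z.2 0, tail z.2)) ?_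
          refine Continuous.prodMk (by fun_prop) ?_
          exact continuous_pi fun i => (continuous_apply i.succ).comp continuous_snd
      · simp only [hzero s hs, zero_mul]; exact continuous_const

/-- Before time `T` the cutoff is invisible, as all increments that matter lie in `(0, t)`. At
positive times the initial condition enters through integrals only, so a measurable representative
may replace it. -/
lemma stratKernel_eq (hg : GreenKernel (greenCutoff G T) C a T) (ha0 : 0 ≤ a) (ha : a < 1)
    (hu : Measurable u₀) (hui : Integrable u₀ volume) {v₀ : Space d → ℝ} (hv : v₀ =ᵐ[volume] u₀)
    (σ : ℝ) (n : ℕ) (ht0 : 0 < t) (ht : t < T) (x : Space d) (y : Fin n → Space d) :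
    stratKernel σ G v₀ n t x y = σ ^ n * chainInt (greenCutoff G T) u₀ n t x y := by
  induction n generalizing t x with
  | zero =>
    rw [stratKernel, freeEvolution, if_neg ht0.ne', pow_zero, one_mul, chainInt_zero]
    refine integral_congr_ae ?_
    filter_upwards [hv] with w hw
    rw [hw, greenCutoff_of_mem G ⟨ht0, ht⟩, mul_comm]
  | succ n ih =>
    rw [stratKernel, chainInt_succ hg hu (absChain_ne_top hg ha0 ha hu hui ht _ _), pow_succ',
      mul_assoc, ← integral_const_mul, intervalIntegral.integral_of_le ht0.le,
      integral_Ioc_eq_integral_Ioo, ← integral_indicator measurableSet_Ioo]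
    congr 1
    refine integral_congr_ae (ae_of_all _ fun s => ?_)
    dsimp only
    by_cases hs : s ∈ Ioo 0 t
    · rw [indicator_of_mem hs, ih hs.1 (hs.2.trans ht),
        greenCutoff_of_mem G ⟨by linarith [hs.2], by linarith [hs.1]⟩]
      ring
    · rw [indicator_of_notMem hs]
      rcases le_or_gt s 0 with h | h
      · rw [chainInt_eq_zero hg hu h]; ring
      · rw [hg.eq_zero_of_nonpos (by simp only [mem_Ioo, not_and, not_lt] at hs; linarith [hs h])]
        ring

set_option maxHeartbeats 400000 in
-- Fubini for the first time and the first vertex, by induction. The finiteness assumption is made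
-- at one point `(t, x)`; through the recursion for `absChain` it gives absolute convergence for
-- almost all intermediate times and vertices.
lemma duhamelTerm_eq (hg : GreenKernel (greenCutoff G T) C a T) (ha0 : 0 ≤ a) (ha : a < 1)
    (hu : Measurable u₀) (hui : Integrable u₀ volume) {v₀ : Space d → ℝ} (hv : v₀ =ᵐ[volume] u₀)
    {V : Space d → ℝ} (hV : Measurable V) (n : ℕ) (ht0 : 0 < t) (ht : t < T) (x : Space d)
    (hfin : ∫⁻ y, absChain (greenCutoff G T) u₀ n t x y * ∏ i, ‖V (y i)‖ₑ ≠ ∞) :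
    duhamelTerm G v₀ V n t x = ∫ y, chainInt (greenCutoff G T) u₀ n t x y * ∏ i, V (y i) := by
  set g := greenCutoff G T with hgdef
  induction n generalizing t x with
  | zero =>
    rw [duhamelTerm, freeEvolution, if_neg ht0.ne', integral_fin_zero, chainInt_zero]
    simp only [Finset.univ_eq_empty, Finset.prod_empty, mul_one]
    refine integral_congr_ae ?_
    filter_upwards [hv] with w hw
    rw [hw, hgdef, greenCutoff_of_mem G ⟨ht0, ht⟩, mul_comm]
  | succ n ih =>
    have hcons : ∀ y₀ : Space d, Measurable fun z : Fin n → Space d =>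
        (Fin.cons y₀ z : Fin (n + 1) → Space d) := fun _ => by fun_prop
    have htl := measurable_tail (n := n) (X := Space d)
    set F : (Fin (n + 1) → Space d) → ℝ → ℝ := fun y s =>
      g (t - s) x (y 0) * chainInt g u₀ n s (y 0) (tail y) * ∏ i, V (y i) with hF
    set A : (Fin (n + 1) → Space d) → ℝ → ℝ≥0∞ := fun y s =>
      ‖g (t - s) x (y 0)‖ₑ * absChain g u₀ n s (y 0) (tail y) * ∏ i, ‖V (y i)‖ₑ with hA
    have hFm : Measurable (uncurry F) := by
      refine (hg.measurable_comp.mul (hg.measurable_chainInt hu (hy := htl.comp measurable_fst))).mul ?_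
      exact measurable_fun_prod _ fun i _ => hV.comp (by fun_prop)
    have hAm : Measurable (uncurry A) := by
      refine (hg.measurable_comp.enorm.mul
        (hg.measurable_absChain hu (hy := htl.comp measurable_fst))).mul ?_
      exact measurable_fun_prod _ fun i _ => (hV.comp (by fun_prop)).enorm
    have hFA : ∀ y s, ‖F y s‖ₑ ≤ A y s := by
      intro y s
      simp only [hF, hA, enorm_mul, enorm_prod_real]
      gcongr
      exact enorm_chainInt_le _ _ _ _ _
    have hAfin : ∫⁻ y, ∫⁻ s, A y s ≠ ∞ := by
      refine ne_of_eq_of_ne (lintegral_congr fun y => ?_) hfin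
      rw [absChain_succ hg hu, lintegral_mul_const]
      exact hg.measurable_comp.enorm.mul (hg.measurable_absChain hu)
    have hFi : Integrable (uncurry F) (volume.prod volume) := by
      refine ⟨hFm.aestronglyMeasurable, lt_of_le_of_lt (lintegral_mono fun z => hFA z.1 z.2) ?_⟩
      have := lintegral_prod (μ := volume) (ν := volume) (uncurry A) hAm.aemeasurable
      exact (this.trans_ne hAfin).lt_top
    have hAs : ∫⁻ s, ∫⁻ y₀, ‖g (t - s) x y₀‖ₑ * ‖V y₀‖ₑ
        * ∫⁻ y, absChain g u₀ n s y₀ y * ∏ i, ‖V (y i)‖ₑ ≠ ∞ := by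
      have hAfin' : ∫⁻ s, ∫⁻ y, A y s ≠ ∞ := by
        rwa [lintegral_lintegral_swap hAm.aemeasurable] at hAfin
      suffices e : ∀ s, ∫⁻ y, A y s = ∫⁻ y₀, ‖g (t - s) x y₀‖ₑ * ‖V y₀‖ₑ
          * ∫⁻ y, absChain g u₀ n s y₀ y * ∏ i, ‖V (y i)‖ₑ by
        simpa only [e] using hAfin'
      intro s
      have hAms : Measurable fun y => A y s := by fun_prop
      rw [lintegral_pi_fin_succ hAms]
      refine lintegral_congr fun y₀ => ?_
      symm
      have hm : Measurable fun y : Fin n → Space d => absChain g u₀ n s y₀ y * ∏ i, ‖V (y i)‖ₑ :=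
        (hg.measurable_absChain hu).mul
          (measurable_fun_prod _ fun i _ => (hV.comp (by fun_prop)).enorm)
      rw [← lintegral_const_mul _ hm]
      refine lintegral_congr fun y => ?_
      simp only [hA, Fin.cons_zero, Fin.tail_cons, Fin.prod_univ_succ, Fin.cons_succ]
      ring
    have hPm : Measurable fun y : Fin n → Space d => ∏ i, ‖V (y i)‖ₑ := by fun_prop
    have hBm : Measurable fun z : ℝ × Space d => ∫⁻ y, absChain g u₀ n z.1 z.2 y * ∏ i, ‖V (y i)‖ₑ := by
      have h1 : Measurable fun b : (ℝ × Space d) × (Fin n → Space d) =>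
          absChain g u₀ n b.1.1 b.1.2 b.2 :=
        hg.measurable_absChain hu
      exact (h1.mul (hPm.comp measurable_snd)).lintegral_prod_right'
    have hDm : Measurable fun z : ℝ × Space d => ‖g (t - z.1) x z.2‖ₑ * ‖V z.2‖ₑ
        * ∫⁻ y, absChain g u₀ n z.1 z.2 y * ∏ i, ‖V (y i)‖ₑ :=
      (hg.measurable_comp.enorm.mul (hV.comp measurable_snd).enorm).mul hBm
    have hae : ∀ᵐ s : ℝ, ∀ᵐ y₀ : Space d, ‖g (t - s) x y₀‖ₑ * ‖V y₀‖ₑ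
        * ∫⁻ y, absChain g u₀ n s y₀ y * ∏ i, ‖V (y i)‖ₑ < ∞ := by
      have hD1 : Measurable fun s => ∫⁻ y₀, ‖g (t - s) x y₀‖ₑ * ‖V y₀‖ₑ
          * ∫⁻ y, absChain g u₀ n s y₀ y * ∏ i, ‖V (y i)‖ₑ := by fun_prop
      filter_upwards [ae_lt_top hD1 hAs] with s hs
      have hD2 : Measurable fun y₀ => ‖g (t - s) x y₀‖ₑ * ‖V y₀‖ₑ
          * ∫⁻ y, absChain g u₀ n s y₀ y * ∏ i, ‖V (y i)‖ₑ :=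
        hDm.comp (f := fun y₀ => (s, y₀)) (by fun_prop)
      exact ae_lt_top hD2 hs.ne
    have hRHS : ∫ y, chainInt g u₀ (n + 1) t x y * ∏ i, V (y i) = ∫ s, ∫ y, F y s := by
      refine Eq.trans ?_ (integral_integral_swap (f := F) hFi)
      refine integral_congr_ae (ae_of_all _ fun y => ?_)
      simp only [hF]
      rw [chainInt_succ hg hu (absChain_ne_top hg ha0 ha hu hui ht _ _), integral_mul_const]
    rw [hRHS, duhamelTerm, intervalIntegral.integral_of_le ht0.le,
      integral_Ioc_eq_integral_Ioo, ← integral_indicator measurableSet_Ioo]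
    refine integral_congr_ae ?_
    filter_upwards [hae, hFi.prod_left_ae] with s hs hFs
    by_cases hst : s ∈ Ioo 0 t
    · have hFs' : Integrable fun y => F y s := hFs
      rw [indicator_of_mem hst, integral_pi_fin_succ hFs']
      refine integral_congr_ae ?_
      filter_upwards [hs] with y₀ hy₀
      simp only [hF, Fin.cons_zero, Fin.tail_cons, Fin.prod_univ_succ, Fin.cons_succ]
      have e1 : ∫ y : Fin n → Space d, g (t - s) x y₀ * chainInt g u₀ n s y₀ y * (V y₀ * ∏ i, V (y i))
          = g (t - s) x y₀ * V y₀ * ∫ y, chainInt g u₀ n s y₀ y * ∏ i, V (y i) := by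
        rw [← integral_const_mul]
        refine integral_congr_ae (ae_of_all _ fun y => ?_)
        dsimp only; ring
      have hGg : G (t - s) x y₀ = g (t - s) x y₀ := by
        rw [hgdef, greenCutoff_of_mem G ⟨by linarith [hst.2], by linarith [hst.1]⟩]
      rw [e1, hGg]
      -- Only the product with the remaining integral is known to be finite. If the prefactor
      -- vanishes, both sides are zero; otherwise the remaining integral is finite and the induction
      -- hypothesis applies.
      by_cases h0 : ‖g (t - s) x y₀‖ₑ * ‖V y₀‖ₑ = 0
      · rw [← enorm_mul, enorm_eq_zero] at h0
        rw [h0, zero_mul, mul_right_comm, h0, zero_mul]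
      · rw [ih hst.1 (hst.2.trans ht) y₀ (fun h => by
          rw [h, ENNReal.mul_top h0] at hy₀; exact lt_irrefl _ hy₀)]
        ring
    · rw [indicator_of_notMem hst]
      symm
      rw [← integral_zero (Fin (n + 1) → Space d) ℝ]
      congr 1
      ext y
      simp only [hF]
      rcases le_or_gt s 0 with h | h
      · rw [chainInt_eq_zero hg hu h]; ring
      · rw [hg.eq_zero_of_nonpos (by simp only [mem_Ioo, not_and, not_lt] at hst; linarith [hst h])]
        ring

lemma duhamelTerm_succ_zero (G : ℝ → Space d → Space d → ℝ) (v₀ V : Space d → ℝ) (n : ℕ)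
    (x : Space d) : duhamelTerm G v₀ V (n + 1) 0 x = 0 := by
  rw [duhamelTerm, intervalIntegral.integral_same]

lemma stratKernel_succ_zero (σ : ℝ) (G : ℝ → Space d → Space d → ℝ) (v₀ : Space d → ℝ) (n : ℕ)
    (x : Space d) (y : Fin (n + 1) → Space d) : stratKernel σ G v₀ (n + 1) 0 x y = 0 := by
  rw [stratKernel, intervalIntegral.integral_same, mul_zero]

/-! ### The semigroup property for the integrands. -/

/-- The integrand integrated over the times in `S` and the initial point. -/
def chainIntOn (g : ℝ → Space d → Space d → ℝ) (u₀ : Space d → ℝ) (n : ℕ) (S : Set (Fin n → ℝ))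
    (t : ℝ) (x : Space d) (y : Fin n → Space d) : ℝ :=
  ∫ s in S, ∫ w, chainDensity g u₀ n t x s w y

lemma GreenKernel.measurable_chainIntOn (hg : GreenKernel g C a T) (hu : Measurable u₀) {β : Type*}
    [MeasurableSpace β] (S : Set (Fin n → ℝ)) {t : β → ℝ} {x : β → Space d}
    {y : β → Fin n → Space d} (ht : Measurable t := by fun_prop) (hx : Measurable x := by fun_prop)
    (hy : Measurable y := by fun_prop) :
    Measurable fun b => chainIntOn g u₀ n S (t b) (x b) (y b) := by
  unfold chainIntOn
  have hm := (hg.measurable_chainDensity hu (β := (β × (Fin n → ℝ)) × Space d)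
    (t := fun b => t b.1.1) (x := fun b => x b.1.1) (s := fun b => b.1.2) (w := fun b => b.2)
    (y := fun b => y b.1.1)).stronglyMeasurable
  have h2 : StronglyMeasurable fun b : β × (Fin n → ℝ) =>
      ∫ w, chainDensity g u₀ n (t b.1) (x b.1) b.2 w (y b.1) := hm.integral_prod_right'
  exact h2.integral_prod_right'.measurable

lemma enorm_chainIntOn_le (S : Set (Fin n → ℝ)) (t : ℝ) (x : Space d) (y : Fin n → Space d) :
    ‖chainIntOn g u₀ n S t x y‖ₑ ≤ ∫⁻ s in S, ∫⁻ w, ‖chainDensity g u₀ n t x s w y‖ₑ :=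
  (enorm_integral_le_lintegral_enorm _).trans
    (lintegral_mono fun _ => enorm_integral_le_lintegral_enorm _)

lemma enorm_chainIntOn_le_absChain (S : Set (Fin n → ℝ)) (t : ℝ) (x : Space d)
    (y : Fin n → Space d) : ‖chainIntOn g u₀ n S t x y‖ₑ ≤ absChain g u₀ n t x y :=
  (enorm_chainIntOn_le S t x y).trans (setLIntegral_le_lintegral _ _)

/-- The semigroup property, for the integrands: up to the contribution of the times after `t`, the
integrand at time `t + r` arises by applying the Green's function at time `r`. -/
lemma chainInt_semigroup (hg : GreenKernel g C a T) (ha0 : 0 ≤ a) (ha : a < 1) (hu : Measurable u₀)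
    (hui : Integrable u₀ volume)
    (hsg : ∀ r t, 0 < r → 0 < t → r + t < T → ∀ x y, ∫ z, g r x z * g t z y = g (r + t) x y) {r : ℝ}
    (hr : 0 < r) (htr : t + r < T) (x : Space d) (y : Fin (n + 1) → Space d) :
    chainInt g u₀ (n + 1) (t + r) x y = (∫ z, g r x z * chainInt g u₀ (n + 1) t z y)
      + chainIntOn g u₀ (n + 1) {s | t + r - s 0 < r} (t + r) x y := by
  set S : Set (Fin (n + 1) → ℝ) := {s | t + r - s 0 < r} with hS
  have hSm : MeasurableSet S := measurableSet_lt (by fun_prop) measurable_const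
  have hm : StronglyMeasurable fun z : (Fin (n + 1) → ℝ) × Space d =>
      chainDensity g u₀ (n + 1) (t + r) x z.1 z.2 y :=
    (hg.measurable_chainDensity hu).stronglyMeasurable
  have hint : Integrable fun s => ∫ w, chainDensity g u₀ (n + 1) (t + r) x s w y := by
    refine ⟨hm.integral_prod_right'.aestronglyMeasurable, ?_⟩
    exact lt_of_le_of_lt (lintegral_mono fun _ => enorm_integral_le_lintegral_enorm _)
      (absChain_ne_top hg ha0 ha hu hui htr x y).lt_top
  -- The operator at time `r` merges with the first edge by the semigroup property. Up to the null
  -- set where the first time equals `t`, the chains of total time `t` correspond to the first times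
  -- before `t`, that is to the complement of `S`.
  have e1 : ∫ z, g r x z * chainInt g u₀ (n + 1) t z y
      = ∫ s in Sᶜ, ∫ w, chainDensity g u₀ (n + 1) (t + r) x s w y := by
    have ht : t < T := by linarith
    rw [← integral_indicator hSm.compl, integral_pi_fin_succ (hint.indicator hSm.compl)]
    set F : Space d → ℝ → ℝ := fun z s =>
      g r x z * (g (t - s) z (y 0) * chainInt g u₀ n s (y 0) (tail y)) with hF
    have hFm : Measurable (uncurry F) := hg.measurable_comp.mul (hg.measurable_comp.mul
          (hg.measurable_chainInt hu))
    have hFi : Integrable (uncurry F) (volume.prod volume) := by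
      refine ⟨hFm.aestronglyMeasurable, ?_⟩
      have := lintegral_prod (μ := volume) (ν := volume) (fun z => ‖uncurry F z‖ₑ)
        hFm.enorm.aemeasurable
      refine lt_of_eq_of_lt this ?_
      obtain ⟨K, hK, h⟩ := exists_absChain_le hg ha0 ha hu hui (n + 1)
      calc _ ≤ ∫⁻ z, ‖g r x z‖ₑ * (K * oldWeight 1 a T t) := by
            refine lintegral_mono fun z => ?_
            simp only [hF, uncurry, enorm_mul]
            have hm2 : Measurable fun s => ‖g (t - s) z (y 0)‖ₑ * ‖chainInt g u₀ n s (y 0) (tail y)‖ₑ :=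
              hg.measurable_comp.enorm.mul (hg.measurable_chainInt hu).enorm
            rw [lintegral_const_mul _ hm2]
            refine mul_le_mul' le_rfl (le_trans ?_ (h t ht z y))
            rw [absChain_succ hg hu]
            exact lintegral_mono fun s => mul_le_mul' le_rfl (enorm_chainInt_le _ _ _ _ _)
        _ < ∞ := by
            have hgm : Measurable fun z => ‖g r x z‖ₑ := hg.measurable_comp.enorm
            rw [lintegral_mul_const _ hgm]
            exact (mul_ne_top (hg.integrable r x).2.ne
              (mul_ne_top hK (oldWeight_ne_top _ _ _ _))).lt_top
    calc _ = ∫ z, ∫ s, F z s := by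
          refine integral_congr_ae (ae_of_all _ fun z => ?_)
          simp only [hF]
          rw [integral_const_mul, chainInt_succ hg hu (absChain_ne_top hg ha0 ha hu hui ht _ _)]
      _ = ∫ s, ∫ z, F z s := integral_integral_swap hFi
      _ = _ := by
          refine integral_congr_ae ?_
          have hne : ∀ᵐ s : ℝ, s ≠ t := by simp [ae_iff]
          filter_upwards [hne] with s hs
          have e2 : ∫ z, F z s = (∫ z, g r x z * g (t - s) z (y 0))
              * chainInt g u₀ n s (y 0) (tail y) := by
            rw [← integral_mul_const]
            refine integral_congr_ae (ae_of_all _ fun z => ?_)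
            simp only [hF]; ring
          rw [e2]
          by_cases hst : s < t
          · have hmem : ∀ s' : Fin n → ℝ, (Fin.cons s s' : Fin (n + 1) → ℝ) ∈ Sᶜ := by
              intro s'; simp only [hS, mem_compl_iff, mem_ofPred_eq, Fin.cons_zero, not_lt]; linarith
            simp only [indicator_of_mem (hmem _), chainDensity_succ, Fin.cons_zero, Fin.tail_cons,
              integral_const_mul]
            -- The semigroup property holds below the cutoff, that is for `r + (t - s) < T`, which
            -- follows from `s > 0`; for `s ≤ 0` the rest of the chain vanishes.
            rcases le_or_gt s 0 with h0 | h0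
            · rw [chainInt_eq_zero hg hu h0]
              have : ∫ s', ∫ w, chainDensity g u₀ n s (y 0) s' w (tail y) = 0 :=
                chainInt_eq_zero hg hu h0 _ _
              rw [this]; simp
            · rw [hsg r (t - s) hr (by linarith) (by linarith)]
              congr 2; ring
          · have hst' : t < s := lt_of_le_of_ne (not_lt.1 hst) (Ne.symm hs)
            have hmem : ∀ s' : Fin n → ℝ, (Fin.cons s s' : Fin (n + 1) → ℝ) ∉ Sᶜ := by
              intro s'; simp only [hS, mem_compl_iff, mem_ofPred_eq, Fin.cons_zero, not_lt, not_le]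
              linarith
            simp only [indicator_of_notMem (hmem _), integral_zero,
              hg.eq_zero_of_nonpos (show t - s ≤ 0 by linarith), mul_zero, zero_mul]
  rw [e1, chainInt, chainIntOn, ← integral_add_compl hSm hint]
  exact add_comm _ _

/-! ### Superpositions of products of Wiener integrals, and their covariances. -/

section

variable {N : ℕ}

lemma Pairing.rep_apply (l : Pairing N) (k : l.Lower) : l.rep (l.1 k) = k := by
  unfold Pairing.rep
  rw [dif_neg (by rw [(l.2 k).2]; exact not_lt.2 k.2.le)]
  exact Subtype.ext (l.2 k).2

lemma Pairing.prod_univ (l : Pairing N) {R : Type*} [CommMonoid R] (F : Fin N → R) :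
    ∏ k, F k = ∏ k : l.Lower, F k.1 * F (l.1 k.1) := by
  rw [prod_mul_distrib, ← Fintype.prod_subtype_mul_prod_subtype (fun k => k < l.1 k) F]
  congr 1
  symm
  refine Fintype.prod_equiv (l.1.subtypeEquiv fun k => ?_) _ _ fun k => rfl
  rw [(l.2 k).2, not_lt]
  exact ⟨le_of_lt, fun h => lt_of_le_of_ne h (l.2 k).1.symm⟩

lemma Pairing.prod_rep (l : Pairing N) {R X : Type*} [CommMonoid R] (F : Fin N → X → R)
    (z : l.Lower → X) :
    ∏ k, F k (z (l.rep k)) = ∏ k : l.Lower, F k.1 (z k) * F (l.1 k.1) (z k) := by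
  have h : ∀ k : l.Lower, l.rep k.1 = k := fun k => by rw [Pairing.rep, dif_pos k.2]
  rw [l.prod_univ]; simp only [h, l.rep_apply]

lemma integrable_prod_rep (l : Pairing N) {Φ : Fin N → Space d → ℝ}
    (hΦ : ∀ k, MemLp (Φ k) 2 volume) :
    Integrable fun z : l.Lower → Space d => ∏ k, Φ k (z (l.rep k)) := by
  simp only [l.prod_rep]
  exact Integrable.fintype_prod (f := fun (k : l.Lower) x => Φ k.1 x * Φ (l.1 k.1) x)
    fun k => (hΦ _).integrable_mul (hΦ _)

/-- Each variable occurs in exactly the two factors of its pair, so the integral splits into one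
inner product per pair. These are the products on the right-hand side of the Isserlis–Wick formula.
-/
lemma integral_prod_rep (l : Pairing N) {Φ : Fin N → Space d → ℝ} (hΦ : ∀ k, MemLp (Φ k) 2 volume) :
    ∫ z : l.Lower → Space d, ∏ k, Φ k (z (l.rep k))
      = ∏ k : l.Lower, inner ℝ ((hΦ k.1).toLp (Φ k.1)) ((hΦ (l.1 k.1)).toLp (Φ (l.1 k.1))) := by
  simp only [l.prod_rep]
  rw [integral_fintype_prod_volume_eq_prod (fun (k : l.Lower) x => Φ k.1 x * Φ (l.1 k.1) x)]
  refine prod_congr rfl fun k _ => ?_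
  rw [L2.inner_def]
  refine integral_congr_ae ?_
  filter_upwards [(hΦ k.1).coeFn_toLp, (hΦ (l.1 k.1)).coeFn_toLp] with x h1 h2
  rw [h1, h2]; simp [mul_comm]

lemma integral_abs_prod_rep_le (l : Pairing N) {Φ : Fin N → Space d → ℝ}
    (hΦ : ∀ k, MemLp (Φ k) 2 volume) {M : ℝ} (hM : ∀ k, ‖(hΦ k).toLp (Φ k)‖ ≤ M) :
    ∫ z : l.Lower → Space d, |∏ k, Φ k (z (l.rep k))| ≤ (M * M) ^ Fintype.card l.Lower := by
  have hΦ' : ∀ k, MemLp (fun x => |Φ k x|) 2 volume := fun k => (hΦ k).abs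
  have hM' : ∀ k, ‖(hΦ' k).toLp _‖ ≤ M := fun k => by
    refine le_trans (le_of_eq ?_) (hM k)
    rw [Lp.norm_toLp, Lp.norm_toLp]
    congr 1
    exact eLpNorm_congr_norm_ae (ae_of_all _ fun x => by simp)
  simp only [Finset.abs_prod]
  rw [integral_prod_rep l hΦ', ← card_univ, ← Finset.prod_const]
  refine Finset.prod_le_prod (fun k _ => ?_) fun k _ => ?_
  · rw [L2.inner_def]
    refine integral_nonneg_of_ae ?_
    filter_upwards [(hΦ' k.1).coeFn_toLp, (hΦ' (l.1 k.1)).coeFn_toLp] with x h1 h2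
    rw [h1, h2]
    simp only [Real.inner_apply, Pi.zero_apply]
    positivity
  · refine (real_inner_le_norm _ _).trans (mul_le_mul (hM' _) (hM' _) (norm_nonneg _) ?_)
    exact (norm_nonneg _).trans (hM' k.1)

end

section

/-- Data that represent a random variable `∫ H(a) ∏ᵢ Qᵢ(a) da`, where `Qᵢ(a) = ∫ φᵢ(a, ·) dW`. -/
structure IsChaos (W : L2 d →ₗᵢ[ℝ] Lp ℝ 2 P) {A : Type*} [MeasurableSpace A] (α : Measure A)
    (H : A → ℝ) (φ : A → Fin n → Space d → ℝ) (Q : A → Fin n → Ω → ℝ) (M : ℝ) : Prop where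
  integrable : Integrable H α
  measurable_fun : ∀ i, Measurable fun z : A × Space d => φ z.1 i z.2
  memLp : ∀ a i, MemLp (φ a i) 2 volume
  norm_le : ∀ a i, ‖(memLp a i).toLp (φ a i)‖ ≤ M
  measurable_noise : ∀ i, Measurable fun z : A × Ω => Q z.1 i z.2
  noise_eq : ∀ a i, Q a i =ᵐ[P] W ((memLp a i).toLp (φ a i))

/-- The random variable `∫ H(a) ∏ᵢ Qᵢ(a) da`. -/
def chaosVar {A : Type*} [MeasurableSpace A] (α : Measure A) (H : A → ℝ) (Q : A → Fin n → Ω → ℝ)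
    (ω : Ω) : ℝ := ∫ a, H a * ∏ i, Q a i ω ∂α

/-- The function `∫ H(a) ∏ᵢ φᵢ(a, zᵢ) da`. -/
def chaosFun {A : Type*} [MeasurableSpace A] (α : Measure A) (H : A → ℝ)
    (φ : A → Fin n → Space d → ℝ) (z : Fin n → Space d) : ℝ :=
  ∫ a, H a * ∏ i, φ a i (z i) ∂α

/-- The bilinear form that gives the covariances of iterated Stratonovich integrals. -/
def pairForm (f f' : (Fin n → Space d) → ℝ) (l : Pairing (n + n)) : ℝ := ∫ z : l.Lower → Space d,
    f (fun i => z low(l, i)) * f' (fun i => z upp(l, i))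

section

variable {A B : Type*} [MeasurableSpace A] [MeasurableSpace B] {α : Measure A} {β : Measure B}
  [SFinite α] [SFinite β] {H : A → ℝ} {φ : A → Fin n → Space d → ℝ} {Q : A → Fin n → Ω → ℝ} {M : ℝ}
  {H' : B → ℝ} {φ' : B → Fin n → Space d → ℝ} {Q' : B → Fin n → Ω → ℝ} {M' : ℝ}

/-- Fubini under the assumptions that recur below: integrable amplitudes, and products of the random
factors bounded in `L¹` uniformly in the parameters. It is used for expectations, for the integrals
attached to pairings and for covariances of fields. -/
lemma integral_mul_integral {X Y : Type*} [MeasurableSpace X] [MeasurableSpace Y] {μ : Measure X}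
    [SFinite μ] {F : A → X → ℝ} {F' : B → X → ℝ} {c : ℝ} (hH : Integrable H α)
    (hH' : Integrable H' β) (hF : Measurable (uncurry F)) (hF' : Measurable (uncurry F'))
    (hi : ∀ a b, Integrable (fun x => F a x * F' b x) μ)
    (hc : ∀ a b, ∫ x, |F a x * F' b x| ∂μ ≤ c) :
    Integrable (fun x => (∫ a, H a * F a x ∂α) * (∫ b, H' b * F' b x ∂β)) μ ∧
    ∫ x, (∫ a, H a * F a x ∂α) * (∫ b, H' b * F' b x ∂β) ∂μ
      = ∫ z, H z.1 * H' z.2 * ∫ x, F z.1 x * F' z.2 x ∂μ ∂(α.prod β) := by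
  have hHH := hH.mul_prod hH'
  set K : (A × B) → X → ℝ := fun z x => H z.1 * H' z.2 * (F z.1 x * F' z.2 x) with hK
  have hKm : AEStronglyMeasurable (uncurry K) ((α.prod β).prod μ) := by
    refine hHH.aestronglyMeasurable.comp_fst.mul (Measurable.aestronglyMeasurable ?_)
    exact (hF.comp (f := fun z : (A × B) × X => (z.1.1, z.2)) (by fun_prop)).mul
      (hF'.comp (f := fun z : (A × B) × X => (z.1.2, z.2)) (by fun_prop))
  have hKi : Integrable (uncurry K) ((α.prod β).prod μ) := by
    rw [integrable_prod_iff hKm]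
    refine ⟨ae_of_all _ fun z => (hi z.1 z.2).const_mul (H z.1 * H' z.2), ?_⟩
    refine Integrable.mono' (hHH.norm.mul_const c) hKm.norm.integral_prod_right' (ae_of_all _ fun z => ?_)
    rw [Real.norm_of_nonneg (integral_nonneg fun x => norm_nonneg _)]
    simp only [uncurry, hK, norm_mul (H z.1 * H' z.2)]
    rw [integral_const_mul]
    exact mul_le_mul_of_nonneg_left (hc _ _) (norm_nonneg _)
  have e : ∀ x, (∫ a, H a * F a x ∂α) * (∫ b, H' b * F' b x ∂β) = ∫ z, K z x ∂(α.prod β) := by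
    intro x
    rw [← integral_prod_mul]
    refine integral_congr_ae (ae_of_all _ fun z => ?_)
    simp only [hK]; ring
  simp only [e]
  refine ⟨hKi.integral_prod_right, ?_⟩
  rw [← integral_integral_swap hKi]
  simp only [hK, integral_const_mul]

lemma IsChaos.append_memLp (h : IsChaos W α H φ Q M) (h' : IsChaos W β H' φ' Q' M') (a : A) (b : B)
    (k : Fin (n + n)) : MemLp (Fin.append (φ a) (φ' b) k) 2 volume := by
  refine Fin.addCases (fun i => ?_) (fun i => ?_) k
  · rw [Fin.append_left]; exact h.memLp a i
  · rw [Fin.append_right]; exact h'.memLp b i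

lemma IsChaos.append_norm_le (h : IsChaos W α H φ Q M) (h' : IsChaos W β H' φ' Q' M') (a : A)
    (b : B) (k : Fin (n + n)) :
    ‖(h.append_memLp h' a b k).toLp (Fin.append (φ a) (φ' b) k)‖ ≤ max M M' := by
  refine Fin.addCases (fun i => ?_) (fun i => ?_) k
  · simp only [Fin.append_left]; exact (h.norm_le a i).trans (le_max_left _ _)
  · simp only [Fin.append_right]; exact (h'.norm_le b i).trans (le_max_right _ _)

lemma IsChaos.prod_noise_ae (h : IsChaos W α H φ Q M) (h' : IsChaos W β H' φ' Q' M') (a : A)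
    (b : B) : (fun ω => (∏ i, Q a i ω) * ∏ i, Q' b i ω)
      =ᵐ[P] fun ω => ∏ k, W ((h.append_memLp h' a b k).toLp (Fin.append (φ a) (φ' b) k)) ω := by
  filter_upwards [ae_all_iff.2 fun i => h.noise_eq a i, ae_all_iff.2 fun i => h'.noise_eq b i]
    with ω h1 h2
  rw [Fin.prod_univ_add]
  simp only [Fin.append_left, Fin.append_right, h1, h2]

/-- Fubini takes the expectation inside, the Isserlis–Wick formula for the `2n` Wiener integrals
turns it into inner products, these are integrals over the identified variables, and Fubini leads
back. All pairings contribute, also those that pair variables of the same factor, as is typical of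
Stratonovich integrals. -/
lemma IsChaos.integral_mul (hW : IsWhiteNoise W) (h : IsChaos W α H φ Q M)
    (h' : IsChaos W β H' φ' Q' M') : Integrable (fun ω => chaosVar α H Q ω * chaosVar β H' Q' ω) P ∧
    (∀ l : Pairing (n + n), Integrable fun z : l.Lower → Space d =>
      chaosFun α H φ (fun i => z low(l, i)) * chaosFun β H' φ' (fun i => z upp(l, i))) ∧
    ∫ ω, chaosVar α H Q ω * chaosVar β H' Q' ω ∂P
      = ∑ l : Pairing (n + n), pairForm (chaosFun α H φ) (chaosFun β H' φ') l := by
  set L := fun a b k => (h.append_memLp h' a b k).toLp (Fin.append (φ a) (φ' b) k) with hL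
  have hLM : ∀ a b k, ‖L a b k‖ ≤ max M M' := h.append_norm_le h'
  have h1 := integral_mul_integral (Y := A) (α := α) (β := β) (μ := P) (H := H) (H' := H')
    (F := fun a ω => ∏ i, Q a i ω) (F' := fun b ω => ∏ i, Q' b i ω) h.integrable h'.integrable
    (measurable_fun_prod _ fun i _ => h.measurable_noise i)
    (measurable_fun_prod _ fun i _ => h'.measurable_noise i)
    (fun a b => (integrable_prod_whiteNoise hW Finset.univ (L a b)).congr
      (h.prod_noise_ae h' a b).symm)
    (fun a b => by
      refine le_trans (le_of_eq (integral_congr_ae ?_))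
        (integral_abs_prod_whiteNoise_le hW Finset.univ (L a b) fun k _ => hLM a b k)
      filter_upwards [h.prod_noise_ae h' a b] with ω hω
      rw [hω])
  have h2 := fun l : Pairing (n + n) => integral_mul_integral (Y := A) (α := α) (β := β)
    (μ := (volume : Measure (l.Lower → Space d))) (H := H) (H' := H')
    (F := fun a z => ∏ i, φ a i (z low(l, i)))
    (F' := fun b z => ∏ i, φ' b i (z upp(l, i))) h.integrable h'.integrable
    (measurable_fun_prod _ fun i _ => (h.measurable_fun i).comp
      (f := fun z : A × (l.Lower → Space d) => (z.1, z.2 low(l, i))) (by fun_prop))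
    (measurable_fun_prod _ fun i _ => (h'.measurable_fun i).comp
      (f := fun z : B × (l.Lower → Space d) => (z.1, z.2 upp(l, i))) (by fun_prop))
    (c := (max M M' * max M M') ^ Fintype.card l.Lower)
    (fun a b => by
      have := integrable_prod_rep l (h.append_memLp h' a b)
      simpa only [Fin.prod_univ_add, Fin.append_left, Fin.append_right] using this)
    (fun a b => by
      have := integral_abs_prod_rep_le l (h.append_memLp h' a b) (h.append_norm_le h' a b)
      simpa only [Fin.prod_univ_add, Fin.append_left, Fin.append_right] using this)
  refine ⟨h1.1, fun l => (h2 l).1, ?_⟩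
  unfold chaosVar
  rw [h1.2]
  simp only [pairForm]
  unfold chaosFun
  rw [sum_congr rfl fun l _ => (h2 l).2]
  have hin : ∀ (l : Pairing (n + n)) (z : A × B), ∫ x : l.Lower → Space d,
      (∏ i, φ z.1 i (x low(l, i))) * ∏ i, φ' z.2 i (x upp(l, i))
      = ∏ k : l.Lower, inner ℝ (L z.1 z.2 k.1) (L z.1 z.2 (l.1 k.1)) := by
    intro l z
    have := integral_prod_rep l (h.append_memLp h' z.1 z.2)
    simpa only [Fin.prod_univ_add, Fin.append_left, Fin.append_right] using this
  have hinm : ∀ l : Pairing (n + n), AEStronglyMeasurable (fun z : A × B => ∫ x : l.Lower → Space d,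
      (∏ i, φ z.1 i (x low(l, i))) * ∏ i, φ' z.2 i (x upp(l, i)))
      (α.prod β) := by
    intro l
    refine (StronglyMeasurable.integral_prod_right' (f := fun y : (A × B) × (l.Lower → Space d) =>
      (∏ i, φ y.1.1 i (y.2 low(l, i))) * ∏ i, φ' y.1.2 i (y.2 upp(l, i))) ?_).aestronglyMeasurable
    refine (Measurable.mul ?_ ?_).stronglyMeasurable
    · exact measurable_fun_prod _ fun i _ => (h.measurable_fun i).comp
        (f := fun y : (A × B) × (l.Lower → Space d) => (y.1.1, y.2 low(l, i)))
        (by fun_prop)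
    · exact measurable_fun_prod _ fun i _ => (h'.measurable_fun i).comp
        (f := fun y : (A × B) × (l.Lower → Space d) => (y.1.2, y.2 upp(l, i)))
        (by fun_prop)
  rw [← integral_finsetSum]
  · refine integral_congr_ae (ae_of_all _ fun z => ?_)
    dsimp only
    rw [← mul_sum, integral_congr_ae (h.prod_noise_ae h' z.1 z.2), integral_prod_whiteNoise hW]
    simp only [hin]
    rfl
  · intro l _
    refine (h.integrable.mul_prod h'.integrable).mul_bdd
      (c := (max M M' * max M M') ^ Fintype.card l.Lower) (hinm l) (ae_of_all _ fun z => ?_)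
    have := integral_abs_prod_rep_le l (h.append_memLp h' z.1 z.2) (h.append_norm_le h' z.1 z.2)
    simp only [Fin.prod_univ_add, Fin.append_left, Fin.append_right] at this
    exact (norm_integral_le_integral_norm _).trans this

lemma IsChaos.aestronglyMeasurable (h : IsChaos W α H φ Q M) :
    AEStronglyMeasurable (chaosVar α H Q) P := by
  obtain ⟨H₀, hH₀, hH₀'⟩ := h.integrable.aestronglyMeasurable
  have : chaosVar α H Q = chaosVar α H₀ Q := by
    ext ω
    refine integral_congr_ae ?_
    filter_upwards [hH₀'] with a ha
    rw [ha]
  rw [this]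
  have hm : StronglyMeasurable fun z : Ω × A => H₀ z.2 * ∏ i, Q z.2 i z.1 :=
    ((hH₀.measurable.comp measurable_snd).mul (measurable_fun_prod _ fun i _ =>
      (h.measurable_noise i).comp measurable_swap)).stronglyMeasurable
  exact hm.integral_prod_right'.aestronglyMeasurable

lemma IsChaos.memLp_var (hW : IsWhiteNoise W) (h : IsChaos W α H φ Q M) :
    MemLp (chaosVar α H Q) 2 P := by
  rw [memLp_two_iff_integrable_sq h.aestronglyMeasurable]
  simpa only [sq] using (h.integral_mul hW h).1

lemma eLpNorm_two_sq {X : Type*} [MeasurableSpace X] (μ : Measure X) (f : X → ℝ) :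
    eLpNorm f 2 μ ^ 2 = ∫⁻ x, ‖f x‖ₑ ^ 2 ∂μ := by
  rw [eLpNorm_eq_lintegral_rpow_enorm_toReal (by norm_num) (by norm_num), ← rpow_natCast,
    ← rpow_mul]
  simp

lemma eLpNorm_two_sq_eq_ofReal {X : Type*} [MeasurableSpace X] {μ : Measure X} {f : X → ℝ}
    (hf : MemLp f 2 μ) : eLpNorm f 2 μ ^ 2 = ofReal (∫ x, f x * f x ∂μ) := by
  rw [eLpNorm_two_sq, ofReal_integral_eq_lintegral_ofReal]
  · refine lintegral_congr fun x => ?_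
    rw [Real.enorm_eq_ofReal_abs, ← ofReal_pow (abs_nonneg _), sq_abs, sq]
  · simpa only [sq] using hf.integrable_sq
  · exact ae_of_all _ fun x => mul_self_nonneg _

lemma integral_sub_sub_sub {X : Type*} [MeasurableSpace X] {μ : Measure X} {f₁ f₂ f₃ f₄ : X → ℝ}
    (h₁ : Integrable f₁ μ) (h₂ : Integrable f₂ μ) (h₃ : Integrable f₃ μ) (h₄ : Integrable f₄ μ) :
    ∫ x, (f₁ x - f₂ x - (f₃ x - f₄ x)) ∂μ
      = ∫ x, f₁ x ∂μ - ∫ x, f₂ x ∂μ - (∫ x, f₃ x ∂μ - ∫ x, f₄ x ∂μ) := by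
  rw [← integral_sub h₁ h₂, ← integral_sub h₃ h₄]
  exact integral_sub (h₁.sub h₂) (h₃.sub h₄)

/-- The distance of two random variables in terms of the norm `‖·‖_n`. -/
lemma IsChaos.eLpNorm_sub_le (hW : IsWhiteNoise W) (h : IsChaos W α H φ Q M)
    (h' : IsChaos W β H' φ' Q' M') : eLpNorm (fun ω => chaosVar α H Q ω - chaosVar β H' Q' ω) 2 P
      ≤ traceNorm n (fun z => chaosFun α H φ z - chaosFun β H' φ' z) := by
  have key : eLpNorm (fun ω => chaosVar α H Q ω - chaosVar β H' Q' ω) 2 P ^ 2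
      ≤ traceNorm n (fun z => chaosFun α H φ z - chaosFun β H' φ' z) ^ 2 := by
    obtain ⟨i11, j11, e11⟩ := h.integral_mul hW h
    obtain ⟨i12, j12, e12⟩ := h.integral_mul hW h'
    obtain ⟨i21, j21, e21⟩ := h'.integral_mul hW h
    obtain ⟨i22, j22, e22⟩ := h'.integral_mul hW h'
    have hsub : MemLp (fun ω => chaosVar α H Q ω - chaosVar β H' Q' ω) 2 P :=
      (h.memLp_var hW).sub (h'.memLp_var hW)
    rw [eLpNorm_two_sq_eq_ofReal hsub, traceNorm_sq]
    have e : ∫ ω, (chaosVar α H Q ω - chaosVar β H' Q' ω) * (chaosVar α H Q ω - chaosVar β H' Q' ω) ∂P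
        = ∑ l : Pairing (n + n), pairForm (fun z => chaosFun α H φ z - chaosFun β H' φ' z)
          (fun z => chaosFun α H φ z - chaosFun β H' φ' z) l := by
      have e0 : ∀ x y : ℝ, (x - y) * (x - y) = x * x - x * y - (y * x - y * y) := fun x y => by ring
      simp only [e0]
      rw [integral_sub_sub_sub i11 i12 i21 i22, e11, e12, e21, e22, ← Finset.sum_sub_distrib, ← Finset.sum_sub_distrib,
        ← Finset.sum_sub_distrib]
      refine sum_congr rfl fun l _ => ?_
      simp only [pairForm]
      rw [← integral_sub_sub_sub (j11 l) (j12 l) (j21 l) (j22 l)]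
      refine integral_congr_ae (ae_of_all _ fun z => ?_)
      dsimp only; ring
    rw [e]
    calc _ ≤ ∑ l : Pairing (n + n), ofReal |pairForm
          (fun z => chaosFun α H φ z - chaosFun β H' φ' z)
          (fun z => chaosFun α H φ z - chaosFun β H' φ' z) l| := by
          rw [← ENNReal.ofReal_sum_of_nonneg fun _ _ => abs_nonneg _]
          exact ofReal_le_ofReal (sum_le_sum fun _ _ => le_abs_self _)
      _ ≤ _ := by
          refine sum_le_sum fun l _ => ?_
          rw [← Real.enorm_eq_ofReal_abs]
          refine (enorm_integral_le_lintegral_enorm _).trans (le_of_eq ?_)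
          simp only [enorm_mul]
  exact (pow_le_pow_left_iff (by norm_num)).1 key

end

/-- Sums of products of test functions are represented by finite sums. -/
lemma ProductSum.isChaos (W : L2 d →ₗᵢ[ℝ] Lp ℝ 2 P) (S : ProductSum d n) :
    ∃ M, IsChaos W (Measure.count : Measure (Fin S.size)) S.coeff (fun j k => S.factor j k)
      (fun j k => wienerIntegral W (S.factor j k)) M := by
  have hL : ∀ (f : C_c(Space d, ℝ)), MemLp f 2 volume := fun f =>
    f.continuous.memLp_of_hasCompactSupport f.hasCompactSupport
  refine ⟨∑ j, ∑ k, ‖(hL (S.factor j k)).toLp _‖, ?_, ?_, fun j k => hL _, ?_, ?_, ?_⟩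
  · exact Integrable.of_finite
  · exact fun i => measurable_from_prod_countable_right fun j => (S.factor j i).continuous.measurable
  · intro j k
    refine le_trans ?_ (single_le_sum (f := fun j => ∑ k, ‖(hL (S.factor j k)).toLp _‖)
      (fun _ _ => sum_nonneg fun _ _ => norm_nonneg _) (Finset.mem_univ j))
    exact single_le_sum (f := fun k => ‖(hL (S.factor j k)).toLp _‖)
      (fun _ _ => norm_nonneg _) (Finset.mem_univ k)
  · intro i
    refine measurable_from_prod_countable_right fun j => ?_
    simp only [wienerIntegral, dif_pos (hL (S.factor j i))]
    exact (Lp.stronglyMeasurable _).measurable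
  · intro j k
    rw [wienerIntegral, dif_pos (hL _)]

lemma ProductSum.chaosVar_eq (W : L2 d →ₗᵢ[ℝ] Lp ℝ 2 P) (S : ProductSum d n) :
    chaosVar (Measure.count : Measure (Fin S.size)) S.coeff
      (fun j k => wienerIntegral W (S.factor j k)) = S.integral W := by
  ext ω
  rw [chaosVar, integral_count, ProductSum.integral]

lemma ProductSum.chaosFun_eq (S : ProductSum d n) :
    chaosFun (Measure.count : Measure (Fin S.size)) S.coeff (fun j k => S.factor j k) = S.toFun := by
  ext z
  rw [chaosFun, integral_count, ProductSum.toFun]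

end

/-! ### Density of sums of products and the Cauchy–Schwarz inequality for the norm `‖·‖_n`. -/

/-- A cutoff function, equal to one on the ball of radius `R`. -/
def cutoff (R : ℝ) (x : Space d) : ℝ := max 0 (min 1 (R + 1 - ‖x‖))

lemma continuous_cutoff (R : ℝ) : Continuous (cutoff R : Space d → ℝ) := by unfold cutoff; fun_prop

lemma cutoff_nonneg (R : ℝ) (x : Space d) : 0 ≤ cutoff R x := le_max_left _ _

lemma cutoff_le_one (R : ℝ) (x : Space d) : cutoff R x ≤ 1 := max_le zero_le_one (min_le_left _ _)

lemma cutoff_eq_one {R : ℝ} {x : Space d} (h : ‖x‖ ≤ R) : cutoff R x = 1 := by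
  rw [cutoff, min_eq_left (by linarith), max_eq_right zero_le_one]

lemma cutoff_eq_zero {R : ℝ} {x : Space d} (h : R + 1 ≤ ‖x‖) : cutoff R x = 0 := by
  rw [cutoff, max_eq_left ((min_le_right _ _).trans (by linarith))]

lemma cutoff_mono (x : Space d) : Monotone fun R => cutoff R x := fun R R' h =>
  max_le_max le_rfl (min_le_min le_rfl (by linarith))

/-- Functions supported in a product of balls. -/
def SupportedIn (R : ℝ) (f : (Fin n → Space d) → ℝ) : Prop := ∀ z, f z ≠ 0 → ∀ i, ‖z i‖ ≤ R

/-- The functions on a subset that are sums of products. -/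
def prodSubalgebra (K : Set (Fin n → Space d)) : Subalgebra ℝ C(K, ℝ) where
  carrier := {p | ∃ (ι : Type) (_ : Fintype ι) (c : ι → ℝ) (h : ι → Fin n → C(Space d, ℝ)),
    ∀ z : K, p z = ∑ j, c j * ∏ k, h j k (z.1 k)}
  mul_mem' := by
    rintro p q ⟨ι, _, c, h, hp⟩ ⟨κ, _, c', h', hq⟩
    refine ⟨ι × κ, inferInstance, fun j => c j.1 * c' j.2, fun j k => h j.1 k * h' j.2 k,
      fun z => ?_⟩
    rw [ContinuousMap.mul_apply, hp, hq, Finset.sum_mul_sum, ← Finset.univ_product_univ,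
      Finset.sum_product]
    refine sum_congr rfl fun i _ => sum_congr rfl fun j _ => ?_
    simp only [ContinuousMap.mul_apply, prod_mul_distrib]
    ring
  add_mem' := by
    rintro p q ⟨ι, _, c, h, hp⟩ ⟨κ, _, c', h', hq⟩
    refine ⟨ι ⊕ κ, inferInstance, Sum.elim c c', Sum.elim h h', fun z => ?_⟩
    rw [ContinuousMap.add_apply, hp, hq, Fintype.sum_sum_type]
    simp
  algebraMap_mem' := fun r => ⟨Unit, inferInstance, fun _ => r, fun _ _ => 1, fun z => by simp⟩

lemma prodSubalgebra_separatesPoints (K : Set (Fin n → Space d)) :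
    (prodSubalgebra K).SeparatesPoints := by
  intro z z' hne
  obtain ⟨k, hk⟩ : ∃ k, z.1 k ≠ z'.1 k := by
    by_contra! h
    exact hne (Subtype.ext (funext h))
  let f : C(Space d, ℝ) := ⟨fun x => dist x (z.1 k), by fun_prop⟩
  let p : C(K, ℝ) := ⟨fun w => dist (w.1 k) (z.1 k),
    ((continuous_apply k).comp continuous_subtype_val).dist continuous_const⟩
  refine ⟨p, ⟨p, ⟨Unit, inferInstance, fun _ => 1, fun _ i => if i = k then f else 1, fun w => ?_⟩,
    rfl⟩, ?_⟩
  · have : ∀ i, (if i = k then f else (1 : C(Space d, ℝ))) (w.1 i) = if i = k then f (w.1 i) else 1 := by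
      intro i; split_ifs <;> rfl
    simp only [this, Finset.prod_ite_eq', Finset.mem_univ, if_true, one_mul]
    simp [p, f]
  · simp only [p, ContinuousMap.coe_mk, dist_self]
    exact (dist_pos.2 hk.symm).ne

/-- Continuous functions with bounded support are uniform limits of sums of products. -/
lemma exists_productSum_near {R : ℝ} {F : (Fin n → Space d) → ℝ} (hF : Continuous F)
    (hsupp : SupportedIn R F) {δ : ℝ} (hδ : 0 < δ) :
    ∃ S : ProductSum d n, (∀ z, |S.toFun z - F z| ≤ δ) ∧ SupportedIn (R + 1) S.toFun := by
  set K : Set (Fin n → Space d) := Set.pi univ fun _ => Metric.closedBall 0 (R + 1) with hK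
  have hKc : IsCompact K := isCompact_univ_pi fun _ => isCompact_closedBall _ _
  have : CompactSpace K := isCompact_iff_compactSpace.1 hKc
  obtain ⟨⟨p, ι, _, c, h, hp⟩, hpF⟩ :=
    ContinuousMap.exists_mem_subalgebra_near_continuous_of_separatesPoints (prodSubalgebra K)
    (prodSubalgebra_separatesPoints K) (fun z => F z.1) (by fun_prop) δ hδ
  let e := Fintype.equivFin ι
  have hcs : ∀ f : C(Space d, ℝ), HasCompactSupport fun x => cutoff R x * f x := fun f => by
    refine HasCompactSupport.intro (isCompact_closedBall 0 (R + 1)) fun x hx => ?_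
    rw [Metric.mem_closedBall, dist_zero_right, not_le] at hx
    rw [cutoff_eq_zero hx.le, zero_mul]
  let S : ProductSum d n := ⟨Fintype.card ι, fun j => c (e.symm j), fun j k =>
    ⟨⟨fun x => cutoff R x * h (e.symm j) k x, (continuous_cutoff R).mul (h _ k).continuous⟩, hcs _⟩⟩
  have hS : ∀ z, S.toFun z = (∏ k, cutoff R (z k)) * ∑ j, c j * ∏ k, h j k (z k) := by
    intro z
    have : S.toFun z = ∑ j, c (e.symm j) * ∏ k, (cutoff R (z k) * h (e.symm j) k (z k)) := rfl
    rw [this, mul_sum, ← e.symm.sum_comp]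
    refine sum_congr rfl fun j _ => ?_
    rw [prod_mul_distrib]; ring
  have hSsupp : SupportedIn (R + 1) S.toFun := by
    intro z hz i
    by_contra! hi
    refine hz ?_
    rw [hS, Finset.prod_eq_zero (Finset.mem_univ i) (cutoff_eq_zero hi.le), zero_mul]
  refine ⟨S, fun z => ?_, hSsupp⟩
  -- The cutoff is one on the support of `F`, so multiplying the Stone–Weierstrass approximation by
  -- it does not spoil the error, while it makes all factors compactly supported.
  have hFz : F z = (∏ k, cutoff R (z k)) * F z := by
    by_cases h0 : F z = 0
    · rw [h0, mul_zero]
    · rw [Finset.prod_eq_one fun k _ => cutoff_eq_one (hsupp z h0 k), one_mul]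
  by_cases hz : z ∈ K
  · have h1 := hpF ⟨z, hz⟩
    have h2 := hp ⟨z, hz⟩
    simp only at h1 h2
    rw [h2] at h1
    rw [hFz, hS, ← mul_sub, abs_mul, abs_of_nonneg (Finset.prod_nonneg fun k _ => cutoff_nonneg _ _)]
    rw [Real.norm_eq_abs] at h1
    calc _ ≤ 1 * δ := mul_le_mul (Finset.prod_le_one (fun k _ => cutoff_nonneg _ _)
          fun k _ => cutoff_le_one _ _) h1.le (abs_nonneg _) zero_le_one
      _ = δ := one_mul δ
  · have hz' : ∃ i, R + 1 < ‖z i‖ := by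
      by_contra! hcon
      exact hz fun i _ => by simpa using hcon i
    obtain ⟨i, hi⟩ := hz'
    have h1 : S.toFun z = 0 := by by_contra h0; exact absurd (hSsupp z h0 i) (not_le.2 hi)
    have h2 : F z = 0 := by by_contra h0; have := hsupp z h0 i; linarith
    rw [h1, h2]; simpa using hδ.le

/-- Every variable is an argument of at least one of the two functions, so together the supports
confine all variables. -/
lemma SupportedIn.norm_le_of_pairing {R : ℝ} {f f' : (Fin n → Space d) → ℝ} (hf : SupportedIn R f)
    (hf' : SupportedIn R f') (l : Pairing (n + n)) {z : l.Lower → Space d}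
    (hz : f (fun i => z low(l, i)) * f' (fun i => z upp(l, i)) ≠ 0)
    (k : l.Lower) : ‖z k‖ ≤ R := by
  have h1 := hf _ (left_ne_zero_of_mul hz)
  have h2 := hf' _ (right_ne_zero_of_mul hz)
  have hk := l.rep_lower k
  obtain ⟨k, hk'⟩ := k
  induction k using Fin.addCases with
  | left i => have := h1 i; rwa [hk] at this
  | right i => have := h2 i; rwa [hk] at this

/-- The polyball of radius `R`. -/
def polyball (ι : Type*) (d : ℕ) (R : ℝ) : Set (ι → Space d) :=
  Set.pi univ fun _ => Metric.closedBall 0 R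

lemma isCompact_polyball (ι : Type*) (d : ℕ) (R : ℝ) : IsCompact (polyball ι d R) :=
  isCompact_univ_pi fun _ => isCompact_closedBall _ _

lemma mem_polyball {ι : Type*} {R : ℝ} {z : ι → Space d} : z ∈ polyball ι d R ↔ ∀ k, ‖z k‖ ≤ R := by
  simp [polyball]

lemma SupportedIn.exists_bound {R : ℝ} {f : (Fin n → Space d) → ℝ} (hf : SupportedIn R f)
    (hc : Continuous f) : ∃ B, 0 ≤ B ∧ ∀ z, |f z| ≤ B := by
  obtain ⟨B, hB⟩ := (isCompact_polyball (Fin n) d R).exists_bound_of_continuousOn hc.continuousOn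
  refine ⟨max B 0, le_max_right _ _, fun z => ?_⟩
  by_cases hz : z ∈ polyball (Fin n) d R
  · exact (hB z hz).trans (le_max_left _ _)
  · have : f z = 0 := by by_contra h0; exact hz (mem_polyball.2 (hf z h0))
    rw [this, abs_zero]; exact le_max_right _ _

lemma SupportedIn.abs_mul_le {R B B' : ℝ} {f f' : (Fin n → Space d) → ℝ} (hf : SupportedIn R f)
    (hf' : SupportedIn R f') (hB0 : 0 ≤ B) (hB : ∀ z, |f z| ≤ B) (hB' : ∀ z, |f' z| ≤ B')
    (l : Pairing (n + n)) (z : l.Lower → Space d) :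
    |f (fun i => z low(l, i)) * f' (fun i => z upp(l, i))|
      ≤ (polyball l.Lower d R).indicator (fun _ => B * B') z := by
  by_cases hz : z ∈ polyball l.Lower d R
  · rw [indicator_of_mem hz, abs_mul]
    exact mul_le_mul (hB _) (hB' _) (abs_nonneg _) hB0
  · rw [indicator_of_notMem hz]
    by_contra! h
    exact hz (mem_polyball.2 (hf.norm_le_of_pairing hf' l (abs_pos.1 h)))

lemma integrable_indicator_polyball (ι : Type*) [Fintype ι] (R B : ℝ) :
    Integrable ((polyball ι d R).indicator fun _ => B) := by
  rw [integrable_indicator_iff (isCompact_polyball ι d R).measurableSet]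
  exact integrableOn_const (isCompact_polyball ι d R).measure_lt_top.ne

lemma SupportedIn.integrable {R : ℝ} {f f' : (Fin n → Space d) → ℝ} (hf : SupportedIn R f)
    (hf' : SupportedIn R f') (hc : Continuous f) (hc' : Continuous f') (l : Pairing (n + n)) :
    Integrable fun z : l.Lower → Space d =>
      f (fun i => z low(l, i)) * f' (fun i => z upp(l, i)) := by
  obtain ⟨B, hB0, hB⟩ := hf.exists_bound hc
  obtain ⟨B', _, hB'⟩ := hf'.exists_bound hc'
  refine Integrable.mono' (integrable_indicator_polyball l.Lower R (B * B')) ?_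
    (ae_of_all _ fun z => hf.abs_mul_le hf' hB0 hB hB' l z)
  exact ((hc.comp (by fun_prop)).mul (by fun_prop)).aestronglyMeasurable

lemma tendsto_pairForm {R : ℝ} {f f' : (Fin n → Space d) → ℝ} {F F' : ℕ → (Fin n → Space d) → ℝ}
    (hf : SupportedIn R f) (hf' : SupportedIn R f') (hc : Continuous f) (hc' : Continuous f')
    (hF : ∀ m, SupportedIn (R + 1) (F m)) (hF' : ∀ m, SupportedIn (R + 1) (F' m))
    (hFc : ∀ m, Continuous (F m)) (hFc' : ∀ m, Continuous (F' m))
    (hFf : ∀ (m : ℕ) z, |F m z - f z| ≤ 1 / ((m : ℝ) + 1))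
    (hFf' : ∀ (m : ℕ) z, |F' m z - f' z| ≤ 1 / ((m : ℝ) + 1)) (l : Pairing (n + n)) :
    Tendsto (fun m => pairForm (F m) (F' m) l) atTop (𝓝 (pairForm f f' l)) := by
  obtain ⟨B, hB0, hB⟩ := hf.exists_bound hc
  obtain ⟨B', _, hB'⟩ := hf'.exists_bound hc'
  have hbd : ∀ {h : (Fin n → Space d) → ℝ} {H : ℕ → (Fin n → Space d) → ℝ} {B : ℝ},
      (∀ z, |h z| ≤ B) → (∀ (m : ℕ) z, |H m z - h z| ≤ 1 / ((m : ℝ) + 1)) →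
      ∀ m z, |H m z| ≤ B + 1 := by
    intro h H B hB hH m z
    have h1 : 1 / ((m : ℝ) + 1) ≤ 1 := by
      rw [div_le_one (by positivity)]; linarith [m.cast_nonneg (α := ℝ)]
    have h2 := abs_sub_abs_le_abs_sub (H m z) (h z)
    linarith [hB z, hH m z]
  have hlim : ∀ {h : (Fin n → Space d) → ℝ} {H : ℕ → (Fin n → Space d) → ℝ},
      (∀ (m : ℕ) z, |H m z - h z| ≤ 1 / ((m : ℝ) + 1)) → ∀ z,
      Tendsto (fun m => H m z) atTop (𝓝 (h z)) := by
    intro h H hH z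
    rw [tendsto_iff_dist_tendsto_zero]
    exact squeeze_zero (fun m => dist_nonneg) (fun m => hH m z)
      tendsto_one_div_add_atTop_nhds_zero_nat
  refine tendsto_integral_of_dominated_convergence
    ((polyball l.Lower d (R + 1)).indicator fun _ => (B + 1) * (B' + 1)) (fun m => ?_)
    (integrable_indicator_polyball _ _ _) (fun m => ae_of_all _ fun z => ?_)
    (ae_of_all _ fun z => (hlim hFf _).mul (hlim hFf' _))
  · exact (((hFc m).comp (by fun_prop)).mul ((hFc' m).comp (by fun_prop))).aestronglyMeasurable
  · exact (hF m).abs_mul_le (hF' m) (by linarith) (hbd hB hFf m) (hbd hB' hFf' m) l z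

lemma ProductSum.continuous (S : ProductSum d n) : Continuous S.toFun := by
  unfold ProductSum.toFun
  refine continuous_finsetSum _ fun j _ => continuous_const.mul ?_
  exact continuous_finsetProd _ fun k _ => (S.factor j k).continuous.comp (continuous_apply k)

/-- The sum over pairings is the covariance of two random variables, so this is the Cauchy–Schwarz
inequality in `L²(Ω)`. The white noise supplies a positivity that the individual pairings need not
have. -/
lemma sum_pairForm_productSum_sq_le (hW : IsWhiteNoise W) (S S' : ProductSum d n) :
    (∑ l, pairForm S.toFun S'.toFun l) ^ 2
      ≤ (∑ l, pairForm S.toFun S.toFun l) * ∑ l, pairForm S'.toFun S'.toFun l := by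
  obtain ⟨M, h⟩ := S.isChaos W
  obtain ⟨M', h'⟩ := S'.isChaos W
  have e11 := (h.integral_mul hW h).2.2
  have e12 := (h.integral_mul hW h').2.2
  have e22 := (h'.integral_mul hW h').2.2
  have hm := h.memLp_var hW
  have hm' := h'.memLp_var hW
  rw [S.chaosFun_eq] at e11 e12
  rw [S'.chaosFun_eq] at e12 e22
  rw [← e11, ← e12, ← e22]
  set X := chaosVar Measure.count S.coeff fun j k => wienerIntegral W (S.factor j k)
  set Y := chaosVar Measure.count S'.coeff fun j k => wienerIntegral W (S'.factor j k)
  have hin : ∀ {X Y : Ω → ℝ} (hX : MemLp X 2 P) (hY : MemLp Y 2 P),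
      inner ℝ (hX.toLp X) (hY.toLp Y) = ∫ ω, X ω * Y ω ∂P := by
    intro X Y hX hY
    rw [L2.inner_def]
    refine integral_congr_ae ?_
    filter_upwards [hX.coeFn_toLp, hY.coeFn_toLp] with x h1 h2
    rw [h1, h2]; simp [mul_comm]
  rw [← hin hm hm', ← hin hm hm, ← hin hm' hm', sq]
  exact real_inner_mul_inner_self_le (hm.toLp X) (hm'.toLp Y)

lemma sum_pairForm_sq_le (hW : IsWhiteNoise W) {R : ℝ} {f f' : (Fin n → Space d) → ℝ}
    (hf : SupportedIn R f) (hf' : SupportedIn R f') (hc : Continuous f) (hc' : Continuous f') :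
    (∑ l, pairForm f f' l) ^ 2 ≤ (∑ l, pairForm f f l) * ∑ l, pairForm f' f' l := by
  choose S hS hS' using fun m : ℕ => exists_productSum_near hc hf
    (show (0 : ℝ) < 1 / ((m : ℝ) + 1) by positivity)
  choose S' hT hT' using fun m : ℕ => exists_productSum_near hc' hf'
    (show (0 : ℝ) < 1 / ((m : ℝ) + 1) by positivity)
  have hSc := fun m => (S m).continuous
  have hTc := fun m => (S' m).continuous
  have t11 := tendsto_finsetSum (Finset.univ : Finset (Pairing (n + n))) fun l _ =>
    tendsto_pairForm hf hf hc hc hS' hS' hSc hSc hS hS l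
  have t12 := tendsto_finsetSum (Finset.univ : Finset (Pairing (n + n))) fun l _ =>
    tendsto_pairForm hf hf' hc hc' hS' hT' hSc hTc hS hT l
  have t22 := tendsto_finsetSum (Finset.univ : Finset (Pairing (n + n))) fun l _ =>
    tendsto_pairForm hf' hf' hc' hc' hT' hT' hTc hTc hT hT l
  exact le_of_tendsto_of_tendsto' (t12.pow 2) (t11.mul t22) fun m =>
    sum_pairForm_productSum_sq_le hW (S m) (S' m)

/-- The bilinear form whose diagonal is the square of the norm `‖·‖_n`. -/
def traceForm (f f' : (Fin n → Space d) → ℝ) : ℝ≥0∞ :=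
  ∑ l : Pairing (n + n), ∫⁻ z : l.Lower → Space d,
    ‖f (fun i => z low(l, i))‖ₑ * ‖f' (fun i => z upp(l, i))‖ₑ

lemma traceForm_self (f : (Fin n → Space d) → ℝ) : traceForm f f = traceNorm n f ^ 2 :=
  (traceNorm_sq f).symm

lemma traceForm_eq_ofReal {R : ℝ} {f f' : (Fin n → Space d) → ℝ} (hf : SupportedIn R f)
    (hf' : SupportedIn R f') (hc : Continuous f) (hc' : Continuous f') (h0 : ∀ z, 0 ≤ f z)
    (h0' : ∀ z, 0 ≤ f' z) : traceForm f f' = ofReal (∑ l, pairForm f f' l) := by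
  have hnn : ∀ l, 0 ≤ pairForm f f' l := fun l => integral_nonneg fun z => mul_nonneg (h0 _) (h0' _)
  rw [ENNReal.ofReal_sum_of_nonneg fun l _ => hnn l]
  refine sum_congr rfl fun l _ => ?_
  rw [pairForm, ofReal_integral_eq_lintegral_ofReal (hf.integrable hf' hc hc' l)
    (ae_of_all _ fun z => mul_nonneg (h0 _) (h0' _))]
  refine lintegral_congr fun z => ?_
  rw [← enorm_mul, Real.enorm_of_nonneg (mul_nonneg (h0 _) (h0' _))]

/-- The absolute value of a function, cut off to bounded arguments. -/
def truncAbs (f : (Fin n → Space d) → ℝ) (m : ℕ) (z : Fin n → Space d) : ℝ :=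
  |f z| * ∏ k, cutoff m (z k)

lemma continuous_truncAbs {f : (Fin n → Space d) → ℝ} (hc : Continuous f) (m : ℕ) :
    Continuous (truncAbs f m) :=
  hc.abs.mul (continuous_finsetProd _ fun k _ => (continuous_cutoff _).comp (continuous_apply k))

lemma prod_cutoff_nonneg (R : ℝ) (z : Fin n → Space d) : 0 ≤ ∏ k, cutoff R (z k) :=
  Finset.prod_nonneg fun _ _ => cutoff_nonneg _ _

lemma prod_cutoff_le_one (R : ℝ) (z : Fin n → Space d) : ∏ k, cutoff R (z k) ≤ 1 :=
  Finset.prod_le_one (fun _ _ => cutoff_nonneg _ _) fun _ _ => cutoff_le_one _ _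

lemma supportedIn_mul_cutoff (f : (Fin n → Space d) → ℝ) (R : ℝ) :
    SupportedIn (R + 1) fun z => f z * ∏ k, cutoff R (z k) := by
  intro z hz i
  by_contra! hi
  refine hz ?_
  show f z * ∏ k, cutoff R (z k) = 0
  rw [Finset.prod_eq_zero (Finset.mem_univ i) (cutoff_eq_zero hi.le), mul_zero]

lemma eventually_prod_cutoff_eq_one (z : Fin n → Space d) :
    ∀ᶠ m : ℕ in atTop, ∏ k, cutoff m (z k) = 1 := by
  obtain ⟨N, hN⟩ := exists_nat_ge (∑ k, ‖z k‖)
  filter_upwards [eventually_ge_atTop N] with m hm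
  refine Finset.prod_eq_one fun k _ => cutoff_eq_one ?_
  have h1 := single_le_sum (f := fun k => ‖z k‖) (fun _ _ => norm_nonneg _) (Finset.mem_univ k)
  have h2 : (N : ℝ) ≤ m := by exact_mod_cast hm
  exact h1.trans (hN.trans h2)

lemma enorm_truncAbs (f : (Fin n → Space d) → ℝ) (m : ℕ) (z : Fin n → Space d) :
    ‖truncAbs f m z‖ₑ = ‖f z‖ₑ * ofReal (∏ k, cutoff m (z k)) := by
  rw [truncAbs, enorm_mul, Real.enorm_of_nonneg (prod_cutoff_nonneg _ _), Real.enorm_abs]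

lemma tendsto_traceForm_truncAbs {f f' : (Fin n → Space d) → ℝ} (hc : Continuous f)
    (hc' : Continuous f') :
    Tendsto (fun m => traceForm (truncAbs f m) (truncAbs f' m)) atTop (𝓝 (traceForm f f')) := by
  refine tendsto_finsetSum _ fun l _ => ?_
  refine lintegral_tendsto_of_tendsto_of_monotone (fun m => ?_) (ae_of_all _ fun z => ?_)
    (ae_of_all _ fun z => ?_)
  · exact (((continuous_truncAbs hc m).comp (by fun_prop)).enorm.measurable.mul
      ((continuous_truncAbs hc' m).comp (by fun_prop)).enorm.measurable).aemeasurable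
  · intro m m' hmm
    simp only [enorm_truncAbs]
    have hmono : ∀ y : Fin n → Space d, ∏ k, cutoff m (y k) ≤ ∏ k, cutoff m' (y k) := fun y =>
      Finset.prod_le_prod (fun _ _ => cutoff_nonneg _ _) fun k _ => cutoff_mono _ (by exact_mod_cast hmm)
    exact mul_le_mul' (mul_le_mul' le_rfl (ofReal_le_ofReal (hmono _)))
      (mul_le_mul' le_rfl (ofReal_le_ofReal (hmono _)))
  · refine tendsto_const_nhds.congr' ?_
    filter_upwards [eventually_prod_cutoff_eq_one fun i => z low(l, i),
      eventually_prod_cutoff_eq_one fun i => z upp(l, i)] with m h1 h2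
    rw [enorm_truncAbs, enorm_truncAbs, h1, h2]; simp

lemma traceForm_truncAbs_le (f f' : (Fin n → Space d) → ℝ) (m : ℕ) :
    traceForm (truncAbs f m) (truncAbs f' m) ≤ traceForm f f' := by
  have : ∀ (f : (Fin n → Space d) → ℝ) z, ‖truncAbs f m z‖ₑ ≤ ‖f z‖ₑ := fun f z => by
    rw [enorm_truncAbs]
    refine mul_le_of_le_one_right zero_le ?_
    rw [ENNReal.ofReal_le_one]; exact prod_cutoff_le_one _ _
  refine sum_le_sum fun l _ => lintegral_mono fun z => mul_le_mul' (this _ _) (this _ _)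

/-- The Cauchy-Schwarz inequality for the norm `‖·‖_n`. -/
lemma traceForm_le (hW : IsWhiteNoise W) {f f' : (Fin n → Space d) → ℝ} (hc : Continuous f)
    (hc' : Continuous f') : traceForm f f' ≤ traceNorm n f * traceNorm n f' := by
  -- Only absolute values enter the form. For absolute values cut off to bounded arguments it equals
  -- the signed sum over pairings, and monotone convergence removes the cutoff.
  refine le_of_tendsto' (tendsto_traceForm_truncAbs hc hc') fun m => ?_
  have hS : ∀ f : (Fin n → Space d) → ℝ, SupportedIn ((m : ℝ) + 1) (truncAbs f m) := fun f =>
    supportedIn_mul_cutoff (fun z => |f z|) m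
  have h0 : ∀ (f : (Fin n → Space d) → ℝ) z, 0 ≤ truncAbs f m z := fun f z =>
    mul_nonneg (abs_nonneg _) (prod_cutoff_nonneg _ _)
  have hc1 := continuous_truncAbs hc m
  have hc2 := continuous_truncAbs hc' m
  have key : traceForm (truncAbs f m) (truncAbs f' m) ^ 2 ≤ (traceNorm n f * traceNorm n f') ^ 2 := by
    calc _ ≤ traceForm (truncAbs f m) (truncAbs f m) * traceForm (truncAbs f' m) (truncAbs f' m) := by
          rw [traceForm_eq_ofReal (hS f) (hS f') hc1 hc2 (h0 f) (h0 f'),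
            traceForm_eq_ofReal (hS f) (hS f) hc1 hc1 (h0 f) (h0 f),
            traceForm_eq_ofReal (hS f') (hS f') hc2 hc2 (h0 f') (h0 f'),
            ← ofReal_pow, ← ofReal_mul]
          · exact ofReal_le_ofReal (sum_pairForm_sq_le hW (hS f) (hS f') hc1 hc2)
          · exact sum_nonneg fun l _ => integral_nonneg fun z => mul_nonneg (h0 _ _) (h0 _ _)
          · exact sum_nonneg fun l _ => integral_nonneg fun z => mul_nonneg (h0 _ _) (h0 _ _)
      _ ≤ traceForm f f * traceForm f' f' :=
          mul_le_mul' (traceForm_truncAbs_le _ _ _) (traceForm_truncAbs_le _ _ _)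
      _ = _ := by rw [traceForm_self, traceForm_self, mul_pow]
  exact (pow_le_pow_left_iff (by norm_num)).1 key

lemma traceNorm_add_le (hW : IsWhiteNoise W) {f f' : (Fin n → Space d) → ℝ} (hc : Continuous f)
    (hc' : Continuous f') : traceNorm n (fun z => f z + f' z) ≤ traceNorm n f + traceNorm n f' := by
  have key : traceNorm n (fun z => f z + f' z) ^ 2 ≤ (traceNorm n f + traceNorm n f') ^ 2 := by
    calc _ ≤ traceForm f f + traceForm f f' + (traceForm f' f + traceForm f' f') := by
          rw [← traceForm_self]
          simp only [traceForm, ← Finset.sum_add_distrib]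
          refine sum_le_sum fun l _ => ?_
          have hm : ∀ {h h' : (Fin n → Space d) → ℝ}, Continuous h → Continuous h' →
              Measurable fun z : l.Lower → Space d => ‖h (fun i => z low(l, i))‖ₑ
                * ‖h' (fun i => z upp(l, i))‖ₑ := fun h1 h2 =>
            (h1.comp (by fun_prop)).enorm.measurable.mul (h2.comp (by fun_prop)).enorm.measurable
          have hsum : Measurable fun z : l.Lower → Space d =>
              ‖f (fun i => z low(l, i))‖ₑ * ‖f (fun i => z upp(l, i))‖ₑ
              + ‖f (fun i => z low(l, i))‖ₑ * ‖f' (fun i => z upp(l, i))‖ₑ := by fun_prop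
          rw [← lintegral_add_left (hm hc hc), ← lintegral_add_left (hm hc' hc),
            ← lintegral_add_left hsum]
          refine lintegral_mono fun z => ?_
          refine (mul_le_mul' (enorm_add_le _ _) (enorm_add_le _ _)).trans (le_of_eq ?_)
          ring
      _ ≤ traceNorm n f ^ 2 + traceNorm n f * traceNorm n f'
          + (traceNorm n f' * traceNorm n f + traceNorm n f' ^ 2) := by
          rw [traceForm_self, traceForm_self]
          gcongr
          · exact traceForm_le hW hc hc'
          · exact traceForm_le hW hc' hc
      _ = _ := by ring
  exact (pow_le_pow_left_iff (by norm_num)).1 key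

lemma traceNorm_congr {f f' : (Fin n → Space d) → ℝ} (h : ∀ z, |f z| = |f' z|) :
    traceNorm n f = traceNorm n f' := by
  unfold traceNorm
  have : ∀ z, ‖f z‖ₑ = ‖f' z‖ₑ := fun z => by rw [← Real.enorm_abs, h, Real.enorm_abs]
  simp only [this]

lemma traceNorm_sub_le (hW : IsWhiteNoise W) {f f' f'' : (Fin n → Space d) → ℝ} (hc : Continuous f)
    (hc' : Continuous f') (hc'' : Continuous f'') : traceNorm n (fun z => f z - f'' z)
      ≤ traceNorm n (fun z => f z - f' z) + traceNorm n (fun z => f' z - f'' z) := by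
  refine le_trans (le_of_eq (traceNorm_congr fun z => ?_))
    (traceNorm_add_le hW (hc.sub hc') (hc'.sub hc''))
  simp

lemma traceNorm_sub_comm (f f' : (Fin n → Space d) → ℝ) :
    traceNorm n (fun z => f z - f' z) = traceNorm n (fun z => f' z - f z) :=
  traceNorm_congr fun _ => abs_sub_comm _ _

lemma traceNorm_sq_le_of_supportedIn {R δ : ℝ} (hδ : 0 ≤ δ) {h : (Fin n → Space d) → ℝ}
    (hs : SupportedIn R h) (hb : ∀ z, |h z| ≤ δ) :
    traceNorm n h ^ 2 ≤ ofReal (δ * δ) * ∑ l : Pairing (n + n), volume (polyball l.Lower d R) := by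
  rw [traceNorm_sq, mul_sum]
  refine sum_le_sum fun l _ => ?_
  calc _ ≤ ∫⁻ z, (polyball l.Lower d R).indicator (fun _ => ofReal (δ * δ)) z := by
        refine lintegral_mono fun z => ?_
        rw [← enorm_mul, Real.enorm_eq_ofReal_abs]
        refine (ofReal_le_ofReal (hs.abs_mul_le hs hδ hb hb l z)).trans ?_
        by_cases hz : z ∈ polyball l.Lower d R
        · rw [indicator_of_mem hz, indicator_of_mem hz]
        · rw [indicator_of_notMem hz, indicator_of_notMem hz, ENNReal.ofReal_zero]
    _ = _ := lintegral_indicator_const (isCompact_polyball _ _ _).measurableSet _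

/-- Sums of products are dense among the continuous functions for the norm `‖·‖_n`. -/
lemma exists_productSum_traceNorm_le (hW : IsWhiteNoise W) {f : (Fin n → Space d) → ℝ}
    (hc : Continuous f) (hf : traceNorm n f ≠ ∞) {δ : ℝ≥0∞} (hδ : δ ≠ 0) :
    ∃ S : ProductSum d n, traceNorm n (fun z => f z - S.toFun z) ≤ δ := by
  have hcut : ∀ m : ℕ, Continuous fun z : Fin n → Space d => ∏ k, cutoff m (z k) := fun m =>
    continuous_finsetProd _ fun k _ => (continuous_cutoff _).comp (continuous_apply k)
  have h1 : Tendsto (fun m : ℕ => traceNorm n (fun z => f z - f z * ∏ k, cutoff m (z k)) ^ 2) atTop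
      (𝓝 0) := by
    have h0 : (0 : ℝ≥0∞) = ∑ l : Pairing (n + n), 0 := by simp
    simp only [traceNorm_sq]
    rw [h0]
    refine tendsto_finsetSum _ fun l _ => ?_
    rw [← lintegral_zero (μ := (volume : Measure (l.Lower → Space d)))]
    have hle : ∀ (m : ℕ) (z : Fin n → Space d), ‖f z - f z * ∏ k, cutoff m (z k)‖ₑ ≤ ‖f z‖ₑ := by
      intro m z
      have : f z - f z * ∏ k, cutoff m (z k) = f z * (1 - ∏ k, cutoff m (z k)) := by ring
      rw [this, enorm_mul, Real.enorm_of_nonneg (sub_nonneg.2 (prod_cutoff_le_one _ _))]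
      refine mul_le_of_le_one_right zero_le ?_
      rw [ENNReal.ofReal_le_one]; linarith [prod_cutoff_nonneg (m : ℝ) z]
    have hcd : ∀ m : ℕ, Continuous fun z => f z - f z * ∏ k, cutoff m (z k) := fun _ => by fun_prop
    refine tendsto_lintegral_of_dominated_convergence (fun z => ‖f (fun i => z low(l, i))‖ₑ
        * ‖f (fun i => z upp(l, i))‖ₑ) (fun m => ?_)
      (fun m => ae_of_all _ fun z => mul_le_mul' (hle _ _) (hle _ _)) ?_ (ae_of_all _ fun z => ?_)
    · exact ((hcd m).comp (f := fun z : l.Lower → Space d => fun i => z low(l, i))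
        (by fun_prop)).enorm.measurable.mul ((hcd m).comp
        (f := fun z : l.Lower → Space d => fun i => z upp(l, i))
        (by fun_prop)).enorm.measurable
    · have hfin : traceNorm n f ^ 2 ≠ ∞ := pow_ne_top hf
      rw [traceNorm_sq] at hfin
      exact ENNReal.sum_ne_top.1 hfin l (Finset.mem_univ _)
    · refine tendsto_const_nhds.congr' ?_
      filter_upwards [eventually_prod_cutoff_eq_one fun i => z low(l, i)] with m hm
      rw [hm]; simp
  have hδ2 : (δ / 2) ^ 2 ≠ 0 := pow_ne_zero 2 (by simpa using hδ)
  obtain ⟨m, hm⟩ := (h1.eventually_le_const (pos_iff_ne_zero.2 hδ2)).exists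
  have hm' := (pow_le_pow_left_iff (by norm_num)).1 hm
  -- The cutoff enlarges the radius of the support by one, the approximation by products by another
  -- one. On this fixed region a uniform error `η` costs at most `η * η * V` in the squared norm.
  set V := ∑ l : Pairing (n + n), volume (polyball l.Lower d ((m : ℝ) + 1 + 1)) with hV
  have hVfin : V ≠ ∞ := ENNReal.sum_ne_top.2 fun l _ => (isCompact_polyball _ _ _).measure_lt_top.ne
  obtain ⟨η, hη, hηV⟩ : ∃ η : ℝ, 0 < η ∧ ofReal (η * η) * V ≤ (δ / 2) ^ 2 := by
    have ht : Tendsto (fun η : ℝ => ofReal (η * η) * V) (𝓝[>] 0) (𝓝 0) := by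
      have : Tendsto (fun η : ℝ => ofReal (η * η)) (𝓝[>] 0) (𝓝 (ofReal (0 * 0))) :=
        ((ENNReal.continuous_ofReal.comp (by fun_prop : Continuous fun η : ℝ => η * η)).tendsto
          0).mono_left nhdsWithin_le_nhds
      simpa using ENNReal.Tendsto.mul_const this (Or.inr hVfin)
    obtain ⟨η, h1, h2⟩ := ((ht.eventually_le_const (pos_iff_ne_zero.2 hδ2)).and
      self_mem_nhdsWithin).exists
    exact ⟨η, h2, h1⟩
  have hsupp := supportedIn_mul_cutoff f (m : ℝ)
  obtain ⟨S, hS, hS'⟩ := exists_productSum_near (hc.mul (hcut m)) hsupp hη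
  refine ⟨S, (traceNorm_sub_le hW hc (hc.mul (hcut m)) S.continuous).trans ?_⟩
  rw [← ENNReal.add_halves δ]
  refine add_le_add hm' ?_
  rw [traceNorm_sub_comm]
  refine (pow_le_pow_left_iff (n := 2) (by norm_num)).1 (le_trans ?_ hηV)
  refine traceNorm_sq_le_of_supportedIn hη.le (fun z hz i => ?_) hS
  by_contra! hi
  refine hz ?_
  have e1 : S.toFun z = 0 := by by_contra h0; exact absurd (hS' z h0 i) (not_le.2 hi)
  have e2 : f z * ∏ k, cutoff m (z k) = 0 := by by_contra h0; have := hsupp z h0 i; linarith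
  show S.toFun z - f z * ∏ k, cutoff m (z k) = 0
  rw [e1, e2, sub_zero]

/-! ### Uniqueness of Stratonovich integrals, and Stratonovich integrals as limits. -/

lemma eLpNorm_two_triangle {X : Type*} [MeasurableSpace X] {μ : Measure X} {f g h : X → ℝ}
    (hf : AEStronglyMeasurable f μ) (hg : AEStronglyMeasurable g μ)
    (hh : AEStronglyMeasurable h μ) : eLpNorm (fun x => f x - h x) 2 μ
      ≤ eLpNorm (fun x => f x - g x) 2 μ + eLpNorm (fun x => g x - h x) 2 μ := by
  have h1 := eLpNorm_add_le (hf.sub hg) (hg.sub hh) (p := 2) (by norm_num)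
  rwa [sub_add_sub_cancel] at h1

lemma eLpNorm_two_sub_comm {X : Type*} [MeasurableSpace X] {μ : Measure X} (f g : X → ℝ) :
    eLpNorm (fun x => f x - g x) 2 μ = eLpNorm (fun x => g x - f x) 2 μ :=
  eLpNorm_congr_norm_ae (ae_of_all _ fun _ => norm_sub_rev _ _)

lemma ProductSum.aestronglyMeasurable_integral (S : ProductSum d n) :
    AEStronglyMeasurable (S.integral W) P := by
  obtain ⟨M, h⟩ := S.isChaos W
  rw [← S.chaosVar_eq W]; exact h.aestronglyMeasurable

lemma IsChaos.eLpNorm_sub_integral_le {A : Type*} [MeasurableSpace A] {α : Measure A} [SFinite α]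
    {H : A → ℝ} {φ : A → Fin n → Space d → ℝ} {Q : A → Fin n → Ω → ℝ} {M : ℝ} (hW : IsWhiteNoise W)
    (h : IsChaos W α H φ Q M) (S : ProductSum d n) :
    eLpNorm (fun ω => chaosVar α H Q ω - S.integral W ω) 2 P
      ≤ traceNorm n (fun z => chaosFun α H φ z - S.toFun z) := by
  obtain ⟨M', h'⟩ := S.isChaos W
  have := h.eLpNorm_sub_le hW h'
  rwa [S.chaosVar_eq W, S.chaosFun_eq] at this

lemma IsChaos.eLpNorm_le {A : Type*} [MeasurableSpace A] {α : Measure A} [SFinite α] {H : A → ℝ}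
    {φ : A → Fin n → Space d → ℝ} {Q : A → Fin n → Ω → ℝ} {M : ℝ} (hW : IsWhiteNoise W)
    (h : IsChaos W α H φ Q M) : eLpNorm (chaosVar α H Q) 2 P ≤ traceNorm n (chaosFun α H φ) := by
  have := h.eLpNorm_sub_integral_le hW ⟨0, fun _ => 0, fun _ _ => 0⟩
  simpa [ProductSum.integral, ProductSum.toFun] using this

/-- The Stratonovich integral is determined by the integrand. -/
lemma IsStratonovichIntegral.ae_eq (hW : IsWhiteNoise W) {f : (Fin n → Space d) → ℝ}
    (hc : Continuous f) {Z Z' : Ω → ℝ} (h : IsStratonovichIntegral W n f Z)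
    (h' : IsStratonovichIntegral W n f Z') : Z =ᵐ[P] Z' := by
  obtain ⟨hZ, S, hS, hSZ⟩ := h
  obtain ⟨hZ', S', hS', hSZ'⟩ := h'
  have hle : ∀ k, eLpNorm (fun ω => Z ω - Z' ω) 2 P
      ≤ eLpNorm (fun ω => Z ω - (S k).integral W ω) 2 P
        + (traceNorm n (fun y => f y - (S k).toFun y) + traceNorm n (fun y => f y - (S' k).toFun y))
        + eLpNorm (fun ω => Z' ω - (S' k).integral W ω) 2 P := by
    intro k
    obtain ⟨M, h⟩ := (S k).isChaos W
    have h1 := h.eLpNorm_sub_integral_le hW (S' k)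
    rw [(S k).chaosVar_eq W, (S k).chaosFun_eq] at h1
    refine (eLpNorm_two_triangle hZ.1
      ((S' k).aestronglyMeasurable_integral (W := W)) hZ'.1).trans ?_
    rw [eLpNorm_two_sub_comm _ Z']
    refine add_le_add_left ((eLpNorm_two_triangle hZ.1 (S k).aestronglyMeasurable_integral
      (S' k).aestronglyMeasurable_integral).trans (add_le_add_right (h1.trans ?_) _)) _
    rw [traceNorm_sub_comm f]
    exact traceNorm_sub_le hW (S k).continuous hc (S' k).continuous
  have h0 : eLpNorm (fun ω => Z ω - Z' ω) 2 P = 0 := by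
    have := ge_of_tendsto' ((hSZ.add (hS.add hS')).add hSZ') hle
    simpa using this
  replace h0 := (eLpNorm_eq_zero_iff (hZ.1.sub hZ'.1) (by norm_num)).1 h0
  filter_upwards [h0] with ω hω
  exact sub_eq_zero.1 hω

/-- Limits of chaos variables are Stratonovich integrals. -/
lemma isStratonovichIntegral_of_tendsto (hW : IsWhiteNoise W) {ι : Type*} {F : Filter ι} [F.NeBot]
    {X : ι → Ω → ℝ} {f : ι → (Fin n → Space d) → ℝ} {f₀ : (Fin n → Space d) → ℝ} {Z : Ω → ℝ}
    (hX : ∀ i, AEStronglyMeasurable (X i) P) (hf : ∀ i, Continuous (f i)) (hf₀ : Continuous f₀)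
    (hfin : traceNorm n f₀ ≠ ∞) (hZ : MemLp Z 2 P)
    (hXS : ∀ i (S : ProductSum d n), eLpNorm (fun ω => X i ω - S.integral W ω) 2 P
      ≤ traceNorm n (fun z => f i z - S.toFun z))
    (hlim : Tendsto (fun i => traceNorm n (fun z => f i z - f₀ z)) F (𝓝 0))
    (hlimZ : Tendsto (fun i => eLpNorm (fun ω => Z ω - X i ω) 2 P) F (𝓝 0)) :
    IsStratonovichIntegral W n f₀ Z := by
  have hδ : ∀ k : ℕ, ((k : ℝ≥0∞) + 1)⁻¹ ≠ 0 := fun k => by simp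
  choose S hS using fun k => exists_productSum_traceNorm_le hW hf₀ hfin (hδ k)
  have hlim0 : Tendsto (fun k : ℕ => ((k : ℝ≥0∞) + 1)⁻¹) atTop (𝓝 0) := by
    have := (tendsto_add_atTop_iff_nat 1).2 ENNReal.tendsto_inv_nat_nhds_zero
    simpa using this
  refine ⟨hZ, S, tendsto_of_tendsto_of_tendsto_of_le_of_le tendsto_const_nhds hlim0
    (fun _ => zero_le) hS, tendsto_of_tendsto_of_tendsto_of_le_of_le tendsto_const_nhds hlim0
    (fun _ => zero_le) fun k => (le_trans ?_ (hS k))⟩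
  have hle : ∀ i, eLpNorm (fun ω => Z ω - (S k).integral W ω) 2 P
      ≤ eLpNorm (fun ω => Z ω - X i ω) 2 P + (traceNorm n (fun z => f i z - f₀ z)
        + traceNorm n (fun z => f₀ z - (S k).toFun z)) := fun i =>
    (eLpNorm_two_triangle hZ.1 (hX i) (S k).aestronglyMeasurable_integral).trans
      (add_le_add_right ((hXS i (S k)).trans (traceNorm_sub_le hW (hf i) hf₀ (S k).continuous)) _)
  have := ge_of_tendsto' (hlimZ.add (hlim.add tendsto_const_nhds)) hle
  simpa using this

/-! ### Mollified kernels and the convergence of the individual terms. -/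

/-- The average of `h(z + εη)` with weights `∏ᵢ ρ(ηᵢ)`. -/
def mollify (ρ : Space d → ℝ) (ε : ℝ) (h : (Fin n → Space d) → ℝ) (z : Fin n → Space d) : ℝ :=
  ∫ η : Fin n → Space d, (∏ i, ρ (η i)) * h (z + ε • η)

/-- At scale zero only the mass of `ρ` survives. With `σ = ∫ ρ` it becomes the factor `σ ^ n` of the
Stratonovich kernels. -/
lemma mollify_zero (ρ : Space d → ℝ) (h : (Fin n → Space d) → ℝ) (z : Fin n → Space d) :
    mollify ρ 0 h z = (∫ x, ρ x) ^ n * h z := by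
  simp only [mollify, zero_smul, add_zero]
  rw [integral_mul_const, integral_fintype_prod_volume_eq_pow ρ, Fintype.card_fin]

/-- The mollifier at scale `ε`. -/
def mollifier (ρ : Space d → ℝ) (ε : ℝ) (x y : Space d) : ℝ := (ε ^ d)⁻¹ * ρ (ε⁻¹ • (x - y))

/-- Substitute `y = z + ε • η`; the Jacobian, a power of `ε` with exponent `d * n`, cancels the
normalization of the `n` mollifiers. The mollification thus moves from the noise to the kernel. -/
lemma integral_mul_prod_mollifier (ρ : Space d → ℝ) (hε : 0 < ε) (h : (Fin n → Space d) → ℝ)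
    (z : Fin n → Space d) :
    ∫ y : Fin n → Space d, h y * ∏ i, mollifier ρ ε (y i) (z i) = mollify ρ ε h z := by
  set F : (Fin n → Space d) → ℝ := fun η => (∏ i, ρ (η i)) * h (z + ε • η) with hF
  have h1 : ∀ y, h y * ∏ i, mollifier ρ ε (y i) (z i) = ((ε ^ d)⁻¹) ^ n * F (ε⁻¹ • (y - z)) := by
    intro y
    have : z + ε • ε⁻¹ • (y - z) = y := by rw [smul_inv_smul₀ hε.ne']; abel
    simp only [mollifier, hF, this, prod_mul_distrib, Finset.prod_const, card_univ,
      Fintype.card_fin, Pi.smul_apply, Pi.sub_apply]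
    ring
  simp only [h1]
  rw [integral_const_mul, integral_sub_right_eq_self (fun y => F (ε⁻¹ • y)) z,
    Measure.integral_comp_smul]
  have hd : Module.finrank ℝ (Fin n → Space d) = d * n := by
    rw [Module.finrank_pi_fintype]; simp [mul_comm]
  rw [hd, inv_pow ε, inv_inv, abs_of_pos (by positivity), smul_eq_mul, ← mul_assoc, inv_pow,
    ← pow_mul, inv_mul_cancel₀ (by positivity), one_mul]
  rfl

lemma continuous_mollify (hρ : Integrable ρ) (ε : ℝ) {h : (Fin n → Space d) → ℝ} (hc : Continuous h)
    {B : ℝ} (hB : ∀ z, |h z| ≤ B) : Continuous (mollify ρ ε h) := by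
  have hi : Integrable fun η : Fin n → Space d => ∏ i, ρ (η i) := Integrable.fintype_prod fun _ => hρ
  refine continuous_of_dominated (bound := fun η => |∏ i, ρ (η i)| * B) (fun z => ?_) (fun z => ?_)
    (hi.abs.mul_const B) (ae_of_all _ fun η => ?_)
  · exact hi.aestronglyMeasurable.mul (hc.comp (by fun_prop)).aestronglyMeasurable
  · exact ae_of_all _ fun η => by
      rw [Real.norm_eq_abs, abs_mul]; exact mul_le_mul_of_nonneg_left (hB _) (abs_nonneg _)
  · exact continuous_const.mul (by fun_prop)

/-- A Green's function on a bounded time interval, with an initial condition. -/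
structure DuhamelData (g : ℝ → Space d → Space d → ℝ) (u₀ : Space d → ℝ) (C : ℝ≥0) (a T : ℝ) :
    Prop where
  kernel : GreenKernel g C a T
  nonneg : 0 ≤ a
  lt_one : a < 1
  measurable : Measurable u₀
  integrable : Integrable u₀
  memLp : MemLp u₀ 2 volume

/-- The measure with density `∏ᵢ |ρ(ηᵢ)|`. -/
def weightMeasure (ρ : Space d → ℝ) (n : ℕ) : Measure (Fin n → Space d) :=
  volume.withDensity fun η => ‖∏ i, ρ (η i)‖ₑ

lemma measurable_prod_weight (hρ : Measurable ρ) :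
    Measurable fun η : Fin n → Space d => ∏ i, ρ (η i) := by fun_prop

lemma lintegral_weightMeasure (hρ : Measurable ρ) (f : (Fin n → Space d) → ℝ≥0∞) :
    ∫⁻ η, f η ∂(weightMeasure ρ n) = ∫⁻ η, ‖∏ i, ρ (η i)‖ₑ * f η :=
  lintegral_withDensity_eq_lintegral_mul_non_measurable _ (measurable_prod_weight hρ).enorm
    (ae_of_all _ fun _ => enorm_lt_top) _

lemma weightMeasure_univ (hρ1 : Integrable ρ) : weightMeasure ρ n univ = (∫⁻ x, ‖ρ x‖ₑ) ^ n := by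
  have hi : Integrable fun η : Fin n → Space d => ∏ i, ρ (η i) := Integrable.fintype_prod fun _ => hρ1
  rw [weightMeasure, withDensity_apply _ MeasurableSet.univ, Measure.restrict_univ,
    ← ofReal_integral_norm_eq_lintegral_enorm hi, ← ofReal_integral_norm_eq_lintegral_enorm hρ1,
    ← ofReal_pow (integral_nonneg fun _ => norm_nonneg _)]
  simp only [norm_prod]
  rw [integral_fintype_prod_volume_eq_pow fun x => ‖ρ x‖, Fintype.card_fin]

lemma isFiniteMeasure_weightMeasure (hρ1 : Integrable ρ) : IsFiniteMeasure (weightMeasure ρ n) :=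
  ⟨by rw [weightMeasure_univ hρ1]; exact ENNReal.pow_lt_top hρ1.2⟩

lemma enorm_mollify_le (hρ : Measurable ρ) (ε : ℝ) (h : (Fin n → Space d) → ℝ)
    (z : Fin n → Space d) : ‖mollify ρ ε h z‖ₑ ≤ ∫⁻ η, ‖h (z + ε • η)‖ₑ ∂(weightMeasure ρ n) := by
  rw [lintegral_weightMeasure hρ]
  refine (enorm_integral_le_lintegral_enorm _).trans (le_of_eq ?_)
  simp only [enorm_mul]

/-- A mollified kernel is an average of shifted kernels with total mass `(∫ |ρ|) ^ n`, so the bound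
does not depend on `ε`. -/
lemma lintegral_traceNorm_mollify_le (D : DuhamelData g u₀ C a T) (hρ : Measurable ρ)
    (hρ1 : Integrable ρ) (ε t : ℝ) (S : Set (Fin n → ℝ)) {H : Space d → (Fin n → Space d) → ℝ}
    (hH : ∀ x y, ‖H x y‖ₑ ≤ ∫⁻ s in S, ∫⁻ w, ‖chainDensity g u₀ n t x s w y‖ₑ) :
    ∫⁻ x, traceNorm n (mollify ρ ε (H x)) ^ 2
      ≤ ((∫⁻ x, ‖ρ x‖ₑ) ^ n) ^ 2 * energyBound C a T (∫⁻ x, ‖u₀ x‖ₑ ^ 2) n t S := by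
  have := isFiniteMeasure_weightMeasure (n := n) hρ1
  rw [← weightMeasure_univ hρ1]
  exact lintegral_traceNorm_sq_le_energyBound D.kernel D.measurable t S _ (c := fun η => ε • η)
    (by fun_prop) fun x z => (enorm_mollify_le hρ _ _ _).trans (lintegral_mono fun η => hH _ _)

lemma DuhamelData.integrable_chainDensity (D : DuhamelData g u₀ C a T) (ht : t < T) (x : Space d)
    (y : Fin n → Space d) :
    Integrable fun z : (Fin n → ℝ) × Space d => chainDensity g u₀ n t x z.1 z.2 y := by
  have hm : Measurable fun z : (Fin n → ℝ) × Space d => chainDensity g u₀ n t x z.1 z.2 y :=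
    D.kernel.measurable_chainDensity D.measurable
  refine ⟨hm.aestronglyMeasurable, ?_⟩
  rw [HasFiniteIntegral, Measure.volume_eq_prod, lintegral_prod _ hm.enorm.aemeasurable]
  exact (absChain_ne_top D.kernel D.nonneg D.lt_one D.measurable D.integrable ht x y).lt_top

lemma DuhamelData.enorm_chainInt_sub_le (D : DuhamelData g u₀ C a T) (ht : t < T) (x : Space d)
    (y c : Fin n → Space d) : ‖chainInt g u₀ n t x (y + c) - chainInt g u₀ n t x y‖ₑ
      ≤ ∫⁻ s, ∫⁻ w, ‖chainDiff g u₀ n t c x s w y‖ₑ := by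
  have h1 := D.integrable_chainDensity ht x (y + c)
  have h2 := D.integrable_chainDensity ht x y
  have e : ∀ y, chainInt g u₀ n t x y
      = ∫ z : (Fin n → ℝ) × Space d, chainDensity g u₀ n t x z.1 z.2 y := fun y =>
    (integral_prod _ (D.integrable_chainDensity ht x y)).symm
  rw [e, e, ← integral_sub h1 h2]
  refine (enorm_integral_le_lintegral_enorm _).trans (le_of_eq ?_)
  rw [Measure.volume_eq_prod, lintegral_prod]
  · rfl
  · exact (h1.sub h2).aestronglyMeasurable.enorm

lemma DuhamelData.exists_bound (D : DuhamelData g u₀ C a T) (n : ℕ) (ht : t < T) :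
    ∃ B, ∀ x y, |chainInt g u₀ n t x y| ≤ B := by
  obtain ⟨K, _, h⟩ := exists_abs_chainInt_le D.kernel D.nonneg D.lt_one D.measurable D.integrable n
  exact ⟨_, h t ht⟩

lemma DuhamelData.continuous_chainInt (D : DuhamelData g u₀ C a T) (n : ℕ) (ht : t < T)
    (x : Space d) : Continuous (chainInt g u₀ n t x) :=
  (StratSPDE.continuous_chainInt D.kernel D.nonneg D.lt_one D.measurable D.integrable n ht).comp
    (by fun_prop : Continuous fun y => (x, y))

lemma DuhamelData.continuous_mollify_chainInt (D : DuhamelData g u₀ C a T) (hρ1 : Integrable ρ)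
    (n : ℕ) (ht : t < T) (ε : ℝ) (x : Space d) :
    Continuous (mollify ρ ε (chainInt g u₀ n t x)) := by
  obtain ⟨B, hB⟩ := D.exists_bound n ht
  exact continuous_mollify hρ1 ε (D.continuous_chainInt n ht x) (hB x)

lemma DuhamelData.enorm_mollify_sub_le (D : DuhamelData g u₀ C a T) (hρ : Measurable ρ)
    (hρ1 : Integrable ρ) (ht : t < T) (ε : ℝ) (x : Space d) (z : Fin n → Space d) :
    ‖mollify ρ ε (chainInt g u₀ n t x) z - mollify ρ 0 (chainInt g u₀ n t x) z‖ₑ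
      ≤ ∫⁻ η, ∫⁻ s, ∫⁻ w, ‖chainDiff g u₀ n t (ε • η) x s w z‖ₑ
      ∂volume ∂volume ∂(weightMeasure ρ n) := by
  obtain ⟨B, hB⟩ := D.exists_bound n ht
  have hi : ∀ ε : ℝ, Integrable fun η : Fin n → Space d =>
      (∏ i, ρ (η i)) * chainInt g u₀ n t x (z + ε • η) := fun ε =>
    (Integrable.fintype_prod fun _ => hρ1).mul_bdd (c := B) ((D.continuous_chainInt n ht x).comp
      (by fun_prop)).aestronglyMeasurable (ae_of_all _ fun η => hB _ _)
  rw [mollify, mollify, ← integral_sub (hi ε) (hi 0), lintegral_weightMeasure hρ]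
  refine (enorm_integral_le_lintegral_enorm _).trans (lintegral_mono fun η => ?_)
  rw [← mul_sub, enorm_mul, zero_smul, add_zero]
  exact mul_le_mul_right (D.enorm_chainInt_sub_le ht x z _) _

lemma DuhamelData.energyBound_ne_top (D : DuhamelData g u₀ C a T) (n : ℕ) (ht : t ≤ T) :
    energyBound C a T (∫⁻ x, ‖u₀ x‖ₑ ^ 2) n t univ ≠ ∞ := by
  have hU : ∫⁻ x, ‖u₀ x‖ₑ ^ 2 ≠ ∞ := by rw [← eLpNorm_two_sq]; exact pow_ne_top D.memLp.2.ne
  obtain ⟨b, -, hb⟩ := exists_summable_energyBound (C := C) (T := T) D.lt_one hU 1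
  have := hb n t ht
  simp only [ENNReal.coe_one, one_pow, one_mul] at this
  exact ne_top_of_le_ne_top (by finiteness) this

/-- For each `η` the shifts `ε • η` tend to zero, and the weights form a finite measure because `ρ`
is integrable. -/
lemma DuhamelData.tendsto_mollify (D : DuhamelData g u₀ C a T) (hρ : Measurable ρ)
    (hρ1 : Integrable ρ) (n : ℕ) (ht : t < T) :
    Tendsto (fun ε => ∫⁻ x, traceNorm n (fun z => mollify ρ ε (chainInt g u₀ n t x) z
      - mollify ρ 0 (chainInt g u₀ n t x) z) ^ 2) (𝓝[>] 0) (𝓝 0) := by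
  have := isFiniteMeasure_weightMeasure (n := n) hρ1
  refine tendsto_lintegral_traceNorm_sq D.kernel D.measurable D.integrable t
    (D.energyBound_ne_top n ht.le) (weightMeasure ρ n) (c := fun ε η => ε • η)
    (fun ε => by fun_prop) (fun η => ?_) fun ε x z => D.enorm_mollify_sub_le hρ hρ1 ht ε x z
  have : Tendsto (fun ε : ℝ => ε • η) (𝓝 0) (𝓝 ((0 : ℝ) • η)) :=
    (continuous_id.smul continuous_const).tendsto 0
  rw [zero_smul] at this
  exact this.mono_left nhdsWithin_le_nhds

lemma measurable_mollify (hρ : Measurable ρ) (ε : ℝ) {H : Space d → (Fin n → Space d) → ℝ}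
    (hH : Measurable (uncurry H)) :
    Measurable fun z : Space d × (Fin n → Space d) => mollify ρ ε (H z.1) z.2 := by
  refine (StronglyMeasurable.integral_prod_right' (f := fun z : (Space d × (Fin n → Space d))
    × (Fin n → Space d) => (∏ i, ρ (z.2 i)) * H z.1.1 (z.1.2 + ε • z.2))
    (Measurable.stronglyMeasurable ?_)).measurable
  exact ((measurable_prod_weight hρ).comp measurable_snd).mul (hH.comp
    (f := fun z : (Space d × (Fin n → Space d)) × (Fin n → Space d) =>
      (z.1.1, z.1.2 + ε • z.2)) (by fun_prop))

lemma measurable_traceNorm_sq {f : Space d → (Fin n → Space d) → ℝ} (hf : Measurable (uncurry f)) :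
    Measurable fun x => traceNorm n (f x) ^ 2 := by
  simp only [traceNorm_sq]
  refine Finset.measurable_fun_sum _ fun l _ => Measurable.lintegral_prod_right'
    (f := fun z : Space d × (l.Lower → Space d) => ‖f z.1 (fun i => z.2 low(l, i))‖ₑ
      * ‖f z.1 (fun i => z.2 upp(l, i))‖ₑ) ?_
  exact ((hf.comp (f := fun z : Space d × (l.Lower → Space d) =>
    (z.1, fun i => z.2 low(l, i))) (by fun_prop)).enorm).mul
    ((hf.comp (f := fun z : Space d × (l.Lower → Space d) =>
    (z.1, fun i => z.2 upp(l, i))) (by fun_prop)).enorm)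

lemma DuhamelData.measurable_chainInt (D : DuhamelData g u₀ C a T) (n : ℕ) (t : ℝ) :
    Measurable (uncurry (chainInt g u₀ n t)) :=
  D.kernel.measurable_chainInt D.measurable

lemma DuhamelData.integrable_of_le (D : DuhamelData g u₀ C a T) (ht : t < T)
    {H : Space d → (Fin n → Space d) → ℝ} (hm : Measurable (uncurry H))
    (hH : ∀ x y, ‖H x y‖ₑ ≤ absChain g u₀ n t x y) (x : Space d) : Integrable (H x) := by
  obtain ⟨K, hK, h⟩ := exists_lintegral_absChain_le D.kernel D.nonneg D.lt_one D.measurable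
    D.integrable n
  refine ⟨(hm.comp measurable_prodMk_left).aestronglyMeasurable, ?_⟩
  exact ((lintegral_mono fun y => hH x y).trans (h t ht x)).trans_lt
    (mul_ne_top hK (oldWeight_ne_top _ _ _ _)).lt_top

section

variable {H : Space d → (Fin n → Space d) → ℝ}

/-- A term of the Duhamel expansion: a kernel integrated against products of the potential. -/
def noiseTerm (H : Space d → (Fin n → Space d) → ℝ) (V : Space d → Ω → ℝ) (z : Space d × Ω) : ℝ :=
  ∫ y : Fin n → Space d, H z.1 y * ∏ i, V (y i) z.2

lemma measurable_noiseTerm {V : Space d → Ω → ℝ} (hH : Measurable (uncurry H))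
    (hV : Measurable (uncurry V)) : Measurable (noiseTerm H V) := by
  refine (StronglyMeasurable.integral_prod_right' (f := fun z : (Space d × Ω) × (Fin n → Space d) =>
    H z.1.1 z.2 * ∏ i, V (z.2 i) z.1.2) (Measurable.stronglyMeasurable ?_)).measurable
  refine (hH.comp (f := fun z : (Space d × Ω) × (Fin n → Space d) => (z.1.1, z.2))
    (by fun_prop)).mul (measurable_fun_prod _ fun i _ => ?_)
  exact hV.comp (f := fun z : (Space d × Ω) × (Fin n → Space d) => (z.2 i, z.1.2)) (by fun_prop)

lemma eLpNorm_prod_sq {X : Type*} [MeasurableSpace X] {μ : Measure X} [SFinite μ] {F : X × Ω → ℝ}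
    (hF : AEStronglyMeasurable F (μ.prod P)) :
    eLpNorm F 2 (μ.prod P) ^ 2 = ∫⁻ x, eLpNorm (fun ω => F (x, ω)) 2 P ^ 2 ∂μ := by
  simp only [eLpNorm_two_sq]
  exact lintegral_prod _ (hF.enorm.pow_const 2)

lemma memLp_mollifier (hρ2 : MemLp ρ 2 volume) (hε : 0 < ε) (x : Space d) :
    MemLp (mollifier ρ ε x) 2 volume := by
  have h1 : MemLp (fun u => ρ (ε⁻¹ • u)) 2 volume := by
    have hq : Measure.QuasiMeasurePreserving (fun u : Space d => ε⁻¹ • u) volume volume :=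
      ⟨by fun_prop, by
        rw [Measure.map_addHaar_smul _ (inv_ne_zero hε.ne')]
        exact Measure.smul_absolutelyContinuous⟩
    refine (memLp_two_iff_integrable_sq (hρ2.1.comp_quasiMeasurePreserving hq)).2 ?_
    exact (hρ2.integrable_sq).comp_smul (inv_ne_zero hε.ne')
  exact (h1.comp_measurePreserving (Measure.measurePreserving_sub_left volume x)).const_mul _

lemma eLpNorm_mollifier (hρ2 : MemLp ρ 2 volume) (hε : 0 < ε) (x : Space d) :
    eLpNorm (mollifier ρ ε x) 2 volume = eLpNorm (fun u => (ε ^ d)⁻¹ * ρ (ε⁻¹ • u)) 2 volume := by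
  have h := (memLp_mollifier hρ2 hε 0).comp_measurePreserving (Measure.measurePreserving_neg volume)
  have h' : MemLp (fun u => (ε ^ d)⁻¹ * ρ (ε⁻¹ • u)) 2 volume := by
    convert h using 2 with u; simp [mollifier]
  exact eLpNorm_comp_measurePreserving h'.1 (Measure.measurePreserving_sub_left volume x)

lemma wienerIntegral_congr {f f' : Space d → ℝ} (h : f =ᵐ[volume] f') :
    wienerIntegral W f = wienerIntegral W f' := by
  by_cases hf : MemLp f 2 volume
  · have hf' := hf.ae_eq h
    rw [wienerIntegral, wienerIntegral, dif_pos hf, dif_pos hf', MemLp.toLp_congr hf hf' h]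
  · have hf' : ¬ MemLp f' 2 volume := fun h' => hf (h'.ae_eq h.symm)
    rw [wienerIntegral, wienerIntegral, dif_neg hf, dif_neg hf']

lemma IsMollifiedNoise.congr (hQ : IsMollifiedNoise W ρ Q) {ρ' : Space d → ℝ}
    (h : ρ =ᵐ[volume] ρ') : IsMollifiedNoise W ρ' Q := by
  refine fun ε hε => ⟨(hQ ε hε).1, fun x => ((hQ ε hε).2 x).trans (Eq.eventuallyEq ?_)⟩
  have hq : Measure.QuasiMeasurePreserving (fun y : Space d => ε⁻¹ • (x - y)) volume volume := by
    refine Measure.QuasiMeasurePreserving.comp (g := fun u : Space d => ε⁻¹ • u)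
      ⟨by fun_prop, ?_⟩ (Measure.measurePreserving_sub_left volume x).quasiMeasurePreserving
    rw [Measure.map_addHaar_smul _ (inv_ne_zero hε.ne')]
    exact Measure.smul_absolutelyContinuous
  refine wienerIntegral_congr ?_
  filter_upwards [hq.ae_eq_comp h] with y hy
  simp only [Function.comp] at hy
  rw [hy]

lemma IsMollifiedNoise.isChaos (hQ : IsMollifiedNoise W ρ Q) (hρ : Measurable ρ)
    (hρ2 : MemLp ρ 2 volume) (hε : 0 < ε) {h : (Fin n → Space d) → ℝ} (hh : Integrable h) :
    IsChaos W volume h (fun y i => mollifier ρ ε (y i)) (fun y i => Q ε (y i))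
      (eLpNorm (fun u => (ε ^ d)⁻¹ * ρ (ε⁻¹ • u)) 2 volume).toReal where
  integrable := hh
  measurable_fun i := (hρ.comp (by fun_prop :
    Measurable fun z : (Fin n → Space d) × Space d => ε⁻¹ • (z.1 i - z.2))).const_mul _
  memLp a i := memLp_mollifier hρ2 hε _
  norm_le a i := by rw [Lp.norm_toLp, eLpNorm_mollifier hρ2 hε]
  measurable_noise i := (hQ ε hε).1.comp
    (f := fun z : (Fin n → Space d) × Ω => (z.1 i, z.2)) (by fun_prop)
  noise_eq a i := by
    refine ((hQ ε hε).2 (a i)).trans (Eq.eventuallyEq ?_)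
    exact dif_pos (memLp_mollifier hρ2 hε (a i))

lemma chaosFun_mollifier (hε : 0 < ε) (h : (Fin n → Space d) → ℝ) :
    chaosFun volume h (fun y i => mollifier ρ ε (y i)) = mollify ρ ε h :=
  funext fun z => integral_mul_prod_mollifier ρ hε h z

lemma IsMollifiedNoise.eLpNorm_noiseTerm_sq_le (hW : IsWhiteNoise W) (hQ : IsMollifiedNoise W ρ Q)
    (hρ : Measurable ρ) (hρ2 : MemLp ρ 2 volume) (hε : 0 < ε) (hm : Measurable (uncurry H))
    (hi : ∀ x, Integrable (H x)) : eLpNorm (noiseTerm H (Q ε)) 2 (volume.prod P) ^ 2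
      ≤ ∫⁻ x, traceNorm n (mollify ρ ε (H x)) ^ 2 := by
  rw [eLpNorm_prod_sq (measurable_noiseTerm hm (hQ ε hε).1).aestronglyMeasurable]
  refine lintegral_mono fun x => ?_
  have h := (hQ.isChaos hρ hρ2 hε (hi x)).eLpNorm_le hW
  rw [chaosFun_mollifier hε] at h
  exact pow_le_pow_left' h 2

lemma IsMollifiedNoise.eLpNorm_noiseTerm_sub_sq_le (hW : IsWhiteNoise W)
    (hQ : IsMollifiedNoise W ρ Q) (hρ : Measurable ρ) (hρ2 : MemLp ρ 2 volume) (hε : 0 < ε) {ε' : ℝ}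
    (hε' : 0 < ε') (hm : Measurable (uncurry H)) (hi : ∀ x, Integrable (H x)) :
    eLpNorm (fun z => noiseTerm H (Q ε) z - noiseTerm H (Q ε') z) 2 (volume.prod P) ^ 2
      ≤ ∫⁻ x, traceNorm n (fun z => mollify ρ ε (H x) z - mollify ρ ε' (H x) z) ^ 2 := by
  refine (eLpNorm_prod_sq ((measurable_noiseTerm hm (hQ ε hε).1).sub
    (measurable_noiseTerm hm (hQ ε' hε').1)).aestronglyMeasurable).le.trans ?_
  refine lintegral_mono fun x => ?_
  have h := (hQ.isChaos hρ hρ2 hε (hi x)).eLpNorm_sub_le hW (hQ.isChaos hρ hρ2 hε' (hi x))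
  rw [chaosFun_mollifier hε, chaosFun_mollifier hε'] at h
  exact pow_le_pow_left' h 2

lemma DuhamelData.integrable_chainInt (D : DuhamelData g u₀ C a T) (n : ℕ) (ht : t < T)
    (x : Space d) : Integrable (chainInt g u₀ n t x) :=
  D.integrable_of_le ht (D.measurable_chainInt n t) (fun _ _ => enorm_chainInt_le _ _ _ _ _) x

/-- The terms of the Duhamel expansion with mollified noise are a Cauchy family. -/
lemma DuhamelData.exists_cauchy (D : DuhamelData g u₀ C a T) (hW : IsWhiteNoise W)
    (hQ : IsMollifiedNoise W ρ Q) (hρ : Measurable ρ) (hρ1 : Integrable ρ) (hρ2 : MemLp ρ 2 volume)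
    (n : ℕ) (ht : t < T) : ∃ e : ℝ → ℝ≥0∞, Tendsto e (𝓝[>] 0) (𝓝 0) ∧
      (∀ ε, ∫⁻ x, traceNorm n (fun z => mollify ρ ε (chainInt g u₀ n t x) z
        - mollify ρ 0 (chainInt g u₀ n t x) z) ^ 2 ≤ e ε ^ 2) ∧
      ∀ ε > 0, ∀ ε' > 0, eLpNorm (fun z => noiseTerm (chainInt g u₀ n t) (Q ε) z
      - noiseTerm (chainInt g u₀ n t) (Q ε') z) 2 (volume.prod P) ≤ e ε + e ε' := by
  set E : ℝ → ℝ≥0∞ := fun ε => ∫⁻ x, traceNorm n (fun z => mollify ρ ε (chainInt g u₀ n t x) z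
        - mollify ρ 0 (chainInt g u₀ n t x) z) ^ 2 with hE
  have hsq : ∀ b : ℝ≥0∞, (b ^ (1 / 2 : ℝ)) ^ 2 = b := fun b => by
    rw [← rpow_natCast, ← rpow_mul]; norm_num
  -- The factor two absorbs the constant in `(a + b) ^ 2 ≤ 4 * (a ^ 2 + b ^ 2)`, so that the errors
  -- of two scales simply add.
  refine ⟨fun ε => 2 * E ε ^ (1 / 2 : ℝ), ?_, fun ε => ?_, fun ε hε ε' hε' => ?_⟩
  · have h1 := (D.tendsto_mollify hρ hρ1 n ht).ennrpow_const (1 / 2 : ℝ)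
    rw [ENNReal.zero_rpow_of_pos (by norm_num)] at h1
    simpa using ENNReal.Tendsto.const_mul h1 (Or.inr (by norm_num : (2 : ℝ≥0∞) ≠ ∞))
  · dsimp only
    rw [mul_pow, hsq]
    exact le_mul_of_one_le_left zero_le (by norm_num)
  · refine (pow_le_pow_left_iff (n := 2) (by norm_num)).1 ?_
    refine (hQ.eLpNorm_noiseTerm_sub_sq_le hW hρ hρ2 hε hε' (D.measurable_chainInt n t)
      (D.integrable_chainInt n ht)).trans ?_
    have hc := D.continuous_mollify_chainInt hρ1 n ht
    have hmm := fun ε : ℝ => measurable_traceNorm_sq (n := n)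
      (f := fun x z => mollify ρ ε (chainInt g u₀ n t x) z - mollify ρ 0 (chainInt g u₀ n t x) z)
      ((measurable_mollify hρ ε (D.measurable_chainInt n t)).sub
        (measurable_mollify hρ 0 (D.measurable_chainInt n t)))
    have hab : ∀ a b : ℝ≥0∞, (a + b) ^ 2 ≤ 4 * (a ^ 2 + b ^ 2) := by
      intro a b
      calc (a + b) ^ 2 ≤ (2 * max a b) ^ 2 := by
            rw [two_mul]; gcongr; exacts [le_max_left _ _, le_max_right _ _]
        _ = 4 * (max a b) ^ 2 := by rw [mul_pow]; norm_num
        _ ≤ _ := by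
            gcongr
            rcases max_choice a b with h | h <;> rw [h]
            exacts [le_add_right le_rfl, le_add_left le_rfl]
    calc _ ≤ ∫⁻ x, 4 * (traceNorm n (fun z => mollify ρ ε (chainInt g u₀ n t x) z
              - mollify ρ 0 (chainInt g u₀ n t x) z) ^ 2
            + traceNorm n (fun z => mollify ρ ε' (chainInt g u₀ n t x) z
              - mollify ρ 0 (chainInt g u₀ n t x) z) ^ 2) := by
          refine lintegral_mono fun x => (pow_le_pow_left' (traceNorm_sub_le hW (hc ε x) (hc 0 x)
            (hc ε' x)) 2).trans ((hab _ _).trans ?_)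
          rw [traceNorm_sub_comm (mollify ρ 0 _)]
      _ = 4 * (E ε + E ε') := by
          rw [lintegral_const_mul' _ _ (by norm_num), lintegral_add_left (hmm ε)]
      _ ≤ _ := by
          rw [← mul_add, mul_pow]
          refine mul_le_mul' (by norm_num) ?_
          nth_rw 1 [← hsq (E ε), ← hsq (E ε'), add_sq]
          exact add_le_add_left (le_add_right le_rfl) _

/-- The terms of the Duhamel expansion with mollified noise converge to iterated Stratonovich
integrals. -/
lemma DuhamelData.exists_limit (D : DuhamelData g u₀ C a T) (hW : IsWhiteNoise W)
    (hQ : IsMollifiedNoise W ρ Q) (hρ : Measurable ρ) (hρ1 : Integrable ρ) (hρ2 : MemLp ρ 2 volume)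
    (n : ℕ) (ht : t < T) : ∃ v : Space d × Ω → ℝ, MemLp v 2 (volume.prod P) ∧
      Tendsto (fun ε => eLpNorm (fun z => noiseTerm (chainInt g u₀ n t) (Q ε) z - v z) 2
        (volume.prod P)) (𝓝[>] 0) (𝓝 0) ∧
      ∀ᵐ x, IsStratonovichIntegral W n (mollify ρ 0 (chainInt g u₀ n t x)) fun ω => v (x, ω) := by
  obtain ⟨e, he, heE, hcau⟩ := D.exists_cauchy hW hQ hρ hρ1 hρ2 n ht
  have hmc := D.measurable_chainInt n t
  have hic := D.integrable_chainInt n ht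
  set X : ℝ → Space d × Ω → ℝ := fun ε => noiseTerm (chainInt g u₀ n t) (Q ε) with hX
  have hXm : ∀ ε > 0, Measurable (X ε) := fun ε hε => measurable_noiseTerm hmc (hQ ε hε).1
  have hfin : ∀ ε, ∫⁻ x, traceNorm n (mollify ρ ε (chainInt g u₀ n t x)) ^ 2 ≠ ∞ := fun ε => by
    refine ne_top_of_le_ne_top ?_ (lintegral_traceNorm_mollify_le D hρ hρ1 ε t univ
      (H := chainInt g u₀ n t) fun x y => by
        rw [Measure.restrict_univ]; exact enorm_chainInt_le _ _ _ _ _)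
    exact mul_ne_top (pow_ne_top (pow_ne_top hρ1.2.ne)) (D.energyBound_ne_top n ht.le)
  have hXL : ∀ ε > 0, MemLp (X ε) 2 (volume.prod P) := fun ε hε => by
    refine ⟨(hXm ε hε).aestronglyMeasurable, ?_⟩
    have h1 := (hQ.eLpNorm_noiseTerm_sq_le hW hρ hρ2 hε hmc hic).trans_lt (hfin ε).lt_top
    exact lt_of_not_ge fun h => by simp [X, top_le_iff.1 h] at h1
  -- Scales along which the errors decay geometrically. Two errors then add up to less than `2⁻¹ ^
  -- N`, as the completeness criterion wants, and the squared errors are summable, which yields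
  -- convergence for almost every `x` and not only on average.
  have hex : ∀ k : ℕ, ∃ ε > 0, e ε ≤ (2⁻¹ : ℝ≥0∞) ^ k * 4⁻¹ := fun k => by
    obtain ⟨ε, h1, h2⟩ := ((he.eventually_le_const (show 0 < (2⁻¹ : ℝ≥0∞) ^ k * 4⁻¹ from
      ENNReal.mul_pos (by simp) (by simp))).and self_mem_nhdsWithin).exists
    exact ⟨ε, h2, h1⟩
  choose δ hδ hδe using hex
  have h4 : (4⁻¹ : ℝ≥0∞) + 4⁻¹ = 2⁻¹ := by
    rw [← two_mul, show (4 : ℝ≥0∞) = 2 * 2 by norm_num, ENNReal.mul_inv (by simp) (by simp),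
      ← mul_assoc, ENNReal.mul_inv_cancel (by simp) (by simp), one_mul]
  have hpow : ∀ {N m : ℕ}, N ≤ m → (2⁻¹ : ℝ≥0∞) ^ m ≤ 2⁻¹ ^ N := fun h =>
    pow_le_pow_right_of_le_one' (by norm_num) h
  obtain ⟨v₀, hv₀, hlim₀⟩ := Lp.cauchy_complete_eLpNorm (p := 2) (f := fun k => X (δ k))
    (B := fun k => 2⁻¹ ^ k) (by norm_num) (fun k => hXL _ (hδ k)) (by
      rw [ENNReal.tsum_geometric]; simp) (fun N k m hk hm => by
      refine (hcau _ (hδ k) _ (hδ m)).trans_lt ?_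
      calc _ ≤ (2⁻¹ : ℝ≥0∞) ^ N * 4⁻¹ + 2⁻¹ ^ N * 4⁻¹ := add_le_add
            ((hδe k).trans (mul_le_mul_left (hpow hk) _)) ((hδe m).trans (mul_le_mul_left (hpow hm) _))
        _ = 2⁻¹ ^ N * 2⁻¹ := by rw [← mul_add, h4]
        _ < 2⁻¹ ^ N * 1 := (ENNReal.mul_lt_mul_iff_right (by simp) (by finiteness)).2 (by norm_num)
        _ = _ := mul_one _)
  obtain ⟨v, hvm, hv⟩ := hv₀.1
  have hvL : MemLp v 2 (volume.prod P) := hv₀.ae_eq hv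
  have hlim : Tendsto (fun k => eLpNorm (fun z => X (δ k) z - v z) 2 (volume.prod P)) atTop
      (𝓝 0) := hlim₀.congr fun k => eLpNorm_congr_ae (by
    filter_upwards [hv] with z hz
    simp [hz])
  have hδ0 : Tendsto (fun k => e (δ k)) atTop (𝓝 0) := by
    refine tendsto_of_tendsto_of_tendsto_of_le_of_le tendsto_const_nhds ?_ (fun _ => zero_le) hδe
    simpa using ENNReal.Tendsto.mul_const (ENNReal.tendsto_pow_atTop_nhds_zero_of_lt_one
      (show (2⁻¹ : ℝ≥0∞) < 1 by norm_num)) (Or.inr (by simp : (4⁻¹ : ℝ≥0∞) ≠ ∞))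
  have hXv : ∀ ε > 0, eLpNorm (fun z => X ε z - v z) 2 (volume.prod P) ≤ e ε := fun ε hε => by
    have h1 : ∀ k, eLpNorm (fun z => X ε z - v z) 2 (volume.prod P)
        ≤ e ε + e (δ k) + eLpNorm (fun z => X (δ k) z - v z) 2 (volume.prod P) := fun k =>
      (eLpNorm_two_triangle (hXL ε hε).1 (hXL _ (hδ k)).1 hvL.1).trans
        (add_le_add_left (hcau ε hε _ (hδ k)) _)
    simpa using ge_of_tendsto' ((tendsto_const_nhds.add hδ0).add hlim) h1
  refine ⟨v, hvL, tendsto_of_tendsto_of_tendsto_of_le_of_le' tendsto_const_nhds he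
    (Eventually.of_forall fun _ => zero_le) (eventually_nhdsWithin_of_forall hXv), ?_⟩
  set A : ℕ → Space d → ℝ≥0∞ := fun k x => traceNorm n (fun z => mollify ρ (δ k)
    (chainInt g u₀ n t x) z - mollify ρ 0 (chainInt g u₀ n t x) z) ^ 2 with hA
  set B : ℕ → Space d → ℝ≥0∞ := fun k x => eLpNorm (fun ω => X (δ k) (x, ω) - v (x, ω)) 2 P ^ 2
    with hB
  have hAm : ∀ k, Measurable (A k) := fun k => measurable_traceNorm_sq
    (f := fun x z => mollify ρ (δ k) (chainInt g u₀ n t x) z - mollify ρ 0 (chainInt g u₀ n t x) z)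
    ((measurable_mollify hρ _ hmc).sub (measurable_mollify hρ 0 hmc))
  have hBm : ∀ k, Measurable (B k) := fun k => by
    simp only [hB, eLpNorm_two_sq]
    exact Measurable.lintegral_prod_right' (f := fun z : Space d × Ω => ‖X (δ k) z - v z‖ₑ ^ 2)
      ((((hXm _ (hδ k)).sub hvm.measurable).enorm).pow_const 2)
  have hsum : ∫⁻ x, ∑' k, (A k x + B k x) ≠ ∞ := by
    rw [lintegral_tsum (f := fun k x => A k x + B k x) fun k => ((hAm k).add (hBm k)).aemeasurable]
    have hle : ∀ k, ∫⁻ x, A k x + B k x ≤ 2⁻¹ ^ k := by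
      intro k
      rw [lintegral_add_left (hAm k)]
      have h2 : ∫⁻ x, B k x ≤ e (δ k) ^ 2 := by
        refine (eLpNorm_prod_sq (P := P) (F := fun z => X (δ k) z - v z)
          ((hXm _ (hδ k)).sub hvm.measurable).aestronglyMeasurable).symm.le.trans ?_
        exact pow_le_pow_left' (hXv _ (hδ k)) 2
      have h3 : e (δ k) ^ 2 ≤ 2⁻¹ ^ k * 4⁻¹ := by
        refine (pow_le_pow_left' (hδe k) 2).trans ?_
        rw [sq]
        refine mul_le_of_le_one_left zero_le (mul_le_one' ?_ (by norm_num))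
        exact pow_le_one' (by norm_num) k
      calc _ ≤ (2⁻¹ : ℝ≥0∞) ^ k * 4⁻¹ + 2⁻¹ ^ k * 4⁻¹ :=
            add_le_add ((heE _).trans h3) (h2.trans h3)
        _ = 2⁻¹ ^ k * (4⁻¹ + 4⁻¹) := by ring
        _ ≤ 2⁻¹ ^ k * 1 := by
            gcongr
            rw [h4]; norm_num
        _ = _ := mul_one _
    refine ne_top_of_le_ne_top ?_ (ENNReal.tsum_le_tsum hle)
    rw [ENNReal.tsum_geometric]; simp
  have hvx := (eLpNorm_prod_sq (P := P) hvL.1).symm.trans_ne (pow_ne_top hvL.2.ne)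
  have hvxm : Measurable fun x => eLpNorm (fun ω => v (x, ω)) 2 P ^ 2 := by
    simp only [eLpNorm_two_sq]
    exact Measurable.lintegral_prod_right' (f := fun z : Space d × Ω => ‖v z‖ₑ ^ 2)
      (hvm.measurable.enorm.pow_const 2)
  have hsq : ∀ {ι : Type} {F : Filter ι} {c : ι → ℝ≥0∞}, Tendsto (fun i => c i ^ 2) F (𝓝 0) →
      Tendsto c F (𝓝 0) := fun h => by
    have := h.ennrpow_const (1 / 2 : ℝ)
    rw [ENNReal.zero_rpow_of_pos (by norm_num)] at this
    refine this.congr fun i => ?_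
    rw [← rpow_natCast, ← rpow_mul]; norm_num
  filter_upwards [ae_lt_top (Measurable.tsum fun k => (hAm k).add (hBm k)) hsum,
    ae_lt_top (measurable_traceNorm_sq (f := fun x => mollify ρ 0 (chainInt g u₀ n t x))
      (measurable_mollify hρ 0 hmc)) (hfin 0), ae_lt_top hvxm hvx] with x h1 h2 h3
  have h0 := ENNReal.tendsto_atTop_zero_of_tsum_ne_top h1.ne
  have hAx : Tendsto (fun k => A k x) atTop (𝓝 0) := tendsto_of_tendsto_of_tendsto_of_le_of_le
    tendsto_const_nhds h0 (fun _ => zero_le) fun k => le_add_right le_rfl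
  have hBx : Tendsto (fun k => B k x) atTop (𝓝 0) := tendsto_of_tendsto_of_tendsto_of_le_of_le
    tendsto_const_nhds h0 (fun _ => zero_le) fun k => le_add_left le_rfl
  refine isStratonovichIntegral_of_tendsto hW (F := atTop) (X := fun k ω => X (δ k) (x, ω))
    (f := fun k => mollify ρ (δ k) (chainInt g u₀ n t x))
    (fun k => ((hXm _ (hδ k)).comp measurable_prodMk_left).aestronglyMeasurable)
    (fun k => D.continuous_mollify_chainInt hρ1 n ht _ x)
    (D.continuous_mollify_chainInt hρ1 n ht _ x) (fun h => by rw [h] at h2; simp at h2)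
    ⟨(hvm.measurable.comp measurable_prodMk_left).aestronglyMeasurable,
      lt_of_not_ge fun h => by rw [top_le_iff.1 h] at h3; simp at h3⟩ (fun k S => ?_) (hsq hAx) ?_
  · have := (hQ.isChaos hρ hρ2 (hδ k) (hic x)).eLpNorm_sub_integral_le hW S
    rwa [chaosFun_mollifier (hδ k)] at this
  · simp only [eLpNorm_two_sub_comm (fun ω => v (x, ω))]
    exact hsq hBx

end

/-! ### Schur's test, short-time propagation and uniformity in time. -/

lemma sq_lintegral_mul_le {X : Type*} [MeasurableSpace X] {μ : Measure X} {f h : X → ℝ≥0∞}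
    (hf : Measurable f) (hh : Measurable h) :
    (∫⁻ x, f x * h x ∂μ) ^ 2 ≤ (∫⁻ x, f x ∂μ) * ∫⁻ x, f x * h x ^ 2 ∂μ := by
  have hs : ∀ b : ℝ≥0∞, (b ^ (1 / 2 : ℝ)) ^ (2 : ℝ) = b := fun b => by rw [← rpow_mul]; norm_num
  have hs' : ∀ b : ℝ≥0∞, b ^ (1 / 2 : ℝ) * b ^ (1 / 2 : ℝ) = b := fun b => by
    rw [← ENNReal.rpow_add_of_nonneg _ _ (by norm_num) (by norm_num)]; norm_num
  have h1 := ENNReal.lintegral_mul_le_Lp_mul_Lq μ (Real.holderConjugate_iff.2 ⟨by norm_num,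
    by norm_num⟩ : (2 : ℝ).HolderConjugate 2) (f := fun x => f x ^ (1 / 2 : ℝ))
    (g := fun x => f x ^ (1 / 2 : ℝ) * h x) (hf.pow_const _).aemeasurable
    ((hf.pow_const _).mul hh).aemeasurable
  simp only [Pi.mul_apply, ← mul_assoc, hs', ENNReal.mul_rpow_of_nonneg _ _ zero_le_two, hs] at h1
  have h2 := pow_le_pow_left' h1 2
  rw [mul_pow, ← rpow_natCast, ← rpow_natCast, ← rpow_natCast, ← rpow_mul, ← rpow_mul] at h2
  norm_num at h2
  exact h2

/-- Schur's test. -/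
lemma lintegral_sq_kernel_le {k : Space d → Space d → ℝ} (hk : Measurable (uncurry k)) {C : ℝ≥0∞}
    (h1 : ∀ x, ∫⁻ y, ‖k x y‖ₑ ≤ C) (h2 : ∀ y, ∫⁻ x, ‖k x y‖ₑ ≤ C) {F : Space d × Ω → ℝ}
    (hF : Measurable F) : ∫⁻ z, (∫⁻ y, ‖k z.1 y‖ₑ * ‖F (y, z.2)‖ₑ) ^ 2 ∂(volume.prod P)
      ≤ C ^ 2 * ∫⁻ z, ‖F z‖ₑ ^ 2 ∂(volume.prod P) := by
  have hm : Measurable fun z : (Space d × Ω) × Space d => ‖k z.1.1 z.2‖ₑ * ‖F (z.2, z.1.2)‖ₑ ^ 2 := by fun_prop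
  calc _ ≤ ∫⁻ z : Space d × Ω, C * ∫⁻ y, ‖k z.1 y‖ₑ * ‖F (y, z.2)‖ₑ ^ 2 ∂volume ∂(volume.prod P) := by
        refine lintegral_mono fun z => (sq_lintegral_mul_le (hk.comp measurable_prodMk_left).enorm
          (hF.comp (f := fun y => (y, z.2)) (by fun_prop)).enorm).trans ?_
        exact mul_le_mul_left (h1 _) _
    _ = C * ∫⁻ ω, ∫⁻ x, ∫⁻ y, ‖k x y‖ₑ * ‖F (y, ω)‖ₑ ^ 2 ∂volume ∂volume ∂P := by
        rw [lintegral_const_mul _ hm.lintegral_prod_right',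
          lintegral_prod_symm' _ hm.lintegral_prod_right']
    _ ≤ C * ∫⁻ ω, ∫⁻ y, C * ‖F (y, ω)‖ₑ ^ 2 ∂volume ∂P := by
        refine mul_le_mul_right (lintegral_mono fun ω => ?_) _
        rw [lintegral_lintegral_swap (f := fun x y => ‖k x y‖ₑ * ‖F (y, ω)‖ₑ ^ 2)
          (hm.comp (f := fun z : Space d × Space d => ((z.1, ω), z.2)) (by fun_prop)).aemeasurable]
        refine lintegral_mono fun y => ?_
        have hky : Measurable fun x => ‖k x y‖ₑ := by fun_prop
        rw [lintegral_mul_const _ hky]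
        exact mul_le_mul_left (h2 y) _
    _ = _ := by
        have : Measurable fun z : Space d × Ω => C * ‖F z‖ₑ ^ 2 := by fun_prop
        rw [← lintegral_prod_symm' (fun z : Space d × Ω => C * ‖F z‖ₑ ^ 2) this,
          lintegral_const_mul _ (hF.enorm.pow_const 2), ← mul_assoc, sq]

section

variable {v₀ : Space d → ℝ} {V : Space d → Ω → ℝ}

/-- A jointly measurable random field with bounded moments. -/
structure HasMoments (P : Measure Ω) (V : Space d → Ω → ℝ) : Prop where
  measurable : Measurable (uncurry V)
  moment : ∀ n : ℕ, ∃ K : ℝ≥0∞, K ≠ ∞ ∧ ∀ y : Fin n → Space d, ∫⁻ ω, ∏ i, ‖V (y i) ω‖ₑ ∂P ≤ K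

/-- By Tonelli and the moment bound the expectation is finite at every `x`. So all Duhamel integrals
converge absolutely at almost every sample, and Fubini may be used there. -/
lemma HasMoments.ae_lintegral_ne_top (hV : HasMoments P V) {H : Space d → (Fin n → Space d) → ℝ≥0∞}
    (hH : Measurable (uncurry H)) {L : ℝ≥0∞} (hL : L ≠ ∞) (hHL : ∀ x, ∫⁻ y, H x y ≤ L) :
    ∀ᵐ z ∂(volume.prod P), ∫⁻ y, H z.1 y * ∏ i, ‖V (y i) z.2‖ₑ ≠ ∞ := by
  obtain ⟨K, hK, hVK⟩ := hV.moment n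
  have hp : Measurable fun z : Ω × (Fin n → Space d) => ∏ i, ‖V (z.2 i) z.1‖ₑ :=
    measurable_fun_prod _ fun i _ => (hV.measurable.comp
      (f := fun z : Ω × (Fin n → Space d) => (z.2 i, z.1)) (by fun_prop)).enorm
  have hm : Measurable fun z : (Space d × Ω) × (Fin n → Space d) =>
      H z.1.1 z.2 * ∏ i, ‖V (z.2 i) z.1.2‖ₑ :=
    (hH.comp (f := fun z : (Space d × Ω) × (Fin n → Space d) => (z.1.1, z.2)) (by fun_prop)).mul
      (hp.comp (f := fun z : (Space d × Ω) × (Fin n → Space d) => (z.1.2, z.2)) (by fun_prop))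
  have hJ := hm.lintegral_prod_right' (ν := volume)
  have hs : MeasurableSet {z : Space d × Ω | ¬ ∫⁻ y, H z.1 y * ∏ i, ‖V (y i) z.2‖ₑ ≠ ∞} :=
    (hJ (measurableSet_singleton ∞).compl).compl
  refine ae_iff.2 ((Measure.measure_prod_null hs).2 (ae_of_all _ fun x => ?_))
  have hx : ∫⁻ ω, ∫⁻ y, H x y * ∏ i, ‖V (y i) ω‖ₑ ∂volume ∂P ≠ ∞ := by
    rw [lintegral_lintegral_swap (f := fun ω y => H x y * ∏ i, ‖V (y i) ω‖ₑ)
      (hm.comp (f := fun z : Ω × (Fin n → Space d) => ((x, z.1), z.2)) (by fun_prop)).aemeasurable]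
    refine ne_top_of_le_ne_top (mul_ne_top hL hK) ?_
    calc _ ≤ ∫⁻ y, H x y * K := lintegral_mono fun y => by
          have hpy : Measurable fun ω => ∏ i, ‖V (y i) ω‖ₑ := hp.comp (f := fun ω => (ω, y)) (by fun_prop)
          rw [lintegral_const_mul _ hpy]
          exact mul_le_mul_right (hVK y) _
      _ ≤ L * K := by
          have hHx : Measurable (H x) := by fun_prop
          rw [lintegral_mul_const _ hHx]
          exact mul_le_mul_left (hHL x) _
  exact ae_iff.1 ((ae_lt_top (by fun_prop) hx).mono fun ω h => h.ne)

lemma IsMollifiedNoise.hasMoments (hW : IsWhiteNoise W) (hQ : IsMollifiedNoise W ρ Q)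
    (hρ2 : MemLp ρ 2 volume) (hε : 0 < ε) : HasMoments P (Q ε) := by
  refine ⟨(hQ ε hε).1, fun n => ⟨ofReal (1 + (Finset.univ : Finset (Fin n)).card *
    ((eLpNorm (fun u => (ε ^ d)⁻¹ * ρ (ε⁻¹ • u)) 2 volume).toReal ^ (Finset.univ : Finset (Fin n)).card
      * gaussianMoment (Finset.univ : Finset (Fin n)).card)), ofReal_ne_top, fun y => ?_⟩⟩
  have hL := fun i => memLp_mollifier hρ2 hε (y i)
  have h1 := integral_abs_prod_whiteNoise_le hW Finset.univ (fun i => (hL i).toLp _)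
    fun i _ => (by rw [Lp.norm_toLp, eLpNorm_mollifier hρ2 hε] :
      _ ≤ (eLpNorm (fun u => (ε ^ d)⁻¹ * ρ (ε⁻¹ • u)) 2 volume).toReal)
  refine le_trans (le_of_eq ?_) (ofReal_le_ofReal h1)
  rw [ofReal_integral_eq_lintegral_ofReal (integrable_prod_whiteNoise hW _ _).abs
    (ae_of_all _ fun _ => abs_nonneg _)]
  refine lintegral_congr_ae ?_
  filter_upwards [ae_all_iff.2 fun i => (hQ ε hε).2 (y i)] with ω hω
  rw [← enorm_prod_real, Real.enorm_eq_ofReal_abs]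
  simp only [hω]
  congr 3
  funext i
  exact congrFun (dif_pos (hL i)) ω

lemma DuhamelData.exists_lintegral_absChain_le (D : DuhamelData g u₀ C a T) (n : ℕ) (ht : t < T) :
    ∃ L : ℝ≥0∞, L ≠ ∞ ∧ ∀ x, ∫⁻ y : Fin n → Space d, absChain g u₀ n t x y ≤ L := by
  obtain ⟨K, hK, h⟩ := StratSPDE.exists_lintegral_absChain_le D.kernel D.nonneg D.lt_one D.measurable
    D.integrable n
  exact ⟨_, mul_ne_top hK (oldWeight_ne_top _ _ _ _), h t ht⟩

lemma DuhamelData.measurable_absChain (D : DuhamelData g u₀ C a T) (n : ℕ) (t : ℝ) :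
    Measurable (uncurry (absChain g u₀ n t)) :=
  D.kernel.measurable_absChain D.measurable

lemma DuhamelData.duhamelTerm_ae_eq (D : DuhamelData (greenCutoff G T) u₀ C a T)
    (hv : v₀ =ᵐ[volume] u₀) (hV : HasMoments P V) (n : ℕ) (ht0 : 0 < t) (ht : t < T) :
    (fun z : Space d × Ω => duhamelTerm G v₀ (fun y => V y z.2) n t z.1)
      =ᵐ[volume.prod P] noiseTerm (chainInt (greenCutoff G T) u₀ n t) V := by
  obtain ⟨L, hL, h⟩ := D.exists_lintegral_absChain_le n ht
  filter_upwards [hV.ae_lintegral_ne_top (D.measurable_absChain n t) hL h] with z hz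
  exact duhamelTerm_eq D.kernel D.nonneg D.lt_one D.measurable D.integrable hv
    (hV.measurable.comp measurable_prodMk_right) n ht0 ht z.1 hz

lemma DuhamelData.lintegral_kernel_absChain_le (D : DuhamelData g u₀ C a T) (r : ℝ) {L : ℝ≥0∞}
    (h : ∀ x, ∫⁻ y : Fin n → Space d, absChain g u₀ n t x y ≤ L) :
    (Measurable fun z : (Space d × (Fin n → Space d)) × Space d =>
      ‖g r z.1.1 z.2‖ₑ * absChain g u₀ n t z.2 z.1.2) ∧ ∀ x, ∫⁻ y : Fin n → Space d,
      ∫⁻ w, ‖g r x w‖ₑ * absChain g u₀ n t w y ≤ C * L := by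
  have hgr : Measurable (uncurry (g r)) := (D.kernel.continuous r).measurable
  have hA := D.measurable_absChain n t
  have hm0 : Measurable fun z : (Space d × (Fin n → Space d)) × Space d =>
      ‖g r z.1.1 z.2‖ₑ * absChain g u₀ n t z.2 z.1.2 :=
    (hgr.comp (f := fun z : (Space d × (Fin n → Space d)) × Space d => (z.1.1, z.2))
      (by fun_prop)).enorm.mul (by fun_prop)
  refine ⟨hm0, fun x => ?_⟩
  rw [lintegral_lintegral_swap (f := fun y w => ‖g r x w‖ₑ * absChain g u₀ n t w y)
    (hm0.comp (f := fun z : (Fin n → Space d) × Space d => ((x, z.1), z.2))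
      (by fun_prop)).aemeasurable]
  have hgx : Measurable fun w => ‖g r x w‖ₑ := (hgr.comp (f := fun w => (x, w)) (by fun_prop)).enorm
  refine le_trans (lintegral_mono (g := fun w => ‖g r x w‖ₑ * L) fun w => ?_) ?_
  · have hmw : Measurable fun y => absChain g u₀ n t w y := hA.comp (f := fun y => (w, y)) (by fun_prop)
    dsimp only
    rw [lintegral_const_mul _ hmw]
    exact mul_le_mul_right (h w) _
  · rw [lintegral_mul_const _ hgx]
    exact mul_le_mul_left ((D.kernel.l1_le r x).trans (newWeight_le C T r)) _

/-- The identity `chainInt_semigroup`, integrated against products of the potential; the moments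
justify exchanging the operator with this integral for almost every sample. -/
lemma DuhamelData.noiseTerm_semigroup (D : DuhamelData g u₀ C a T) (hV : HasMoments P V)
    (hsg : ∀ r t, 0 < r → 0 < t → r + t < T → ∀ x y, ∫ z, g r x z * g t z y = g (r + t) x y) {r : ℝ}
    (hr : 0 < r) (htr : t + r < T) :
    ∀ᵐ z ∂(volume.prod P), noiseTerm (chainInt g u₀ (n + 1) (t + r)) V z
      = (∫ y, g r z.1 y * noiseTerm (chainInt g u₀ (n + 1) t) V (y, z.2))
      + noiseTerm (chainIntOn g u₀ (n + 1) {s | t + r - s 0 < r} (t + r)) V z := by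
  have ht : t < T := by linarith
  obtain ⟨L, hL, h⟩ := D.exists_lintegral_absChain_le (n + 1) ht
  obtain ⟨L', hL', h'⟩ := D.exists_lintegral_absChain_le (n + 1) htr
  have hgr : Measurable (uncurry (g r)) := (D.kernel.continuous r).measurable
  obtain ⟨hm0, hgL⟩ := D.lintegral_kernel_absChain_le r h
  have hmg : Measurable (uncurry fun (x : Space d) (y : Fin (n + 1) → Space d) =>
      ∫⁻ w, ‖g r x w‖ₑ * absChain g u₀ (n + 1) t w y) := by fun_prop
  filter_upwards [hV.ae_lintegral_ne_top hmg (mul_ne_top coe_ne_top hL) hgL,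
    hV.ae_lintegral_ne_top (D.measurable_absChain (n + 1) (t + r)) hL' h'] with z h1 h2
  obtain ⟨x, ω⟩ := z
  have hVm : Measurable fun y : Fin (n + 1) → Space d => ∏ i, V (y i) ω :=
    measurable_fun_prod _ fun i _ => hV.measurable.comp
      (f := fun y : Fin (n + 1) → Space d => (y i, ω)) (by fun_prop)
  have hcm : Measurable (uncurry (chainInt g u₀ (n + 1) t)) := D.measurable_chainInt _ _
  set F : (Fin (n + 1) → Space d) → Space d → ℝ := fun y w =>
    g r x w * chainInt g u₀ (n + 1) t w y * ∏ i, V (y i) ω with hF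
  have hFm : Measurable (uncurry F) :=
    ((hgr.comp (f := fun z : (Fin (n + 1) → Space d) × Space d => (x, z.2)) (by fun_prop)).mul
      (by fun_prop)).mul (hVm.comp measurable_fst)
  have hFi : Integrable (uncurry F) (volume.prod volume) := by
    refine ⟨hFm.aestronglyMeasurable, lt_of_le_of_lt ?_ (lt_top_iff_ne_top.2 h1)⟩
    rw [lintegral_prod _ hFm.enorm.aemeasurable]
    refine lintegral_mono fun y => ?_
    have hm1 : Measurable fun w => ‖g r x w‖ₑ * absChain g u₀ (n + 1) t w y :=
      hm0.comp (f := fun w => ((x, y), w)) (by fun_prop)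
    rw [← lintegral_mul_const _ hm1]
    refine lintegral_mono fun w => ?_
    simp only [uncurry, hF, enorm_mul, enorm_prod_real]
    exact mul_le_mul_left (mul_le_mul_right (enorm_chainInt_le _ _ _ _ _) _) _
  have hi2 : Integrable fun y => chainIntOn g u₀ (n + 1) {s | t + r - s 0 < r} (t + r) x y
      * ∏ i, V (y i) ω := by
    refine ⟨((D.kernel.measurable_chainIntOn D.measurable _).mul hVm).aestronglyMeasurable, lt_of_le_of_lt ?_ (lt_top_iff_ne_top.2 h2)⟩
    refine lintegral_mono fun y => ?_
    rw [enorm_mul, enorm_prod_real]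
    exact mul_le_mul_left (enorm_chainIntOn_le_absChain _ _ _ _) _
  simp only [noiseTerm]
  have e1 : ∀ y, chainInt g u₀ (n + 1) (t + r) x y * ∏ i, V (y i) ω = (∫ w, F y w)
      + chainIntOn g u₀ (n + 1) {s | t + r - s 0 < r} (t + r) x y * ∏ i, V (y i) ω := fun y => by
    rw [chainInt_semigroup D.kernel D.nonneg D.lt_one D.measurable D.integrable hsg hr htr,
      add_mul, integral_mul_const]
  simp only [e1]
  have hi1 : Integrable fun y => ∫ w, F y w := hFi.integral_prod_left
  rw [integral_add hi1 hi2, integral_integral_swap hFi]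
  congr 1
  refine integral_congr_ae (ae_of_all _ fun w => ?_)
  simp only [hF, mul_assoc]
  rw [integral_const_mul]

end

section

variable {v₀ : Space d → ℝ}

/-- The bound for chains with first increment below `r` is quadratic in the integrals of the weights
over `(0, r)`. These tend to zero because the weights are integrable, and `t` does not enter. -/
lemma exists_energyBound_le (ha : a < 1) (C : ℝ≥0) (T : ℝ) {U N : ℝ≥0∞} (hU : U ≠ ∞) (hN : N ≠ ∞)
    (n : ℕ) {η : ℝ≥0∞} (hη : η ≠ 0) : ∃ δ > 0, ∀ r ≤ δ, ∀ t,
      (N ^ (n + 1)) ^ 2 * energyBound C a T U (n + 1) t {s | t - s 0 < r} ≤ η ^ 2 := by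
  have hnew : ∫⁻ τ, newWeight C T τ ≠ ∞ := by
    simp only [newWeight]
    rw [lintegral_indicator_const measurableSet_Ioo]
    exact mul_ne_top coe_ne_top measure_Ioo_lt_top.ne
  have hold := lintegral_oldWeight_ne_top (C := C) (T := T) ha
  set M : ℝ≥0∞ := C + (∫⁻ τ, newWeight C T τ) + ∫⁻ τ, oldWeight C a T τ with hM
  have hMfin : M ≠ ∞ := by finiteness
  have hcut : ∀ (w : ℝ → ℝ≥0∞) (r : ℝ), (∀ τ, τ ∉ Ioo 0 T → w τ = 0) →
      ∫⁻ τ in Iio r, w τ = ∫⁻ τ in Ioo 0 r, w τ := fun w r hw => by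
    rw [← lintegral_indicator measurableSet_Iio, ← lintegral_indicator measurableSet_Ioo]
    refine lintegral_congr fun τ => ?_
    by_cases h0 : 0 < τ
    · by_cases hr : τ < r
      · rw [indicator_of_mem (show τ ∈ Iio r from hr), indicator_of_mem (show τ ∈ Ioo 0 r from ⟨h0, hr⟩)]
      · rw [indicator_of_notMem (show τ ∉ Iio r from hr),
          indicator_of_notMem (show τ ∉ Ioo 0 r from fun h => hr h.2)]
    · rw [indicator_of_notMem (show τ ∉ Ioo 0 r from fun h => h0 h.1)]
      exact indicator_apply_eq_zero.2 fun _ => hw τ fun h => h0 h.1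
  set c : ℝ → ℝ≥0∞ := fun r => (∫⁻ τ in Ioo 0 r, newWeight C T τ) + ∫⁻ τ in Ioo 0 r, oldWeight C a T τ
    with hc
  have hc0 : Tendsto c (𝓝[>] 0) (𝓝 0) := by
    have hv : Tendsto (volume ∘ fun r : ℝ => Ioo 0 r) (𝓝[>] 0) (𝓝 0) := by
      have h1 : Tendsto (fun r : ℝ => ofReal r) (𝓝[>] 0) (𝓝 (ofReal 0)) :=
        (ENNReal.continuous_ofReal.tendsto 0).mono_left nhdsWithin_le_nhds
      rw [ENNReal.ofReal_zero] at h1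
      exact h1.congr fun r => by simp
    have := (tendsto_setLIntegral_zero hnew hv).add (tendsto_setLIntegral_zero hold hv)
    rwa [add_zero] at this
  set K : ℝ≥0∞ := (N ^ (n + 1)) ^ 2 * (Fintype.card (Pairing (n + 1 + (n + 1)))
    * (U * (2 * (M ^ (n + 1)) ^ 2))) with hK
  have hKfin : K ≠ ∞ := by finiteness
  have hlim : Tendsto (fun r => K * c r ^ 2) (𝓝[>] 0) (𝓝 0) := by
    have := ENNReal.Tendsto.const_mul (ENNReal.Tendsto.pow (n := 2) hc0) (Or.inr hKfin)
    simpa using this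
  obtain ⟨δ, h1, h2⟩ := ((hlim.eventually_le_const (pos_iff_ne_zero.2 (pow_ne_zero 2 hη))).and
    self_mem_nhdsWithin).exists
  refine ⟨δ, h2, fun r hr t => le_trans ?_ h1⟩
  have hle : ∀ w : ℝ → ℝ≥0∞, (∀ τ, τ ∉ Ioo 0 T → w τ = 0) →
      ∫⁻ τ in Iio r, w τ ≤ ∫⁻ τ in Ioo 0 δ, w τ := fun w hw => by
    rw [hcut w r hw]; exact lintegral_mono_set (Ioo_subset_Ioo_right hr)
  have hp := fun l : Pairing (n + 1 + (n + 1)) => lintegral_pairBound_restrict_le (l := l) (C := C)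
    (a := a) (T := T) (δ := c δ) (M := M) (r := r) (le_add_right (le_add_left le_rfl))
    (le_add_left le_rfl)
    ((hle _ fun τ h => indicator_of_notMem h _).trans (le_add_right le_rfl))
    ((hle _ fun τ h => indicator_of_notMem h _).trans (le_add_left le_rfl))
    (le_add_right (le_add_right le_rfl)) t
  calc _ ≤ (N ^ (n + 1)) ^ 2 * ∑ l : Pairing (n + 1 + (n + 1)), U * (2 * (c δ * M ^ (n + 1)) ^ 2) :=
        mul_le_mul_right (sum_le_sum fun l _ => mul_le_mul_right (hp l) _) _
    _ = _ := by rw [Finset.sum_const, card_univ, nsmul_eq_mul, hK]; ring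

/-- The square integrability of the terms of the Duhamel expansion with mollified noise. -/
lemma DuhamelData.memLp_noiseTerm (D : DuhamelData g u₀ C a T) (hW : IsWhiteNoise W)
    (hQ : IsMollifiedNoise W ρ Q) (hρ : Measurable ρ) (hρ1 : Integrable ρ) (hρ2 : MemLp ρ 2 volume)
    (hε : 0 < ε) (ht : t < T) (S : Set (Fin n → ℝ)) {H : Space d → (Fin n → Space d) → ℝ}
    (hm : Measurable (uncurry H))
    (hH : ∀ x y, ‖H x y‖ₑ ≤ ∫⁻ s in S, ∫⁻ w, ‖chainDensity g u₀ n t x s w y‖ₑ) :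
    MemLp (noiseTerm H (Q ε)) 2 (volume.prod P) ∧ eLpNorm (noiseTerm H (Q ε)) 2 (volume.prod P) ^ 2
      ≤ ((∫⁻ x, ‖ρ x‖ₑ) ^ n) ^ 2 * energyBound C a T (∫⁻ x, ‖u₀ x‖ₑ ^ 2) n t S := by
  have h1 := (hQ.eLpNorm_noiseTerm_sq_le hW hρ hρ2 hε hm (D.integrable_of_le ht hm fun x y =>
    (hH x y).trans (setLIntegral_le_lintegral _ _))).trans
    (lintegral_traceNorm_mollify_le D hρ hρ1 ε t S hH)
  refine ⟨⟨(measurable_noiseTerm hm (hQ ε hε).1).aestronglyMeasurable, ?_⟩, h1⟩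
  have hfin : energyBound C a T (∫⁻ x, ‖u₀ x‖ₑ ^ 2) n t S ≠ ∞ := by
    refine ne_top_of_le_ne_top (D.energyBound_ne_top n ht.le) (sum_le_sum fun l _ =>
      mul_le_mul_right ?_ _)
    rw [Measure.restrict_univ]
    exact (setLIntegral_le_lintegral _ _).trans (lintegral_mono fun s => setLIntegral_le_lintegral _ _)
  have h2 := h1.trans_lt (mul_ne_top (pow_ne_top (pow_ne_top hρ1.2.ne)) hfin).lt_top
  exact lt_of_not_ge fun h => by simp [top_le_iff.1 h] at h2

lemma DuhamelData.memLp_chainInt (D : DuhamelData g u₀ C a T) (hW : IsWhiteNoise W)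
    (hQ : IsMollifiedNoise W ρ Q) (hρ : Measurable ρ) (hρ1 : Integrable ρ) (hρ2 : MemLp ρ 2 volume)
    (n : ℕ) (hε : 0 < ε) (ht : t < T) :
    MemLp (noiseTerm (chainInt g u₀ n t) (Q ε)) 2 (volume.prod P) ∧
    eLpNorm (noiseTerm (chainInt g u₀ n t) (Q ε)) 2 (volume.prod P) ^ 2
      ≤ ((∫⁻ x, ‖ρ x‖ₑ) ^ n) ^ 2 * energyBound C a T (∫⁻ x, ‖u₀ x‖ₑ ^ 2) n t univ :=
  D.memLp_noiseTerm hW hQ hρ hρ1 hρ2 hε ht univ (D.measurable_chainInt n t) fun x y => by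
    rw [Measure.restrict_univ]; exact enorm_chainInt_le _ _ _ _ _

/-- Propagation of the difference between two regularizations over a short time. -/
lemma DuhamelData.eLpNorm_noiseTerm_sub_le (D : DuhamelData g u₀ C a T) (hW : IsWhiteNoise W)
    (hQ : IsMollifiedNoise W ρ Q) (hρ : Measurable ρ) (hρ1 : Integrable ρ) (hρ2 : MemLp ρ 2 volume)
    (hsg : ∀ r t, 0 < r → 0 < t → r + t < T → ∀ x y, ∫ z, g r x z * g t z y = g (r + t) x y)
    {ε' : ℝ} (hε : 0 < ε) (hε' : 0 < ε') {r : ℝ} (hr : 0 < r) (htr : t + r < T) {η : ℝ≥0∞}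
    (hη : ((∫⁻ x, ‖ρ x‖ₑ) ^ (n + 1)) ^ 2 * energyBound C a T (∫⁻ x, ‖u₀ x‖ₑ ^ 2) (n + 1) (t + r)
      {s | t + r - s 0 < r} ≤ η ^ 2) :
    eLpNorm (fun z => noiseTerm (chainInt g u₀ (n + 1) (t + r)) (Q ε) z
      - noiseTerm (chainInt g u₀ (n + 1) (t + r)) (Q ε') z) 2 (volume.prod P)
      ≤ C * eLpNorm (fun z => noiseTerm (chainInt g u₀ (n + 1) t) (Q ε) z
        - noiseTerm (chainInt g u₀ (n + 1) t) (Q ε') z) 2 (volume.prod P) + (η + η) := by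
  have ht : t < T := by linarith
  set S : Set (Fin (n + 1) → ℝ) := {s | t + r - s 0 < r} with hS
  set X : ℝ → Space d × Ω → ℝ := fun ε => noiseTerm (chainInt g u₀ (n + 1) t) (Q ε) with hX
  set R : ℝ → Space d × Ω → ℝ := fun ε => noiseTerm (chainIntOn g u₀ (n + 1) S (t + r)) (Q ε) with hR
  have hXm : ∀ {ε}, 0 < ε → Measurable (X ε) := fun hε =>
    measurable_noiseTerm (D.measurable_chainInt _ _) (hQ _ hε).1
  have hRη : ∀ {ε}, 0 < ε → MemLp (R ε) 2 (volume.prod P) ∧ eLpNorm (R ε) 2 (volume.prod P) ≤ η :=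
    fun hε => by
      obtain ⟨h1, h2⟩ := D.memLp_noiseTerm hW hQ hρ hρ1 hρ2 hε htr S
        (H := chainIntOn g u₀ (n + 1) S (t + r)) (D.kernel.measurable_chainIntOn D.measurable _) fun x y => enorm_chainIntOn_le _ _ _ _
      exact ⟨h1, (pow_le_pow_left_iff (by norm_num)).1 (h2.trans hη)⟩
  have hgr : Measurable (uncurry (g r)) := (D.kernel.continuous r).measurable
  have hg1 : ∀ x, ∫⁻ y, ‖g r x y‖ₑ ≤ C := fun x => (D.kernel.l1_le r x).trans (newWeight_le C T r)
  have hg2 : ∀ y, ∫⁻ x, ‖g r x y‖ₑ ≤ C := fun y => by simp only [D.kernel.symm r _ y]; exact hg1 y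
  have hop : ∀ F : Space d × Ω → ℝ, Measurable F → Measurable fun z : Space d × Ω =>
      ∫ y, g r z.1 y * F (y, z.2) := fun F hF => by
    refine (StronglyMeasurable.integral_prod_right' (f := fun z : (Space d × Ω) × Space d =>
      g r z.1.1 z.2 * F (z.2, z.1.2)) (Measurable.stronglyMeasurable ?_)).measurable
    exact (hgr.comp (f := fun z : (Space d × Ω) × Space d => (z.1.1, z.2)) (by fun_prop)).mul
      (hF.comp (f := fun z : (Space d × Ω) × Space d => (z.2, z.1.2)) (by fun_prop))
  have hint : ∀ {ε}, 0 < ε → ∀ᵐ z ∂(volume.prod P), Integrable fun y => g r z.1 y * X ε (y, z.2) := by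
    intro ε hε
    have hfin : ∫⁻ z, (∫⁻ y, ‖g r z.1 y‖ₑ * ‖X ε (y, z.2)‖ₑ) ^ 2 ∂(volume.prod P) ≠ ∞ := by
      refine ne_top_of_le_ne_top ?_ (lintegral_sq_kernel_le hgr hg1 hg2 (hXm hε))
      rw [← eLpNorm_two_sq]
      exact mul_ne_top (by finiteness)
        (pow_ne_top (D.memLp_chainInt hW hQ hρ hρ1 hρ2 _ hε ht).1.2.ne)
    have hm : Measurable fun z : Space d × Ω => ∫⁻ y, ‖g r z.1 y‖ₑ * ‖X ε (y, z.2)‖ₑ := by fun_prop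
    filter_upwards [ae_lt_top (hm.pow_const 2) hfin] with z hz
    refine ⟨((hgr.comp measurable_prodMk_left).mul ((hXm hε).comp
      (f := fun y => (y, z.2)) (by fun_prop))).aestronglyMeasurable, ?_⟩
    simp only [HasFiniteIntegral, enorm_mul]
    exact lt_of_not_ge fun h => by simp [top_le_iff.1 h] at hz
  -- The Green's operator at time `r`, applied to the earlier difference, plus one short-time
  -- remainder for each scale. Schur's test bounds the first by `C`, and the remainders are at most
  -- `η` each.
  have hsplit : (fun z => noiseTerm (chainInt g u₀ (n + 1) (t + r)) (Q ε) z
      - noiseTerm (chainInt g u₀ (n + 1) (t + r)) (Q ε') z) =ᵐ[volume.prod P]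
      (fun z => ∫ y, g r z.1 y * (X ε (y, z.2) - X ε' (y, z.2))) + (R ε - R ε') := by
    filter_upwards [hint hε, hint hε', D.noiseTerm_semigroup (hQ.hasMoments hW hρ2 hε) hsg hr htr,
      D.noiseTerm_semigroup (hQ.hasMoments hW hρ2 hε') hsg hr htr] with z h1 h2 h3 h4
    rw [h3, h4]
    simp only [Pi.add_apply, Pi.sub_apply, mul_sub]
    rw [integral_sub h1 h2]
    simp only [X, R]
    ring
  rw [eLpNorm_congr_ae hsplit]
  have hdm : Measurable fun z => X ε z - X ε' z := by fun_prop
  refine (eLpNorm_add_le (hop _ hdm).aestronglyMeasurable ((hRη hε).1.1.sub (hRη hε').1.1)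
    (by norm_num)).trans (add_le_add ?_ ((eLpNorm_sub_le (hRη hε).1.1 (hRη hε').1.1
    (by norm_num)).trans (add_le_add (hRη hε).2 (hRη hε').2)))
  refine (pow_le_pow_left_iff (n := 2) (by norm_num)).1 ?_
  rw [mul_pow, eLpNorm_two_sq, eLpNorm_two_sq]
  refine le_trans (lintegral_mono fun z => pow_le_pow_left' ?_ 2)
    (lintegral_sq_kernel_le hgr hg1 hg2 hdm)
  refine (enorm_integral_le_lintegral_enorm _).trans (le_of_eq ?_)
  simp only [enorm_mul]
  rfl

/-- Convergence at each time is uniform in time. -/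
lemma tendsto_iSup_of_propagation {F : Filter ℝ} {N : ℝ → ℝ → ℝ≥0∞} {C : ℝ≥0∞} (hC : C ≠ ∞)
    (hlim : ∀ t ∈ Icc 0 T, Tendsto (fun ε => N ε t) F (𝓝 0))
    (hstep : ∀ η : ℝ≥0∞, η ≠ 0 → ∃ δ > 0, ∀ᶠ ε in F, ∀ t r, 0 ≤ t → 0 < r → r ≤ δ → t + r ≤ T →
      N ε (t + r) ≤ C * N ε t + η) :
    Tendsto (fun ε => ⨆ t ∈ Icc 0 T, N ε t) F (𝓝 0) := by
  rw [ENNReal.tendsto_nhds_zero]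
  intro η hη
  have hC1 : C + 1 ≠ ∞ := by finiteness
  have hη2 : η / 2 ≠ 0 := by simpa using hη.ne'
  obtain ⟨δ, hδ, h1⟩ := hstep (η / 2) hη2
  have hκ : 0 < η / 2 / (C + 1) := ENNReal.div_pos hη2 hC1
  -- Every time is a grid point or follows one within `δ`. The grid is finite, so smallness there
  -- holds simultaneously; `C + 1` in place of `C` avoids a zero denominator and also covers the
  -- grid points themselves.
  have hgrid : ∀ᶠ ε in F, ∀ j ∈ Finset.range (⌊T / δ⌋₊ + 1), (j * δ : ℝ) ∈ Icc 0 T →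
      N ε (j * δ) ≤ η / 2 / (C + 1) := by
    rw [Filter.eventually_all_finset]
    intro j _
    by_cases h : (j * δ : ℝ) ∈ Icc 0 T
    · filter_upwards [(hlim _ h).eventually_le_const hκ] with ε h _ using h
    · exact Eventually.of_forall fun _ h' => absurd h' h
  filter_upwards [h1, hgrid] with ε h2 h3
  refine iSup₂_le fun t ht => ?_
  have hj := Nat.floor_le (div_nonneg ht.1 hδ.le)
  rw [le_div_iff₀ hδ] at hj
  have hj' := Nat.lt_floor_add_one (t / δ)
  rw [div_lt_iff₀ hδ] at hj'
  have h4 := h3 ⌊t / δ⌋₊ (Finset.mem_range.2 (Nat.lt_succ_of_le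
    (Nat.floor_mono (by gcongr; exact ht.2)))) ⟨by positivity, hj.trans ht.2⟩
  set s := (⌊t / δ⌋₊ : ℝ) * δ with hs
  have h5 : (C + 1) * N ε s ≤ η / 2 := by
    rw [mul_comm]; exact (ENNReal.le_div_iff_mul_le (Or.inl (by simp)) (Or.inl hC1)).1 h4
  rcases hj.eq_or_lt with h | h
  · rw [← h]
    calc N ε s ≤ (C + 1) * N ε s := le_mul_of_one_le_left zero_le (le_add_left le_rfl)
      _ ≤ η / 2 := h5
      _ ≤ η := ENNReal.half_le_self
  · have h6 := h2 s (t - s) (by positivity) (by linarith) (by linarith) (by linarith [ht.2])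
    rw [add_sub_cancel] at h6
    refine h6.trans ?_
    exact (add_le_add_left ((mul_le_mul_left (le_add_right le_rfl) _).trans h5) _).trans
      (ENNReal.add_halves η).le

end

/-! ### Series converging in `L²`. -/

section

variable {X : Type*} [MeasurableSpace X] {μ : Measure X}

/-- `u` is the sum of the series `∑ v n`, converging in `L²`. -/
def HasL2Sum (μ : Measure X) (v : ℕ → X → ℝ) (u : X → ℝ) : Prop :=
  Tendsto (fun N => eLpNorm (fun x => u x - ∑ n ∈ Finset.range N, v n x) 2 μ) atTop (𝓝 0)

lemma exists_hasL2Sum {v : ℕ → X → ℝ} (hv : ∀ n, MemLp (v n) 2 μ) {b : ℕ → ℝ≥0} (hb : Summable b)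
    (hvb : ∀ n, eLpNorm (v n) 2 μ ≤ b n) : ∃ u, MemLp u 2 μ ∧ HasL2Sum μ v u := by
  have hs : Summable fun n => (hv n).toLp (v n) := by
    refine Summable.of_norm_bounded (NNReal.summable_coe.2 hb) fun n => ?_
    rw [Lp.norm_toLp]
    exact ENNReal.toReal_le_coe_of_le_coe (hvb n)
  refine ⟨(∑' n, (hv n).toLp (v n) : Lp ℝ 2 μ), Lp.memLp _, ?_⟩
  have h1 := hs.hasSum.tendsto_sum_nat
  rw [tendsto_iff_edist_tendsto_0] at h1
  refine h1.congr fun N => ?_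
  rw [edist_comm, Lp.edist_def]
  refine eLpNorm_congr_ae ?_
  have h2 : (∑ n ∈ Finset.range N, (hv n).toLp (v n) : Lp ℝ 2 μ) =ᵐ[μ]
      fun x => ∑ n ∈ Finset.range N, v n x := by
    refine (Lp.coeFn_finsetSum _ _).trans ?_
    filter_upwards [ae_all_iff.2 fun n => (hv n).coeFn_toLp] with x hx
    rw [Finset.sum_apply]
    exact sum_congr rfl fun n _ => hx n
  filter_upwards [h2] with x hx
  rw [Pi.sub_apply, hx]

lemma HasL2Sum.congr {v v' : ℕ → X → ℝ} {u : X → ℝ} (h : HasL2Sum μ v u)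
    (hv : ∀ n, v n =ᵐ[μ] v' n) : HasL2Sum μ v' u := by
  refine Tendsto.congr (fun N => eLpNorm_congr_ae ?_) h
  filter_upwards [ae_all_iff.2 hv] with x hx
  simp only [hx]

lemma HasL2Sum.eLpNorm_sub_le {v v' : ℕ → X → ℝ} {u u' : X → ℝ} (hu : MemLp u 2 μ)
    (hu' : MemLp u' 2 μ) (h : HasL2Sum μ v u) (h' : HasL2Sum μ v' u') (hv : ∀ n, MemLp (v n) 2 μ)
    (hv' : ∀ n, MemLp (v' n) 2 μ) {c : ℕ → ℝ≥0∞}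
    (hc : ∀ n, eLpNorm (fun x => v n x - v' n x) 2 μ ≤ c n) :
    eLpNorm (fun x => u x - u' x) 2 μ ≤ ∑' n, c n := by
  have hm := fun N => (memLp_finsetSum (Finset.range N) fun n _ => hv n).1
  have hm' := fun N => (memLp_finsetSum (Finset.range N) fun n _ => hv' n).1
  have hle : ∀ N, eLpNorm (fun x => u x - u' x) 2 μ
      ≤ eLpNorm (fun x => u x - ∑ n ∈ Finset.range N, v n x) 2 μ
        + (∑' n, c n + eLpNorm (fun x => u' x - ∑ n ∈ Finset.range N, v' n x) 2 μ) := by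
    intro N
    refine (eLpNorm_two_triangle hu.1 (hm N) hu'.1).trans (add_le_add_right ?_ _)
    refine (eLpNorm_two_triangle (hm N) (hm' N) hu'.1).trans (add_le_add ?_
      (eLpNorm_two_sub_comm _ _).le)
    have e : (fun x => ∑ n ∈ Finset.range N, v n x - ∑ n ∈ Finset.range N, v' n x)
        = ∑ n ∈ Finset.range N, fun x => v n x - v' n x := by
      ext x; simp [Finset.sum_apply]
    rw [e]
    refine (eLpNorm_sum_le (fun n _ => ((hv n).sub (hv' n)).1) (by norm_num)).trans ?_
    exact (sum_le_sum fun n _ => hc n).trans (ENNReal.sum_le_tsum _)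
  have := ge_of_tendsto' (h.add (tendsto_const_nhds.add h')) hle
  simpa using this

end

/-! ### The Duhamel series for the mollified noise, and its terms in the limit. -/

section

variable {m : ℝ} {p : Space d → Space d → ℂ} {V : Space d → Ω → ℝ}

/-- The assumptions on the Green's function and the initial condition. -/
structure GreenSetting (m : ℝ) (p : Space d → Space d → ℂ) (G : ℝ → Space d → Space d → ℝ)
    (u₀ : Space d → ℝ) : Prop where
  order_gt : (d : ℝ) < m
  green : IsGreenFunction p G
  symm : ∀ t : ℝ, 0 < t → ∀ x y, G t x y = G t y x
  cont : ContinuousOn (fun z : ℝ × Space d × Space d => G z.1 z.2.1 z.2.2) (Ioi 0 ×ˢ univ)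
  bounds : GreenBounds m G
  memLp_one : MemLp u₀ 1 volume
  memLp_two : MemLp u₀ 2 volume

/-- The singular exponent is `d / m`, which is less than one because the order exceeds the
dimension. A measurable representative takes the place of `u₀`. -/
lemma GreenSetting.exists_data (S : GreenSetting m p G u₀) (hT : 0 < T) :
    ∃ C u, u₀ =ᵐ[volume] u ∧ DuhamelData (greenCutoff G T) u C (d / m) T := by
  obtain ⟨C, hC⟩ := exists_greenKernel S.symm S.cont S.bounds hT
  have hm : (0 : ℝ) < m := (Nat.cast_nonneg d).trans_lt S.order_gt
  refine ⟨C, S.memLp_one.1.mk u₀, S.memLp_one.1.ae_eq_mk, hC, by positivity,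
    (div_lt_one hm).2 S.order_gt, S.memLp_one.1.stronglyMeasurable_mk.measurable,
    (memLp_one_iff_integrable.1 S.memLp_one).congr S.memLp_one.1.ae_eq_mk,
    S.memLp_two.ae_eq S.memLp_one.1.ae_eq_mk⟩

/-- The terms of the Duhamel series, as functions of the point and the random parameter. -/
def duhamel (G : ℝ → Space d → Space d → ℝ) (u₀ : Space d → ℝ) (V : Space d → Ω → ℝ) (n : ℕ) (t : ℝ)
    (z : Space d × Ω) : ℝ := duhamelTerm G u₀ (fun y => V y z.2) n t z.1

lemma duhamel_zero_zero : duhamel G u₀ V 0 0 = fun z => u₀ z.1 :=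
  funext fun _ => if_pos rfl

lemma duhamel_succ_zero : duhamel G u₀ V (n + 1) 0 = 0 :=
  funext fun _ => duhamelTerm_succ_zero _ _ _ _ _

lemma GreenSetting.memLp_initial (S : GreenSetting m p G u₀) :
    MemLp (fun z : Space d × Ω => u₀ z.1) 2 (volume.prod P) ∧
      eLpNorm (fun z : Space d × Ω => u₀ z.1) 2 (volume.prod P) = eLpNorm u₀ 2 volume := by
  have hf : MeasurePreserving (Prod.fst : Space d × Ω → Space d) (volume.prod P) volume :=
    measurePreserving_fst
  exact ⟨S.memLp_two.comp_measurePreserving hf, eLpNorm_comp_measurePreserving S.memLp_two.1 hf⟩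

lemma DuhamelData.duhamel_succ_ae_eq {u : Space d → ℝ} (D : DuhamelData (greenCutoff G T) u C a T)
    (hu : u₀ =ᵐ[volume] u) (hV : HasMoments P V) (n : ℕ) (ht0 : 0 ≤ t) (ht : t < T) :
    duhamel G u₀ V (n + 1) t
      =ᵐ[volume.prod P] noiseTerm (chainInt (greenCutoff G T) u (n + 1) t) V := by
  rcases ht0.eq_or_lt with rfl | ht0
  · rw [duhamel_succ_zero]
    refine ae_of_all _ fun z => ?_
    simp [noiseTerm, chainInt_eq_zero D.kernel D.measurable le_rfl]
  · exact D.duhamelTerm_ae_eq hu hV (n + 1) ht0 ht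

/-- The summable energy bounds, uniform in `ε` and in time. The kernel is cut off at `T + 1` so that
`t = T` is admissible. At `t = 0` only the term `n = 0` survives; it is `u₀` itself, whence the
extra summand. -/
lemma GreenSetting.exists_bound (S : GreenSetting m p G u₀) (hW : IsWhiteNoise W)
    (hQ : IsMollifiedNoise W ρ Q) (hρ1 : Integrable ρ) (hρ2 : MemLp ρ 2 volume) (hT : 0 < T) :
    ∃ b : ℕ → ℝ≥0, Summable b ∧ ∀ n, ∀ t ∈ Icc 0 T, ∀ ε > 0,
      MemLp (duhamel G u₀ (Q ε) n t) 2 (volume.prod P) ∧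
      eLpNorm (duhamel G u₀ (Q ε) n t) 2 (volume.prod P) ≤ b n := by
  obtain ⟨C, u, hu, D⟩ := S.exists_data (show 0 < T + 1 by linarith)
  have hρ' := hρ1.1.ae_eq_mk
  have hQ' := hQ.congr hρ'
  have hρm := hρ1.1.stronglyMeasurable_mk.measurable
  have hU : ∫⁻ x, ‖u x‖ₑ ^ 2 ≠ ∞ := by rw [← eLpNorm_two_sq]; exact pow_ne_top D.memLp.2.ne
  have hN := (hρ1.congr hρ').2.ne
  obtain ⟨b, hb, hbn⟩ := exists_summable_energyBound (C := C) (T := T + 1) D.lt_one hU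
    (∫⁻ x, ‖hρ1.1.mk ρ x‖ₑ).toNNReal
  rw [ENNReal.coe_toNNReal hN] at hbn
  refine ⟨fun n => b n + if n = 0 then (eLpNorm u₀ 2 volume).toNNReal else 0,
    hb.add (summable_of_hasFiniteSupport ((Set.finite_singleton 0).subset fun n hn => by
      by_contra h; exact hn (if_neg h))), fun n t ht ε hε => ?_⟩
  rcases ht.1.eq_or_lt with rfl | ht0
  · rcases n with _ | n
    · rw [duhamel_zero_zero]
      refine ⟨S.memLp_initial.1, S.memLp_initial.2.le.trans ?_⟩
      dsimp only
      rw [if_pos rfl, ENNReal.coe_add, ENNReal.coe_toNNReal S.memLp_two.2.ne]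
      exact le_add_left le_rfl
    · rw [duhamel_succ_zero]
      exact ⟨MemLp.zero, by simp⟩
  · have ht' : t < T + 1 := by linarith [ht.2]
    have hae := D.duhamelTerm_ae_eq hu (hQ.hasMoments hW hρ2 hε) n ht0 ht'
    obtain ⟨h1, h2⟩ := D.memLp_chainInt hW hQ' hρm (hρ1.congr hρ') (hρ2.ae_eq hρ') n hε ht'
    refine ⟨h1.ae_eq hae.symm, (eLpNorm_congr_ae hae).le.trans ?_⟩
    refine ((pow_le_pow_left_iff (by norm_num)).1 (h2.trans (hbn n t ht'.le))).trans ?_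
    rw [ENNReal.coe_add]; exact le_add_right le_rfl

lemma isStratonovichIntegral_const (c : ℝ) :
    IsStratonovichIntegral W 0 (fun _ => c) fun _ => c := by
  refine ⟨memLp_const c, fun _ => ⟨1, fun _ => c, fun _ => Fin.elim0⟩, ?_, ?_⟩
  · simp [ProductSum.toFun, traceNorm]
  · simp [ProductSum.integral]

lemma isStratonovichIntegral_zero (n : ℕ) : IsStratonovichIntegral W n (fun _ => 0) fun _ => 0 := by
  refine ⟨MemLp.zero, fun _ => ⟨0, fun _ => 0, fun _ _ => 0⟩, ?_, ?_⟩
  · simp [ProductSum.toFun, traceNorm]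
  · simp [ProductSum.integral]

lemma GreenSetting.continuous_stratKernel (S : GreenSetting m p G u₀) (σ : ℝ) (n : ℕ) (ht : 0 ≤ t)
    (x : Space d) : Continuous (stratKernel σ G u₀ n t x) := by
  rcases ht.eq_or_lt with rfl | ht
  · rcases n with _ | n
    · exact continuous_const
    · rw [show stratKernel σ G u₀ (n + 1) 0 x = fun _ => 0 from
        funext fun y => stratKernel_succ_zero σ G u₀ n x y]
      exact continuous_const
  · obtain ⟨C, u, hu, D⟩ := S.exists_data (show 0 < t + 1 by linarith)
    rw [show stratKernel σ G u₀ n t x = fun y => σ ^ n * chainInt (greenCutoff G (t + 1)) u n t x y from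
      funext fun y => stratKernel_eq D.kernel D.nonneg D.lt_one D.measurable D.integrable hu σ n ht
        (by linarith) x y]
    exact continuous_const.mul (D.continuous_chainInt n (by linarith) x)

/-- At positive times the limit has the kernel mollified at scale zero, which is the Stratonovich
kernel because `σ` is the mass of `ρ`. At `t = 0` the terms contain no noise. -/
lemma GreenSetting.exists_stratonovichTerm (S : GreenSetting m p G u₀) (hW : IsWhiteNoise W)
    (hQ : IsMollifiedNoise W ρ Q) (hρ1 : Integrable ρ) (hρ2 : MemLp ρ 2 volume) {σ : ℝ}
    (hσ : σ = ∫ x, ρ x) (n : ℕ) (ht : 0 ≤ t) : ∃ v : Space d × Ω → ℝ, MemLp v 2 (volume.prod P) ∧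
      (∀ᵐ x, IsStratonovichIntegral W n (stratKernel σ G u₀ n t x) fun ω => v (x, ω)) ∧
      Tendsto (fun ε => eLpNorm (fun z => duhamel G u₀ (Q ε) n t z - v z) 2 (volume.prod P))
      (𝓝[>] 0) (𝓝 0) := by
  rcases ht.eq_or_lt with rfl | ht0
  · rcases n with _ | n
    · refine ⟨fun z => u₀ z.1, S.memLp_initial.1, ae_of_all _ fun x => ?_, ?_⟩
      · rw [show stratKernel σ G u₀ 0 0 x = fun _ => u₀ x from funext fun y => if_pos rfl]
        exact isStratonovichIntegral_const _
      · simp [duhamel_zero_zero]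
    · refine ⟨0, MemLp.zero, ae_of_all _ fun x => ?_, ?_⟩
      · rw [show stratKernel σ G u₀ (n + 1) 0 x = fun _ => 0 from
          funext fun y => stratKernel_succ_zero σ G u₀ n x y]
        exact isStratonovichIntegral_zero _
      · simp [duhamel_succ_zero]
  · obtain ⟨C, u, hu, D⟩ := S.exists_data (show 0 < t + 1 by linarith)
    have hρ' := hρ1.1.ae_eq_mk
    obtain ⟨v, hv, hlim, hst⟩ := D.exists_limit hW (hQ.congr hρ')
      hρ1.1.stronglyMeasurable_mk.measurable (hρ1.congr hρ') (hρ2.ae_eq hρ') n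
      (show t < t + 1 by linarith)
    refine ⟨v, hv, ?_, hlim.congr' ?_⟩
    · filter_upwards [hst] with x hx
      convert hx using 1
      ext y
      rw [mollify_zero, ← integral_congr_ae hρ', ← hσ]
      exact stratKernel_eq D.kernel D.nonneg D.lt_one D.measurable D.integrable hu σ n ht0
        (by linarith) x y
    · refine eventually_nhdsWithin_of_forall fun ε hε => eLpNorm_congr_ae ?_
      filter_upwards [D.duhamelTerm_ae_eq hu (hQ.hasMoments hW hρ2 hε) n ht0
        (show t < t + 1 by linarith)] with z hz
      rw [← hz]; rfl

/-- The terms of the Duhamel series converge uniformly in time. -/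
lemma GreenSetting.tendsto_iSup (S : GreenSetting m p G u₀) (hW : IsWhiteNoise W)
    (hQ : IsMollifiedNoise W ρ Q) (hρ1 : Integrable ρ) (hρ2 : MemLp ρ 2 volume) (n : ℕ)
    {v : ℝ → Space d × Ω → ℝ} (hv : ∀ t, 0 ≤ t → MemLp (v t) 2 (volume.prod P))
    (hlim : ∀ t, 0 ≤ t → Tendsto (fun ε => eLpNorm (fun z => duhamel G u₀ (Q ε) n t z - v t z) 2
      (volume.prod P)) (𝓝[>] 0) (𝓝 0))  (hT : 0 < T) :
    Tendsto (fun ε => ⨆ t ∈ Icc 0 T, eLpNorm (fun z => duhamel G u₀ (Q ε) n t z - v t z) 2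
      (volume.prod P)) (𝓝[>] 0) (𝓝 0) := by
  rcases n with _ | n
  -- The term `n = 0` does not depend on `ε`, so a norm that tends to zero is zero.
  · refine tendsto_const_nhds.congr fun ε => ?_
    refine (iSup₂_eq_bot.2 fun t ht => ?_).symm
    exact tendsto_nhds_unique tendsto_const_nhds (hlim t ht.1)
  obtain ⟨C, u, hu, D⟩ := S.exists_data (show 0 < T + 1 by linarith)
  have hρ' := hρ1.1.ae_eq_mk
  have hQ' := hQ.congr hρ'
  obtain ⟨b, -, hb⟩ := S.exists_bound hW hQ hρ1 hρ2 hT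
  refine tendsto_iSup_of_propagation (C := C) coe_ne_top (fun t ht => hlim t ht.1) fun η hη => ?_
  have hU : ∫⁻ x, ‖u x‖ₑ ^ 2 ≠ ∞ := by rw [← eLpNorm_two_sq]; exact pow_ne_top D.memLp.2.ne
  obtain ⟨δ, hδ, hδη⟩ := exists_energyBound_le D.lt_one C (T + 1) hU (hρ1.congr hρ').2.ne n
    (show η / 2 ≠ 0 by simpa using hη)
  refine ⟨δ, hδ, eventually_nhdsWithin_of_forall fun ε hε t r ht hr hrδ htr => ?_⟩
  have htT : t ≤ T := by linarith
  have hdm := fun s hs ε hε => (hb (n + 1) s hs ε hε).1.1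
  -- The propagation estimate compares two regularizations. Letting `ε'` tend to zero at the two
  -- fixed times `t` and `t + r` replaces the second one by the limit `v`.
  have hstep : ∀ ε' > 0, eLpNorm (fun z => duhamel G u₀ (Q ε) (n + 1) (t + r) z
      - duhamel G u₀ (Q ε') (n + 1) (t + r) z) 2 (volume.prod P)
      ≤ C * eLpNorm (fun z => duhamel G u₀ (Q ε) (n + 1) t z - duhamel G u₀ (Q ε') (n + 1) t z) 2
        (volume.prod P) + η := by
    intro ε' hε'
    have key := D.eLpNorm_noiseTerm_sub_le hW hQ' hρ1.1.stronglyMeasurable_mk.measurable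
      (hρ1.congr hρ') (hρ2.ae_eq hρ') (fun r t h1 h2 h3 x y =>
        greenCutoff_semigroup S.green S.symm h1 h2 h3 x y) hε hε' hr
      (show t + r < T + 1 by linarith) (hδη r hrδ (t + r))
    rw [ENNReal.add_halves] at key
    have hae : ∀ s, 0 ≤ s → s ≤ T → eLpNorm (fun z => duhamel G u₀ (Q ε) (n + 1) s z
        - duhamel G u₀ (Q ε') (n + 1) s z) 2 (volume.prod P)
        = eLpNorm (fun z => noiseTerm (chainInt (greenCutoff G (T + 1)) u (n + 1) s) (Q ε) z
        - noiseTerm (chainInt (greenCutoff G (T + 1)) u (n + 1) s) (Q ε') z) 2 (volume.prod P) := by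
      intro s hs0 hs
      refine eLpNorm_congr_ae ?_
      filter_upwards [D.duhamel_succ_ae_eq hu (hQ.hasMoments hW hρ2 hε) n hs0 (by linarith),
        D.duhamel_succ_ae_eq hu (hQ.hasMoments hW hρ2 hε') n hs0 (by linarith)] with z h1 h2
      rw [h1, h2]
    rw [hae _ (by linarith) htr, hae _ ht htT]
    exact key
  have hle : ∀ᶠ ε' in 𝓝[>] (0 : ℝ), eLpNorm (fun z => duhamel G u₀ (Q ε) (n + 1) (t + r) z
      - v (t + r) z) 2 (volume.prod P)
      ≤ C * (eLpNorm (fun z => duhamel G u₀ (Q ε) (n + 1) t z - v t z) 2 (volume.prod P)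
        + eLpNorm (fun z => duhamel G u₀ (Q ε') (n + 1) t z - v t z) 2 (volume.prod P)) + η
        + eLpNorm (fun z => duhamel G u₀ (Q ε') (n + 1) (t + r) z - v (t + r) z) 2
          (volume.prod P) := by
    refine eventually_nhdsWithin_of_forall fun ε' hε' => ?_
    refine (eLpNorm_two_triangle (hdm _ ⟨by linarith, htr⟩ ε hε) (hdm _ ⟨by linarith, htr⟩ ε' hε')
      (hv _ (by linarith)).1).trans (add_le_add_left ((hstep ε' hε').trans (add_le_add_left
      (mul_le_mul_right ?_ _) _)) _)
    rw [eLpNorm_two_sub_comm (duhamel G u₀ (Q ε') (n + 1) t)]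
    exact eLpNorm_two_triangle (hdm _ ⟨ht, htT⟩ ε hε) (hv t ht).1 (hdm _ ⟨ht, htT⟩ ε' hε')
  have hl := ((ENNReal.Tendsto.const_mul (a := (C : ℝ≥0∞)) ((tendsto_const_nhds
    (x := eLpNorm (fun z => duhamel G u₀ (Q ε) (n + 1) t z - v t z) 2 (volume.prod P))).add
    (hlim t ht)) (Or.inr coe_ne_top)).add (tendsto_const_nhds (x := η))).add
    (hlim (t + r) (by linarith))
  rw [add_zero, add_zero] at hl
  exact ge_of_tendsto hl hle

end

/-! ### Jointly measurable versions, and the existence of the mollified noise. -/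

section

variable {A X : Type*} [MeasurableSpace A] [MeasurableSpace X] {μ : Measure X}

lemma measurable_simpleFunc_apply (f : SimpleFunc A (Lp ℝ 2 μ)) :
    Measurable fun z : A × X => f z.1 z.2 := by
  classical
  have e : (fun z : A × X => f z.1 z.2) = fun z => ∑ c ∈ f.range, if f z.1 = c then c z.2 else 0 := by
    ext z
    rw [Finset.sum_ite_eq, if_pos (f.mem_range_self z.1)]
  rw [e]
  refine Finset.measurable_fun_sum _ fun c _ => Measurable.ite ?_
    ((Lp.stronglyMeasurable c).measurable.comp measurable_snd) measurable_const
  exact measurable_fst (f.measurableSet_fiber c)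

/-- A measurable function with values in `L²` is represented by a jointly measurable function. -/
lemma exists_measurable_version {Φ : A → Lp ℝ 2 μ} (hΦ : StronglyMeasurable Φ) :
    ∃ F : A × X → ℝ, Measurable F ∧ ∀ a, (fun x => F (a, x)) =ᵐ[μ] Φ a := by
  classical
  -- The first index at which the simple approximation is within `2⁻¹ ^ k` is a measurable function
  -- of `a`. This speed makes the squared distances summable, so that for every `a` the
  -- approximations converge at almost every point.
  have hex : ∀ (k : ℕ) (a : A), ∃ n, edist (hΦ.approx n a) (Φ a) < (2⁻¹ : ℝ≥0∞) ^ k := fun k a =>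
    ((tendsto_iff_edist_tendsto_0.1 (hΦ.tendsto_approx a)).eventually_lt_const
      (ENNReal.pow_pos (by simp) k)).exists
  have hNm : ∀ k, Measurable fun a => Nat.find (hex k a) := fun k => measurable_find _ fun n => by
      have h1 : StronglyMeasurable fun a => edist (hΦ.approx n a) (Φ a) :=
        continuous_edist.comp_stronglyMeasurable ((hΦ.approx n).stronglyMeasurable.prodMk hΦ)
      exact h1.measurable measurableSet_Iio
  set F : ℕ → A × X → ℝ := fun k z => hΦ.approx (Nat.find (hex k z.1)) z.1 z.2 with hF
  have hFm : ∀ k, Measurable (F k) := fun k => by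
    have h1 : Measurable fun z : ℕ × (A × X) => hΦ.approx z.1 z.2.1 z.2.2 :=
      measurable_from_prod_countable_right fun n => measurable_simpleFunc_apply (hΦ.approx n)
    exact h1.comp (((hNm k).comp measurable_fst).prodMk measurable_id)
  refine ⟨fun z => limsup (fun k => F k z) atTop, Measurable.limsup hFm, fun a => ?_⟩
  have hd : ∀ k, ∫⁻ x, ‖F k (a, x) - Φ a x‖ₑ ^ 2 ∂μ ≤ (2⁻¹ : ℝ≥0∞) ^ k := fun k => by
    have h1 := Nat.find_spec (hex k a)
    rw [Lp.edist_def] at h1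
    have h2 := pow_le_pow_left' h1.le 2
    rw [eLpNorm_two_sq] at h2
    refine h2.trans ?_
    rw [sq]
    exact mul_le_of_le_one_left zero_le (pow_le_one' (by norm_num) k)
  have hm : ∀ k, AEMeasurable (fun x => ‖F k (a, x) - Φ a x‖ₑ ^ 2) μ := fun _ => by fun_prop
  have hsum : ∫⁻ x, ∑' k, ‖F k (a, x) - Φ a x‖ₑ ^ 2 ∂μ ≠ ∞ := by
    rw [lintegral_tsum hm]
    refine ne_top_of_le_ne_top ?_ (ENNReal.tsum_le_tsum hd)
    rw [ENNReal.tsum_geometric]; simp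
  filter_upwards [ae_lt_top' (AEMeasurable.tsum hm) hsum] with x hx
  refine Tendsto.limsup_eq ?_
  rw [tendsto_iff_edist_tendsto_0]
  have h0 := (ENNReal.tendsto_atTop_zero_of_tsum_ne_top hx.ne).ennrpow_const (1 / 2 : ℝ)
  rw [ENNReal.zero_rpow_of_pos (by norm_num)] at h0
  refine h0.congr fun k => ?_
  rw [edist_eq_enorm_sub, ← rpow_natCast, ← rpow_mul]; norm_num

end

lemma continuous_mollifier_toLp (hρ2 : MemLp ρ 2 volume) (hε : 0 < ε) :
    Continuous fun x => (memLp_mollifier hρ2 hε x).toLp (mollifier ρ ε x) := by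
  rw [continuous_iff_continuousAt]
  intro x
  rw [ContinuousAt, tendsto_iff_edist_tendsto_0]
  have hk := memLp_mollifier hρ2 hε 0
  have h1 := tendsto_eLpNorm_translate_sub (p := 2) (by norm_num) (by norm_num) hk
  have h2 : Tendsto (fun y : Space d => x - y) (𝓝 x) (𝓝 0) := by
    have : Continuous fun y : Space d => x - y := by fun_prop
    simpa using this.tendsto x
  refine (h1.comp h2).congr fun y => ?_
  rw [Lp.edist_toLp_toLp, Function.comp]
  rw [← eLpNorm_comp_measurePreserving (ν := volume) (f := fun z : Space d => z - x) ?_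
    (measurePreserving_sub_right volume x)]
  · congr 1
    ext z
    simp only [Function.comp, Pi.sub_apply, mollifier]
    congr 4 <;> abel_nf
  · exact ((hk.comp_measurePreserving (measurePreserving_add_right volume (x - y))).sub hk).1

/-- The mollified white noise exists. -/
lemma exists_isMollifiedNoise (W : L2 d →ₗᵢ[ℝ] Lp ℝ 2 P) (hρ2 : MemLp ρ 2 volume) :
    ∃ Q, IsMollifiedNoise W ρ Q := by
  have h : ∀ ε : ℝ, ∃ F : Space d × Ω → ℝ, 0 < ε → Measurable F ∧ ∀ x, (fun ω => F (x, ω)) =ᵐ[P]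
      wienerIntegral W (mollifier ρ ε x) := by
    intro ε
    by_cases hε : 0 < ε
    · obtain ⟨F, hF, hF'⟩ := exists_measurable_version
        (W.continuous.comp (continuous_mollifier_toLp hρ2 hε)).stronglyMeasurable
      refine ⟨F, fun _ => ⟨hF, fun x => (hF' x).trans (Eq.eventuallyEq ?_)⟩⟩
      rw [wienerIntegral, dif_pos (memLp_mollifier hρ2 hε x)]; rfl
    · exact ⟨0, fun h => absurd h hε⟩
  choose F hF using h
  exact ⟨fun ε x ω => F ε (x, ω), fun ε hε => hF ε hε⟩

/-! ### The spectral root of the correlation function -/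

open SchwartzMap

lemma integral_fourier_schwartz_mul (ψ : 𝓢(Space d, ℂ)) {f : Space d → ℂ} (hf : Integrable f) :
    ∫ x, 𝓕 ψ x • f x = ∫ x, ψ x • 𝓕 f x := by
  have := VectorFourier.integral_fourierIntegral_smul_eq_flip (μ := (volume : Measure (Space d)))
    (ν := (volume : Measure (Space d))) (L := innerₗ (Space d)) (f := ψ) (g := f)
    Real.continuous_fourierChar continuous_inner ψ.integrable hf
  rw [flip_innerₗ] at this
  rw [SchwartzMap.fourier_coe]
  exact this

lemma exists_schwartz_eq {φ : Space d → ℝ} (hφ : ContDiff ℝ ((⊤ : ℕ∞) : WithTop ℕ∞) φ)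
    (hc : HasCompactSupport φ) :
    ∃ ψ : 𝓢(Space d, ℂ), ∀ (f : Space d → ℂ), ∫ x, φ x • f x = ∫ x, ψ x • f x := by
  have hc' : HasCompactSupport fun x => (φ x : ℂ) := hc.comp_left (g := Complex.ofReal) rfl
  exact ⟨hc'.toSchwartzMap (Complex.ofRealCLM.contDiff.comp hφ), fun f =>
    integral_congr_ae (ae_of_all _ fun x => Complex.real_smul)⟩

/-- The Fourier transform is injective on `L¹`. -/
lemma ae_eq_of_fourier_eq {f g : Space d → ℂ} (hf : Integrable f) (hg : Integrable g)
    (h : ∀ ξ, 𝓕 f ξ = 𝓕 g ξ) : f =ᵐ[volume] g := by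
  refine ae_eq_of_integral_contDiff_smul_eq hf.locallyIntegrable hg.locallyIntegrable
    fun φ hφ hc => ?_
  obtain ⟨ψ, hψ⟩ := exists_schwartz_eq hφ hc
  have e : 𝓕 (𝓕⁻ ψ) = ψ := FourierTransform.fourier_fourierInv_eq ψ
  rw [hψ, hψ, ← e, integral_fourier_schwartz_mul _ hf, integral_fourier_schwartz_mul _ hg]
  simp only [h]

/-- The Fourier transforms on `L¹` and on `L²` are consistent. -/
lemma fourier_ae_eq_of_ae_eq_fourierInv {f : Space d → ℂ} {g : Lp ℂ 2 (volume : Measure (Space d))}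
    (hf : Integrable f) (h : f =ᵐ[volume] (𝓕⁻ g : Lp ℂ 2 (volume : Measure (Space d)))) :
    𝓕 f =ᵐ[volume] g := by
  have hcont : Continuous (𝓕 f) := VectorFourier.fourierIntegral_continuous
    Real.continuous_fourierChar continuous_inner hf
  refine ae_eq_of_integral_contDiff_smul_eq hcont.locallyIntegrable
    ((Lp.memLp g).locallyIntegrable (by norm_num)) fun φ hφ hc => ?_
  obtain ⟨ψ, hψ⟩ := exists_schwartz_eq hφ hc
  rw [hψ, hψ, ← integral_fourier_schwartz_mul _ hf]
  have e : 𝓕⁻ (𝓕 ψ) = ψ := FourierTransform.fourierInv_fourier_eq ψ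
  have h1 := congrArg (fun T : 𝓢'(Space d, ℂ) => T (𝓕 ψ)) (Lp.fourierInv_toTemperedDistribution_eq g)
  simp only [TemperedDistribution.fourierInv_apply, e, Lp.toTemperedDistribution_apply] at h1
  rw [h1]
  exact integral_congr_ae (by filter_upwards [h] with x hx using by rw [hx])

lemma fourier_ofReal_re {f : Space d → ℝ} (hf : Integrable f) (ξ : Space d) :
    (𝓕 (fun x => (f x : ℂ)) ξ).re = ∫ x, f x * cos (2 * Real.pi * inner ℝ x ξ) := by
  have hi : Integrable fun x : Space d =>
      Complex.exp (((-2 * Real.pi * inner ℝ x ξ : ℝ) : ℂ) * Complex.I) • (f x : ℂ) := by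
    refine Integrable.bdd_mul (c := 1) hf.ofReal (Continuous.aestronglyMeasurable (by fun_prop))
      (ae_of_all _ fun x => by rw [Complex.norm_exp_ofReal_mul_I])
  rw [Real.fourier_eq']
  refine Eq.trans (integral_re hi).symm (integral_congr_ae (ae_of_all _ fun x => ?_))
  simp only [smul_eq_mul, RCLike.re_to_complex]
  rw [Complex.re_mul_ofReal, Complex.exp_ofReal_mul_I_re, mul_comm,
    show -2 * Real.pi * inner ℝ x ξ = -(2 * Real.pi * inner ℝ x ξ) by ring, Real.cos_neg]

lemma fourier_ofReal_conj (f : Space d → ℝ) (ξ : Space d) :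
    𝓕 (fun x => (f (-x) : ℂ)) ξ = starRingEnd ℂ (𝓕 (fun x => (f x : ℂ)) ξ) := by
  rw [Real.fourier_eq', Real.fourier_eq', ← integral_conj,
    ← integral_neg_eq_self (fun x => (starRingEnd ℂ) _)]
  refine integral_congr_ae (ae_of_all _ fun x => ?_)
  simp only [smul_eq_mul, map_mul, ← Complex.exp_conj, Complex.conj_ofReal, Complex.conj_I,
    inner_neg_left]
  congr 2
  push_cast
  ring

section

variable {q : Space d → Ω → ℝ}

lemma IsStationaryGaussianField.identDistrib_pair (hq : IsStationaryGaussianField P q)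
    (x y : Space d) :
    IdentDistrib (fun ω => (q x ω, q y ω)) (fun ω => (q 0 ω, q (y - x) ω)) P P := by
  have h := hq.stationary x {0, y - x}
  have h2 := h.comp (u := fun f : (({0, y - x} : Finset (Space d)) → ℝ) =>
    (f ⟨0, by simp⟩, f ⟨y - x, by simp⟩)) (by fun_prop)
  simpa [Function.comp_def] using h2

lemma IsStationaryGaussianField.integral_mul (hq : IsStationaryGaussianField P q) (x y : Space d) :
    ∫ ω, q x ω * q y ω ∂P = correlation P q (y - x) :=
  ((hq.identDistrib_pair x y).comp (u := fun z : ℝ × ℝ => z.1 * z.2) (by fun_prop)).integral_eq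

lemma correlation_neg (hq : IsStationaryGaussianField P q) (x : Space d) :
    correlation P q (-x) = correlation P q x := by
  have h := hq.integral_mul x 0
  rw [zero_sub] at h
  rw [← h]
  exact integral_congr_ae (ae_of_all _ fun ω => mul_comm _ _)

lemma IsStationaryGaussianField.memLp (hq : IsStationaryGaussianField P q) (x : Space d) {p : ℝ≥0∞}
    (hp : p ≠ ∞) : MemLp (q x) p P :=
  (hq.gaussian.hasGaussianLaw_eval x).memLp hp

lemma IsStationaryGaussianField.integrable_mul (hq : IsStationaryGaussianField P q)
    (x y : Space d) : Integrable (fun ω => q x ω * q y ω) P :=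
  MemLp.integrable_mul (p := 2) (q := 2) (hq.memLp x ENNReal.ofNat_ne_top)
    (hq.memLp y ENNReal.ofNat_ne_top)

/-- The correlation function is positive definite. -/
lemma integral_correlation_nonneg (hq : IsStationaryGaussianField P q)
    (hR : Integrable (correlation P q)) {H : Space d → ℝ} (hH : Integrable H)
    (hb : ∀ x, |H x| ≤ 1) : Integrable (fun u => correlation P q u * ∫ x, H x * H (x + u)) ∧
      0 ≤ ∫ u, correlation P q u * ∫ x, H x * H (x + u) := by
  have hmp := measurePreserving_prod_add_swap (volume : Measure (Space d)) (volume : Measure (Space d))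
  have hme : MeasurableEmbedding fun z : Space d × Space d => (z.2, z.2 + z.1) :=
    (MeasurableEquiv.prodComm.trans (MeasurableEquiv.shearAddRight (Space d))).measurableEmbedding
  have hi : Integrable (fun z : Space d × Space d => correlation P q z.1 * (H z.2 * H (z.2 + z.1)))
      (volume.prod volume) := by
    refine ((hR.mul_prod hH).mul_bdd (c := 1) (g := fun z => H (z.2 + z.1)) ?_
      (ae_of_all _ fun z => hb _)).congr (ae_of_all _ fun z => by ring)
    exact hH.aestronglyMeasurable.comp_snd.comp_quasiMeasurePreserving hmp.quasiMeasurePreserving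
  have hm : ∀ x, Integrable (fun ω => q x ω * q x ω) P := fun x => hq.integrable_mul x x
  have hb2 : ∀ x y, ∫ ω, |q x ω * q y ω| ∂P ≤ correlation P q 0 := fun x y => by
    calc ∫ ω, |q x ω * q y ω| ∂P ≤ ∫ ω, 2⁻¹ * (q x ω * q x ω + q y ω * q y ω) ∂P :=
        integral_mono_of_nonneg (ae_of_all _ fun ω => abs_nonneg _)
          (((hm x).add (hm y)).const_mul _) (ae_of_all _ fun ω => abs_le.2
            ⟨by nlinarith [sq_nonneg (q x ω + q y ω)], by nlinarith [sq_nonneg (q x ω - q y ω)]⟩)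
      _ = correlation P q 0 := by
        rw [integral_const_mul, integral_add (hm x) (hm y), hq.integral_mul, hq.integral_mul,
          sub_self, sub_self]
        ring
  -- The covariance integrated against `H` in both variables is the second moment of `∫ H q`; the
  -- substitution `y = x + u` brings out the correlation function.
  have h := (integral_mul_integral (Y := Ω) hH hH hq.measurable hq.measurable hq.integrable_mul hb2).2
  have h0 : 0 ≤ ∫ ω, (∫ x, H x * q x ω) * (∫ x, H x * q x ω) ∂P :=
    integral_nonneg fun ω => mul_self_nonneg _
  rw [h, ← hmp.integral_comp hme] at h0
  have e : ∀ z : Space d × Space d, H z.2 * H (z.2 + z.1) * ∫ ω, q z.2 ω * q (z.2 + z.1) ω ∂P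
      = correlation P q z.1 * (H z.2 * H (z.2 + z.1)) := fun z => by
    rw [hq.integral_mul, add_sub_cancel_left, mul_comm]
  simp only [e] at h0
  rw [integral_prod _ hi] at h0
  simp only [integral_const_mul] at h0
  exact ⟨by simpa only [integral_const_mul] using hi.integral_prod_left, h0⟩

lemma integrable_gaussian {b : ℝ} (hb : 0 < b) :
    Integrable fun x : Space d => exp (-(b * ‖x‖ ^ 2)) := by
  have h := (GaussianFourier.integrable_cexp_neg_mul_sq_norm_add (V := Space d) (b := (b : ℂ))
    (by simpa using hb) 0 0).norm
  refine h.congr (ae_of_all _ fun x => ?_)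
  simp only [Complex.norm_exp]
  congr 1
  simp [← Complex.ofReal_pow]

/-- The easy half of Bochner's theorem. Positive definiteness is tested with a Gaussian times a
cosine and times a sine; the sum of the two is, by the addition theorem, the Fourier integral with a
Gaussian factor, which disappears as `b` tends to zero. Nonnegativity is what makes the square root
in the definition of `ρ` a root of the whole spectrum. -/
lemma fourier_correlation_nonneg (hq : IsStationaryGaussianField P q)
    (hR : Integrable (correlation P q)) (ξ : Space d) :
    0 ≤ ∫ x, correlation P q x * cos (2 * Real.pi * inner ℝ x ξ) := by
  set θ : Space d → ℝ := fun x => 2 * Real.pi * inner ℝ x ξ with hθ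
  have hθc : Continuous θ := by fun_prop
  have hpos : ∀ b > 0, 0 ≤ ∫ x, correlation P q x * cos (θ x) * exp (-(b / 2 * ‖x‖ ^ 2)) := by
    intro b hb
    have key : ∀ f : ℝ → ℝ, Continuous f → (∀ s, |f s| ≤ 1) →
        Integrable (fun x => exp (-(b * ‖x‖ ^ 2)) * f (θ x)) ∧
        ∀ x, |exp (-(b * ‖x‖ ^ 2)) * f (θ x)| ≤ 1 := by
      intro f hf h1
      refine ⟨(integrable_gaussian hb).mul_bdd (c := 1)
        (hf.comp hθc).aestronglyMeasurable (ae_of_all _ fun x => h1 _), fun x => ?_⟩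
      rw [abs_mul, Real.abs_exp]
      refine mul_le_one₀ (Real.exp_le_one_iff.2 (by have := sq_nonneg ‖x‖; nlinarith)) (abs_nonneg _) (h1 _)
    obtain ⟨ic, bc⟩ := key cos Real.continuous_cos Real.abs_cos_le_one
    obtain ⟨is, bs⟩ := key sin Real.continuous_sin Real.abs_sin_le_one
    obtain ⟨ic', pc⟩ := integral_correlation_nonneg hq hR ic bc
    obtain ⟨is', ps⟩ := integral_correlation_nonneg hq hR is bs
    set c := ∫ x : Space d, exp (-(2 * b * ‖x‖ ^ 2)) with hc
    have hcpos : 0 < c := integral_exp_pos (integrable_gaussian (by positivity))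
    have h := add_nonneg pc ps
    rw [← integral_add ic' is'] at h
    -- As `‖x‖² + ‖x + u‖² = 2 ‖x + u/2‖² + ‖u‖² / 2`, the integral over `x` decouples from `u` and
    -- gives the constant `c`.
    have e : ∀ u, correlation P q u * (∫ x, exp (-(b * ‖x‖ ^ 2)) * cos (θ x) *
          (exp (-(b * ‖x + u‖ ^ 2)) * cos (θ (x + u)))) +
        correlation P q u * (∫ x, exp (-(b * ‖x‖ ^ 2)) * sin (θ x) *
          (exp (-(b * ‖x + u‖ ^ 2)) * sin (θ (x + u))))
        = c * (correlation P q u * cos (θ u) * exp (-(b / 2 * ‖u‖ ^ 2))) := by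
      intro u
      have hshift : ∀ f : Space d → ℝ, Integrable f → (∀ x, |f x| ≤ 1) →
          Integrable fun x => f x * f (x + u) := fun f hf h1 =>
        hf.mul_bdd (c := 1) (hf.comp_add_right u).aestronglyMeasurable (ae_of_all _ fun x => h1 _)
      rw [← mul_add, ← integral_add (hshift _ ic bc) (hshift _ is bs), hc,
        ← integral_add_right_eq_self (fun x : Space d => exp (-(2 * b * ‖x‖ ^ 2))) ((2 : ℝ)⁻¹ • u),
        mul_assoc (correlation P q u), mul_left_comm, ← integral_mul_const]
      congr 1
      refine integral_congr_ae (ae_of_all _ fun x => ?_)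
      have hadd : θ (x + u) = θ x + θ u := by rw [hθ]; simp only [inner_add_left]; ring
      have hcos : cos (θ u) = cos (θ x) * cos (θ (x + u)) + sin (θ x) * sin (θ (x + u)) := by
        rw [← Real.cos_sub, ← Real.cos_neg, hadd]; ring_nf
      have hexp : exp (-(b / 2 * ‖u‖ ^ 2)) * exp (-(2 * b * ‖x + (2 : ℝ)⁻¹ • u‖ ^ 2))
          = exp (-(b * ‖x‖ ^ 2)) * exp (-(b * ‖x + u‖ ^ 2)) := by
        rw [← Real.exp_add, ← Real.exp_add]
        congr 1
        rw [norm_add_sq_real, norm_add_sq_real, real_inner_smul_right, norm_smul, Real.norm_of_nonneg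
          (by norm_num : (0 : ℝ) ≤ 2⁻¹)]
        ring
      linear_combination -(exp (-(b * ‖x‖ ^ 2)) * exp (-(b * ‖x + u‖ ^ 2))) * hcos -
        cos (θ u) * hexp
    simp only [e] at h
    rw [integral_const_mul] at h
    exact nonneg_of_mul_nonneg_right h hcpos
  have hlim : Tendsto (fun b : ℝ => ∫ x, correlation P q x * cos (θ x) *
      exp (-(b / 2 * ‖x‖ ^ 2))) (𝓝[>] 0) (𝓝 (∫ x, correlation P q x * cos (θ x))) := by
    refine tendsto_integral_filter_of_dominated_convergence (fun x => ‖correlation P q x‖)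
      (Eventually.of_forall fun b => ?_) ?_ hR.norm (ae_of_all _ fun x => ?_)
    · exact (hR.aestronglyMeasurable.mul (Continuous.aestronglyMeasurable (by fun_prop))).mul
        (Continuous.aestronglyMeasurable (by fun_prop))
    · filter_upwards [self_mem_nhdsWithin] with b hb
      refine ae_of_all _ fun x => ?_
      have hb : (0 : ℝ) < b := hb
      rw [norm_mul, norm_mul, mul_assoc]
      refine mul_le_of_le_one_right (norm_nonneg _) (mul_le_one₀ (Real.abs_cos_le_one _) (norm_nonneg _) ?_)
      rw [Real.norm_eq_abs, Real.abs_exp]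
      exact Real.exp_le_one_iff.2 (by have := sq_nonneg ‖x‖; nlinarith)
    · have : Continuous fun b : ℝ => correlation P q x * cos (θ x) * exp (-(b / 2 * ‖x‖ ^ 2)) := by
        fun_prop
      simpa using (this.tendsto 0).mono_left nhdsWithin_le_nhds
  exact ge_of_tendsto hlim (by filter_upwards [self_mem_nhdsWithin] with b hb using hpos b hb)

end

section

variable {R : Space d → ℝ}

lemma IsSpectralRoot.memLp (h : IsSpectralRoot R ρ) : MemLp ρ 2 volume := by
  obtain ⟨hg, he⟩ := h
  have := ((memLp_congr_ae he).2 (Lp.memLp _)).re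
  simpa using this

/-- The definition of `ρ` lives in `L²`, where transforms are classes. Since `ρ` and `R` are
integrable, both sides are continuous functions that agree almost everywhere, hence everywhere. -/
lemma IsSpectralRoot.fourier_eq (h : IsSpectralRoot R ρ) (hR : Integrable R) (hρ : Integrable ρ)
    (ξ : Space d) : 𝓕 (fun x => (ρ x : ℂ)) ξ = ((√(𝓕 (fun x => (R x : ℂ)) ξ).re : ℝ) : ℂ) := by
  obtain ⟨hg, he⟩ := h
  have hcont : ∀ {f : Space d → ℝ}, Integrable f → Continuous (𝓕 fun x => (f x : ℂ)) := fun hf =>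
    VectorFourier.fourierIntegral_continuous Real.continuous_fourierChar continuous_inner hf.ofReal
  have h1 := (fourier_ae_eq_of_ae_eq_fourierInv hρ.ofReal he).trans hg.coeFn_toLp
  have hc := hcont hR
  exact congrFun ((Continuous.ae_eq_iff_eq volume (hcont hρ) (by fun_prop)).1 h1) ξ

/-- Evaluation at frequency zero, which is possible because the previous identity holds at every
point. It identifies `σ` with the mass of `ρ`. -/
lemma IsSpectralRoot.integral_eq (h : IsSpectralRoot R ρ) (hR : Integrable R) (hρ : Integrable ρ) :
    ∫ x, ρ x = √(∫ x, R x) := by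
  have h0 := congrArg Complex.re (h.fourier_eq hR hρ 0)
  rw [Complex.ofReal_re, fourier_ofReal_re hρ, fourier_ofReal_re hR] at h0
  simpa using h0

/-- `ρ * ρ = R` almost everywhere. -/
lemma IsSpectralRoot.autocorrelation_ae_eq {q : Space d → Ω → ℝ}
    (hq : IsStationaryGaussianField P q) (hR : Integrable (correlation P q))
    (h : IsSpectralRoot (correlation P q) ρ) (hρ : Integrable ρ) :
    (fun x => ∫ u, ρ u * ρ (u + x)) =ᵐ[volume] correlation P q := by
  have hρ' : Integrable fun x => (ρ (-x) : ℂ) := hρ.comp_neg.ofReal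
  have hρc : Integrable fun x => (ρ x : ℂ) := hρ.ofReal
  have hRc : Integrable fun x => (correlation P q x : ℂ) := hR.ofReal
  have hconv := hρ'.integrable_convolution (ContinuousLinearMap.mul ℂ ℂ) hρc
  have e : ∀ x, (convolution (fun x => (ρ (-x) : ℂ)) (fun x => (ρ x : ℂ))
      (ContinuousLinearMap.mul ℂ ℂ) volume) x = ((∫ u, ρ u * ρ (u + x) : ℝ) : ℂ) := fun x => by
    rw [← integral_neg_eq_self, ← integral_complex_ofReal]
    refine integral_congr_ae (ae_of_all _ fun u => ?_)
    simp [sub_eq_neg_add]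
  -- The transform of the autocorrelation is the squared modulus of that of `ρ`, hence the real part
  -- of the transform of the correlation; the latter is real because the correlation is even.
  have h1 := ae_eq_of_fourier_eq hconv hRc fun ξ => by
    rw [Real.fourier_mul_convolution_eq hρ' hρc, fourier_ofReal_conj, h.fourier_eq hR hρ,
      Complex.conj_ofReal, ← Complex.ofReal_mul, Real.mul_self_sqrt
      (by rw [fourier_ofReal_re hR]; exact fourier_correlation_nonneg hq hR ξ)]
    refine Complex.conj_eq_iff_re.1 ?_
    rw [← fourier_ofReal_conj]
    simp only [correlation_neg hq]
  filter_upwards [h1] with x hx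
  rw [e] at hx
  exact Complex.ofReal_injective hx

end

/-! ### Random elements of `L²(ℝ^d)` -/

section

variable {u u' : Space d × Ω → ℝ}

/-- In a second countable space every open set is a countable union of balls. -/
lemma measurable_of_measurable_edist {A E : Type*} [MeasurableSpace A] [PseudoEMetricSpace E]
    [SecondCountableTopology E] [MeasurableSpace E] [BorelSpace E] {f : A → E}
    (h : ∀ g, Measurable fun a => edist (f a) g) : Measurable f := by
  refine measurable_of_isOpen fun s hs => ?_
  have hr : ∀ x : s, ∃ r > 0, Metric.eball (x : E) r ⊆ s := fun x => EMetric.isOpen_iff.1 hs x x.2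
  choose r hr0 hrs using hr
  obtain ⟨T, hT, hTs⟩ := TopologicalSpace.isOpen_iUnion_countable
    (fun x : s => Metric.eball (x : E) (r x)) fun x => Metric.isOpen_eball
  have e : s = ⋃ x ∈ T, Metric.eball (x : E) (r x) := by
    rw [hTs]
    exact Subset.antisymm (fun x hx => mem_iUnion.2 ⟨⟨x, hx⟩, Metric.mem_eball_self (hr0 _)⟩)
      (iUnion_subset hrs)
  rw [e]
  simp only [preimage_iUnion]
  exact MeasurableSet.biUnion hT fun x _ => measurableSet_lt (h x) measurable_const

lemma toRandomL2_ae_eq {ω : Ω} (h : MemLp (fun x => u (x, ω)) 2 volume) :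
    toRandomL2 u ω =ᵐ[volume] fun x => u (x, ω) := by
  rw [toRandomL2, dif_pos h]
  exact h.coeFn_toLp

lemma toRandomL2_congr_of_ae {u' : Space d × Ω' → ℝ} {ω : Ω} {ω' : Ω'}
    (h : ∀ᵐ x, u (x, ω) = u' (x, ω')) : toRandomL2 u ω = toRandomL2 u' ω' := by
  by_cases h1 : MemLp (fun x => u (x, ω)) 2 volume
  · have h2 : MemLp (fun x => u' (x, ω')) 2 volume := (memLp_congr_ae h).1 h1
    rw [toRandomL2, toRandomL2, dif_pos h1, dif_pos h2]
    exact (MemLp.toLp_eq_toLp_iff _ _).2 h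
  · have h2 : ¬ MemLp (fun x => u' (x, ω')) 2 volume := fun h2 => h1 ((memLp_congr_ae h).2 h2)
    rw [toRandomL2, toRandomL2, dif_neg h1, dif_neg h2]

lemma ae_ae_of_ae_prod_swap {p : Space d × Ω → Prop} (h : ∀ᵐ z ∂(volume.prod P), p z) :
    ∀ᵐ ω ∂P, ∀ᵐ x, p (x, ω) :=
  Measure.ae_ae_of_ae_prod (Measure.measurePreserving_swap.quasiMeasurePreserving.ae h)

lemma toRandomL2_congr (h : u =ᵐ[volume.prod P] u') : toRandomL2 u =ᵐ[P] toRandomL2 u' :=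
  (ae_ae_of_ae_prod_swap h).mono fun _ hω => toRandomL2_congr_of_ae hω

lemma measurable_toRandomL2 (hu : Measurable u) : Measurable (toRandomL2 (d := d) u) := by
  have hn : ∀ g : L2 d, Measurable fun ω => eLpNorm (fun x => u (x, ω) - g x) 2 volume := by
    intro g
    have hg := (Lp.stronglyMeasurable g).measurable
    have h2 : Measurable fun z : Ω × Space d => ‖u (z.2, z.1) - g z.2‖ₑ ^ 2 :=
      ((hu.comp measurable_swap).sub (by fun_prop)).enorm.pow_const 2
    have e : (fun ω => eLpNorm (fun x => u (x, ω) - g x) 2 volume)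
        = fun ω => (∫⁻ x, ‖u (x, ω) - g x‖ₑ ^ 2) ^ (1 / 2 : ℝ) := by
      funext ω
      rw [← eLpNorm_two_sq, ← rpow_natCast, ← rpow_mul]
      norm_num
    rw [e]
    exact (h2.lintegral_prod_right' (ν := volume)).pow_const _
  have hs : MeasurableSet {ω | MemLp (fun x => u (x, ω)) 2 volume} := by
    have e : {ω | MemLp (fun x => u (x, ω)) 2 volume}
        = {ω | eLpNorm (fun x => u (x, ω) - (0 : L2 d) x) 2 volume < ∞} := by
      ext ω
      have h0 : (fun x => u (x, ω) - (0 : L2 d) x) =ᵐ[volume] fun x => u (x, ω) := by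
        filter_upwards [Lp.coeFn_zero ℝ 2 (volume : Measure (Space d))] with x hx
        rw [hx]; simp
      simp only [mem_ofPred_eq]
      rw [eLpNorm_congr_ae h0]
      exact ⟨fun h => h.2, fun h => ⟨(hu.comp measurable_prodMk_right).aestronglyMeasurable, h⟩⟩
    rw [e]
    exact measurableSet_lt (hn 0) measurable_const
  refine measurable_of_measurable_edist fun g => ?_
  classical
  have e : (fun ω => edist (toRandomL2 u ω) g) = fun ω =>
      if ω ∈ {ω | MemLp (fun x => u (x, ω)) 2 volume} then
        eLpNorm (fun x => u (x, ω) - g x) 2 volume else edist 0 g := by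
    funext ω
    split_ifs with h
    · rw [Lp.edist_def]
      exact eLpNorm_congr_ae ((toRandomL2_ae_eq h).sub (ae_eq_refl _))
    · have h' : ¬ MemLp (fun x => u (x, ω)) 2 volume := h
      rw [toRandomL2, dif_neg h']
  rw [e]
  exact Measurable.ite hs (hn g) measurable_const

lemma aemeasurable_toRandomL2 (hu : AEStronglyMeasurable u (volume.prod P)) :
    AEMeasurable (toRandomL2 (d := d) u) P :=
  ⟨_, measurable_toRandomL2 hu.stronglyMeasurable_mk.measurable, toRandomL2_congr hu.ae_eq_mk⟩

lemma eLpNorm_prod_sq_swap (hu : AEStronglyMeasurable u (volume.prod P)) :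
    eLpNorm u 2 (volume.prod P) ^ 2 = ∫⁻ ω, eLpNorm (fun x => u (x, ω)) 2 volume ^ 2 ∂P := by
  simp only [eLpNorm_two_sq]
  exact lintegral_prod_symm _ (hu.enorm.pow_const 2)

lemma ae_memLp_of_memLp_prod (hu : MemLp u 2 (volume.prod P)) :
    ∀ᵐ ω ∂P, MemLp (fun x => u (x, ω)) 2 volume := by
  have hm := hu.1.prod_swap.prodMk_left
  have hm2 : AEMeasurable (fun ω => eLpNorm (fun x => u (x, ω)) 2 volume ^ 2) P := by
    simp only [eLpNorm_two_sq]
    exact (hu.1.prod_swap.enorm.pow_const 2).lintegral_prod_right'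
  have hi := ae_lt_top' hm2 (by rw [← eLpNorm_prod_sq_swap hu.1]; exact pow_ne_top hu.2.ne)
  filter_upwards [hm, hi] with ω h1 h2
  exact ⟨h1, (ENNReal.pow_lt_top_iff.1 h2).resolve_right two_ne_zero⟩

/-- The norm in `L²(Ω; L²(ℝ^d))`. -/
lemma eLpNorm_toRandomL2_sub (hu : MemLp u 2 (volume.prod P)) (hu' : MemLp u' 2 (volume.prod P)) :
    eLpNorm (fun ω => toRandomL2 u ω - toRandomL2 u' ω) 2 P
      = eLpNorm (fun z => u z - u' z) 2 (volume.prod P) := by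
  refine (ENNReal.pow_right_strictMono two_ne_zero).injective ?_
  rw [eLpNorm_prod_sq_swap (u := fun z => u z - u' z) (hu.1.sub hu'.1), ← eLpNorm_norm,
    eLpNorm_two_sq]
  simp only [enorm_norm]
  refine lintegral_congr_ae ?_
  filter_upwards [ae_memLp_of_memLp_prod hu, ae_memLp_of_memLp_prod hu'] with ω h h'
  rw [← edist_eq_enorm_sub, Lp.edist_def]
  exact congrArg (· ^ 2) (eLpNorm_congr_ae ((toRandomL2_ae_eq h).sub (toRandomL2_ae_eq h')))

end

/-! ### The law of a Gaussian field -/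

section

variable {V : Space d → Ω → ℝ}

/-- A jointly measurable centred Gaussian field with bounded variance. -/
structure IsCenteredGaussianField (P : Measure Ω) (V : Space d → Ω → ℝ) : Prop where
  measurable : Measurable (uncurry V)
  gaussian : IsGaussianProcess V P
  mean_zero : ∀ x, ∫ ω, V x ω ∂P = 0
  bound : ∃ c, ∀ x, ∫ ω, V x ω ^ 2 ∂P ≤ c

lemma integral_cexp_of_hasGaussianLaw {Y : Ω → ℝ} (hY : HasGaussianLaw Y P) (h0 : ∫ ω, Y ω ∂P = 0) :
    ∫ ω, Complex.exp (Y ω * Complex.I) ∂P = Complex.exp (-((∫ ω, Y ω ^ 2 ∂P : ℝ) : ℂ) / 2) := by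
  have h := hY.charFun_map_eq 1
  rw [charFun_apply_real, integral_map hY.aemeasurable (by fun_prop)] at h
  simp only [Complex.ofReal_one, one_mul] at h
  rw [h]
  have e : (fun ω => inner ℝ (1 : ℝ) (Y ω)) = Y := by funext ω; simp
  rw [e, variance_of_integral_eq_zero hY.aemeasurable h0, h0]
  congr 1
  push_cast
  ring

lemma integral_cexp_congr {X Y : Ω → ℝ} (h : X =ᵐ[P] Y) :
    ∫ ω, Complex.exp (X ω * Complex.I) ∂P = Complex.exp (-((∫ ω, X ω ^ 2 ∂P : ℝ) : ℂ) / 2) ↔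
      ∫ ω, Complex.exp (Y ω * Complex.I) ∂P = Complex.exp (-((∫ ω, Y ω ^ 2 ∂P : ℝ) : ℂ) / 2) := by
  have e1 : ∫ ω, Complex.exp (X ω * Complex.I) ∂P = ∫ ω, Complex.exp (Y ω * Complex.I) ∂P :=
    integral_congr_ae (h.fun_comp fun t : ℝ => Complex.exp (t * Complex.I))
  have e2 : ∫ ω, X ω ^ 2 ∂P = ∫ ω, Y ω ^ 2 ∂P := integral_congr_ae (h.fun_comp fun t : ℝ => t ^ 2)
  rw [e1, e2]

lemma continuous_integral_cexp :
    Continuous fun Z : Lp ℝ 2 P => ∫ ω, Complex.exp (Z ω * Complex.I) ∂P := by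
  have hi : ∀ Z : Lp ℝ 2 P, Integrable (fun ω => Complex.exp (Z ω * Complex.I)) P := fun Z => by
    refine Integrable.of_bound (C := 1) ?_ (ae_of_all _ fun ω => by rw [Complex.norm_exp_ofReal_mul_I])
    exact (by fun_prop : Continuous fun x : ℝ => Complex.exp (x * Complex.I)).comp_aestronglyMeasurable
      (by fun_prop)
  refine LipschitzWith.continuous (K := 1) (LipschitzWith.of_dist_le_mul fun Z Z' => ?_)
  have hd : MemLp (fun ω => Z ω - Z' ω) 2 P := (Lp.memLp Z).sub (Lp.memLp Z')
  rw [dist_eq_norm, ← integral_sub (hi Z) (hi Z'), NNReal.coe_one, one_mul]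
  calc _ ≤ ∫ ω, ‖Z ω - Z' ω‖ ∂P := by
        refine norm_integral_le_of_norm_le (hd.integrable one_le_two).norm (ae_of_all _ fun ω => ?_)
        have e : Complex.exp (Z ω * Complex.I) - Complex.exp (Z' ω * Complex.I)
            = Complex.exp (Z' ω * Complex.I) * (Complex.exp (Complex.I * ((Z ω - Z' ω : ℝ) : ℂ)) - 1) := by
          rw [mul_sub, mul_one, ← Complex.exp_add]
          congr 2
          push_cast
          ring
        rw [e, norm_mul, Complex.norm_exp_ofReal_mul_I, one_mul]
        exact Real.norm_exp_I_mul_ofReal_sub_one_le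
    _ = (eLpNorm (fun ω => Z ω - Z' ω) 1 P).toReal := by
        rw [eLpNorm_one_eq_lintegral_enorm, integral_norm_eq_lintegral_enorm hd.1]
    _ ≤ (eLpNorm (fun ω => Z ω - Z' ω) 2 P).toReal :=
        ENNReal.toReal_mono hd.2.ne (eLpNorm_le_eLpNorm_of_exponent_le one_le_two hd.1)
    _ = dist Z Z' := by rw [Lp.dist_def]; rfl

lemma IsCenteredGaussianField.memLp (hV : IsCenteredGaussianField P V) (x : Space d) :
    MemLp (V x) 2 P := (hV.gaussian.hasGaussianLaw_eval x).memLp_two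

/-- The closed linear span of the field in `L²(Ω)` consists of centred Gaussian variables. -/
lemma IsCenteredGaussianField.integral_cexp_of_mem_closure (hV : IsCenteredGaussianField P V)
    {Z : Lp ℝ 2 P}
    (hZ : Z ∈ (Submodule.span ℝ (range fun x => (hV.memLp x).toLp (V x))).topologicalClosure) :
    ∫ ω, Complex.exp (Z ω * Complex.I) ∂P = Complex.exp (-((∫ ω, Z ω ^ 2 ∂P : ℝ) : ℂ) / 2) := by
  have hn : ∀ Z : Lp ℝ 2 P, ∫ ω, Z ω ^ 2 ∂P = ‖Z‖ ^ 2 := fun Z => by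
    rw [← real_inner_self_eq_norm_sq, L2.inner_def]
    exact integral_congr_ae (ae_of_all _ fun ω => by simp [sq])
  have hcl : IsClosed {Z : Lp ℝ 2 P | ∫ ω, Complex.exp (Z ω * Complex.I) ∂P
      = Complex.exp (-((∫ ω, Z ω ^ 2 ∂P : ℝ) : ℂ) / 2)} := by
    simp only [hn]
    exact isClosed_eq continuous_integral_cexp (by fun_prop)
  refine closure_minimal (fun Z hZ => ?_) hcl hZ
  obtain ⟨c, rfl⟩ := (Finsupp.mem_span_range_iff_exists_finsupp).1 hZ
  have hG : IsGaussianProcess (fun x ω => c x • V x ω) P := hV.gaussian.smul c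
  have he : (c.sum fun x a => a • (hV.memLp x).toLp (V x) : Lp ℝ 2 P)
      =ᵐ[P] fun ω => ∑ x ∈ c.support, c x • V x ω := by
    rw [Finsupp.sum]
    refine (Lp.coeFn_finsetSum _ _).trans ?_
    filter_upwards [(ae_ball_iff c.support.countable_toSet).2 fun x _ => (Lp.coeFn_smul (c x)
      ((hV.memLp x).toLp (V x))).trans ((hV.memLp x).coeFn_toLp.const_smul (c x))] with ω hω
    rw [Finset.sum_apply]
    exact sum_congr rfl fun x hx => hω x hx
  refine (integral_cexp_congr he).2 (integral_cexp_of_hasGaussianLaw hG.hasGaussianLaw_fun_sum ?_)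
  rw [integral_finsetSum (f := fun x ω => c x • V x ω) _
    fun x _ => ((hV.memLp x).integrable one_le_two).smul (c x)]
  simp [integral_const_mul, hV.mean_zero]

lemma integral_abs_mul_le {X Y : Ω → ℝ} (hX : MemLp X 2 P) (hY : MemLp Y 2 P) {b : ℝ}
    (ha : ∫ ω, X ω ^ 2 ∂P ≤ a) (hb : ∫ ω, Y ω ^ 2 ∂P ≤ b) : ∫ ω, |X ω * Y ω| ∂P ≤ a + b := by
  have hi := hX.integrable_sq.add hY.integrable_sq
  refine (integral_mono_of_nonneg (ae_of_all _ fun ω => abs_nonneg _) hi (ae_of_all _ fun ω =>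
    abs_le.2 ⟨?_, ?_⟩)).trans ((integral_add hX.integrable_sq hY.integrable_sq).le.trans
      (add_le_add ha hb))
  · simp only [Pi.add_apply]
    nlinarith [sq_nonneg (X ω + Y ω), sq_nonneg (X ω), sq_nonneg (Y ω)]
  · simp only [Pi.add_apply]
    nlinarith [sq_nonneg (X ω - Y ω), sq_nonneg (X ω), sq_nonneg (Y ω)]

/-- By Fubini, `∫ k V` is orthogonal to every variable orthogonal to the field, so it lies in the
closed span of the field and is a centred Gaussian variable. No approximation by Riemann sums is
needed. Its variance is computed by Fubini. -/
lemma IsCenteredGaussianField.integral_cexp (hV : IsCenteredGaussianField P V) {k : Space d → ℝ}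
    (hk : Integrable k) :
    ∫ ω, Complex.exp (((∫ x, k x * V x ω : ℝ) : ℂ) * Complex.I) ∂P = Complex.exp
      (-((∫ z, k z.1 * k z.2 * ∫ ω, V z.1 ω * V z.2 ω ∂P ∂(volume.prod volume) : ℝ) : ℂ) / 2) := by
  obtain ⟨c, hc⟩ := hV.bound
  obtain ⟨h1, h2⟩ := integral_mul_integral (Y := Ω) (μ := P) hk hk hV.measurable hV.measurable
    (fun x y => (hV.memLp x).integrable_mul (hV.memLp y))
    fun x y => integral_abs_mul_le (hV.memLp x) (hV.memLp y) (hc x) (hc y)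
  set Z : Ω → ℝ := fun ω => ∫ x, k x * V x ω with hZ
  have hZm : AEStronglyMeasurable Z P :=
    (hk.aestronglyMeasurable.comp_snd.mul (hV.measurable.comp measurable_swap).aestronglyMeasurable
      : AEStronglyMeasurable (fun z : Ω × Space d => k z.2 * V z.2 z.1) (P.prod volume)).integral_prod_right'
  have hZ2 : MemLp Z 2 P := (memLp_two_iff_integrable_sq hZm).2 (h1.congr (ae_of_all _ fun ω => (sq _).symm))
  have hmem : hZ2.toLp Z ∈
      (Submodule.span ℝ (range fun x => (hV.memLp x).toLp (V x))).topologicalClosure := by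
    rw [← Submodule.orthogonal_orthogonal_eq_closure, Submodule.mem_orthogonal]
    intro Y hY
    have hYm : MemLp Y 2 P := Lp.memLp Y
    have hY0 : ∀ x, ∫ ω, V x ω * Y ω ∂P = 0 := fun x => by
      have h0 := (Submodule.mem_orthogonal _ _).1 hY _ (Submodule.subset_span ⟨x, rfl⟩)
      rw [L2.inner_def] at h0
      rw [← h0]
      refine integral_congr_ae ?_
      filter_upwards [(hV.memLp x).coeFn_toLp] with ω hω
      simp only [hω, RCLike.inner_apply, conj_trivial, mul_comm]
    -- The same Fubini statement, with a one-point space for the second parameter.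
    have h := (integral_mul_integral (Y := Ω) (μ := P) (β := Measure.dirac ()) (H' := fun _ => 1)
      (F' := fun _ => Y) hk (integrable_const _) hV.measurable
      ((Lp.stronglyMeasurable Y).measurable.comp measurable_snd)
      (fun x _ => (hV.memLp x).integrable_mul hYm)
      fun x _ => integral_abs_mul_le (hV.memLp x) hYm (hc x) le_rfl).2
    simp only [hY0, mul_zero, integral_zero, integral_dirac, one_mul] at h
    rw [L2.inner_def, ← h]
    refine integral_congr_ae ?_
    filter_upwards [hZ2.coeFn_toLp] with ω hω
    rw [RCLike.inner_apply, conj_trivial, hω]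
  rw [(integral_cexp_congr hZ2.coeFn_toLp).1 (hV.integral_cexp_of_mem_closure hmem), ← h2]
  simp only [sq, hZ]

/-- A positive integrable weight. -/
def weight (x : Space d) : ℝ := exp (-(1 * ‖x‖ ^ 2))

lemma weight_pos (x : Space d) : 0 < weight x := Real.exp_pos _

lemma measurable_weight : Measurable (weight : Space d → ℝ) :=
  (by unfold weight; fun_prop : Continuous (weight : Space d → ℝ)).measurable

lemma integrable_weight_sq : Integrable fun x : Space d => weight x ^ 2 := by
  refine (integrable_gaussian (d := d) (b := 2) two_pos).congr (ae_of_all _ fun x => ?_)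
  simp only [weight, sq (exp _)]
  rw [← Real.exp_add]
  ring_nf

/-- The random element of `L²(ℝ^d)` given by the field times the weight. -/
def fieldElement (V : Space d → Ω → ℝ) : Ω → L2 d := toRandomL2 fun z => weight z.1 * V z.1 z.2

lemma IsCenteredGaussianField.memLp_weight_mul (hV : IsCenteredGaussianField P V) :
    MemLp (fun z : Space d × Ω => weight z.1 * V z.1 z.2) 2 (volume.prod P) := by
  obtain ⟨c, hc⟩ := hV.bound
  have hm : Measurable fun z : Space d × Ω => weight z.1 * V z.1 z.2 :=
    (measurable_weight.comp measurable_fst).mul hV.measurable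
  refine (memLp_two_iff_integrable_sq hm.aestronglyMeasurable).2
    ((integrable_prod_iff (hm.pow_const 2).aestronglyMeasurable).2 ⟨ae_of_all _ fun x => ?_, ?_⟩)
  · exact ((hV.memLp x).const_mul (weight x)).integrable_sq
  · refine (integrable_weight_sq.mul_const c).mono'
      (hm.pow_const 2).aestronglyMeasurable.norm.integral_prod_right' (ae_of_all _ fun x => ?_)
    rw [Real.norm_of_nonneg (integral_nonneg fun _ => norm_nonneg _)]
    simp only [norm_pow, norm_mul, mul_pow, Real.norm_eq_abs, sq_abs]
    rw [integral_const_mul]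
    exact mul_le_mul_of_nonneg_left (hc x) (sq_nonneg _)

lemma IsCenteredGaussianField.aemeasurable_fieldElement (hV : IsCenteredGaussianField P V) :
    AEMeasurable (fieldElement V) P := aemeasurable_toRandomL2 hV.memLp_weight_mul.1

lemma IsCenteredGaussianField.fieldElement_ae_eq (hV : IsCenteredGaussianField P V) :
    ∀ᵐ ω ∂P, fieldElement V ω =ᵐ[volume] fun x => weight x * V x ω :=
  (ae_memLp_of_memLp_prod hV.memLp_weight_mul).mono fun _ h => toRandomL2_ae_eq h

lemma IsCenteredGaussianField.charFun_fieldElement (hV : IsCenteredGaussianField P V) (h : L2 d) :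
    charFun (P.map (fieldElement V)) h = Complex.exp (-((∫ z, weight z.1 * h z.1 *
      (weight z.2 * h z.2) * ∫ ω, V z.1 ω * V z.2 ω ∂P ∂(volume.prod volume) : ℝ) : ℂ) / 2) := by
  have hk : Integrable fun x : Space d => weight x * h x :=
    ((memLp_two_iff_integrable_sq measurable_weight.aestronglyMeasurable).2
      integrable_weight_sq).integrable_mul (Lp.memLp h)
  rw [charFun_apply, integral_map hV.aemeasurable_fieldElement (by fun_prop), ← hV.integral_cexp hk]
  refine integral_congr_ae ?_
  filter_upwards [hV.fieldElement_ae_eq] with ω hω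
  have e : (inner ℝ (fieldElement V ω) h : ℝ) = ∫ x, weight x * h x * V x ω := by
    rw [L2.inner_def]
    refine integral_congr_ae ?_
    filter_upwards [hω] with x hx
    rw [RCLike.inner_apply, conj_trivial, hx]
    ring
  rw [e]

/-- The law of a Gaussian field depends on the covariance only through its class. -/
lemma IsCenteredGaussianField.map_fieldElement_eq {V' : Space d → Ω' → ℝ}
    (hV : IsCenteredGaussianField P V) (hV' : IsCenteredGaussianField P' V')
    (hc : ∀ᵐ z ∂(volume.prod volume), ∫ ω, V z.1 ω * V z.2 ω ∂P = ∫ ω, V' z.1 ω * V' z.2 ω ∂P') :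
    P.map (fieldElement V) = P'.map (fieldElement V') := by
  have := Measure.isProbabilityMeasure_map (μ := P) hV.aemeasurable_fieldElement
  have := Measure.isProbabilityMeasure_map (μ := P') hV'.aemeasurable_fieldElement
  refine Measure.ext_of_charFun (funext fun h => ?_)
  rw [hV.charFun_fieldElement, hV'.charFun_fieldElement]
  congr 4
  exact integral_congr_ae (hc.mono fun z hz => by simp only [hz])

/-- A measurable field on `L²(ℝ^d)` from which every Gaussian field is recovered. -/
lemma exists_canonicalField (d : ℕ) : ∃ V₀ : Space d → L2 d → ℝ, Measurable (uncurry V₀) ∧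
      ∀ h : L2 d, ∀ᵐ x, weight x * V₀ x h = h x := by
  -- A jointly measurable version of the identity of `L²(ℝ^d)`, that is a measurable choice of
  -- representatives; dividing by the weight recovers the field.
  obtain ⟨F, hF, hFh⟩ := exists_measurable_version (A := L2 d) (μ := (volume : Measure (Space d)))
    (stronglyMeasurable_id : StronglyMeasurable fun h : L2 d => h)
  refine ⟨fun x h => (weight x)⁻¹ * F (h, x), ((measurable_weight.comp measurable_fst).inv).mul
    (by fun_prop), fun h => ?_⟩
  filter_upwards [hFh h] with x hx
  rw [mul_inv_cancel_left₀ (weight_pos x).ne']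
  exact hx

lemma IsCenteredGaussianField.ae_eq_canonicalField (hV : IsCenteredGaussianField P V)
    {V₀ : Space d → L2 d → ℝ} (h₀ : ∀ h : L2 d, ∀ᵐ x, weight x * V₀ x h = h x) :
    ∀ᵐ ω ∂P, ∀ᵐ x, V x ω = V₀ x (fieldElement V ω) := by
  filter_upwards [hV.fieldElement_ae_eq] with ω hω
  filter_upwards [hω, h₀ (fieldElement V ω)] with x hx hx'
  rw [hx] at hx'
  exact (mul_left_cancel₀ (weight_pos x).ne' hx').symm

end

/-! ### Transfer of the law of the solutions -/

section

variable {V : Space d → Ω → ℝ} {V' : Space d → Ω' → ℝ} {m : ℝ} {p : Space d → Space d → ℂ}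

/-- Two random fields are represented by one field on a third probability space. -/
structure IsCoupled (P : Measure Ω) (P' : Measure Ω') (V : Space d → Ω → ℝ) (V' : Space d → Ω' → ℝ)
    (ℓ : Measure (L2 d)) (V₀ : Space d → L2 d → ℝ) (Φ : Ω → L2 d) (Φ' : Ω' → L2 d) : Prop where
  measurable : Measurable (uncurry V₀)
  left : MeasurePreserving Φ P ℓ
  right : MeasurePreserving Φ' P' ℓ
  left_eq : ∀ᵐ ω ∂P, ∀ᵐ x, V x ω = V₀ x (Φ ω)
  right_eq : ∀ᵐ ω ∂P', ∀ᵐ x, V' x ω = V₀ x (Φ' ω)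

lemma IsCoupled.isProbabilityMeasure {ℓ : Measure (L2 d)} {V₀ : Space d → L2 d → ℝ} {Φ : Ω → L2 d}
    {Φ' : Ω' → L2 d} (hc : IsCoupled P P' V V' ℓ V₀ Φ Φ') : IsProbabilityMeasure ℓ :=
  hc.left.map_eq ▸ Measure.isProbabilityMeasure_map hc.left.aemeasurable

lemma IsCenteredGaussianField.exists_isCoupled (hV : IsCenteredGaussianField P V)
    (hV' : IsCenteredGaussianField P' V')
    (hc : ∀ᵐ z ∂(volume.prod volume), ∫ ω, V z.1 ω * V z.2 ω ∂P = ∫ ω, V' z.1 ω * V' z.2 ω ∂P') :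
    ∃ ℓ V₀ Φ Φ', IsCoupled P P' V V' ℓ V₀ Φ Φ' := by
  obtain ⟨V₀, hm, h₀⟩ := exists_canonicalField d
  have h := hV.aemeasurable_fieldElement
  have h' := hV'.aemeasurable_fieldElement
  refine ⟨P.map (fieldElement V), V₀, h.mk _, h'.mk _, hm, ⟨h.measurable_mk, ?_⟩,
    ⟨h'.measurable_mk, ?_⟩, ?_, ?_⟩
  · exact (Measure.map_congr h.ae_eq_mk).symm
  · rw [hV.map_fieldElement_eq hV' hc]
    exact (Measure.map_congr h'.ae_eq_mk).symm
  · filter_upwards [hV.ae_eq_canonicalField h₀, h.ae_eq_mk] with ω h1 h2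
    rwa [← h2]
  · filter_upwards [hV'.ae_eq_canonicalField h₀, h'.ae_eq_mk] with ω h1 h2
    rwa [← h2]

/-- Coordinate projections pull null sets back to null sets, so fields that agree for almost every
point agree in all `n` factors for almost every vector of points. -/
lemma noiseTerm_congr {H : Space d → (Fin n → Space d) → ℝ} {V' : Space d → Ω' → ℝ} {ω : Ω}
    {ω' : Ω'} (h : ∀ᵐ x, V x ω = V' x ω') (x : Space d) :
    noiseTerm H V (x, ω) = noiseTerm H V' (x, ω') := by
  have h2 : ∀ᵐ y : Fin n → Space d, ∀ i, V (y i) ω = V' (y i) ω' := ae_all_iff.2 fun i =>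
    (Measure.quasiMeasurePreserving_eval (fun _ : Fin n => (volume : Measure (Space d))) i).ae h
  exact integral_congr_ae (h2.mono fun y hy => by simp only [hy])

lemma MeasurePreserving.id_prodMap {ℓ : Measure (L2 d)} {Φ : Ω → L2 d} [IsProbabilityMeasure ℓ]
    (h : MeasurePreserving Φ P ℓ) :
    MeasurePreserving (fun z : Space d × Ω => (z.1, Φ z.2)) (volume.prod P) (volume.prod ℓ) :=
  (MeasurePreserving.id volume).prod h

/-- The terms of the Duhamel expansion as functionals of the field. -/
lemma GreenSetting.exists_canonicalTerm (S : GreenSetting m p G u₀) {ℓ : Measure (L2 d)}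
    [IsProbabilityMeasure ℓ] {V₀ : Space d → L2 d → ℝ} {Φ : Ω → L2 d} {Φ' : Ω' → L2 d}
    (hc : IsCoupled P P' V V' ℓ V₀ Φ Φ') (hV : HasMoments P V) (hV' : HasMoments P' V') (ht : 0 ≤ t)
    (hmem : MemLp (duhamel G u₀ V 0 t) 2 (volume.prod P)) :
    ∃ N : ℕ → Space d × L2 d → ℝ, (∀ n, AEStronglyMeasurable (N n) (volume.prod ℓ)) ∧
      (∀ n, duhamel G u₀ V n t =ᵐ[volume.prod P] fun z => N n (z.1, Φ z.2)) ∧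
      (∀ n, duhamel G u₀ V' n t =ᵐ[volume.prod P'] fun z => N n (z.1, Φ' z.2)) := by
  obtain ⟨C, u, hu, D⟩ := S.exists_data (show 0 < t + 1 by linarith)
  refine ⟨fun n => Nat.casesOn n (fun z => freeEvolution G u₀ t z.1)
    fun n => noiseTerm (chainInt (greenCutoff G (t + 1)) u (n + 1) t) V₀, fun n => ?_, fun n => ?_,
    fun n => ?_⟩
  · rcases n with _ | n
    -- The zeroth term does not depend on the sample, so its measurability in `x` can be read off
    -- from one section.
    · obtain ⟨ω, hω⟩ := hmem.1.prod_swap.prodMk_left.exists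
      exact AEStronglyMeasurable.comp_fst (f := freeEvolution G u₀ t) hω
    · exact (measurable_noiseTerm (D.measurable_chainInt _ _) hc.measurable).aestronglyMeasurable
  · rcases n with _ | n
    · rfl
    · refine (D.duhamel_succ_ae_eq hu hV n ht (by linarith)).trans ?_
      filter_upwards [Measure.quasiMeasurePreserving_snd.ae hc.left_eq] with z hz
      exact noiseTerm_congr hz z.1
  · rcases n with _ | n
    · rfl
    · refine (D.duhamel_succ_ae_eq hu hV' n ht (by linarith)).trans ?_
      filter_upwards [Measure.quasiMeasurePreserving_snd.ae hc.right_eq] with z hz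
      exact noiseTerm_congr hz z.1

lemma HasL2Sum.ae_eq {X : Type*} [MeasurableSpace X] {μ : Measure X} {v v' : ℕ → X → ℝ}
    {u u' : X → ℝ} (hu : MemLp u 2 μ) (hu' : MemLp u' 2 μ) (h : HasL2Sum μ v u)
    (h' : HasL2Sum μ v' u') (hv : ∀ n, MemLp (v n) 2 μ) (hvv : ∀ n, v n =ᵐ[μ] v' n) :
    u =ᵐ[μ] u' := by
  have h0 := h.eLpNorm_sub_le hu hu' (h'.congr fun n => (hvv n).symm) hv hv (c := fun _ => 0)
    fun n => by simp
  rw [tsum_zero, nonpos_iff_eq_zero, eLpNorm_eq_zero_iff (f := fun x => u x - u' x) (hu.1.sub hu'.1)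
    two_ne_zero] at h0
  filter_upwards [h0] with x hx using sub_eq_zero.1 hx

lemma HasL2Sum.comp {X Y : Type*} [MeasurableSpace X] [MeasurableSpace Y] {μ : Measure X}
    {ν : Measure Y} {v : ℕ → Y → ℝ} {u : Y → ℝ} {Ψ : X → Y} (hΨ : MeasurePreserving Ψ μ ν)
    (hu : MemLp u 2 ν) (hv : ∀ n, MemLp (v n) 2 ν) (h : HasL2Sum ν v u) :
    HasL2Sum μ (fun n x => v n (Ψ x)) fun x => u (Ψ x) := by
  have e : ∀ N, eLpNorm (fun y => u y - ∑ n ∈ Finset.range N, v n y) 2 ν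
      = eLpNorm (fun x => u (Ψ x) - ∑ n ∈ Finset.range N, v n (Ψ x)) 2 μ := fun N => by
    have hm : AEStronglyMeasurable (fun y => u y - ∑ n ∈ Finset.range N, v n y) ν :=
      hu.1.sub (memLp_finsetSum _ fun n _ => hv n).1
    rw [← eLpNorm_comp_measurePreserving hm hΨ]
    rfl
  unfold HasL2Sum at h ⊢
  simpa only [e] using h

/-- The terms of the expansions for two coupled fields have the same norm. -/
lemma GreenSetting.memLp_duhamel_of_isCoupled (S : GreenSetting m p G u₀) {ℓ : Measure (L2 d)}
    {V₀ : Space d → L2 d → ℝ} {Φ : Ω → L2 d} {Φ' : Ω' → L2 d} (hc : IsCoupled P P' V V' ℓ V₀ Φ Φ')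
    (hV : HasMoments P V) (hV' : HasMoments P' V') (ht : 0 ≤ t)
    (hmem : ∀ n, MemLp (duhamel G u₀ V n t) 2 (volume.prod P)) (n : ℕ) :
    MemLp (duhamel G u₀ V' n t) 2 (volume.prod P') ∧
    eLpNorm (duhamel G u₀ V' n t) 2 (volume.prod P')
      = eLpNorm (duhamel G u₀ V n t) 2 (volume.prod P) := by
  have := hc.isProbabilityMeasure
  obtain ⟨N, hN, h1, h2⟩ := S.exists_canonicalTerm hc hV hV' ht (hmem 0)
  have e1 := eLpNorm_comp_measurePreserving (p := 2) (hN n) (MeasurePreserving.id_prodMap hc.left)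
  have e2 := eLpNorm_comp_measurePreserving (p := 2) (hN n) (MeasurePreserving.id_prodMap hc.right)
  have e : eLpNorm (duhamel G u₀ V' n t) 2 (volume.prod P')
      = eLpNorm (duhamel G u₀ V n t) 2 (volume.prod P) := by
    rw [eLpNorm_congr_ae (h1 n), eLpNorm_congr_ae (h2 n)]
    exact e2.trans e1.symm
  refine ⟨⟨((hN n).comp_measurePreserving (MeasurePreserving.id_prodMap hc.right)).congr (h2 n).symm, ?_⟩, e⟩
  rw [e]
  exact (hmem n).2

/-- The solutions for two coupled fields have the same finite dimensional distributions. -/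
lemma GreenSetting.map_toRandomL2_eq (S : GreenSetting m p G u₀) {ℓ : Measure (L2 d)}
    {V₀ : Space d → L2 d → ℝ} {Φ : Ω → L2 d} {Φ' : Ω' → L2 d}
    (hc : IsCoupled P P' V V' ℓ V₀ Φ Φ') (hV : HasMoments P V) (hV' : HasMoments P' V') {k : ℕ}
    {τ : Fin k → ℝ} (hτ : ∀ i, 0 ≤ τ i) {b : Fin k → ℕ → ℝ≥0} (hb : ∀ i, Summable (b i))
    (hmem : ∀ i n, MemLp (duhamel G u₀ V n (τ i)) 2 (volume.prod P) ∧
      eLpNorm (duhamel G u₀ V n (τ i)) 2 (volume.prod P) ≤ b i n)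
    {u : Fin k → Space d × Ω → ℝ} {u' : Fin k → Space d × Ω' → ℝ}
    (hu : ∀ i, MemLp (u i) 2 (volume.prod P)) (hu' : ∀ i, MemLp (u' i) 2 (volume.prod P'))
    (hs : ∀ i, HasL2Sum (volume.prod P) (fun n => duhamel G u₀ V n (τ i)) (u i))
    (hs' : ∀ i, HasL2Sum (volume.prod P') (fun n => duhamel G u₀ V' n (τ i)) (u' i)) :
    P.map (fun ω i => toRandomL2 (u i) ω) = P'.map (fun ω i => toRandomL2 (u' i) ω) := by
  have := hc.isProbabilityMeasure
  have hΨ := MeasurePreserving.id_prodMap hc.left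
  have hΨ' := MeasurePreserving.id_prodMap hc.right
  -- The series is summed once, on the canonical space; by uniqueness of sums both solutions are
  -- pullbacks of this one function.
  have key : ∀ i, ∃ U : Space d × L2 d → ℝ, MemLp U 2 (volume.prod ℓ) ∧
      (u i =ᵐ[volume.prod P] fun z => U (z.1, Φ z.2)) ∧
      (u' i =ᵐ[volume.prod P'] fun z => U (z.1, Φ' z.2)) := by
    intro i
    obtain ⟨N, hN, h1, h2⟩ := S.exists_canonicalTerm hc hV hV' (hτ i) (hmem i 0).1
    have e : ∀ n, eLpNorm (N n) 2 (volume.prod ℓ) = eLpNorm (duhamel G u₀ V n (τ i)) 2 (volume.prod P) :=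
      fun n => (eLpNorm_comp_measurePreserving (hN n) hΨ).symm.trans (eLpNorm_congr_ae (h1 n)).symm
    have hNm : ∀ n, MemLp (N n) 2 (volume.prod ℓ) := fun n => ⟨hN n, by rw [e]; exact (hmem i n).1.2⟩
    obtain ⟨U, hU, hUs⟩ := exists_hasL2Sum hNm (hb i) fun n => by rw [e]; exact (hmem i n).2
    refine ⟨U, hU, ?_, ?_⟩
    · exact (hs i).ae_eq (hu i) (hU.comp_measurePreserving hΨ) (hUs.comp hΨ hU hNm)
        (fun n => (hmem i n).1) h1
    · exact (hs' i).ae_eq (hu' i) (hU.comp_measurePreserving hΨ') (hUs.comp hΨ' hU hNm)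
        (fun n => (S.memLp_duhamel_of_isCoupled hc hV hV' (hτ i) (fun n => (hmem i n).1) n).1) h2
  choose U hU h1 h2 using key
  have hΘ : AEMeasurable (fun h i => toRandomL2 (U i) h) ℓ :=
    aemeasurable_pi_lambda _ fun i => aemeasurable_toRandomL2 (hU i).1
  have e1 : P.map (fun ω i => toRandomL2 (u i) ω) = ℓ.map fun h i => toRandomL2 (U i) h := by
    rw [← hc.left.map_eq, AEMeasurable.map_map_of_aemeasurable (hc.left.map_eq ▸ hΘ) hc.left.aemeasurable]
    refine Measure.map_congr ((ae_all_iff.2 fun i => toRandomL2_congr (h1 i)).mono fun ω hω => ?_)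
    exact funext hω
  have e2 : P'.map (fun ω i => toRandomL2 (u' i) ω) = ℓ.map fun h i => toRandomL2 (U i) h := by
    rw [← hc.right.map_eq, AEMeasurable.map_map_of_aemeasurable (hc.right.map_eq ▸ hΘ) hc.right.aemeasurable]
    refine Measure.map_congr ((ae_all_iff.2 fun i => toRandomL2_congr (h2 i)).mono fun ω hω => ?_)
    exact funext hω
  rw [e1, e2]

end

/-! ### The rescaled field and the mollified noise -/

section

variable {q : Space d → Ω' → ℝ}

lemma measurable_rescale (hq : IsStationaryGaussianField P' q) (ε : ℝ) :
    Measurable (uncurry (rescale q ε)) :=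
  (hq.measurable.comp (f := fun z : Space d × Ω' => (ε⁻¹ • z.1, z.2)) (by fun_prop)).const_mul _

lemma integral_rescale_mul (hq : IsStationaryGaussianField P' q) (hε : 0 < ε) (x y : Space d) :
    ∫ ω, rescale q ε x ω * rescale q ε y ω ∂P' = (ε ^ d)⁻¹ * correlation P' q (ε⁻¹ • (y - x)) := by
  rw [smul_sub, ← hq.integral_mul, ← integral_const_mul]
  refine integral_congr_ae (ae_of_all _ fun ω => ?_)
  have e : ε ^ (-(d : ℝ) / 2) * ε ^ (-(d : ℝ) / 2) = (ε ^ d)⁻¹ := by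
    rw [← Real.rpow_add hε, ← Real.rpow_natCast, ← Real.rpow_neg hε.le]
    congr 1
    ring
  simp only [rescale]
  rw [← e]
  ring

lemma isCenteredGaussianField_rescale (hq : IsStationaryGaussianField P' q) (hε : 0 < ε) :
    IsCenteredGaussianField P' (rescale q ε) where
  measurable := measurable_rescale hq ε
  gaussian := (hq.gaussian.comp_right fun x => ε⁻¹ • x).smul fun _ => ε ^ (-(d : ℝ) / 2)
  mean_zero x := by simp only [rescale, integral_const_mul, hq.mean_zero, mul_zero]
  bound := ⟨_, fun x => by simp only [sq]; rw [integral_rescale_mul hq hε, sub_self]⟩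

lemma hasMoments_rescale (hq : IsStationaryGaussianField P' q) (ε : ℝ) :
    HasMoments P' (rescale q ε) := by
  refine ⟨measurable_rescale hq ε, fun n => ⟨1 + n * ∫⁻ ω, ‖rescale q ε 0 ω‖ₑ ^ n ∂P', ?_, fun y => ?_⟩⟩
  · have h := ((hq.memLp 0 (ENNReal.natCast_ne_top n)).const_mul (ε ^ (-(d : ℝ) / 2))).integrable_norm_pow'
    have h2 := h.2
    simp only [HasFiniteIntegral, enorm_pow, enorm_norm] at h2
    simp only [rescale, smul_zero]
    exact ENNReal.add_ne_top.2 ⟨ENNReal.one_ne_top, mul_ne_top (ENNReal.natCast_ne_top n) h2.ne⟩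
  · have hm : ∀ i, Measurable fun ω => ‖rescale q ε (y i) ω‖ₑ ^ n := fun i =>
      ((measurable_rescale hq ε).comp (measurable_prodMk_left (x := y i))).enorm.pow_const n
    have hi : ∀ i, ∫⁻ ω, ‖rescale q ε (y i) ω‖ₑ ^ n ∂P' = ∫⁻ ω, ‖rescale q ε 0 ω‖ₑ ^ n ∂P' := fun i => by
      have h := (hq.identDistrib_pair (ε⁻¹ • y i) (ε⁻¹ • y i)).comp
        (u := fun z : ℝ × ℝ => ‖ε ^ (-(d : ℝ) / 2) * z.1‖ₑ ^ n) (by fun_prop)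
      simpa [rescale, Function.comp_def] using h.lintegral_eq
    calc ∫⁻ ω, ∏ i, ‖rescale q ε (y i) ω‖ₑ ∂P'
        ≤ ∫⁻ ω, (1 + ∑ i, ‖rescale q ε (y i) ω‖ₑ ^ n) ∂P' := lintegral_mono fun ω => by
          simp only [Real.enorm_eq_ofReal_abs, ← ofReal_pow (abs_nonneg _)]
          rw [← ENNReal.ofReal_prod_of_nonneg fun _ _ => abs_nonneg _, ← ENNReal.ofReal_sum_of_nonneg
            fun _ _ => by positivity, ← ENNReal.ofReal_one, ← ENNReal.ofReal_add one_pos.le (by positivity)]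
          exact ofReal_le_ofReal (prod_abs_le_one_add_sum _ _ n (by simp))
      _ = 1 + n * ∫⁻ ω, ‖rescale q ε 0 ω‖ₑ ^ n ∂P' := by
          rw [lintegral_add_left measurable_const, lintegral_finsetSum _ fun i _ => hm i]
          simp [hi]

lemma IsMollifiedNoise.ae_eq (hQ : IsMollifiedNoise W ρ Q) (hρ2 : MemLp ρ 2 volume) (hε : 0 < ε)
    (x : Space d) : Q ε x =ᵐ[P] W ((memLp_mollifier hρ2 hε x).toLp _) :=
  ((hQ ε hε).2 x).trans (Eq.eventuallyEq (dif_pos (memLp_mollifier hρ2 hε x)))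

lemma IsMollifiedNoise.integral_mul (hQ : IsMollifiedNoise W ρ Q) (hρ2 : MemLp ρ 2 volume)
    (hε : 0 < ε) (x y : Space d) :
    ∫ ω, Q ε x ω * Q ε y ω ∂P = (ε ^ d)⁻¹ * ∫ u, ρ u * ρ (u + ε⁻¹ • (y - x)) := by
  refine (integral_congr_ae ((hQ.ae_eq hρ2 hε x).mul (hQ.ae_eq hρ2 hε y))).trans ?_
  refine (integral_whiteNoise_mul _ _).trans ?_
  rw [L2.inner_def]
  have e : ∀ u, mollifier ρ ε y u * mollifier ρ ε x u = (ε ^ d)⁻¹ * (ε ^ d)⁻¹ *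
      (fun v => ρ (ε⁻¹ • v) * ρ (ε⁻¹ • v + ε⁻¹ • (y - x))) (x - u) := fun u => by
    simp only [mollifier, ← smul_add]
    rw [show x - u + (y - x) = y - u by abel]
    ring
  have e2 : ∫ u, mollifier ρ ε y u * mollifier ρ ε x u
      = (ε ^ d)⁻¹ * ∫ u, ρ u * ρ (u + ε⁻¹ • (y - x)) := by
    simp only [e]
    rw [integral_const_mul, integral_sub_left_eq_self (fun v => ρ (ε⁻¹ • v) *
      ρ (ε⁻¹ • v + ε⁻¹ • (y - x))), Measure.integral_comp_inv_smul_of_nonneg volume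
      (fun v => ρ v * ρ (v + ε⁻¹ • (y - x))) hε.le, finrank_euclideanSpace_fin, smul_eq_mul]
    field_simp
  rw [← e2]
  refine integral_congr_ae ?_
  filter_upwards [(memLp_mollifier hρ2 hε x).coeFn_toLp, (memLp_mollifier hρ2 hε y).coeFn_toLp]
    with u h1 h2
  rw [RCLike.inner_apply, conj_trivial, h1, h2]

lemma IsMollifiedNoise.isCenteredGaussianField (hQ : IsMollifiedNoise W ρ Q) (hW : IsWhiteNoise W)
    (hρ2 : MemLp ρ 2 volume) (hε : 0 < ε) : IsCenteredGaussianField P (Q ε) where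
  measurable := (hQ ε hε).1
  gaussian := ((isGaussianProcess_whiteNoise hW).comp_right fun x =>
    (memLp_mollifier hρ2 hε x).toLp _).congr fun x => (hQ.ae_eq hρ2 hε x).symm
  mean_zero x := by rw [integral_congr_ae (hQ.ae_eq hρ2 hε x), integral_whiteNoise hW]
  bound := ⟨_, fun x => by simp only [sq]; rw [hQ.integral_mul hρ2 hε, sub_self]⟩

/-- The mollified noise has the law of the rescaled field. -/
lemma IsMollifiedNoise.exists_isCoupled (hQ : IsMollifiedNoise W ρ Q) (hW : IsWhiteNoise W)
    (hq : IsStationaryGaussianField P' q) (hR : Integrable (correlation P' q))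
    (hρ : IsSpectralRoot (correlation P' q) ρ) (hρ1 : Integrable ρ) (hε : 0 < ε) :
    ∃ ℓ V₀ Φ Φ', IsCoupled P P' (Q ε) (rescale q ε) ℓ V₀ Φ Φ' := by
  refine (hQ.isCenteredGaussianField hW hρ.memLp hε).exists_isCoupled
    (isCenteredGaussianField_rescale hq hε) ?_
  -- The identity `ρ * ρ = R` is known almost everywhere only; this map pulls its exceptional set
  -- back to a null set of pairs of points.
  have hmp : Measure.QuasiMeasurePreserving (fun z : Space d × Space d => ε⁻¹ • (z.2 - z.1))
      (volume.prod volume) volume := by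
    refine Measure.QuasiMeasurePreserving.comp (g := fun u : Space d => ε⁻¹ • u) ⟨by fun_prop, ?_⟩
      (Measure.quasiMeasurePreserving_snd.comp
        (measurePreserving_prod_sub (volume : Measure (Space d)) volume).quasiMeasurePreserving)
    rw [Measure.map_addHaar_smul _ (inv_ne_zero hε.ne')]
    exact Measure.smul_absolutelyContinuous
  filter_upwards [hmp.ae (hρ.autocorrelation_ae_eq hq hR hρ1)] with z hz
  rw [hQ.integral_mul hρ.memLp hε, integral_rescale_mul hq hε, hz]

end

/-! ### Convergence of the solutions -/

section

variable {q : Space d → Ω' → ℝ} {m : ℝ} {p : Space d → Space d → ℂ} {σ : ℝ}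

lemma exists_isDuhamelSolution {V : Space d → Ω → ℝ} {b : ℕ → ℝ≥0} (hb : Summable b)
    (h : ∀ n, MemLp (duhamel G u₀ V n t) 2 (volume.prod P) ∧
      eLpNorm (duhamel G u₀ V n t) 2 (volume.prod P) ≤ b n) :
    ∃ u, IsDuhamelSolution P G u₀ V t u := by
  obtain ⟨u, hu, hs⟩ := exists_hasL2Sum (fun n => (h n).1) hb fun n => (h n).2
  exact ⟨u, fun n => (h n).1, hu, hs⟩

lemma ae_eq_of_isStratonovichIntegral (hW : IsWhiteNoise W) {f : Space d → (Fin n → Space d) → ℝ}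
    (hf : ∀ x, Continuous (f x)) {v v' : Space d × Ω → ℝ} (hv : MemLp v 2 (volume.prod P))
    (hv' : MemLp v' 2 (volume.prod P))
    (h : ∀ᵐ x, IsStratonovichIntegral W n (f x) fun ω => v (x, ω))
    (h' : ∀ᵐ x, IsStratonovichIntegral W n (f x) fun ω => v' (x, ω)) : v =ᵐ[volume.prod P] v' := by
  have hm : AEStronglyMeasurable (fun z => v z - v' z) (volume.prod P) := hv.1.sub hv'.1
  have h0 : eLpNorm (fun z => v z - v' z) 2 (volume.prod P) ^ 2 = 0 := by
    rw [eLpNorm_prod_sq hm]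
    refine (lintegral_congr_ae ?_).trans lintegral_zero
    filter_upwards [h, h'] with x hx hx'
    rw [eLpNorm_congr_ae (g := fun _ => (0 : ℝ))
      ((hx.ae_eq hW (hf x) hx').mono fun ω hω => sub_eq_zero.2 hω)]
    simp
  have h1 := (eLpNorm_eq_zero_iff hm two_ne_zero).1 (pow_eq_zero_iff two_ne_zero |>.1 h0)
  filter_upwards [h1] with z hz using sub_eq_zero.1 hz

/-- The terms of the expansion of the stochastic equation. -/
structure IsStratonovichExpansion (W : L2 d →ₗᵢ[ℝ] Lp ℝ 2 P) (σ : ℝ) (G : ℝ → Space d → Space d → ℝ)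
    (u₀ : Space d → ℝ) (Q : ℝ → Space d → Ω → ℝ) (v : ℕ → ℝ → Space d × Ω → ℝ) : Prop where
  memLp : ∀ n t, 0 ≤ t → MemLp (v n t) 2 (volume.prod P)
  isIntegral : ∀ n t, 0 ≤ t → ∀ᵐ x, IsStratonovichIntegral W n (stratKernel σ G u₀ n t x)
    fun ω => v n t (x, ω)
  tendsto : ∀ n t, 0 ≤ t → Tendsto (fun ε => eLpNorm (fun z => duhamel G u₀ (Q ε) n t z - v n t z) 2
    (volume.prod P)) (𝓝[>] 0) (𝓝 0)

variable {v : ℕ → ℝ → Space d × Ω → ℝ}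

lemma GreenSetting.exists_isStratonovichExpansion (S : GreenSetting m p G u₀) (hW : IsWhiteNoise W)
    (hQ : IsMollifiedNoise W ρ Q) (hρ1 : Integrable ρ) (hρ2 : MemLp ρ 2 volume)
    (hσ : σ = ∫ x, ρ x) : ∃ v, IsStratonovichExpansion W σ G u₀ Q v := by
  have h := fun n t (ht : 0 ≤ t) => S.exists_stratonovichTerm hW hQ hρ1 hρ2 hσ n ht
  choose! v h1 h2 h3 using h
  exact ⟨v, h1, h2, h3⟩

lemma IsStratonovichExpansion.eLpNorm_le (hv : IsStratonovichExpansion W σ G u₀ Q v)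
    (ht : 0 ≤ t) {b : ℝ≥0∞} (h : ∀ ε > 0, MemLp (duhamel G u₀ (Q ε) n t) 2 (volume.prod P) ∧
      eLpNorm (duhamel G u₀ (Q ε) n t) 2 (volume.prod P) ≤ b) :
    eLpNorm (v n t) 2 (volume.prod P) ≤ b := by
  have hlim := (hv.tendsto n t ht).add_const b
  rw [zero_add] at hlim
  refine ge_of_tendsto hlim ?_
  filter_upwards [self_mem_nhdsWithin] with ε hε
  obtain ⟨h1, h2⟩ := h ε hε
  have h3 := eLpNorm_two_triangle (hv.memLp n t ht).1 h1.1 (aestronglyMeasurable_const (b := (0 : ℝ)))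
  simp only [sub_zero] at h3
  rw [eLpNorm_two_sub_comm] at h3
  exact h3.trans (add_le_add_right h2 _)

/-- A given solution may come with other terms, but Stratonovich integrals of continuous kernels are
unique, so its terms agree almost everywhere with the constructed ones. -/
lemma IsStratonovichExpansion.hasL2Sum (hv : IsStratonovichExpansion W σ G u₀ Q v)
    (S : GreenSetting m p G u₀) (hW : IsWhiteNoise W) (ht : 0 ≤ t) {u : Space d × Ω → ℝ}
    (hu : IsStratonovichSolution W σ G u₀ t u) : HasL2Sum (volume.prod P) (fun n => v n t) u := by
  obtain ⟨-, w, hw1, hw2, hw3⟩ := hu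
  exact HasL2Sum.congr hw3 fun n => ae_eq_of_isStratonovichIntegral hW
    (S.continuous_stratKernel σ n ht) (hw1 n) (hv.memLp n t ht) (hw2 n) (hv.isIntegral n t ht)

lemma GreenSetting.exists_isStratonovichSolution (S : GreenSetting m p G u₀) (hW : IsWhiteNoise W)
    (hQ : IsMollifiedNoise W ρ Q) (hρ1 : Integrable ρ) (hρ2 : MemLp ρ 2 volume) (hσ : σ = ∫ x, ρ x)
    (ht : 0 ≤ t) : ∃ u, IsStratonovichSolution W σ G u₀ t u := by
  obtain ⟨v, hv⟩ := S.exists_isStratonovichExpansion hW hQ hρ1 hρ2 hσ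
  obtain ⟨b, hb, hle⟩ := S.exists_bound hW hQ hρ1 hρ2 (show 0 < t + 1 by linarith)
  obtain ⟨u, hu, hs⟩ := exists_hasL2Sum (fun n => hv.memLp n t ht) hb fun n =>
    hv.eLpNorm_le ht (hle n t ⟨ht, by linarith⟩)
  exact ⟨u, hu, fun n => v n t, fun n => hv.memLp n t ht, fun n => hv.isIntegral n t ht, hs⟩

/-- Strong convergence of the solutions for the mollified noise. -/
lemma GreenSetting.tendsto_solution (S : GreenSetting m p G u₀) (hW : IsWhiteNoise W)
    (hQ : IsMollifiedNoise W ρ Q) (hρ1 : Integrable ρ) (hρ2 : MemLp ρ 2 volume) (hσ : σ = ∫ x, ρ x)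
    {uε : ℝ → ℝ → Space d × Ω → ℝ} {u : ℝ → Space d × Ω → ℝ}
    (huε : ∀ ε > 0, ∀ t ≥ 0, IsDuhamelSolution P G u₀ (Q ε) t (uε ε t))
    (hu : ∀ t ≥ 0, IsStratonovichSolution W σ G u₀ t (u t)) (hT : 0 < T) :
    Tendsto (fun ε => ⨆ t ∈ Icc 0 T, eLpNorm (fun z => uε ε t z - u t z) 2 (volume.prod P))
      (𝓝[>] 0) (𝓝 0) := by
  obtain ⟨v, hv⟩ := S.exists_isStratonovichExpansion hW hQ hρ1 hρ2 hσ
  obtain ⟨b, hb, hle⟩ := S.exists_bound hW hQ hρ1 hρ2 hT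
  set c : ℝ → ℕ → ℝ≥0∞ := fun ε n => ⨆ t ∈ Icc 0 T,
    eLpNorm (fun z => duhamel G u₀ (Q ε) n t z - v n t z) 2 (volume.prod P) with hc
  have hcb : ∀ ε > 0, ∀ n, c ε n ≤ b n + b n := fun ε hε n => iSup₂_le fun t ht => by
    obtain ⟨h1, h2⟩ := hle n t ht ε hε
    exact (eLpNorm_sub_le h1.1 (hv.memLp n t ht.1).1 one_le_two).trans
      (add_le_add h2 (hv.eLpNorm_le ht.1 (hle n t ht)))
  have hlim : Tendsto (fun ε => ∑' n, c ε n) (𝓝[>] 0) (𝓝 0) := by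
    -- Dominated convergence for series: each supremum over the times tends to zero, and `b n + b n`
    -- dominates uniformly in `ε`.
    have h := tendsto_lintegral_filter_of_dominated_convergence (μ := Measure.count) (l := 𝓝[>] (0 : ℝ))
      (F := c) (f := fun _ => 0) (fun n => (b n : ℝ≥0∞) + b n)
      (Eventually.of_forall fun _ => measurable_of_countable _) (by
        filter_upwards [self_mem_nhdsWithin] with ε hε using ae_of_all _ (hcb ε hε)) (by
        rw [lintegral_count, ENNReal.tsum_add]
        exact ENNReal.add_ne_top.2 ⟨ENNReal.tsum_coe_ne_top_iff_summable.2 hb,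
          ENNReal.tsum_coe_ne_top_iff_summable.2 hb⟩)
      (ae_of_all _ fun n => S.tendsto_iSup hW hQ hρ1 hρ2 n (hv.memLp n) (hv.tendsto n) hT)
    simpa only [lintegral_count, tsum_zero] using h
  refine tendsto_of_tendsto_of_tendsto_of_le_of_le' tendsto_const_nhds hlim
    (Eventually.of_forall fun _ => zero_le) ?_
  filter_upwards [self_mem_nhdsWithin] with ε hε
  refine iSup₂_le fun t ht => ?_
  have hs := huε ε hε t ht.1
  exact HasL2Sum.eLpNorm_sub_le hs.memLp (hu t ht.1).1 hs.tendsto (hv.hasL2Sum S hW ht.1 (hu t ht.1))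
    hs.memLp_term (fun n => hv.memLp n t ht.1) fun n => le_iSup₂ (f := fun t (_ : t ∈ Icc 0 T) =>
        eLpNorm (fun z => duhamel G u₀ (Q ε) n t z - v n t z) 2 (volume.prod P)) t ht

/-- Convergence in `L²(Ω; L²(ℝ^d))`, jointly in the finitely many components, gives convergence in
measure and hence in distribution. -/
lemma tendstoInDistribution_toRandomL2 {ι : Type*} {l : Filter ι} [l.IsCountablyGenerated] [l.NeBot]
    {k : ℕ} {X : ι → Fin k → Space d × Ω → ℝ} {Z : Fin k → Space d × Ω → ℝ}
    (hX : ∀ i j, MemLp (X i j) 2 (volume.prod P)) (hZ : ∀ j, MemLp (Z j) 2 (volume.prod P))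
    (h : ∀ j, Tendsto (fun i => eLpNorm (fun z => X i j z - Z j z) 2 (volume.prod P)) l (𝓝 0)) :
    TendstoInDistribution (fun i ω j => toRandomL2 (X i j) ω) l (fun ω j => toRandomL2 (Z j) ω)
      (fun _ => P) P := by
  have hXm : ∀ i, AEMeasurable (fun ω j => toRandomL2 (X i j) ω) P := fun i =>
    aemeasurable_pi_lambda _ fun j => aemeasurable_toRandomL2 (hX i j).1
  have hZm : AEMeasurable (fun ω j => toRandomL2 (Z j) ω) P :=
    aemeasurable_pi_lambda _ fun j => aemeasurable_toRandomL2 (hZ j).1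
  refine TendstoInMeasure.tendstoInDistribution (tendstoInMeasure_of_tendsto_eLpNorm two_ne_zero
    (fun i => (hXm i).aestronglyMeasurable) hZm.aestronglyMeasurable ?_) hXm
  have hsum : Tendsto (fun i => ∑ j, eLpNorm (fun z => X i j z - Z j z) 2 (volume.prod P)) l (𝓝 0) := by
    simpa using tendsto_finsetSum Finset.univ fun j _ => h j
  refine tendsto_of_tendsto_of_tendsto_of_le_of_le tendsto_const_nhds hsum (fun _ => zero_le) fun i => ?_
  have hm : ∀ j, AEStronglyMeasurable (fun ω => toRandomL2 (X i j) ω - toRandomL2 (Z j) ω) P := fun j =>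
    ((aemeasurable_toRandomL2 (hX i j).1).sub (aemeasurable_toRandomL2 (hZ j).1)).aestronglyMeasurable
  simp only [← eLpNorm_toRandomL2_sub (hX i _) (hZ _)]
  calc _ ≤ eLpNorm (∑ j, fun ω => ‖toRandomL2 (X i j) ω - toRandomL2 (Z j) ω‖) 2 P := by
        refine eLpNorm_mono_real fun ω => ?_
        rw [Finset.sum_apply]
        refine (pi_norm_le_iff_of_nonneg (sum_nonneg fun _ _ => norm_nonneg _)).2 fun j => ?_
        exact single_le_sum (f := fun j => ‖toRandomL2 (X i j) ω - toRandomL2 (Z j) ω‖)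
          (fun _ _ => norm_nonneg _) (Finset.mem_univ j)
    _ ≤ _ := by
        refine (eLpNorm_sum_le (fun j _ => (hm j).norm) one_le_two).trans ?_
        simp only [eLpNorm_norm, le_refl]

/-- Convergence in distribution of the solutions for the rescaled field. -/
lemma GreenSetting.tendstoInDistribution (S : GreenSetting m p G u₀) (hW : IsWhiteNoise W)
    (hQ : IsMollifiedNoise W ρ Q) (hq : IsStationaryGaussianField P' q)
    (hR : Integrable (correlation P' q)) (hρ : IsSpectralRoot (correlation P' q) ρ)
    (hρ1 : Integrable ρ) (hσ : σ = ∫ x, ρ x) {uε : ℝ → ℝ → Space d × Ω' → ℝ}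
    {u : ℝ → Space d × Ω → ℝ}
    (huε : ∀ ε > 0, ∀ t ≥ 0, IsDuhamelSolution P' G u₀ (rescale q ε) t (uε ε t))
    (hu : ∀ t ≥ 0, IsStratonovichSolution W σ G u₀ t (u t)) {k : ℕ} {τ : Fin k → ℝ}
    (hτ : ∀ i, 0 ≤ τ i) :
    TendstoInDistribution (fun (ε : Ioi (0 : ℝ)) (ω : Ω') (i : Fin k) => toRandomL2 (uε ε (τ i)) ω)
      (comap Subtype.val (𝓝 0)) (fun (ω : Ω) (i : Fin k) => toRandomL2 (u (τ i)) ω)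
      (fun _ => P') P := by
  have : (comap (Subtype.val : Ioi (0 : ℝ) → ℝ) (𝓝 0)).NeBot :=
    mem_closure_iff_comap_neBot.1 (by rw [closure_Ioi]; exact self_mem_Ici)
  have hl : Tendsto (Subtype.val : Ioi (0 : ℝ) → ℝ) (comap Subtype.val (𝓝 0)) (𝓝[>] 0) :=
    tendsto_nhdsWithin_iff.2 ⟨tendsto_comap, Eventually.of_forall fun x => x.2⟩
  have hb : ∀ i, ∃ b : ℕ → ℝ≥0, Summable b ∧ ∀ n, ∀ ε > 0,
      MemLp (duhamel G u₀ (Q ε) n (τ i)) 2 (volume.prod P) ∧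
      eLpNorm (duhamel G u₀ (Q ε) n (τ i)) 2 (volume.prod P) ≤ b n := fun i => by
    obtain ⟨b, hb, h⟩ := S.exists_bound hW hQ hρ1 hρ.memLp (show 0 < τ i + 1 by linarith [hτ i])
    exact ⟨b, hb, fun n => h n _ ⟨hτ i, by linarith⟩⟩
  choose b hb hle using hb
  have hex : ∀ ε > 0, ∀ t ≥ 0, ∃ w, IsDuhamelSolution P G u₀ (Q ε) t w := fun ε hε t ht => by
    obtain ⟨b, hb, h⟩ := S.exists_bound hW hQ hρ1 hρ.memLp (show 0 < t + 1 by linarith)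
    exact exists_isDuhamelSolution hb fun n => h n t ⟨ht, by linarith⟩ ε hε
  choose! w hw using hex
  have hd := tendstoInDistribution_toRandomL2 (l := comap (Subtype.val : Ioi (0 : ℝ) → ℝ) (𝓝 0))
    (X := fun ε i => w ε (τ i)) (Z := fun i => u (τ i)) (fun ε i => (hw ε ε.2 _ (hτ i)).memLp)
    (fun i => (hu _ (hτ i)).1) fun i => by
      have h := (S.tendsto_solution hW hQ hρ1 hρ.memLp hσ hw hu
        (show 0 < τ i + 1 by linarith [hτ i])).comp hl
      refine tendsto_of_tendsto_of_tendsto_of_le_of_le tendsto_const_nhds h (fun _ => zero_le) fun ε => ?_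
      exact le_iSup₂ (f := fun t (_ : t ∈ Icc 0 (τ i + 1)) =>
        eLpNorm (fun z => w ε t z - u t z) 2 (volume.prod P)) (τ i) ⟨hτ i, by linarith⟩
  refine ⟨fun ε => aemeasurable_pi_lambda _ fun i =>
    aemeasurable_toRandomL2 (huε ε ε.2 _ (hτ i)).memLp.1, hd.aemeasurable_limit, ?_⟩
  -- For every fixed `ε` the law for the rescaled field equals the law for the mollified noise, so
  -- the laws already known to converge are the same ones.
  refine hd.tendsto.congr fun ε => Subtype.ext ?_
  obtain ⟨ℓ, V₀, Φ, Φ', hc⟩ := hQ.exists_isCoupled hW hq hR hρ hρ1 ε.2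
  exact S.map_toRandomL2_eq hc (hQ.hasMoments hW hρ.memLp ε.2) (hasMoments_rescale hq ε) hτ hb
    (fun i n => hle i n ε ε.2) (fun i => (hw ε ε.2 _ (hτ i)).memLp)
    (fun i => (huε ε ε.2 _ (hτ i)).memLp) (fun i => (hw ε ε.2 _ (hτ i)).tendsto)
    fun i => (huε ε ε.2 _ (hτ i)).tendsto

end

end StratSPDE

end

open StratSPDE

theorem theorem4p2 {d : ℕ} (hd : 0 < d) {m : ℝ} (hm : (d : ℝ) < m)
    -- the unperturbed operator `P(x,D)`, its Green's function and the initial condition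
    (p : Space d → Space d → ℂ) (hp : IsEllipticSymbol m p)
    (G : ℝ → Space d → Space d → ℝ) (hG : IsGreenFunction p G)
    (hG_symm : ∀ t : ℝ, 0 < t → ∀ x y, G t x y = G t y x)
    (hG_cont : ContinuousOn (fun z : ℝ × Space d × Space d => G z.1 z.2.1 z.2.2)
      (Ioi 0 ×ˢ univ))
    (hG_bounds : GreenBounds m G) (hG_modulus : GreenModulus m G)
    (u₀ : Space d → ℝ) (hu₀ : MemLp u₀ 1 volume) (hu₀' : MemLp u₀ 2 volume)
    -- the random field
    {Ω' : Type*} [MeasurableSpace Ω'] (P' : Measure Ω') [IsProbabilityMeasure P']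
    (q : Space d → Ω' → ℝ) (hq : IsStationaryGaussianField P' q)
    (hR : Integrable (correlation P' q) volume)
    (σ : ℝ) (hσ : σ = √(∫ x, correlation P' q x))
    (ρ : Space d → ℝ) (hρ : IsSpectralRoot (correlation P' q) ρ) (hρ' : Integrable ρ volume)
    -- the white noise
    {Ω : Type*} [MeasurableSpace Ω] (P : Measure Ω) [IsProbabilityMeasure P]
    (W : L2 d →ₗᵢ[ℝ] Lp ℝ 2 P) (hW : IsWhiteNoise W) :
    -- the Duhamel solutions and the mollified noise exist
    (∀ ε > 0, ∀ t ≥ 0, ∃ u, IsDuhamelSolution P' G u₀ (rescale q ε) t u) ∧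
    (∀ t ≥ 0, ∃ u, IsStratonovichSolution W σ G u₀ t u) ∧
    (∃ Q, IsMollifiedNoise W ρ Q) ∧
    -- convergence in distribution, for finitely many times jointly
    (∀ (uε : ℝ → ℝ → Space d × Ω' → ℝ) (u : ℝ → Space d × Ω → ℝ),
      (∀ ε > 0, ∀ t ≥ 0, IsDuhamelSolution P' G u₀ (rescale q ε) t (uε ε t)) →
      (∀ t ≥ 0, IsStratonovichSolution W σ G u₀ t (u t)) →
      ∀ (k : ℕ) (τ : Fin k → ℝ), (∀ i, 0 ≤ τ i) →
        TendstoInDistribution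
          (fun (ε : Ioi (0 : ℝ)) (ω : Ω') (i : Fin k) => toRandomL2 (uε ε (τ i)) ω)
          (comap Subtype.val (𝓝 0))
          (fun (ω : Ω) (i : Fin k) => toRandomL2 (u (τ i)) ω)
          (fun _ => P') P) ∧
    -- strong convergence for the potential built from the same white noise
    (∀ Q : ℝ → Space d → Ω → ℝ, IsMollifiedNoise W ρ Q →
      (∀ ε > 0, ∀ t ≥ 0, ∃ u, IsDuhamelSolution P G u₀ (Q ε) t u) ∧
      ∀ (uε : ℝ → ℝ → Space d × Ω → ℝ) (u : ℝ → Space d × Ω → ℝ),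
        (∀ ε > 0, ∀ t ≥ 0, IsDuhamelSolution P G u₀ (Q ε) t (uε ε t)) →
        (∀ t ≥ 0, IsStratonovichSolution W σ G u₀ t (u t)) →
        ∀ T > 0, Tendsto (fun ε : ℝ => ⨆ t ∈ Icc 0 T,
            eLpNorm (fun z => uε ε t z - u t z) 2 (volume.prod P))
          (𝓝[>] 0) (𝓝 0)) := by
  have S : GreenSetting m p G u₀ := ⟨hm, hG, hG_symm, hG_cont, hG_bounds, hu₀, hu₀'⟩
  have hρ2 := hρ.memLp
  have hσ' : σ = ∫ x, ρ x := hσ.trans (hρ.integral_eq hR hρ').symm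
  -- An auxiliary mollified noise. The moment bounds are proved for it, and the coupling transfers
  -- them to the rescaled field, which gives the existence of its solutions.
  obtain ⟨Q₀, hQ₀⟩ := exists_isMollifiedNoise W hρ2
  refine ⟨fun ε hε t ht => ?_, fun t ht => S.exists_isStratonovichSolution hW hQ₀ hρ' hρ2 hσ' ht,
    ⟨Q₀, hQ₀⟩, fun uε u huε hu k τ hτ =>
      S.tendstoInDistribution hW hQ₀ hq hR hρ hρ' hσ' huε hu hτ,
    fun Q hQ => ⟨fun ε hε t ht => ?_, fun uε u huε hu T hT =>
      S.tendsto_solution hW hQ hρ' hρ2 hσ' huε hu hT⟩⟩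
  · obtain ⟨b, hb, h⟩ := S.exists_bound hW hQ₀ hρ' hρ2 (show 0 < t + 1 by linarith)
    obtain ⟨ℓ, V₀, Φ, Φ', hc⟩ := hQ₀.exists_isCoupled hW hq hR hρ hρ' hε
    have h' := fun n => h n t ⟨ht, by linarith⟩ ε hε
    have he := S.memLp_duhamel_of_isCoupled hc (hQ₀.hasMoments hW hρ2 hε) (hasMoments_rescale hq ε)
      ht fun n => (h' n).1
    exact exists_isDuhamelSolution hb fun n => ⟨(he n).1, (he n).2.le.trans (h' n).2⟩
  · obtain ⟨b, hb, h⟩ := S.exists_bound hW hQ hρ' hρ2 (show 0 < t + 1 by linarith)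
    exact exists_isDuhamelSolution hb fun n => h n t ⟨ht, by linarith⟩ ε hε
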